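/- **Setting.** For $y>0$ and $w\in\mathbb R$ let $K_w(y)=\frac12\int_0^\infty x^{w-1}\exp\{-\frac y2(x+\frac1x)\}\,dx$ be the modified Bessel function, and let $NIG(\alpha,\beta,\delta,\mu)$ be the law on $\mathbb R$ with density $$p(y;\alpha,\beta,\delta,\mu)=\frac{\alpha\delta}{\pi}\exp\{\delta\sqrt{\alpha^2-\beta^2}+\beta(y-\mu)\}\frac{K_1(\alpha\sqrt{\delta^2+(y-\mu)^2})}{\sqrt{\delta^2+(y-\mu)^2}} .$$ Let $\Theta\subset\mathbb R^4$ be a bounded, convex, open set of parameters $\theta=(\alpha,\beta,\delta,\mu)$ whose closure is contained in $\{\alpha>0,\ |\beta|<\alpha,\ \delta>0,\ \mu\in\mathbb R\}$. For each $\theta\in\Theta$ let $X=(X_t)_{t\ge0}$ be under $P_\theta$ a Lévy process with $\mathcal L(X_1)=NIG(\alpha,\beta,\delta,\mu)$. Observe $X_{jh_n}$, $j=0,\dots,n$, where $h_n>0$, and put $\Delta_j^nX=X_{jh_n}-X_{(j-1)h_n}$ and $T_n=nh_n$. Let $P^n_\theta$ be the law of $(\Delta^n_jX)_{j\le n}$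 under $P_\theta$, and $$\ell_n(\theta)=\sum_{j=1}^n\log p(\Delta_j^nX;\alpha,\beta,\delta h_n,\mu h_n),\qquad \mathcal S_n(\theta)=\partial_\theta\ell_n(\theta),\qquad \mathcal I_n(\theta)=-\partial_\theta^2\ell_n(\theta).$$ Write $\to_u$ for uniform convergence over each compact subset of $\Theta$. For statistics $\zeta_n(\theta)$ write $\zeta_n(\theta)\to^{\mathcal L}_u\nu_\theta$ if $\sup_{\|f\|_{BL}\le1}|E_\theta f(\zeta_n(\theta))-\int f\,d\nu_\theta|\to_u0$, where $\|f\|_{BL}$ is the sum of the Lipschitz constant and the supremum norm of $f$, and write $\zeta_n(\theta)\to^p_u\zeta(\theta)$ if $E_\theta\{|\zeta_n(\theta)-\zeta(\theta)|/(1+|\zeta_n(\theta)-\zeta(\theta)|)\}\to_u0$. **Theorem.** Suppose that $T_n\to\infty$ and $h_n\to0$. Put $$A_n=\mathrm{diag}\Big(\frac1{\sqrt{T_n}},\frac1{\sqrt{T_n}},\frac1{\sqrt n},\frac1{\sqrt n}\Big),\qquad \mathcal I(\theta)=\begin{pmatrix}\mathcal I_{11}&\mathcal I_{12}&0&0\\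 \mathcal I_{12}&\mathcal I_{22}&0&0\\0&0&\frac1{2\delta^2}&0\\0&0&0&\frac1{2\delta^2}\end{pmatrix},$$ $$\mathcal I_{11}=\frac{\delta}{\alpha\pi}\int_0^\infty(e^{(\beta/\alpha)y}+e^{-(\beta/\alpha)y})\,y\,\frac{K_0(y)^2}{K_1(y)}\,dy,\quad \mathcal I_{12}=\frac{-\alpha\beta\delta}{(\alpha^2-\beta^2)^{3/2}},\quad \mathcal I_{22}=\frac{\alpha^2\delta}{(\alpha^2-\beta^2)^{3/2}} .$$ 1. For each $\theta\in\Theta$ the integral in $\mathcal I_{11}$ is finite and $\mathcal I(\theta)$ is positive definite. 2. The family $(P^n_\theta)$ is uniformly locally asymptotically normal (ULAN) in $\Theta$ with rate $A_n$ and Fisher information $\mathcal I(\theta)$. That is: $\ell_n$ is the log-likelihood of $P^n_\theta$ with respect to Lebesgue measure and is of class $C^2$ in $\theta\in\Theta$; $A_n\mathcal S_n(\theta)\to^{\mathcal L}_uN_4(0,\mathcal I(\theta))$; $A_n\mathcal I_n(\theta)A_n\to^p_u\mathcal I(\theta)$; and for every non-random bounded sequence $(u_n)\subset\mathbb R^4$,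 $$\ell_n(\theta+A_nu_n)-\ell_n(\theta)-\Big(\mathcal S_n(\theta)^\top A_nu_n-\tfrac12(A_nu_n)^\top\mathcal I_n(\theta)A_nu_n\Big)\to^p_u0 .$$ 3. There are measurable functions $\hat\theta_n$ of the data, not depending on $\theta$ (the maximum-likelihood estimator), such that $P_\theta(\hat\theta_n\in\Theta\text{ is a local maximizer of }\ell_n)\to_u1$ and $A_n^{-1}(\hat\theta_n-\theta)\to^{\mathcal L}_uN_4(0,\mathcal I(\theta)^{-1})$. -/

import Mathlib

open MeasureTheory ProbabilityTheory Filter Topology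
open scoped NNReal ENNReal

noncomputable section

namespace NIG

/-! ### Uniform convergence of statistics, and the ULAN property -/

/-- `f` lies in the unit ball of the bounded-Lipschitz norm
`‖f‖_BL = sup_{x ≠ y} |f x - f y| / |x - y| + sup_x |f x|`. -/
def InUnitBL {F : Type*} [PseudoEMetricSpace F] (f : F → ℝ) : Prop :=
  ∃ L M : ℝ≥0, L + M ≤ 1 ∧ LipschitzWith L f ∧ ∀ x, |f x| ≤ M

/-- The bounded-Lipschitz distance `sup {|∫ f dμ - ∫ f dν| : ‖f‖_BL ≤ 1}` between two laws,
which metrizes convergence in law. -/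
def blDist {F : Type*} [PseudoEMetricSpace F] [MeasurableSpace F] (μ ν : Measure F) : ℝ :=
  sSup {r : ℝ | ∃ f : F → ℝ, InUnitBL f ∧ r = |(∫ x, f x ∂μ) - ∫ x, f x ∂ν|}

/-- The quantity `E_μ(|Y| / (1 + |Y|))`, i.e. the distance of `Y` to `0` in a metric for convergence
in probability. It is an upper integral, so it is meaningful without measurability of `Y`. -/
def probDist {S : Type*} [MeasurableSpace S] (μ : Measure S) (Y : S → ℝ) : ℝ :=
  (∫⁻ x, ENNReal.ofReal (|Y x| / (1 + |Y x|)) ∂μ).toReal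

section Experiments

variable {p : ℕ}

/-- Convergence in law, uniformly over compact subsets of `Θ`: the law of the statistic `ζ n θ` under
`P n θ` approaches `ν θ` in the bounded-Lipschitz distance. The `n`-th sample is a vector of `n`
reals. (If `ζ n θ` were not a.e. measurable its law would be `0`, at distance `1` from a
probability measure, so measurability is implied.) -/
def TendstoInLawU {F : Type*} [PseudoEMetricSpace F] [MeasurableSpace F]
    (Θ : Set (EuclideanSpace ℝ (Fin p)))
    (P : ∀ n : ℕ, EuclideanSpace ℝ (Fin p) → Measure (Fin n → ℝ))
    (ζ : ∀ n : ℕ, EuclideanSpace ℝ (Fin p) → (Fin n → ℝ) → F)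
    (ν : EuclideanSpace ℝ (Fin p) → Measure F) : Prop :=
  ∀ K ⊆ Θ, IsCompact K →
    TendstoUniformlyOn (fun n θ => blDist ((P n θ).map (ζ n θ)) (ν θ)) 0 atTop K

/-- Convergence to `0` in probability under `P n θ`, uniformly over compact subsets of `Θ`. -/
def TendstoInProbU (Θ : Set (EuclideanSpace ℝ (Fin p)))
    (P : ∀ n : ℕ, EuclideanSpace ℝ (Fin p) → Measure (Fin n → ℝ))
    (ζ : ∀ n : ℕ, EuclideanSpace ℝ (Fin p) → (Fin n → ℝ) → ℝ) : Prop :=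
  ∀ K ⊆ Θ, IsCompact K →
    TendstoUniformlyOn (fun n θ => probDist (P n θ) (ζ n θ)) 0 atTop K

/-- The score vector `∂_θ ℓ(θ)`. -/
def score (ℓ : EuclideanSpace ℝ (Fin p) → ℝ) (θ : EuclideanSpace ℝ (Fin p)) (k : Fin p) : ℝ :=
  fderiv ℝ ℓ θ (EuclideanSpace.single k 1)

/-- The observed information matrix `-∂_θ² ℓ(θ)`. -/
def obsInfo (ℓ : EuclideanSpace ℝ (Fin p) → ℝ) (θ : EuclideanSpace ℝ (Fin p)) :
    Matrix (Fin p) (Fin p) ℝ :=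
  Matrix.of fun k l => -fderiv ℝ (fun ρ => score ℓ ρ l) θ (EuclideanSpace.single k 1)

/-- The vector `A u`, where `A` is the diagonal matrix with diagonal `a`. -/
def diagMul (a : Fin p → ℝ) (u : EuclideanSpace ℝ (Fin p)) : EuclideanSpace ℝ (Fin p) :=
  WithLp.toLp 2 fun k => a k * u k

/-- The experiments `P n θ` (laws of samples of `n` reals) with log-likelihood `ℓ n θ` (with respect to
Lebesgue measure) are uniformly locally asymptotically normal in `Θ`, with rate the diagonal matrix
`A_n(θ) = diag (a n θ)` and with Fisher information `I θ`. -/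
structure IsULAN (Θ : Set (EuclideanSpace ℝ (Fin p)))
    (P : ∀ n : ℕ, EuclideanSpace ℝ (Fin p) → Measure (Fin n → ℝ))
    (ℓ : ∀ n : ℕ, EuclideanSpace ℝ (Fin p) → (Fin n → ℝ) → ℝ)
    (a : ℕ → EuclideanSpace ℝ (Fin p) → Fin p → ℝ)
    (I : EuclideanSpace ℝ (Fin p) → Matrix (Fin p) (Fin p) ℝ) : Prop where
  /-- `ℓ n` is the log-likelihood of `P n`. -/
  likelihood : ∀ n, ∀ θ ∈ Θ,
    P n θ = volume.withDensity fun x => ENNReal.ofReal (Real.exp (ℓ n θ x))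
  /-- The log-likelihood is of class `C²` in the parameter. -/
  contDiff : ∀ n x, ContDiffOn ℝ 2 (fun θ => ℓ n θ x) Θ
  rate_pos : ∀ᶠ n in atTop, ∀ θ ∈ Θ, ∀ k, 0 < a n θ k
  rate_tendsto : ∀ K ⊆ Θ, IsCompact K → ∀ k, TendstoUniformlyOn (fun n θ => a n θ k) 0 atTop K
  posDef : ∀ θ ∈ Θ, (I θ).PosDef
  /-- `A_n(θ) S_n(θ)` converges in law to `N(0, I(θ))`, uniformly. -/
  score_tendsto : TendstoInLawU Θ P
    (fun n θ x => (WithLp.toLp 2 fun k => a n θ k * score (fun ρ => ℓ n ρ x) θ k :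
      EuclideanSpace ℝ (Fin p)))
    (fun θ => multivariateGaussian 0 (I θ))
  /-- `A_n(θ) I_n(θ) A_n(θ)` converges in probability to `I(θ)`, uniformly. -/
  info_tendsto : ∀ k l, TendstoInProbU Θ P fun n θ x =>
    a n θ k * obsInfo (fun ρ => ℓ n ρ x) θ k l * a n θ l - I θ k l
  /-- The remainder of the quadratic expansion of the log-likelihood ratio is negligible. -/
  expansion : ∀ u : ℕ → EuclideanSpace ℝ (Fin p), Bornology.IsBounded (Set.range u) →
    TendstoInProbU Θ P fun n θ x =>
      ℓ n (θ + diagMul (a n θ) (u n)) x - ℓ n θ x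
        - (∑ k, score (fun ρ => ℓ n ρ x) θ k * (a n θ k * u n k)
          - 1 / 2 * ∑ k, ∑ l, obsInfo (fun ρ => ℓ n ρ x) θ k l
              * (a n θ k * u n k) * (a n θ l * u n l))

end Experiments

/-! ### Lévy processes and their sampled increments -/

/-- `X` is a real-valued Lévy process under `μ`. -/
structure IsLevyProcess {Ω : Type*} [MeasurableSpace Ω] (X : ℝ≥0 → Ω → ℝ) (μ : Measure Ω) :
    Prop where
  isProb : IsProbabilityMeasure μ
  measurable : ∀ t, Measurable (X t)
  zero : ∀ᵐ ω ∂μ, X 0 ω = 0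
  indep : HasIndepIncrements X μ
  stationary : ∀ s t, μ.map (fun ω => X (s + t) ω - X s ω) = μ.map (X t)
  stochCont : ∀ s, TendstoInMeasure μ X (𝓝 s) (X s)

/-- The increments `X_{jh} - X_{(j-1)h}`, `j = 1, …, n`. -/
def increments {Ω : Type*} (X : ℝ≥0 → Ω → ℝ) (h : ℝ≥0) (n : ℕ) (ω : Ω) : Fin n → ℝ :=
  fun j => X (((j : ℕ) + 1 : ℝ≥0) * h) ω - X (((j : ℕ) : ℝ≥0) * h) ω

/-! ### The normal inverse-Gaussian model -/

/-- The modified Bessel function `K_w(y)` of the second (or third) kind, for `y > 0`. -/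
def besselK (w y : ℝ) : ℝ :=
  1 / 2 * ∫ x in Set.Ioi (0 : ℝ), x ^ (w - 1) * Real.exp (-(y / 2) * (x + 1 / x))

/-- The density of `NIG(α, β, δ, μ)`. -/
def density (α β δ μ y : ℝ) : ℝ :=
  α * δ / Real.pi * Real.exp (δ * √(α ^ 2 - β ^ 2) + β * (y - μ))
    * (besselK 1 (α * √(δ ^ 2 + (y - μ) ^ 2)) / √(δ ^ 2 + (y - μ) ^ 2))

/-- The distribution `NIG(α, β, δ, μ)`. -/
def law (α β δ μ : ℝ) : Measure ℝ :=
  volume.withDensity fun y => ENNReal.ofReal (density α β δ μ y)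

/-- The parameters `θ = (α, β, δ, μ)` with `α > 0`, `|β| < α`, `δ > 0`. -/
def region : Set (EuclideanSpace ℝ (Fin 4)) :=
  {θ | 0 < θ 0 ∧ |θ 1| < θ 0 ∧ 0 < θ 2}

/-- The log-likelihood of `n` increments over time steps of length `h`: the law of one such increment
is `NIG(α, β, δh, μh)`. -/
def logLik (h : ℝ) (n : ℕ) (θ : EuclideanSpace ℝ (Fin 4)) (x : Fin n → ℝ) : ℝ :=
  ∑ j, Real.log (density (θ 0) (θ 1) (θ 2 * h) (θ 3 * h) (x j))

/-- The diagonal `(T^{-1/2}, T^{-1/2}, n^{-1/2}, n^{-1/2})` of the rate matrix, with `T = n h`. -/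
def rate (h : ℝ) (n : ℕ) : Fin 4 → ℝ :=
  ![1 / √(n * h), 1 / √(n * h), 1 / √(n : ℝ), 1 / √(n : ℝ)]

/-- The integrand in the first entry of the Fisher information. -/
def integrand (θ : EuclideanSpace ℝ (Fin 4)) (y : ℝ) : ℝ :=
  (Real.exp (θ 1 / θ 0 * y) + Real.exp (-(θ 1 / θ 0 * y))) * y * (besselK 0 y ^ 2 / besselK 1 y)

/-- The Fisher information matrix. -/
def fisher (θ : EuclideanSpace ℝ (Fin 4)) : Matrix (Fin 4) (Fin 4) ℝ :=
  let α := θ 0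
  let β := θ 1
  let δ := θ 2
  let I11 := δ / (α * Real.pi) * ∫ y in Set.Ioi (0 : ℝ), integrand θ y
  let I12 := -(α * β * δ) / (α ^ 2 - β ^ 2) ^ (3 / 2 : ℝ)
  let I22 := α ^ 2 * δ / (α ^ 2 - β ^ 2) ^ (3 / 2 : ℝ)
  !![I11, I12, 0, 0;
     I12, I22, 0, 0;
     0, 0, 1 / (2 * δ ^ 2), 0;
     0, 0, 0, 1 / (2 * δ ^ 2)]

end NIG

end

/-! Two scales govern an increment over a short time step `h`. On the scale `h` it is nearly a
Cauchy variable with scale `δ` and location `μ`, because `x K₁(x) → 1` as `x → 0`: after the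
substitution `y = h z` its density tends to `cauchyD` (`tendsto_integral_inc`). Each of the `n`
increments thus informs about `(δ, μ)` like one Cauchy observation, and the rate is `1/√n`. Away
from the origin the density divided by `h` tends to the Lévy density `lev`
(`tendsto_integral_inc_div`). The pair `(α, β)` is felt only there, through a number of jumps of
order `T = n h`, and the rate is `1/√T`. The two blocks of the information are the covariances of
the limiting scores under these two measures. The cross terms vanish because the mean of `h + |y|`
is `o(√h)` (`tendsto_integral_msize_div`).

The analysis rests on the Bessel ratio. In the variable `w = x²` the functions `x K₁(x)` and `K₀(x)`
satisfy a closed linear system, so `q = x K₀(x)/K₁(x)` solves a Riccati equation, and the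
derivatives of the log-density are explicit in `q`, in its logarithmic derivative and in the bounded
quantities `uf`, `vf`. With `m = h + |y|`, every Hessian entry and its parameter derivative are
bounded by `zsize` (`tame_hess1`), uniformly over a compact set of parameters. A function of order
`m^(3/2) + m^6` has mean of order `h` (`exists_moment`); an exponent above `1` at the origin is what
makes integrals against `y⁻²` converge.

The increments are independent, and their law is identified by its Laplace transform: its logarithm
is additive in time, hence linear by stochastic continuity (`IsLevyProcess.map_eq_law`). The score
then obeys a Lyapunov central limit theorem (`tendsto_integral_exp_score`). The observed information
has the right mean by the Bartlett identity `integral_hess1`, and a variance of order `1/T`. The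
remainder of the expansion is controlled by a random Lipschitz constant of the rescaled Hessian with
bounded mean. Uniformity in `θ` is obtained by compactness: statements are proved along sequences of
sample sizes and converging parameters, the structure `Regime`, and transferred by
`tendstoUniformlyOn_zero_of_seq`.

The information is positive definite because the limiting `α`-score is negative on both half-lines
while the `β`-score `y` changes sign, so no nontrivial combination vanishes almost everywhere.

For the estimator, four simple averages converge to a continuous injective function of `θ`
(`injOn_ident`), so they confine the parameter to a small neighbourhood of the truth. There the
log-likelihood is, with high probability, strongly concave in rescaled coordinates. It has a single
maximizer, which is close to `θ + A_n I⁻¹ A_n S_n` (`mle_spec`), and a measurable selection along a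
dense sequence returns it. -/

noncomputable section

/-! ### The Bessel functions `K₀`, `K₁` and their ratio -/

namespace NIG

open Set Real

/-- The integrals `∫₀^∞ s⁻ʲ exp (-s/2 - w/(2s)) ds`. -/
def besselInt (j : ℕ) (w : ℝ) : ℝ :=
  ∫ s in Ioi (0 : ℝ), s⁻¹ ^ j * exp (-(s / 2) - w / (2 * s))

/-- The function `w ↦ √w K₁(√w)`. -/
def kone (w : ℝ) : ℝ := 1 / 2 * besselInt 0 w

/-- The function `w ↦ K₀(√w)`. -/
def kzero (w : ℝ) : ℝ := 1 / 2 * besselInt 1 w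

/-- The function `w ↦ √w K₀(√w) / K₁(√w)`. -/
def kratio (w : ℝ) : ℝ := w * kzero w / kone w

/-- Twice the logarithmic-scale derivative of `kratio`. -/
def kratioDeriv (w : ℝ) : ℝ := kratio w ^ 2 + 2 * kratio w - w

/-- Since `xʲ / j! ≤ exp x`, the factor `exp (-w/(2s))` absorbs the pole `s⁻ʲ` at a cost depending
only on `w` and `j`. -/
lemma inv_pow_mul_exp_le (j : ℕ) {w s : ℝ} (hw : 0 < w) (hs : 0 < s) :
    s⁻¹ ^ j * exp (-(s / 2) - w / (2 * s)) ≤ (j.factorial * (2 / w) ^ j) * exp (-(1 / 2) * s) := by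
  have h1 := Real.pow_div_factorial_le_exp (w / (2 * s)) (by positivity) j
  have h2 : exp (-(s / 2) - w / (2 * s)) = exp (-(1 / 2) * s) * (exp (w / (2 * s)))⁻¹ := by
    rw [← exp_neg, ← exp_add]; ring_nf
  rw [h2]
  have h3 : s⁻¹ ^ j ≤ j.factorial * (2 / w) ^ j * exp (w / (2 * s)) := by
    have : s⁻¹ ^ j = j.factorial * (2 / w) ^ j * ((w / (2 * s)) ^ j / j.factorial) := by
      have : (j.factorial : ℝ) ≠ 0 := by positivity
      rw [mul_assoc, mul_div_assoc', mul_div_cancel₀ _ this, ← mul_pow]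
      congr 1
      field_simp
    rw [this]
    gcongr
  calc s⁻¹ ^ j * (exp (-(1 / 2) * s) * (exp (w / (2 * s)))⁻¹)
      ≤ (j.factorial * (2 / w) ^ j * exp (w / (2 * s))) *
        (exp (-(1 / 2) * s) * (exp (w / (2 * s)))⁻¹) := by gcongr
    _ = _ := by field_simp

lemma integrableOn_exp_neg_half : IntegrableOn (fun s : ℝ => exp (-(1 / 2) * s)) (Ioi 0) :=
  integrableOn_exp_mul_Ioi (by norm_num) 0

lemma measurable_besselInt_integrand (j : ℕ) (w : ℝ) :
    Measurable fun s : ℝ => s⁻¹ ^ j * exp (-(s / 2) - w / (2 * s)) := by fun_prop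

lemma integrableOn_besselInt (j : ℕ) {w : ℝ} (hw : 0 < w) :
    IntegrableOn (fun s : ℝ => s⁻¹ ^ j * exp (-(s / 2) - w / (2 * s))) (Ioi 0) := by
  refine Integrable.mono' (integrableOn_exp_neg_half.const_mul (j.factorial * (2 / w) ^ j))
    (measurable_besselInt_integrand j w).aestronglyMeasurable ?_
  filter_upwards [ae_restrict_mem measurableSet_Ioi] with s (hs : 0 < s)
  rw [norm_of_nonneg (by positivity)]
  exact inv_pow_mul_exp_le j hw hs

lemma integrableOn_besselInt_zero {w : ℝ} (hw : 0 ≤ w) :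
    IntegrableOn (fun s : ℝ => s⁻¹ ^ 0 * exp (-(s / 2) - w / (2 * s))) (Ioi 0) := by
  refine Integrable.mono' integrableOn_exp_neg_half
    (measurable_besselInt_integrand 0 w).aestronglyMeasurable ?_
  filter_upwards [ae_restrict_mem measurableSet_Ioi] with s (hs : 0 < s)
  rw [norm_of_nonneg (by positivity), pow_zero, one_mul]
  apply exp_le_exp.2
  have : 0 ≤ w / (2 * s) := by positivity
  linarith

/-- Differentiation in `w` brings down the factor `-1/(2s)`, which raises `j` by one. For parameters
above `w/2` the differentiated integrands are dominated by half the one of index `j + 1` at `w/2`.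
-/
lemma hasDerivAt_besselInt (j : ℕ) {w : ℝ} (hw : 0 < w) :
    HasDerivAt (besselInt j) (-(1 / 2) * besselInt (j + 1) w) w := by
  have := (hasDerivAt_integral_of_dominated_loc_of_deriv_le (μ := volume.restrict (Ioi (0 : ℝ)))
    (F := fun w s => s⁻¹ ^ j * exp (-(s / 2) - w / (2 * s)))
    (F' := fun w s => -(1 / 2) * (s⁻¹ ^ (j + 1) * exp (-(s / 2) - w / (2 * s))))
    (x₀ := w) (s := Ioi (w / 2)) (bound := fun s => (1 / 2) *
      (s⁻¹ ^ (j + 1) * exp (-(s / 2) - (w / 2) / (2 * s)))) (Ioi_mem_nhds (by linarith))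
    (Eventually.of_forall fun x => (measurable_besselInt_integrand j x).aestronglyMeasurable)
    (integrableOn_besselInt j hw)
    ((measurable_besselInt_integrand (j + 1) w).const_mul _).aestronglyMeasurable ?_
    ((integrableOn_besselInt (j + 1) (half_pos hw)).const_mul _) ?_).2
  · rw [integral_const_mul] at this
    exact this
  · filter_upwards [ae_restrict_mem measurableSet_Ioi] with s (hs : 0 < s) x (hx : w / 2 < x)
    rw [norm_mul, norm_of_nonneg (r := s⁻¹ ^ (j + 1) * _) (by positivity)]
    norm_num
    gcongr
  · filter_upwards [ae_restrict_mem measurableSet_Ioi] with s (hs : 0 < s) x _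
    have h1 : HasDerivAt (fun x : ℝ => -(s / 2) - x / (2 * s)) (-(1 / (2 * s))) x := by
      simpa using ((hasDerivAt_id x).div_const (2 * s)).const_sub (-(s / 2))
    convert! h1.exp.const_mul (s⁻¹ ^ j) using 1
    rw [pow_succ]
    field_simp

/-- The substitution `s ↦ w/s` leaves the exponent invariant. This closes the hierarchy in `j`: the
derivative of `kzero` is again a multiple of `kone`. -/
lemma besselInt_zero_eq {w : ℝ} (hw : 0 < w) : besselInt 0 w = w * besselInt 2 w := by
  -- The substitution is carried out as an inversion followed by a dilation by `w`.
  have h1 := integral_comp_rpow_Ioi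
    (fun s : ℝ => s⁻¹ ^ 0 * exp (-(s / 2) - w / (2 * s))) (p := -1) (by norm_num)
  have h2 := integral_comp_mul_left_Ioi
    (fun s : ℝ => s⁻¹ ^ 2 * exp (-(s / 2) - w / (2 * s))) 0 hw
  simp only [mul_zero, smul_eq_mul] at h2
  unfold besselInt
  rw [← h1]
  have h3 : ∫ x in Ioi (0 : ℝ), (|(-1 : ℝ)| * x ^ ((-1 : ℝ) - 1)) •
      ((x ^ (-1 : ℝ))⁻¹ ^ 0 * exp (-(x ^ (-1 : ℝ) / 2) - w / (2 * x ^ (-1 : ℝ)))) =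
      w ^ 2 * ∫ x in Ioi (0 : ℝ), (w * x)⁻¹ ^ 2 * exp (-((w * x) / 2) - w / (2 * (w * x))) := by
    rw [← integral_const_mul]
    refine setIntegral_congr_fun measurableSet_Ioi fun x (hx : 0 < x) => ?_
    have e1 : x ^ ((-1 : ℝ) - 1) = x⁻¹ ^ 2 := by
      rw [show (-1 : ℝ) - 1 = -(2 : ℕ) by norm_num, rpow_neg hx.le, rpow_natCast, inv_pow]
    have e2 : x ^ (-1 : ℝ) = x⁻¹ := rpow_neg_one x
    simp only [e1, e2]
    have e3 : -(x⁻¹ / 2) - w / (2 * x⁻¹) = -(w * x / 2) - w / (2 * (w * x)) := by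
      field_simp; ring
    rw [e3]
    simp
    field_simp
  rw [h3, h2, ← mul_assoc, pow_two, mul_assoc w, mul_inv_cancel₀ hw.ne', mul_one]

lemma besselInt_pos (j : ℕ) {w : ℝ} (hw : 0 < w) : 0 < besselInt j w := by
  unfold besselInt
  rw [setIntegral_pos_iff_support_of_nonneg_ae]
  · have : Function.support (fun s : ℝ => s⁻¹ ^ j * exp (-(s / 2) - w / (2 * s))) ∩ Ioi 0 = Ioi 0 := by
      ext s
      simp only [mem_inter_iff, Function.mem_support, mem_Ioi, and_iff_right_iff_imp]
      intro hs
      positivity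
    rw [this]; simp
  · filter_upwards [ae_restrict_mem measurableSet_Ioi] with s (hs : 0 < s)
    simp only [Pi.zero_apply]
    positivity
  · exact integrableOn_besselInt j hw

lemma kone_pos {w : ℝ} (hw : 0 < w) : 0 < kone w := by
  have := besselInt_pos 0 hw
  unfold kone; positivity

lemma kzero_pos {w : ℝ} (hw : 0 < w) : 0 < kzero w := by
  have := besselInt_pos 1 hw
  unfold kzero; positivity

lemma hasDerivAt_kone {w : ℝ} (hw : 0 < w) : HasDerivAt kone (-(kzero w / 2)) w := by
  convert! (hasDerivAt_besselInt 0 hw).const_mul (1 / 2) using 1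
  unfold kzero; ring

lemma hasDerivAt_kzero {w : ℝ} (hw : 0 < w) : HasDerivAt kzero (-(kone w / (2 * w))) w := by
  convert! (hasDerivAt_besselInt 1 hw).const_mul (1 / 2) using 1
  unfold kone
  rw [besselInt_zero_eq hw]
  field_simp

lemma kratio_pos {w : ℝ} (hw : 0 < w) : 0 < kratio w := by
  have := kone_pos hw
  have := kzero_pos hw
  unfold kratio; positivity

/-- The system `kone' = -kzero/2`, `kzero' = -kone/(2w)` turns into a Riccati equation for the
quotient. Hence no new transcendental function appears in higher derivatives. -/
lemma hasDerivAt_kratio {w : ℝ} (hw : 0 < w) :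
    HasDerivAt kratio (kratioDeriv w / (2 * w)) w := by
  have h1 := kone_pos hw
  convert! ((hasDerivAt_id w).mul (hasDerivAt_kzero hw)).div (hasDerivAt_kone hw) h1.ne' using 1
  simp only [kratioDeriv, kratio, id, Pi.mul_apply]
  field_simp
  ring

lemma hasDerivAt_log_kone {w : ℝ} (hw : 0 < w) :
    HasDerivAt (fun w => log (kone w)) (-(kratio w / (2 * w))) w := by
  convert! (hasDerivAt_kone hw).log (kone_pos hw).ne' using 1
  unfold kratio
  field_simp

lemma hasDerivAt_kratioDeriv {w : ℝ} (hw : 0 < w) :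
    HasDerivAt kratioDeriv ((kratio w + 1) * kratioDeriv w / w - 1) w := by
  have h := hasDerivAt_kratio hw
  convert! ((h.pow 2).add (h.const_mul 2)).sub (hasDerivAt_id w) using 1
  push_cast
  field_simp

/-- This is `K₀ ≤ K₁`. The integral of the square `(1 - √w/s)²` expands to `I₀ + w I₂ - 2 √w I₁`,
where `w I₂ = I₀`. -/
lemma sqrt_mul_kzero_le_kone {w : ℝ} (hw : 0 < w) : √w * kzero w ≤ kone w := by
  have h0 : 0 ≤ ∫ s in Ioi (0 : ℝ), (1 - √w * s⁻¹) ^ 2 * exp (-(s / 2) - w / (2 * s)) :=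
    integral_nonneg fun s => by positivity
  have hsq : √w ^ 2 = w := sq_sqrt hw.le
  have h1 : ∫ s in Ioi (0 : ℝ), (1 - √w * s⁻¹) ^ 2 * exp (-(s / 2) - w / (2 * s)) =
      besselInt 0 w + w * besselInt 2 w - 2 * √w * besselInt 1 w := by
    unfold besselInt
    have i0 := integrableOn_besselInt 0 hw
    have i2 := (integrableOn_besselInt 2 hw).const_mul w
    have i1 := (integrableOn_besselInt 1 hw).const_mul (2 * √w)
    rw [← integral_const_mul, ← integral_const_mul]
    refine Eq.trans ?_ ((integral_sub (i0.add i2) i1).trans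
      (congrArg (· - _) (integral_add i0 i2)))
    congr 1
    ext s
    simp only [Pi.add_apply]
    rw [sub_sq, mul_pow, hsq]
    ring
  rw [h1, ← besselInt_zero_eq hw] at h0
  unfold kzero kone
  linarith

lemma kratio_le_sqrt {w : ℝ} (hw : 0 < w) : kratio w ≤ √w := by
  unfold kratio
  rw [div_le_iff₀ (kone_pos hw)]
  calc w * kzero w = √w * (√w * kzero w) := by rw [← mul_assoc, mul_self_sqrt hw.le]
    _ ≤ _ := by gcongr; exact sqrt_mul_kzero_le_kone hw

lemma kone_zero : kone 0 = 1 := by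
  unfold kone besselInt
  have := integral_exp_mul_Ioi (a := -(1 / 2)) (by norm_num) 0
  simp only [zero_div, sub_zero, pow_zero, one_mul]
  have h2 : (fun s : ℝ => exp (-(s / 2))) = fun s => exp (-(1 / 2) * s) := by
    ext s; ring_nf
  rw [h2, this]
  norm_num

lemma kone_antitone {v w : ℝ} (hv : 0 ≤ v) (hvw : v ≤ w) : kone w ≤ kone v := by
  unfold kone besselInt
  gcongr ?_ * ?_
  refine setIntegral_mono_on (integrableOn_besselInt_zero (hv.trans hvw))
    (integrableOn_besselInt_zero hv) measurableSet_Ioi fun s (hs : 0 < s) => ?_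
  gcongr

lemma continuousOn_kone : ContinuousOn kone (Ici 0) := by
  unfold kone besselInt
  refine ContinuousOn.mul continuousOn_const ?_
  refine continuousOn_of_dominated (bound := fun s => exp (-(1 / 2) * s))
    (fun w _ => (measurable_besselInt_integrand 0 w).aestronglyMeasurable) ?_
    integrableOn_exp_neg_half ?_
  · intro w (hw : 0 ≤ w)
    filter_upwards [ae_restrict_mem measurableSet_Ioi] with s (hs : 0 < s)
    rw [norm_of_nonneg (by positivity), pow_zero, one_mul]
    apply exp_le_exp.2
    have : 0 ≤ w / (2 * s) := by positivity
    linarith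
  · exact Eventually.of_forall fun s => by fun_prop

lemma kone_pos' {w : ℝ} (hw : 0 ≤ w) : 0 < kone w :=
  (kone_pos (by linarith : 0 < w + 1)).trans_le (kone_antitone hw (by linarith))

/-- By the arithmetic-geometric mean inequality the exponent `s/2 + w/(2s)` is at least `√w`. A
share `1 - ε` of it is spent on that bound; the rest keeps the integral in `s` convergent. -/
lemma kone_le_exp {w ε : ℝ} (hw : 0 ≤ w) (hε : 0 < ε) (hε1 : ε ≤ 1) :
    kone w ≤ ε⁻¹ * exp (-((1 - ε) * √w)) := by
  have h1 : besselInt 0 w ≤ ∫ s in Ioi (0 : ℝ), exp (-((1 - ε) * √w)) * exp (-(ε / 2) * s) := by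
    refine setIntegral_mono_on (integrableOn_besselInt_zero hw)
      ((integrableOn_exp_mul_Ioi (by linarith) 0).const_mul _) measurableSet_Ioi
      fun s (hs : 0 < s) => ?_
    rw [pow_zero, one_mul, ← exp_add]
    apply exp_le_exp.2
    have h2 : √w ≤ s / 2 + w / (2 * s) := by
      have : 0 ≤ (s - √w) ^ 2 / (2 * s) := by positivity
      have h3 : (s - √w) ^ 2 / (2 * s) = s / 2 + w / (2 * s) - √w := by
        rw [sub_sq, sq_sqrt hw]; field_simp; ring
      linarith
    have h4 : 0 ≤ w / (2 * s) := by positivity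
    nlinarith
  have h2 : ∫ s in Ioi (0 : ℝ), exp (-((1 - ε) * √w)) * exp (-(ε / 2) * s) =
      exp (-((1 - ε) * √w)) * (2 * ε⁻¹) := by
    rw [integral_const_mul, integral_exp_mul_Ioi (by linarith) 0]
    simp
    field_simp
  unfold kone
  rw [h2] at h1
  calc 1 / 2 * besselInt 0 w ≤ 1 / 2 * (exp (-((1 - ε) * √w)) * (2 * ε⁻¹)) := by gcongr
    _ = _ := by ring

lemma exp_neg_le_rpow_neg {x : ℝ} (hx : 0 < x) : exp (-x) ≤ x ^ (-(1 / 4) : ℝ) := by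
  rw [exp_neg, rpow_neg hx.le]
  apply inv_anti₀ (by positivity)
  have : x ^ (1 / 4 : ℝ) ≤ 1 + x := by
    rcases le_total x 1 with h | h
    · have := rpow_le_one hx.le h (by norm_num : (0 : ℝ) ≤ 1 / 4)
      linarith
    · have := rpow_le_rpow_of_exponent_le h (by norm_num : (1 / 4 : ℝ) ≤ 1)
      rw [rpow_one] at this
      linarith
  linarith [add_one_le_exp x]

/-- A crude substitute for the logarithmic singularity of `K₀`. Any exponent in `(-1/2, 0)` would
serve, since what is needed is that `w * kzero w` be of smaller order than `√w` at `0` by a power.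
-/
lemma exists_kzero_le : ∃ C, 0 < C ∧ ∀ w, 0 < w → kzero w ≤ C * w ^ (-(1 / 4) : ℝ) := by
  have hint : IntegrableOn (fun s : ℝ => s ^ (-(3 / 4) : ℝ) * exp (-(1 / 2) * s)) (Ioi 0) :=
    integrableOn_rpow_mul_exp_neg_mul_rpow (p := 1) (s := -(3 / 4)) (b := 1 / 2)
      (by norm_num) (by norm_num) (by norm_num) |>.congr_fun
      (fun s _ => by simp) measurableSet_Ioi
  refine ⟨1 / 2 * (2 ^ (1 / 4 : ℝ) * (∫ s in Ioi (0 : ℝ), s ^ (-(3 / 4) : ℝ) * exp (-(1 / 2) * s)))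
    + 1, ?_, ?_⟩
  · have : 0 ≤ ∫ s in Ioi (0 : ℝ), s ^ (-(3 / 4) : ℝ) * exp (-(1 / 2) * s) :=
      setIntegral_nonneg measurableSet_Ioi fun s (hs : 0 < s) => by positivity
    positivity
  · intro w hw
    have h1 : besselInt 1 w ≤ ∫ s in Ioi (0 : ℝ),
        (2 ^ (1 / 4 : ℝ) * w ^ (-(1 / 4) : ℝ)) * (s ^ (-(3 / 4) : ℝ) * exp (-(1 / 2) * s)) := by
      refine setIntegral_mono_on (integrableOn_besselInt 1 hw)
        (hint.const_mul _) measurableSet_Ioi fun s (hs : 0 < s) => ?_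
      have h2 := exp_neg_le_rpow_neg (x := w / (2 * s)) (by positivity)
      have h3 : (w / (2 * s)) ^ (-(1 / 4) : ℝ) =
          2 ^ (1 / 4 : ℝ) * w ^ (-(1 / 4) : ℝ) * s ^ (1 / 4 : ℝ) := by
        rw [div_rpow hw.le (by positivity), mul_rpow (by norm_num) hs.le,
          rpow_neg (by norm_num : (0 : ℝ) ≤ 2), rpow_neg hs.le]
        field_simp
      have h4 : s ^ (-(3 / 4) : ℝ) = s⁻¹ * s ^ (1 / 4 : ℝ) := by
        rw [← rpow_neg_one s, ← rpow_add hs]; norm_num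
      have h5 : exp (-(s / 2) - w / (2 * s)) = exp (-(1 / 2) * s) * exp (-(w / (2 * s))) := by
        rw [← exp_add]; ring_nf
      rw [h5, h4, pow_one]
      rw [h3] at h2
      calc s⁻¹ * (exp (-(1 / 2) * s) * exp (-(w / (2 * s))))
          ≤ s⁻¹ * (exp (-(1 / 2) * s) *
            (2 ^ (1 / 4 : ℝ) * w ^ (-(1 / 4) : ℝ) * s ^ (1 / 4 : ℝ))) := by gcongr
        _ = _ := by ring
    rw [integral_const_mul] at h1
    unfold kzero
    have : 0 ≤ w ^ (-(1 / 4) : ℝ) := by positivity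
    nlinarith

/-- For small `w` this improves on `kratio_le_sqrt` by a power, and for `w ≥ 1` it follows from it.
With `w` of order `m²` the bound reads `m^(3/2)`, which is integrable against `m⁻²` at the origin,
whereas `m` is not. -/
lemma exists_kratio_le : ∃ C, 0 < C ∧ ∀ w, 0 < w → kratio w ≤ C * w ^ (3 / 4 : ℝ) := by
  obtain ⟨C, hC, h⟩ := exists_kzero_le
  refine ⟨C / kone 1 + 1, by have := kone_pos one_pos; positivity, fun w hw => ?_⟩
  have hk1 := kone_pos one_pos
  have hw34 : 0 ≤ w ^ (3 / 4 : ℝ) := by positivity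
  rcases le_total w 1 with h1 | h1
  · have : kratio w ≤ C / kone 1 * w ^ (3 / 4 : ℝ) := by
      unfold kratio
      have e : w * w ^ (-(1 / 4) : ℝ) = w ^ (3 / 4 : ℝ) := by
        nth_rewrite 1 [← rpow_one w]
        rw [← rpow_add hw]; norm_num
      calc w * kzero w / kone w ≤ w * (C * w ^ (-(1 / 4) : ℝ)) / kone 1 := by
            gcongr
            · exact h w hw
            · exact kone_antitone hw.le h1
        _ = C / kone 1 * (w * w ^ (-(1 / 4) : ℝ)) := by ring
        _ = _ := by rw [e]
    nlinarith
  · have : kratio w ≤ w ^ (3 / 4 : ℝ) := by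
      refine (kratio_le_sqrt hw).trans ?_
      rw [sqrt_eq_rpow]
      exact rpow_le_rpow_of_exponent_le h1 (by norm_num)
    have h2 : 0 ≤ C / kone 1 * w ^ (3 / 4 : ℝ) := by positivity
    nlinarith

/-- Each function is differentiated into the other, so smoothness has to be proved for both at once.
-/
lemma contDiffOn_kone_kzero (n : ℕ) :
    ContDiffOn ℝ n kone (Ioi 0) ∧ ContDiffOn ℝ n kzero (Ioi 0) := by
  induction n with
  | zero =>
    refine ⟨contDiffOn_zero.2 fun w hw => (hasDerivAt_kone hw).continuousAt.continuousWithinAt,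
      contDiffOn_zero.2 fun w hw => (hasDerivAt_kzero hw).continuousAt.continuousWithinAt⟩
  | succ n ih =>
    rw [Nat.cast_add, Nat.cast_one]
    constructor
    · refine (contDiffOn_succ_iff_deriv_of_isOpen (n := n) isOpen_Ioi).2 ⟨fun w hw =>
        (hasDerivAt_kone hw).differentiableAt.differentiableWithinAt, fun h => by simp at h, ?_⟩
      exact (ih.2.div_const 2).neg.congr fun w hw => (hasDerivAt_kone hw).deriv
    · refine (contDiffOn_succ_iff_deriv_of_isOpen (n := n) isOpen_Ioi).2 ⟨fun w hw =>
        (hasDerivAt_kzero hw).differentiableAt.differentiableWithinAt, fun h => by simp at h, ?_⟩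
      refine (ih.1.div (contDiffOn_const.mul contDiffOn_id) fun w (hw : 0 < w) => ?_).neg.congr
        fun w hw => (hasDerivAt_kzero hw).deriv
      simp [hw.ne']

lemma besselK_one {x : ℝ} (hx : 0 < x) : besselK 1 x = kone (x ^ 2) / x := by
  have h2 := integral_comp_mul_left_Ioi
    (fun s : ℝ => s⁻¹ ^ 0 * exp (-(s / 2) - x ^ 2 / (2 * s))) 0 hx
  simp only [mul_zero, smul_eq_mul] at h2
  unfold besselK kone besselInt
  have h3 : ∫ t in Ioi (0 : ℝ), t ^ ((1 : ℝ) - 1) * exp (-(x / 2) * (t + 1 / t)) =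
      ∫ t in Ioi (0 : ℝ), (x * t)⁻¹ ^ 0 * exp (-(x * t / 2) - x ^ 2 / (2 * (x * t))) := by
    refine setIntegral_congr_fun measurableSet_Ioi fun t (ht : 0 < t) => ?_
    simp only [sub_self, rpow_zero, pow_zero]
    congr 2
    field_simp
    ring
  rw [h3, h2]
  field_simp

lemma besselK_zero {x : ℝ} (hx : 0 < x) : besselK 0 x = kzero (x ^ 2) := by
  have h2 := integral_comp_mul_left_Ioi
    (fun s : ℝ => s⁻¹ ^ 1 * exp (-(s / 2) - x ^ 2 / (2 * s))) 0 hx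
  simp only [mul_zero, smul_eq_mul] at h2
  unfold besselK kzero besselInt
  have h3 : ∫ t in Ioi (0 : ℝ), t ^ ((0 : ℝ) - 1) * exp (-(x / 2) * (t + 1 / t)) =
      x * ∫ t in Ioi (0 : ℝ), (x * t)⁻¹ ^ 1 * exp (-(x * t / 2) - x ^ 2 / (2 * (x * t))) := by
    rw [← integral_const_mul]
    refine setIntegral_congr_fun measurableSet_Ioi fun t (ht : 0 < t) => ?_
    simp only [zero_sub, rpow_neg_one, pow_one]
    have : -(x * t / 2) - x ^ 2 / (2 * (x * t)) = -(x / 2) * (t + 1 / t) := by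
      field_simp; ring
    rw [this]
    field_simp
  rw [h3, h2]
  field_simp

end NIG
end

/-! ### The normal inverse Gaussian density: total mass and Laplace transform -/

noncomputable section

namespace NIG

open Set Real

/-- An odd antiderivative of the Gaussian function. -/
def gaussPrim (u : ℝ) : ℝ := ∫ t in (0 : ℝ)..u, exp (-(1 / 2) * t ^ 2)

lemma hasDerivAt_gaussPrim (u : ℝ) : HasDerivAt gaussPrim (exp (-(1 / 2) * u ^ 2)) u := by
  have hc : Continuous fun t : ℝ => exp (-(1 / 2) * t ^ 2) := by fun_prop
  exact intervalIntegral.integral_hasDerivAt_right (hc.intervalIntegrable _ _)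
    hc.stronglyMeasurable.stronglyMeasurableAtFilter hc.continuousAt

lemma tendsto_gaussPrim_atTop : Tendsto gaussPrim atTop (𝓝 (√(2 * π) / 2)) := by
  have h := intervalIntegral_tendsto_integral_Ioi 0
    (integrable_exp_neg_mul_sq (b := 1 / 2) (by norm_num)).integrableOn tendsto_id
  rw [integral_gaussian_Ioi, show π / (1 / 2) = 2 * π by ring] at h
  exact h

lemma gaussPrim_neg (u : ℝ) : gaussPrim (-u) = -gaussPrim u := by
  unfold gaussPrim
  have := intervalIntegral.integral_comp_neg (a := 0) (b := u) fun t : ℝ => exp (-(1 / 2) * t ^ 2)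
  simp only [neg_zero, neg_sq] at this
  rw [intervalIntegral.integral_symm, ← this]

lemma tendsto_gaussPrim_atBot : Tendsto gaussPrim atBot (𝓝 (-(√(2 * π) / 2))) := by
  have := (tendsto_gaussPrim_atTop.comp tendsto_neg_atBot_atTop).neg
  refine this.congr fun u => ?_
  simp [gaussPrim_neg]

/-- The integral of the (unnormalized) inverse Gaussian density. -/
lemma integral_invGauss {a g : ℝ} (ha : 0 < a) (hg : 0 < g) :
    IntegrableOn (fun s => s⁻¹ ^ 2 * √s * exp (-(a ^ 2 / (2 * s)) - g ^ 2 * s / 2)) (Ioi 0) ∧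
    ∫ s in Ioi (0 : ℝ), s⁻¹ ^ 2 * √s * exp (-(a ^ 2 / (2 * s)) - g ^ 2 * s / 2) =
      √(2 * π) / a * exp (-(a * g)) := by
  -- Up to constants this is the inverse Gaussian distribution function. In its derivative both
  -- Gaussian factors, multiplied by `exp (∓ a g)`, become equal; the terms in `g` cancel and those
  -- in `a` add up.
  set G : ℝ → ℝ := fun s => exp (-(a * g)) * gaussPrim (g * √s - a * (√s)⁻¹) -
    exp (a * g) * gaussPrim (g * √s + a * (√s)⁻¹) with hG
  set c := √(2 * π) / 2 with hc
  set L := exp (-(a * g)) * (-c) - exp (a * g) * c with hL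
  have hsq : Tendsto (fun s => √s) (𝓝[>] 0) (𝓝 0) := by
    have := (continuous_sqrt.tendsto 0).mono_left (nhdsWithin_le_nhds (s := Ioi 0))
    simpa using this
  have hsq' : Tendsto (fun s => √s) (𝓝[>] 0) (𝓝[>] 0) :=
    tendsto_nhdsWithin_iff.2 ⟨hsq, by
      filter_upwards [self_mem_nhdsWithin] with s hs using sqrt_pos.2 hs⟩
  have hinv : Tendsto (fun s => a * (√s)⁻¹) (𝓝[>] 0) atTop :=
    (tendsto_inv_nhdsGT_zero.comp hsq').const_mul_atTop ha
  have hinv' : Tendsto (fun s => a * (√s)⁻¹) atTop (𝓝 0) := by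
    simpa using (tendsto_inv_atTop_zero.comp tendsto_sqrt_atTop).const_mul a
  have hlin : Tendsto (fun s => g * √s) atTop atTop := tendsto_sqrt_atTop.const_mul_atTop hg
  have h0 : Tendsto G (𝓝[>] 0) (𝓝 L) := by
    refine ((tendsto_gaussPrim_atBot.comp ?_).const_mul _).sub
      ((tendsto_gaussPrim_atTop.comp ?_).const_mul _)
    · exact ((hsq.const_mul g).add_atBot (tendsto_neg_atTop_atBot.comp hinv))
    · exact ((hsq.const_mul g).add_atTop hinv)
  have h1 : Tendsto G atTop (𝓝 (exp (-(a * g)) * c - exp (a * g) * c)) := by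
    refine ((tendsto_gaussPrim_atTop.comp ?_).const_mul _).sub
      ((tendsto_gaussPrim_atTop.comp ?_).const_mul _)
    · simpa [sub_eq_add_neg] using hlin.atTop_add hinv'.neg
    · exact hlin.atTop_add hinv'
  -- `G` has only a limit from the right at `0`; it is given that value there, as the fundamental
  -- theorem on the half-line asks for continuity at the endpoint.
  have hd : ∀ s ∈ Ioi (0 : ℝ), HasDerivAt (Function.update G 0 L)
      (a * (s⁻¹ ^ 2 * √s * exp (-(a ^ 2 / (2 * s)) - g ^ 2 * s / 2))) s := by
    intro s (hs : 0 < s)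
    have hev : Function.update G 0 L =ᶠ[𝓝 s] G := by
      filter_upwards [lt_mem_nhds hs] with x hx using Function.update_of_ne hx.ne' _ _
    refine HasDerivAt.congr_of_eventuallyEq ?_ hev
    have hr : 0 < √s := sqrt_pos.2 hs
    have hss : √s ^ 2 = s := sq_sqrt hs.le
    have d1 : HasDerivAt (fun s => √s) (1 / (2 * √s)) s := hasDerivAt_sqrt hs.ne'
    have d2 : HasDerivAt (fun s => (√s)⁻¹) (-(1 / (2 * √s)) / √s ^ 2) s := d1.inv hr.ne'
    have dm := ((hasDerivAt_gaussPrim (g * √s - a * (√s)⁻¹)).comp s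
      ((d1.const_mul g).sub (d2.const_mul a))).const_mul (exp (-(a * g)))
    have dp := ((hasDerivAt_gaussPrim (g * √s + a * (√s)⁻¹)).comp s
      ((d1.const_mul g).add (d2.const_mul a))).const_mul (exp (a * g))
    convert! dm.sub dp using 1
    have e1 : exp (-(a * g)) * exp (-(1 / 2) * (g * √s - a * (√s)⁻¹) ^ 2) =
        exp (-(a ^ 2 / (2 * s)) - g ^ 2 * s / 2) := by
      have alg : ∀ r : ℝ, 0 < r → -(a * g) + -(1 / 2) * (g * r - a * r⁻¹) ^ 2 =
          -(a ^ 2 / (2 * r ^ 2)) - g ^ 2 * r ^ 2 / 2 := by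
        intro r hr; field_simp; ring
      rw [← exp_add, alg _ hr, hss]
    have e2 : exp (a * g) * exp (-(1 / 2) * (g * √s + a * (√s)⁻¹) ^ 2) =
        exp (-(a ^ 2 / (2 * s)) - g ^ 2 * s / 2) := by
      have alg : ∀ r : ℝ, 0 < r → a * g + -(1 / 2) * (g * r + a * r⁻¹) ^ 2 =
          -(a ^ 2 / (2 * r ^ 2)) - g ^ 2 * r ^ 2 / 2 := by
        intro r hr; field_simp; ring
      rw [← exp_add, alg _ hr, hss]
    rw [← mul_assoc (exp (-(a * g))), ← mul_assoc (exp (a * g)), e1, e2]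
    have e3 : s⁻¹ ^ 2 * √s = (√s ^ 3)⁻¹ := by
      nth_rewrite 1 [← hss]
      field_simp
    rw [e3]
    field_simp
    ring
  have hcont : ContinuousWithinAt (Function.update G 0 L) (Ici 0) 0 := by
    rw [continuousWithinAt_update_same]
    have : Ici (0 : ℝ) \ {0} = Ioi 0 := by
      ext x; simp [lt_iff_le_and_ne, eq_comm]
    rwa [this]
  have hlim : Tendsto (Function.update G 0 L) atTop (𝓝 (exp (-(a * g)) * c - exp (a * g) * c)) := by
    refine h1.congr' ?_
    filter_upwards [eventually_gt_atTop 0] with x hx using (Function.update_of_ne hx.ne' _ _).symm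
  have hnn : ∀ s ∈ Ioi (0 : ℝ),
      0 ≤ a * (s⁻¹ ^ 2 * √s * exp (-(a ^ 2 / (2 * s)) - g ^ 2 * s / 2)) := by
    intro s (hs : 0 < s)
    positivity
  have hI := integrableOn_Ioi_deriv_of_nonneg hcont hd hnn hlim
  have hE := integral_Ioi_of_hasDerivAt_of_nonneg hcont hd hnn hlim
  constructor
  · have := hI.const_mul a⁻¹
    refine this.congr (Eventually.of_forall fun s => ?_)
    field_simp
  · rw [integral_const_mul, Function.update_self] at hE
    have : ∫ s in Ioi (0 : ℝ), s⁻¹ ^ 2 * √s * exp (-(a ^ 2 / (2 * s)) - g ^ 2 * s / 2) =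
        a⁻¹ * (a * ∫ s in Ioi (0 : ℝ), s⁻¹ ^ 2 * √s * exp (-(a ^ 2 / (2 * s)) - g ^ 2 * s / 2)) := by
      rw [← mul_assoc, inv_mul_cancel₀ ha.ne', one_mul]
    rw [this, hE, hL, hc]
    field_simp
    ring

/-- The squared distance in the density. -/
lemma density_eq {α δ : ℝ} (hα : 0 < α) (hδ : 0 < δ) (β μ y : ℝ) :
    density α β δ μ y = δ / π * exp (δ * √(α ^ 2 - β ^ 2) + β * (y - μ)) *
      (kone (α ^ 2 * (δ ^ 2 + (y - μ) ^ 2)) / (δ ^ 2 + (y - μ) ^ 2)) := by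
  have hs : 0 < δ ^ 2 + (y - μ) ^ 2 := by positivity
  have hr : 0 < √(δ ^ 2 + (y - μ) ^ 2) := sqrt_pos.2 hs
  unfold density
  rw [besselK_one (by positivity), mul_pow, sq_sqrt hs.le]
  generalize kone (α ^ 2 * (δ ^ 2 + (y - μ) ^ 2)) = k
  rw [div_div k, mul_assoc α, mul_self_sqrt hs.le]
  field_simp

lemma density_pos {α δ : ℝ} (hα : 0 < α) (hδ : 0 < δ) (β μ y : ℝ) : 0 < density α β δ μ y := by
  rw [density_eq hα hδ]
  have hs : 0 < δ ^ 2 + (y - μ) ^ 2 := by positivity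
  have := kone_pos (w := α ^ 2 * (δ ^ 2 + (y - μ) ^ 2)) (by positivity)
  have := pi_pos
  positivity

lemma continuous_density {α δ : ℝ} (hα : 0 < α) (hδ : 0 < δ) (β μ : ℝ) :
    Continuous (density α β δ μ) := by
  have : density α β δ μ = fun y => δ / π * exp (δ * √(α ^ 2 - β ^ 2) + β * (y - μ)) *
      (kone (α ^ 2 * (δ ^ 2 + (y - μ) ^ 2)) / (δ ^ 2 + (y - μ) ^ 2)) :=
    funext (density_eq hα hδ β μ)
  rw [this]
  refine Continuous.mul (by fun_prop) (Continuous.div ?_ (by fun_prop) fun y => by positivity)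
  exact continuousOn_kone.comp_continuous (by fun_prop) fun y => mem_Ici.2 (by positivity)

lemma lintegral_exp_quadratic {b v : ℝ} (hv : 0 < v) :
    ∫⁻ x, ENNReal.ofReal (exp (b * x - x ^ 2 / (2 * v))) =
      ENNReal.ofReal (√(2 * π * v) * exp (b ^ 2 * v / 2)) := by
  have e : ∀ x : ℝ, exp (b * x - x ^ 2 / (2 * v)) =
      exp (b ^ 2 * v / 2) * exp (-(1 / (2 * v)) * (x - b * v) ^ 2) := by
    intro x
    rw [← exp_add]
    congr 1
    field_simp
    ring
  have hi : Integrable fun x => exp (-(1 / (2 * v)) * (x - b * v) ^ 2) :=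
    (integrable_exp_neg_mul_sq (b := 1 / (2 * v)) (by positivity)).comp_sub_right (b * v)
  simp_rw [e]
  rw [← ofReal_integral_eq_lintegral_ofReal (hi.const_mul _) (Eventually.of_forall fun x => by
    positivity), integral_const_mul,
    integral_sub_right_eq_self (fun x => exp (-(1 / (2 * v)) * x ^ 2)), integral_gaussian]
  congr 1
  rw [mul_comm]
  congr 2
  field_simp

/-- The law is a normal variance mixture: the density is an integral over `t` of Gaussian functions
of `y` with variance `t / α²`. After Tonelli's theorem the Gaussian integral in `y` leaves the
inverse Gaussian integral in `t`. -/
lemma lintegral_density {α β δ : ℝ} (hβ : |β| < α) (hδ : 0 < δ) (μ : ℝ) :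
    ∫⁻ y, ENNReal.ofReal (density α β δ μ y) = 1 := by
  have hα : 0 < α := (abs_nonneg β).trans_lt hβ
  have hγ : 0 < α ^ 2 - β ^ 2 := by
    have := sq_lt_sq' (neg_lt_of_abs_lt hβ) (lt_of_abs_lt hβ)
    linarith
  set γ := √(α ^ 2 - β ^ 2) with hγd
  have hγ0 : 0 < γ := sqrt_pos.2 hγ
  have hγ2 : γ ^ 2 = α ^ 2 - β ^ 2 := sq_sqrt hγ.le
  have hπ := pi_pos
  have key : ∀ y, ENNReal.ofReal (density α β δ μ y) = ∫⁻ t in Ioi (0 : ℝ),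
      ENNReal.ofReal (δ / π * exp (δ * γ) * (α ^ 2 / 2) *
        (t⁻¹ ^ 2 * exp (-(t / 2) - α ^ 2 * δ ^ 2 / (2 * t)))) *
      ENNReal.ofReal (exp (β * (y - μ) - (y - μ) ^ 2 / (2 * (t / α ^ 2)))) := by
    intro y
    have hs : 0 < δ ^ 2 + (y - μ) ^ 2 := by positivity
    have hw : 0 < α ^ 2 * (δ ^ 2 + (y - μ) ^ 2) := by positivity
    rw [density_eq hα hδ, ← hγd]
    -- Writing `kone` through `besselInt 2` rather than `besselInt 0` cancels the denominator, so
    -- that `y` enters only through the exponent.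
    have h1 : kone (α ^ 2 * (δ ^ 2 + (y - μ) ^ 2)) / (δ ^ 2 + (y - μ) ^ 2) =
        α ^ 2 / 2 * besselInt 2 (α ^ 2 * (δ ^ 2 + (y - μ) ^ 2)) := by
      unfold kone
      rw [besselInt_zero_eq hw]
      field_simp
    rw [h1, ← mul_assoc, besselInt, ← integral_const_mul, ofReal_integral_eq_lintegral_ofReal
      ((integrableOn_besselInt 2 hw).const_mul _)
      (Eventually.of_forall fun s => by positivity)]
    refine setLIntegral_congr_fun measurableSet_Ioi fun t (ht : 0 < t) => ?_
    rw [← ENNReal.ofReal_mul (by positivity)]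
    congr 1
    have e1 : exp (δ * γ + β * (y - μ)) * exp (-(t / 2) - α ^ 2 * (δ ^ 2 + (y - μ) ^ 2) / (2 * t)) =
        exp (δ * γ) * (exp (-(t / 2) - α ^ 2 * δ ^ 2 / (2 * t)) *
          exp (β * (y - μ) - (y - μ) ^ 2 / (2 * (t / α ^ 2)))) := by
      rw [← exp_add, ← exp_add, ← exp_add]
      congr 1
      field_simp
      ring
    linear_combination (δ / π * (α ^ 2 / 2) * t⁻¹ ^ 2) * e1
  simp_rw [key]
  rw [lintegral_lintegral_swap]
  · have h2 : ∀ t ∈ Ioi (0 : ℝ), ∫⁻ y, ENNReal.ofReal (δ / π * exp (δ * γ) * (α ^ 2 / 2) *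
        (t⁻¹ ^ 2 * exp (-(t / 2) - α ^ 2 * δ ^ 2 / (2 * t)))) *
      ENNReal.ofReal (exp (β * (y - μ) - (y - μ) ^ 2 / (2 * (t / α ^ 2)))) =
      ENNReal.ofReal (δ / π * exp (δ * γ) * (α / 2) * √(2 * π) *
        (t⁻¹ ^ 2 * √t * exp (-((α * δ) ^ 2 / (2 * t)) - (γ / α) ^ 2 * t / 2))) := by
      intro t (ht : 0 < t)
      rw [lintegral_const_mul _ (by fun_prop), lintegral_sub_right_eq_self
        (fun y => ENNReal.ofReal (exp (β * y - y ^ 2 / (2 * (t / α ^ 2))))) μ,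
        lintegral_exp_quadratic (by positivity), ← ENNReal.ofReal_mul (by positivity)]
      congr 1
      have e2 : √(2 * π * (t / α ^ 2)) = √(2 * π) * √t / α := by
        rw [sqrt_mul (by positivity), sqrt_div ht.le, sqrt_sq hα.le]; ring
      have e3 : exp (-(t / 2) - α ^ 2 * δ ^ 2 / (2 * t)) * exp (β ^ 2 * (t / α ^ 2) / 2) =
          exp (-((α * δ) ^ 2 / (2 * t)) - (γ / α) ^ 2 * t / 2) := by
        rw [← exp_add]
        congr 1
        rw [div_pow, hγ2]
        field_simp
        ring
      rw [e2, ← e3]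
      field_simp
    rw [setLIntegral_congr_fun measurableSet_Ioi h2]
    obtain ⟨hI, hE⟩ := integral_invGauss (a := α * δ) (g := γ / α) (by positivity) (by positivity)
    rw [← ofReal_integral_eq_lintegral_ofReal (hI.const_mul _)
      (Eventually.of_forall fun s => by positivity), integral_const_mul, hE]
    rw [ENNReal.ofReal_eq_one]
    have e4 : exp (-(α * δ * (γ / α))) = (exp (δ * γ))⁻¹ := by
      rw [← exp_neg]; congr 1; field_simp
    have e5 : √(2 * π) * √(2 * π) = 2 * π := mul_self_sqrt (by positivity)
    rw [e4]
    have := exp_pos (δ * γ)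
    calc δ / π * exp (δ * γ) * (α / 2) * √(2 * π) * (√(2 * π) / (α * δ) * (exp (δ * γ))⁻¹)
        = (√(2 * π) * √(2 * π)) / (2 * π) := by field_simp
      _ = 1 := by rw [e5]; field_simp
  · refine Measurable.aemeasurable ?_
    fun_prop

lemma isProbabilityMeasure_law {α β δ : ℝ} (hβ : |β| < α) (hδ : 0 < δ) (μ : ℝ) :
    IsProbabilityMeasure (law α β δ μ) :=
  ⟨by rw [law, withDensity_apply _ MeasurableSet.univ, Measure.restrict_univ,
    lintegral_density hβ hδ]⟩

lemma measurable_density {α δ : ℝ} (hα : 0 < α) (hδ : 0 < δ) (β μ : ℝ) :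
    Measurable (density α β δ μ) := (continuous_density hα hδ β μ).measurable

/-- Multiplying the density by `exp (u y)` gives, up to a constant, the density with `β + u` in
place of `β`, whose mass is again one. -/
lemma lintegral_exp_law {α β δ u : ℝ} (hβ : |β| < α) (hu : |β + u| < α) (hδ : 0 < δ) (μ : ℝ) :
    ∫⁻ y, ENNReal.ofReal (exp (u * y)) ∂(law α β δ μ) =
      ENNReal.ofReal (exp (μ * u + δ * (√(α ^ 2 - β ^ 2) - √(α ^ 2 - (β + u) ^ 2)))) := by
  have hα : 0 < α := (abs_nonneg β).trans_lt hβ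
  rw [law, lintegral_withDensity_eq_lintegral_mul _
    (measurable_density hα hδ β μ).ennreal_ofReal (by fun_prop)]
  have : ∀ y, ENNReal.ofReal (density α β δ μ y) * ENNReal.ofReal (exp (u * y)) =
      ENNReal.ofReal (exp (μ * u + δ * (√(α ^ 2 - β ^ 2) - √(α ^ 2 - (β + u) ^ 2)))) *
        ENNReal.ofReal (density α (β + u) δ μ y) := by
    intro y
    rw [← ENNReal.ofReal_mul (density_pos hα hδ β μ y).le, ← ENNReal.ofReal_mul (exp_pos _).le,
      density_eq hα hδ, density_eq hα hδ]
    congr 1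
    have e : exp (δ * √(α ^ 2 - β ^ 2) + β * (y - μ)) * exp (u * y) =
        exp (μ * u + δ * (√(α ^ 2 - β ^ 2) - √(α ^ 2 - (β + u) ^ 2))) *
        exp (δ * √(α ^ 2 - (β + u) ^ 2) + (β + u) * (y - μ)) := by
      rw [← exp_add, ← exp_add]; ring_nf
    linear_combination (δ / π * (kone (α ^ 2 * (δ ^ 2 + (y - μ) ^ 2)) / (δ ^ 2 + (y - μ) ^ 2))) * e
  simp only [Pi.mul_apply, this]
  rw [lintegral_const_mul _ (measurable_density hα hδ _ μ).ennreal_ofReal,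
    lintegral_density hu hδ, mul_one]

end NIG
end

/-! ### Laws of the increments of a Lévy process -/

noncomputable section

namespace NIG

open Set Real

lemma integrable_exp_of_lintegral {Ω : Type*} [MeasurableSpace Ω] {μ : Measure Ω} {X : Ω → ℝ}
    (hX : Measurable X) (u : ℝ) (h : ∫⁻ x, ENNReal.ofReal (exp (u * X x)) ∂μ ≠ ⊤) :
    Integrable (fun x => exp (u * X x)) μ := by
  refine ⟨by fun_prop, ?_⟩
  rw [hasFiniteIntegral_iff_ofReal (Eventually.of_forall fun x => (exp_pos _).le)]
  exact h.lt_top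

/-- Two laws on the line with the same finite exponential moments near `0` agree. -/
lemma ext_of_lintegral_exp {μ ν : Measure ℝ} [IsProbabilityMeasure μ] [IsProbabilityMeasure ν]
    {a b : ℝ} (ha : a < 0) (hb : 0 < b)
    (hμ : ∀ u ∈ Ioo a b, ∫⁻ x, ENNReal.ofReal (exp (u * x)) ∂μ ≠ ⊤)
    (h : ∀ u ∈ Ioo a b, ∫⁻ x, ENNReal.ofReal (exp (u * x)) ∂μ =
      ∫⁻ x, ENNReal.ofReal (exp (u * x)) ∂ν) : μ = ν := by
  have iμ : ∀ u ∈ Ioo a b, u ∈ integrableExpSet id μ := fun u hu =>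
    integrable_exp_of_lintegral measurable_id u (hμ u hu)
  have iν : ∀ u ∈ Ioo a b, u ∈ integrableExpSet id ν := fun u hu =>
    integrable_exp_of_lintegral measurable_id u (h u hu ▸ hμ u hu)
  have sμ : Ioo a b ⊆ interior (integrableExpSet id μ) := interior_maximal iμ isOpen_Ioo
  have sν : Ioo a b ⊆ interior (integrableExpSet id ν) := interior_maximal iν isOpen_Ioo
  have aμ : AnalyticOnNhd ℂ (complexMGF id μ) {z | z.re ∈ Ioo a b} := fun z hz =>
    analyticAt_complexMGF (sμ hz)
  have aν : AnalyticOnNhd ℂ (complexMGF id ν) {z | z.re ∈ Ioo a b} := fun z hz =>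
    analyticAt_complexMGF (sν hz)
  have hev : ∀ᶠ u : ℝ in 𝓝[≠] (0 : ℝ), complexMGF id μ (u : ℂ) = complexMGF id ν (u : ℂ) := by
    have h0 : Ioo a b ∈ 𝓝[≠] (0 : ℝ) := nhdsWithin_le_nhds (Ioo_mem_nhds ha hb)
    filter_upwards [h0] with u hu
    rw [complexMGF_ofReal, complexMGF_ofReal, mgf, mgf,
      integral_eq_lintegral_of_nonneg_ae (Eventually.of_forall fun x => (exp_pos _).le)
        (by fun_prop),
      integral_eq_lintegral_of_nonneg_ae (Eventually.of_forall fun x => (exp_pos _).le)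
        (by fun_prop)]
    simp only [id]
    rw [h u hu]
  -- Both transforms are analytic in a vertical strip and agree on real points accumulating at `0`,
  -- so they agree on the imaginary axis, where they are the characteristic functions.
  have heq : EqOn (complexMGF id μ) (complexMGF id ν) {z | z.re ∈ Ioo a b} := by
    refine AnalyticOnNhd.eqOn_of_preconnected_of_frequently_eq aμ aν
      ((convex_Ioo a b).linear_preimage Complex.reLm).isPreconnected (z₀ := ((0 : ℝ) : ℂ))
      (by simp [ha, hb]) ?_
    have hfr := hev.frequently
    rw [frequently_iff_seq_forall] at hfr ⊢
    obtain ⟨xs, hx, hxe⟩ := hfr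
    refine ⟨fun n => (xs n : ℂ), ?_, hxe⟩
    rw [tendsto_nhdsWithin_iff] at hx ⊢
    refine ⟨(Complex.continuous_ofReal.tendsto 0).comp hx.1, ?_⟩
    simpa using hx.2
  apply Measure.ext_of_charFun
  ext t
  rw [← complexMGF_id_mul_I, ← complexMGF_id_mul_I]
  exact heq (by simp [ha, hb])

/-- An additive function on `[0, ∞)` that is bounded below near `0` by arbitrarily small constants
is linear. -/
lemma additive_eq_mul {f : ℝ≥0 → ℝ} (hadd : ∀ s t, f (s + t) = f s + f t)
    (hlow : ∀ ε > 0, ∃ η : ℝ≥0, 0 < η ∧ ∀ t < η, -ε ≤ f t) (t : ℝ≥0) : f t = t * f 1 := by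
  -- Without its linear part the function is still additive and bounded below near `0`, and it
  -- vanishes at `1`, hence at all nonnegative rationals.
  set g : ℝ≥0 → ℝ := fun t => f t - t * f 1 with hg
  have gadd : ∀ s t, g (s + t) = g s + g t := fun s t => by
    simp only [hg, hadd]; push_cast; ring
  have g0 : g 0 = 0 := by have := gadd 0 0; simp at this; exact this
  have gn : ∀ (n : ℕ) (s : ℝ≥0), g (n * s) = n * g s := by
    intro n s
    induction n with
    | zero => simp [g0]
    | succ n ih => rw [Nat.cast_add, Nat.cast_one, add_mul, gadd, ih, one_mul]; push_cast; ring
  have g1 : g 1 = 0 := by simp [hg]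
  have glow : ∀ ε > 0, ∃ η : ℝ≥0, 0 < η ∧ ∀ t < η, -ε ≤ g t := by
    intro ε hε
    obtain ⟨η, hη, h⟩ := hlow (ε / 2) (by positivity)
    refine ⟨min η (Real.toNNReal (ε / 2 / (|f 1| + 1))),
      lt_min hη (Real.toNNReal_pos.2 (by positivity)), fun t ht => ?_⟩
    have h1 := h t (ht.trans_le (min_le_left _ _))
    have h2 : (t : ℝ) < ε / 2 / (|f 1| + 1) :=
      Real.lt_toNNReal_iff_coe_lt.1 (ht.trans_le (min_le_right _ _))
    rw [lt_div_iff₀ (by positivity)] at h2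
    have h3 : (t : ℝ) * f 1 ≤ t * (|f 1| + 1) := by
      gcongr; linarith [le_abs_self (f 1)]
    simp only [hg]
    linarith
  have grat : ∀ q : ℚ, 0 ≤ q → g (Real.toNNReal q) = 0 := by
    intro q hq
    have h1 : ((q.den : ℕ) : ℝ≥0) * Real.toNNReal q = ((q.num.toNat : ℕ) : ℝ≥0) * 1 := by
      apply NNReal.eq
      have h3 : ((q.num.toNat : ℕ) : ℤ) = q.num := Int.toNat_of_nonneg (Rat.num_nonneg.2 hq)
      have h4 : ((q.num.toNat : ℕ) : ℝ) = (q.num : ℝ) := by exact_mod_cast congrArg (Int.cast (R := ℝ)) h3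
      rw [mul_one, NNReal.coe_mul, NNReal.coe_natCast, NNReal.coe_natCast, h4,
        Real.coe_toNNReal _ (by exact_mod_cast hq)]
      exact_mod_cast Rat.den_mul_eq_num q
    have h2 := gn q.den (Real.toNNReal q)
    rw [h1, gn, g1, mul_zero] at h2
    have : (q.den : ℝ) ≠ 0 := by exact_mod_cast q.den_ne_zero
    exact (mul_eq_zero.1 h2.symm).resolve_left this
  have hgt : g t = 0 := by
    -- Only lower bounds near `0` are available. A rational `q` just above `t` gives `g t = -g (q -
    -- t) ≤ ε`; one just below gives `g t = g (t - q) ≥ -ε`.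
    apply le_antisymm
    · apply le_of_forall_pos_le_add
      intro ε hε
      obtain ⟨η, hη, h⟩ := glow ε hε
      obtain ⟨q, hq0, hq1, hq2⟩ :=
        (NNReal.lt_iff_exists_rat_btwn _ _).1 (lt_add_of_pos_right t hη)
      have h1 := gadd t (Real.toNNReal q - t)
      rw [add_tsub_cancel_of_le hq1.le, grat q hq0] at h1
      have := h (Real.toNNReal q - t) ((tsub_lt_iff_left hq1.le).2 hq2)
      linarith
    · apply le_of_forall_pos_le_add
      intro ε hε
      obtain ⟨η, hη, h⟩ := glow ε hε
      rcases eq_or_lt_of_le (zero_le : 0 ≤ t) with h0 | h0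
      · rw [← h0, g0]; linarith
      obtain ⟨q, hq0, hq1, hq2⟩ :=
        (NNReal.lt_iff_exists_rat_btwn _ _).1 (tsub_lt_self h0 hη)
      have h1 := gadd (Real.toNNReal q) (t - Real.toNNReal q)
      rw [add_tsub_cancel_of_le hq2.le, grat q hq0] at h1
      have := h (t - Real.toNNReal q) ((tsub_lt_iff_left hq2.le).2 (lt_add_of_tsub_lt_right hq1))
      linarith
  simp only [hg] at hgt
  linarith

section Levy

variable {Ω : Type*} [MeasurableSpace Ω] {X : ℝ≥0 → Ω → ℝ} {P : Measure Ω}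

lemma IsLevyProcess.lintegral_exp_add (hX : IsLevyProcess X P) (u : ℝ) (s t : ℝ≥0) :
    ∫⁻ ω, ENNReal.ofReal (exp (u * X (s + t) ω)) ∂P =
      (∫⁻ ω, ENNReal.ofReal (exp (u * X s ω)) ∂P) * ∫⁻ ω, ENNReal.ofReal (exp (u * X t ω)) ∂P := by
  have hm := hX.measurable
  have hmu : Measurable fun x : ℝ => ENNReal.ofReal (exp (u * x)) := by fun_prop
  have hi := hX.indep.indepFun_eval_sub (zero_le : 0 ≤ s) (le_self_add : s ≤ s + t) hX.zero
  have hi' := hi.comp hmu hmu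
  have h1 := lintegral_mul_eq_lintegral_mul_lintegral_of_indepFun (μ := P) (hmu.comp (hm s))
    (hmu.comp ((hm (s + t)).sub (hm s))) hi'
  have h2 : ∫⁻ ω, ENNReal.ofReal (exp (u * (X (s + t) ω - X s ω))) ∂P =
      ∫⁻ ω, ENNReal.ofReal (exp (u * X t ω)) ∂P := by
    rw [← lintegral_map (f := fun x : ℝ => ENNReal.ofReal (exp (u * x)))
      (g := fun ω => X (s + t) ω - X s ω) hmu ((hm (s + t)).sub (hm s)), hX.stationary s t, lintegral_map hmu (hm t)]
  rw [← h2]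
  refine Eq.trans ?_ h1
  congr 1
  ext ω
  simp only [Function.comp, Pi.mul_apply, Pi.sub_apply]
  rw [← ENNReal.ofReal_mul (exp_pos _).le, ← exp_add]
  congr 2
  ring

lemma lintegral_exp_pos [IsProbabilityMeasure P] {Y : Ω → ℝ} (hY : Measurable Y) (u : ℝ) :
    ∫⁻ ω, ENNReal.ofReal (exp (u * Y ω)) ∂P ≠ 0 := by
  rw [Ne, lintegral_eq_zero_iff (by fun_prop)]
  intro h
  have h1 : ∀ᵐ ω ∂P, False := by
    filter_upwards [h] with ω hω
    simp only [Pi.zero_apply, ENNReal.ofReal_eq_zero] at hω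
    exact absurd hω (not_le.2 (exp_pos _))
  simp [IsProbabilityMeasure.ne_zero] at h1

/-- Multiplicativity carries finiteness from time `1` to all positive integers. An infinite value at
`t` would make a later integer time infinite, because the complementary factor is never zero. -/
lemma IsLevyProcess.lintegral_exp_ne_top (hX : IsLevyProcess X P) {u : ℝ}
    (h1 : ∫⁻ ω, ENNReal.ofReal (exp (u * X 1 ω)) ∂P ≠ ⊤) (t : ℝ≥0) :
    ∫⁻ ω, ENNReal.ofReal (exp (u * X t ω)) ∂P ≠ ⊤ := by
  have := hX.isProb
  have hn : ∀ n : ℕ, ∫⁻ ω, ENNReal.ofReal (exp (u * X (n + 1) ω)) ∂P ≠ ⊤ := by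
    intro n
    induction n with
    | zero => simpa using h1
    | succ n ih =>
      push_cast
      rw [hX.lintegral_exp_add]
      exact ENNReal.mul_ne_top ih h1
  obtain ⟨n, hnt⟩ := exists_nat_ge t
  have h2 := hX.lintegral_exp_add u t (n + 1 - t)
  rw [add_tsub_cancel_of_le (hnt.trans le_self_add)] at h2
  intro h3
  rw [h3, ENNReal.top_mul (lintegral_exp_pos (hX.measurable _) u)] at h2
  exact hn n h2

/-- The logarithm of the Laplace transform is additive in `t`. Convergence in probability does not
bound such a transform from above, but it does from below, and this is all that `additive_eq_mul`
requires. -/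
lemma IsLevyProcess.lintegral_exp_eq (hX : IsLevyProcess X P) {u c : ℝ}
    (h1 : ∫⁻ ω, ENNReal.ofReal (exp (u * X 1 ω)) ∂P = ENNReal.ofReal (exp c)) (t : ℝ≥0) :
    ∫⁻ ω, ENNReal.ofReal (exp (u * X t ω)) ∂P = ENNReal.ofReal (exp (t * c)) := by
  have := hX.isProb
  have hfin := hX.lintegral_exp_ne_top (u := u) (by rw [h1]; exact ENNReal.ofReal_ne_top)
  have hpos := fun t => lintegral_exp_pos (P := P) (hX.measurable t) u
  set L : ℝ≥0 → ℝ≥0∞ := fun t => ∫⁻ ω, ENNReal.ofReal (exp (u * X t ω)) ∂P with hL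
  have hLpos : ∀ t, 0 < (L t).toReal := fun t => ENNReal.toReal_pos (hpos t) (hfin t)
  have key := additive_eq_mul (f := fun t => log (L t).toReal) ?_ ?_ t
  · have hc : log (L 1).toReal = c := by
      rw [hL]; simp only; rw [h1, ENNReal.toReal_ofReal (exp_pos _).le, log_exp]
    simp only [hc] at key
    rw [← key, exp_log (hLpos t), ENNReal.ofReal_toReal (hfin t)]
  · intro s t
    simp only [hL]
    rw [hX.lintegral_exp_add, ENNReal.toReal_mul, log_mul (hLpos s).ne' (hLpos t).ne']
  · intro ε hε
    -- For small `t`, with probability at least `exp (-ε/2)`, the process is so close to `0` that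
    -- `|u X_t| ≤ ε/2`; the transform is then at least `exp (-ε)`.
    have hc := (tendstoInMeasure_iff_measureReal_dist.1 (hX.stochCont 0))
      (ε / 2 / (|u| + 1)) (by positivity)
    have hev : ∀ᶠ t in 𝓝 (0 : ℝ≥0), P.real {ω | ε / 2 / (|u| + 1) ≤ dist (X t ω) (X 0 ω)} <
        1 - exp (-(ε / 2)) := by
      refine hc.eventually_lt_const ?_
      have : exp (-(ε / 2)) < 1 := by rw [exp_lt_one_iff]; linarith
      linarith
    obtain ⟨η, hη, hball⟩ := Metric.eventually_nhds_iff.1 hev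
    refine ⟨Real.toNNReal η, Real.toNNReal_pos.2 hη, fun t ht => ?_⟩
    have h2 := hball (y := t) (by
      rw [NNReal.dist_eq, NNReal.coe_zero, sub_zero, abs_of_nonneg t.coe_nonneg]
      exact Real.lt_toNNReal_iff_coe_lt.1 ht)
    have hA : MeasurableSet {ω | ε / 2 / (|u| + 1) ≤ dist (X t ω) (X 0 ω)} :=
      measurableSet_le measurable_const ((hX.measurable t).dist (hX.measurable 0))
    set A := {ω | ε / 2 / (|u| + 1) ≤ dist (X t ω) (X 0 ω)} with hAdef
    have hA2 : P.real Aᶜ = 1 - P.real A := probReal_compl_eq_one_sub hA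
    have h3 : ENNReal.ofReal (exp (-(ε / 2))) * P Aᶜ ≤ L t := by
      rw [← setLIntegral_const]
      refine le_trans ?_ (setLIntegral_le_lintegral Aᶜ _)
      refine lintegral_mono_ae ?_
      filter_upwards [ae_restrict_mem hA.compl, ae_restrict_of_ae hX.zero] with ω hω h0
      simp only [hAdef, mem_compl_iff, mem_ofPred_eq, not_le, h0, dist_zero_right, norm_eq_abs] at hω
      rw [lt_div_iff₀ (by positivity)] at hω
      apply ENNReal.ofReal_le_ofReal
      apply exp_le_exp.2
      have : |u * X t ω| ≤ ε / 2 := by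
        rw [abs_mul]
        nlinarith [abs_nonneg (X t ω), abs_nonneg u]
      linarith [neg_abs_le (u * X t ω)]
    have h4 : exp (-(ε / 2)) * P.real Aᶜ ≤ (L t).toReal := by
      have := ENNReal.toReal_mono (hfin t) h3
      rwa [ENNReal.toReal_mul, ENNReal.toReal_ofReal (exp_pos _).le] at this
    have h5 : exp (-(ε / 2)) * exp (-(ε / 2)) ≤ (L t).toReal := by
      refine le_trans ?_ h4
      gcongr
      linarith
    rw [← exp_add] at h5
    have h6 := log_le_log (exp_pos _) h5
    rw [log_exp] at h6
    linarith

/-- The exponent in `lintegral_exp_law` is linear in `(δ, μ)`, so raising the transform to the power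
`t` multiplies both by `t`. It is finite for `|β + u| < α`, an interval around `0`, which determines
the law. -/
lemma IsLevyProcess.map_eq_law (hX : IsLevyProcess X P) {α β δ μ : ℝ} (hβ : |β| < α) (hδ : 0 < δ)
    (hlaw : P.map (X 1) = law α β δ μ) {t : ℝ≥0} (ht : 0 < t) :
    P.map (X t) = law α β (δ * t) (μ * t) := by
  have := hX.isProb
  have hmu : ∀ u : ℝ, Measurable fun x : ℝ => ENNReal.ofReal (exp (u * x)) := by fun_prop
  have hδt : 0 < δ * t := mul_pos hδ ht
  have := isProbabilityMeasure_law hβ hδt (μ * t)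
  have := Measure.isProbabilityMeasure_map (μ := P) (hX.measurable t).aemeasurable
  have hb := abs_lt.1 hβ
  have key : ∀ u ∈ Ioo (-α - β) (α - β), ∫⁻ x, ENNReal.ofReal (exp (u * x)) ∂(P.map (X t)) =
      ∫⁻ x, ENNReal.ofReal (exp (u * x)) ∂(law α β (δ * t) (μ * t)) := by
    intro u hu
    have hu' : |β + u| < α := abs_lt.2 ⟨by linarith [hu.1], by linarith [hu.2]⟩
    rw [lintegral_map (hmu u) (hX.measurable t), lintegral_exp_law hβ hu' hδt]
    have h1 : ∫⁻ ω, ENNReal.ofReal (exp (u * X 1 ω)) ∂P = ENNReal.ofReal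
        (exp (μ * u + δ * (√(α ^ 2 - β ^ 2) - √(α ^ 2 - (β + u) ^ 2)))) := by
      rw [← lintegral_map (hmu u) (hX.measurable 1), hlaw, lintegral_exp_law hβ hu' hδ]
    rw [hX.lintegral_exp_eq h1]
    congr 2
    ring
  refine ext_of_lintegral_exp (a := -α - β) (b := α - β) (by linarith) (by linarith) ?_ key
  intro u hu
  have hu' : |β + u| < α := abs_lt.2 ⟨by linarith [hu.1], by linarith [hu.2]⟩
  rw [key u hu, lintegral_exp_law hβ hu' hδt]
  exact ENNReal.ofReal_ne_top

lemma IsLevyProcess.map_increments (hX : IsLevyProcess X P) (h : ℝ≥0) (n : ℕ) :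
    P.map (increments X h n) = Measure.pi fun _ : Fin n => P.map (X h) := by
  have := hX.isProb
  have hi := hX.indep n (fun i => ((i : ℕ) : ℝ≥0) * h) (fun i j hij =>
    mul_le_mul_left (Nat.cast_le.2 hij) h)
  have hm : ∀ i : Fin n, AEMeasurable (fun ω => X (((i.succ : Fin (n + 1)) : ℕ) * h) ω -
      X (((i.castSucc : Fin (n + 1)) : ℕ) * h) ω) P :=
    fun i => ((hX.measurable _).sub (hX.measurable _)).aemeasurable
  rw [iIndepFun_iff_map_fun_eq_pi_map hm] at hi
  have e : increments X h n = fun ω i => X (((i.succ : Fin (n + 1)) : ℕ) * h) ω -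
      X (((i.castSucc : Fin (n + 1)) : ℕ) * h) ω := by
    ext ω i
    simp [increments]
  rw [e, hi]
  congr 1
  ext1 i
  have hs := hX.stationary ((i : ℕ) * h) h
  rw [← hs]
  congr 1
  ext ω
  simp only [Fin.val_succ, Fin.val_castSucc]
  push_cast
  rw [add_mul, one_mul]

end Levy

end NIG
end

/-! ### Derivatives of the log-density in the parameters -/

noncomputable section

namespace NIG

open Set Real

/-- The parameter space. -/
abbrev E4 := EuclideanSpace ℝ (Fin 4)

/-- Squared distance of the observation `y` to the location parameter, in the time-`h` model. -/
def dsq (h y : ℝ) (ρ : E4) : ℝ := (ρ 2 * h) ^ 2 + (y - ρ 3 * h) ^ 2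

/-- The squared argument of the Bessel functions. -/
def barg (h y : ℝ) (ρ : E4) : ℝ := ρ 0 ^ 2 * dsq h y ρ

/-- `√(α² - β²)`. -/
def gam (ρ : E4) : ℝ := √(ρ 0 ^ 2 - ρ 1 ^ 2)

/-- The ratio function at the observation. -/
def qf (h y : ℝ) (ρ : E4) : ℝ := kratio (barg h y ρ)

/-- The derivative of the ratio function at the observation. -/
def wf (h y : ℝ) (ρ : E4) : ℝ := kratioDeriv (barg h y ρ)

/-- `h² / s`, where `s = dsq`. -/
def uf (h y : ℝ) (ρ : E4) : ℝ := h ^ 2 / dsq h y ρ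

/-- `h (y - μ h) / s`, where `s = dsq`. -/
def vf (h y : ℝ) (ρ : E4) : ℝ := h * (y - ρ 3 * h) / dsq h y ρ

/-- The log-density of one increment. -/
def logDens (h y : ℝ) (ρ : E4) : ℝ := log (density (ρ 0) (ρ 1) (ρ 2 * h) (ρ 3 * h) y)

/-- The score of one increment. -/
def score1 (h y : ℝ) (ρ : E4) : Fin 4 → ℝ :=
  ![ρ 2 * h * (ρ 0 / gam ρ) - qf h y ρ / ρ 0,
    -(ρ 2 * h * (ρ 1 / gam ρ)) + (y - ρ 3 * h),
    1 / ρ 2 + h * gam ρ - (qf h y ρ + 2) * ρ 2 * uf h y ρ,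
    -(ρ 1 * h) + (qf h y ρ + 2) * vf h y ρ]

/-- The Hessian of the log-density of one increment. -/
def hess1 (h y : ℝ) (ρ : E4) : Matrix (Fin 4) (Fin 4) ℝ :=
  !![-(ρ 2 * h * (ρ 1 ^ 2 / gam ρ ^ 3)) + (qf h y ρ - wf h y ρ) / ρ 0 ^ 2,
      ρ 2 * h * (ρ 0 * ρ 1 / gam ρ ^ 3),
      h * (ρ 0 / gam ρ) - wf h y ρ * ρ 2 * uf h y ρ / ρ 0,
      wf h y ρ * vf h y ρ / ρ 0;
    ρ 2 * h * (ρ 0 * ρ 1 / gam ρ ^ 3),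
      -(ρ 2 * h * (ρ 0 ^ 2 / gam ρ ^ 3)),
      -(h * (ρ 1 / gam ρ)),
      -h;
    h * (ρ 0 / gam ρ) - wf h y ρ * ρ 2 * uf h y ρ / ρ 0,
      -(h * (ρ 1 / gam ρ)),
      -(1 / ρ 2 ^ 2) - (qf h y ρ + 2) * uf h y ρ
        + (2 * (qf h y ρ + 2) - wf h y ρ) * (ρ 2 * uf h y ρ) ^ 2,
      (wf h y ρ - 2 * (qf h y ρ + 2)) * (ρ 2 * uf h y ρ) * vf h y ρ;
    wf h y ρ * vf h y ρ / ρ 0,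
      -h,
      (wf h y ρ - 2 * (qf h y ρ + 2)) * (ρ 2 * uf h y ρ) * vf h y ρ,
      -((qf h y ρ + 2) * uf h y ρ) + (2 * (qf h y ρ + 2) - wf h y ρ) * vf h y ρ ^ 2]

/-- Coordinate functional. -/
abbrev pr (k : Fin 4) : E4 →L[ℝ] ℝ := EuclideanSpace.proj k

lemma hasFDerivAt_coord (k : Fin 4) (ρ : E4) : HasFDerivAt (fun ρ : E4 => ρ k) (pr k) ρ :=
  (pr k).hasFDerivAt

lemma region_pos {ρ : E4} (hρ : ρ ∈ region) : 0 < ρ 0 ∧ 0 < ρ 2 ∧ 0 < ρ 0 ^ 2 - ρ 1 ^ 2 := by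
  obtain ⟨h0, h1, h2⟩ := hρ
  refine ⟨h0, h2, ?_⟩
  have := sq_lt_sq' (neg_lt_of_abs_lt h1) (lt_of_abs_lt h1)
  linarith

lemma isOpen_region : IsOpen region := by
  have hc : ∀ k : Fin 4, Continuous fun ρ : E4 => ρ k := fun k => by fun_prop
  exact (isOpen_lt continuous_const (hc 0)).inter
    ((isOpen_lt (hc 1).abs (hc 0)).inter (isOpen_lt continuous_const (hc 2)))

lemma gam_pos {ρ : E4} (hρ : ρ ∈ region) : 0 < gam ρ := sqrt_pos.2 (region_pos hρ).2.2

lemma gam_sq {ρ : E4} (hρ : ρ ∈ region) : gam ρ ^ 2 = ρ 0 ^ 2 - ρ 1 ^ 2 :=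
  sq_sqrt (region_pos hρ).2.2.le

variable {h y : ℝ} {ρ : E4}

lemma dsq_pos (hh : 0 < h) (hρ : ρ ∈ region) : 0 < dsq h y ρ := by
  have := (region_pos hρ).2.1
  unfold dsq; positivity

lemma barg_pos (hh : 0 < h) (hρ : ρ ∈ region) : 0 < barg h y ρ := by
  have := dsq_pos (y := y) hh hρ
  have := (region_pos hρ).1
  unfold barg; positivity

lemma logDens_eq (hh : 0 < h) (hρ : ρ ∈ region) :
    logDens h y ρ = log (h / π) + log (ρ 2) + ρ 2 * h * gam ρ + ρ 1 * (y - ρ 3 * h)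
      + log (kone (barg h y ρ)) - log (dsq h y ρ) := by
  obtain ⟨h0, h2, h01⟩ := region_pos hρ
  have hs := dsq_pos (y := y) hh hρ
  have hk := kone_pos (barg_pos (y := y) hh hρ)
  have hπ := pi_pos
  unfold logDens
  rw [density_eq h0 (by positivity)]
  have e : ρ 2 * h / π = ρ 2 * (h / π) := by ring
  change log (ρ 2 * h / π * exp (ρ 2 * h * gam ρ + ρ 1 * (y - ρ 3 * h)) *
    (kone (barg h y ρ) / dsq h y ρ)) = _
  rw [log_mul (by positivity) (by positivity), log_mul (by positivity) (by positivity), log_exp,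
    log_div hk.ne' hs.ne', e, log_mul (by positivity) (by positivity)]
  ring

lemma exp_logDens (hh : 0 < h) (hρ : ρ ∈ region) :
    exp (logDens h y ρ) = density (ρ 0) (ρ 1) (ρ 2 * h) (ρ 3 * h) y :=
  exp_log (density_pos (region_pos hρ).1 (mul_pos (region_pos hρ).2.1 hh) _ _ _)

/-- The logarithmic differential of `dsq`. -/
def dlogS (h y : ℝ) (ρ : E4) : E4 →L[ℝ] ℝ :=
  (2 * (ρ 2 * uf h y ρ)) • pr 2 - (2 * vf h y ρ) • pr 3

/-- The logarithmic differential of `barg`. -/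
def dlogW (h y : ℝ) (ρ : E4) : E4 →L[ℝ] ℝ := (2 / ρ 0) • pr 0 + dlogS h y ρ

/-- Differentials are kept in logarithmic form because the coefficients of `dlogS` and `dlogW` stay
bounded uniformly in `h` and `y` over compact sets of parameters (`exists_norm_dlogS_le`). -/
lemma hasFDerivAt_dsq (hh : 0 < h) (hρ : ρ ∈ region) :
    HasFDerivAt (dsq h y) (dsq h y ρ • dlogS h y ρ) ρ := by
  have hs := dsq_pos (y := y) hh hρ
  have h1 := ((hasFDerivAt_coord 2 ρ).mul_const h).pow 2
  have h2 := (((hasFDerivAt_coord 3 ρ).mul_const h).const_sub y).pow 2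
  convert! h1.add h2 using 1
  ext v
  simp [dlogS, uf, vf]
  field_simp
  ring

lemma hasFDerivAt_barg (hh : 0 < h) (hρ : ρ ∈ region) :
    HasFDerivAt (barg h y) (barg h y ρ • dlogW h y ρ) ρ := by
  have h0 := (region_pos hρ).1
  have h1 := (hasFDerivAt_coord 0 ρ).pow 2
  convert! h1.mul (hasFDerivAt_dsq (y := y) hh hρ) using 1
  ext v
  simp [dlogW, barg]
  field_simp
  ring

lemma hasFDerivAt_qf (hh : 0 < h) (hρ : ρ ∈ region) :
    HasFDerivAt (qf h y) ((wf h y ρ / 2) • dlogW h y ρ) ρ := by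
  have hb := barg_pos (y := y) hh hρ
  convert! (hasDerivAt_kratio hb).comp_hasFDerivAt ρ (hasFDerivAt_barg (y := y) hh hρ) using 1
  rw [smul_smul]
  congr 1
  unfold wf
  field_simp

lemma hasFDerivAt_wf (hh : 0 < h) (hρ : ρ ∈ region) :
    HasFDerivAt (wf h y) (((qf h y ρ + 1) * wf h y ρ - barg h y ρ) • dlogW h y ρ) ρ := by
  have hb := barg_pos (y := y) hh hρ
  convert! (hasDerivAt_kratioDeriv hb).comp_hasFDerivAt ρ (hasFDerivAt_barg (y := y) hh hρ) using 1
  rw [smul_smul]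
  congr 1
  unfold wf qf
  field_simp

lemma hasFDerivAt_log_kone (hh : 0 < h) (hρ : ρ ∈ region) :
    HasFDerivAt (fun ρ => log (kone (barg h y ρ))) (-(qf h y ρ / 2) • dlogW h y ρ) ρ := by
  have hb := barg_pos (y := y) hh hρ
  convert! (hasDerivAt_log_kone hb).comp_hasFDerivAt ρ (hasFDerivAt_barg (y := y) hh hρ) using 1
  rw [smul_smul]
  congr 1
  unfold qf
  field_simp

lemma hasFDerivAt_log_dsq (hh : 0 < h) (hρ : ρ ∈ region) :
    HasFDerivAt (fun ρ => log (dsq h y ρ)) (dlogS h y ρ) ρ := by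
  have hs := dsq_pos (y := y) hh hρ
  convert! (hasFDerivAt_dsq (y := y) hh hρ).log hs.ne' using 1
  rw [smul_smul, inv_mul_cancel₀ hs.ne', one_smul]

lemma hasFDerivAt_uf (hh : 0 < h) (hρ : ρ ∈ region) :
    HasFDerivAt (uf h y) (-uf h y ρ • dlogS h y ρ) ρ := by
  have hs := dsq_pos (y := y) hh hρ
  have h1 := ((hasDerivAt_inv hs.ne').comp_hasFDerivAt ρ
    (hasFDerivAt_dsq (y := y) hh hρ)).const_mul (h ^ 2)
  convert! h1 using 1
  rw [smul_smul, smul_smul]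
  congr 1
  unfold uf
  field_simp

lemma hasFDerivAt_vf (hh : 0 < h) (hρ : ρ ∈ region) :
    HasFDerivAt (vf h y) (-uf h y ρ • pr 3 - vf h y ρ • dlogS h y ρ) ρ := by
  have hs := dsq_pos (y := y) hh hρ
  have h1 := (((hasFDerivAt_coord 3 ρ).mul_const h).const_sub y).const_mul h
  have h2 := (hasDerivAt_inv hs.ne').comp_hasFDerivAt ρ (hasFDerivAt_dsq (y := y) hh hρ)
  convert! h1.mul h2 using 1
  ext v
  simp [uf, vf]
  field_simp
  ring

lemma hasFDerivAt_gam (hρ : ρ ∈ region) :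
    HasFDerivAt gam ((ρ 0 / gam ρ) • pr 0 - (ρ 1 / gam ρ) • pr 1) ρ := by
  have hg := gam_pos hρ
  have h1 := (((hasFDerivAt_coord 0 ρ).pow 2).sub ((hasFDerivAt_coord 1 ρ).pow 2)).sqrt
    (region_pos hρ).2.2.ne'
  convert! h1 using 1
  change _ = (1 / (2 * gam ρ)) • _
  ext v
  simp
  field_simp

lemma hasFDerivAt_inv_gam (hρ : ρ ∈ region) :
    HasFDerivAt (fun ρ => (gam ρ)⁻¹)
      (-(ρ 0 / gam ρ ^ 3) • pr 0 + (ρ 1 / gam ρ ^ 3) • pr 1) ρ := by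
  have hg := gam_pos hρ
  convert! (hasDerivAt_inv hg.ne').comp_hasFDerivAt ρ (hasFDerivAt_gam hρ) using 1
  ext v
  simp
  field_simp
  ring

lemma hasFDerivAt_inv_coord {k : Fin 4} (hk : ρ k ≠ 0) :
    HasFDerivAt (fun ρ : E4 => (ρ k)⁻¹) (-(ρ k ^ 2)⁻¹ • pr k) ρ :=
  (hasDerivAt_inv hk).comp_hasFDerivAt ρ (hasFDerivAt_coord k ρ)

/-- The functional with the given coefficients. -/
def lin (c : Fin 4 → ℝ) : E4 →L[ℝ] ℝ := ∑ k, c k • pr k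

lemma lin_apply (c : Fin 4 → ℝ) (v : E4) : lin c v = ∑ k, c k * v k := by
  simp [lin]

lemma lin_single (c : Fin 4 → ℝ) (k : Fin 4) : lin c (EuclideanSpace.single k 1) = c k := by
  rw [lin_apply]
  simp

lemma hasFDerivAt_logDens (hh : 0 < h) (hρ : ρ ∈ region) :
    HasFDerivAt (logDens h y) (lin (score1 h y ρ)) ρ := by
  obtain ⟨h0, h2, -⟩ := region_pos hρ
  have hg := gam_pos hρ
  have key : HasFDerivAt (fun ρ : E4 => log (h / π) + log (ρ 2) + ρ 2 * h * gam ρ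
      + ρ 1 * (y - ρ 3 * h) + log (kone (barg h y ρ)) - log (dsq h y ρ))
      (lin (score1 h y ρ)) ρ := by
    have d1 := ((hasFDerivAt_coord 2 ρ).log h2.ne').const_add (log (h / π))
    have d2 := ((hasFDerivAt_coord 2 ρ).mul_const h).mul (hasFDerivAt_gam hρ)
    have d3 := (hasFDerivAt_coord 1 ρ).mul (((hasFDerivAt_coord 3 ρ).mul_const h).const_sub y)
    convert! (((d1.add d2).add d3).add (hasFDerivAt_log_kone (y := y) hh hρ)).sub
      (hasFDerivAt_log_dsq (y := y) hh hρ) using 1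
    ext v
    simp [lin_apply, Fin.sum_univ_four, score1, dlogW, dlogS]
    field_simp
    ring
  refine key.congr_of_eventuallyEq ?_
  filter_upwards [isOpen_region.mem_nhds hρ] with ρ' hρ'
  exact logDens_eq hh hρ'

lemma hasFDerivAt_score1 (hh : 0 < h) (hρ : ρ ∈ region) (l : Fin 4) :
    HasFDerivAt (fun ρ => score1 h y ρ l) (lin fun k => hess1 h y ρ k l) ρ := by
  obtain ⟨h0, h2, -⟩ := region_pos hρ
  have hg := gam_pos hρ
  have hg2 := gam_sq hρ
  have dq := hasFDerivAt_qf (y := y) hh hρ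
  have du := hasFDerivAt_uf (y := y) hh hρ
  have dv := hasFDerivAt_vf (y := y) hh hρ
  have dg := hasFDerivAt_gam hρ
  have dig := hasFDerivAt_inv_gam hρ
  have p := fun k => hasFDerivAt_coord k ρ
  -- The relation `γ² = α² - β²` is used as an elimination of `β²`, or of `α²` in the `β`-score
  -- below, so that the remaining identities are purely rational.
  have hb : ρ 1 ^ 2 = ρ 0 ^ 2 - gam ρ ^ 2 := by linarith
  fin_cases l
  · convert! (((p 2).mul_const h).mul ((p 0).mul dig)).sub
      (dq.mul (hasFDerivAt_inv_coord (k := 0) h0.ne')) using 1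
    ext v
    simp [lin_apply, Fin.sum_univ_four, hess1, dlogW, dlogS, hb]
    field_simp
    ring
  · convert! (((p 2).mul_const h).mul ((p 1).mul dig)).neg.add
      (((p 3).mul_const h).const_sub y) using 1
    ext v
    simp [lin_apply, Fin.sum_univ_four, hess1]
    have hb' : ρ 0 ^ 2 = ρ 1 ^ 2 + gam ρ ^ 2 := by linarith
    simp only [hb']
    field_simp
    ring
  · convert! (((hasFDerivAt_inv_coord (k := 2) h2.ne').add (dg.const_mul h))).sub
      (((dq.add_const 2).mul (p 2)).mul du) using 1
    · ext ρ; simp [score1]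
    ext v
    simp [lin_apply, Fin.sum_univ_four, hess1, dlogW, dlogS]
    field_simp
    ring
  · convert! ((p 1).mul_const h).neg.add ((dq.add_const 2).mul dv) using 1
    ext v
    simp [lin_apply, Fin.sum_univ_four, hess1, dlogW, dlogS]
    field_simp
    ring

lemma contDiffOn_logDens (hh : 0 < h) : ContDiffOn ℝ 2 (logDens h y) region := by
  have hc : ∀ k : Fin 4, ContDiffOn ℝ 2 (fun ρ : E4 => ρ k) region := fun k =>
    (pr k).contDiff.contDiffOn
  have hs : ContDiffOn ℝ 2 (dsq h y) region :=
    (((hc 2).mul contDiffOn_const).pow 2).add ((contDiffOn_const.sub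
      ((hc 3).mul contDiffOn_const)).pow 2)
  have hw : ContDiffOn ℝ 2 (barg h y) region := ((hc 0).pow 2).mul hs
  have hg : ContDiffOn ℝ 2 gam region := (((hc 0).pow 2).sub ((hc 1).pow 2)).sqrt fun ρ hρ =>
    (region_pos hρ).2.2.ne'
  have hk : ContDiffOn ℝ 2 (fun ρ => kone (barg h y ρ)) region :=
    (contDiffOn_kone_kzero 2).1.comp hw fun ρ hρ => barg_pos hh hρ
  refine ContDiffOn.congr ?_ fun ρ hρ => logDens_eq hh hρ
  refine ((((contDiffOn_const.add ((hc 2).log fun ρ hρ => (region_pos hρ).2.1.ne')).add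
    (((hc 2).mul contDiffOn_const).mul hg)).add ((hc 1).mul (contDiffOn_const.sub
    ((hc 3).mul contDiffOn_const)))).add (hk.log fun ρ hρ => (kone_pos (barg_pos hh hρ)).ne')).sub
    (hs.log fun ρ hρ => (dsq_pos hh hρ).ne')

lemma logLik_eq_sum (h : ℝ) (n : ℕ) (x : Fin n → ℝ) :
    (fun ρ => logLik h n ρ x) = fun ρ => ∑ j, logDens h (x j) ρ := rfl

lemma contDiffOn_logLik (hh : 0 < h) (n : ℕ) (x : Fin n → ℝ) :
    ContDiffOn ℝ 2 (fun ρ => logLik h n ρ x) region := by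
  rw [logLik_eq_sum]
  exact ContDiffOn.sum fun j _ => contDiffOn_logDens hh

lemma hasFDerivAt_logLik (hh : 0 < h) (hρ : ρ ∈ region) (n : ℕ) (x : Fin n → ℝ) :
    HasFDerivAt (fun ρ => logLik h n ρ x) (lin fun k => ∑ j, score1 h (x j) ρ k) ρ := by
  rw [logLik_eq_sum]
  convert! HasFDerivAt.fun_sum fun j (_ : j ∈ Finset.univ) =>
    hasFDerivAt_logDens (y := x j) hh hρ using 1
  ext v
  simp only [lin_apply, sum_apply, Finset.sum_mul]
  exact Finset.sum_comm

lemma score_logLik (hh : 0 < h) (hρ : ρ ∈ region) (n : ℕ) (x : Fin n → ℝ) (k : Fin 4) :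
    score (fun ρ => logLik h n ρ x) ρ k = ∑ j, score1 h (x j) ρ k := by
  rw [score, (hasFDerivAt_logLik hh hρ n x).fderiv, lin_single]

lemma hasFDerivAt_score_sum (hh : 0 < h) (hρ : ρ ∈ region) (n : ℕ) (x : Fin n → ℝ) (l : Fin 4) :
    HasFDerivAt (fun ρ => ∑ j, score1 h (x j) ρ l) (lin fun k => ∑ j, hess1 h (x j) ρ k l) ρ := by
  convert! HasFDerivAt.fun_sum fun j (_ : j ∈ Finset.univ) =>
    hasFDerivAt_score1 (y := x j) hh hρ l using 1
  ext v
  simp only [lin_apply, sum_apply, Finset.sum_mul]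
  exact Finset.sum_comm

lemma obsInfo_logLik (hh : 0 < h) (hρ : ρ ∈ region) (n : ℕ) (x : Fin n → ℝ) (k l : Fin 4) :
    obsInfo (fun ρ => logLik h n ρ x) ρ k l = -∑ j, hess1 h (x j) ρ k l := by
  have hev : (fun ρ => score (fun ρ => logLik h n ρ x) ρ l) =ᶠ[𝓝 ρ]
      fun ρ => ∑ j, score1 h (x j) ρ l := by
    filter_upwards [isOpen_region.mem_nhds hρ] with ρ' hρ'
    exact score_logLik hh hρ' n x l
  rw [obsInfo, Matrix.of_apply, hev.fderiv_eq, (hasFDerivAt_score_sum hh hρ n x l).fderiv,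
    lin_single]

end NIG
end

/-! ### Bounds uniform over a compact set of parameters -/

noncomputable section

namespace NIG

open Set Real

/-- A compact convex set of parameters. -/
def box (c B : ℝ) : Set E4 :=
  {ρ | c ≤ ρ 0 - |ρ 1| ∧ c ≤ ρ 2 ∧ ρ 0 ≤ B ∧ ρ 2 ≤ B ∧ |ρ 3| ≤ B}

/-- The size of an observation in the time-`h` model. -/
def msize (h y : ℝ) : ℝ := h + |y|

variable {c B h y : ℝ} {ρ : E4}

lemma convex_box (c B : ℝ) : Convex ℝ (box c B) := by
  rintro ρ ⟨h1, h2, h3, h4, h5⟩ σ ⟨k1, k2, k3, k4, k5⟩ a b ha hb hab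
  have t1 : |a * ρ 1 + b * σ 1| ≤ a * |ρ 1| + b * |σ 1| := by
    refine (abs_add_le _ _).trans ?_
    rw [abs_mul, abs_mul, abs_of_nonneg ha, abs_of_nonneg hb]
  have t3 : |a * ρ 3 + b * σ 3| ≤ a * |ρ 3| + b * |σ 3| := by
    refine (abs_add_le _ _).trans ?_
    rw [abs_mul, abs_mul, abs_of_nonneg ha, abs_of_nonneg hb]
  have hb' : b = 1 - a := by linarith
  have hc : ∀ x : ℝ, x = a * x + b * x := fun x => by rw [← add_mul, hab, one_mul]
  simp only [box, mem_ofPred_eq, PiLp.add_apply, PiLp.smul_apply, smul_eq_mul]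
  refine ⟨?_, ?_, ?_, ?_, ?_⟩
  · rw [hc c]; nlinarith
  · rw [hc c]; nlinarith
  · rw [hc B]; nlinarith
  · rw [hc B]; nlinarith
  · rw [hc B]; nlinarith

lemma box_subset_region (hc : 0 < c) : box c B ⊆ region := by
  rintro ρ ⟨h1, h2, -⟩
  exact ⟨by linarith [abs_nonneg (ρ 1)], by linarith, by linarith⟩

lemma box_bounds (hc : 0 < c) (hρ : ρ ∈ box c B) :
    c ≤ ρ 0 ∧ ρ 0 ≤ B ∧ |ρ 1| ≤ B ∧ c ≤ ρ 2 ∧ ρ 2 ≤ B ∧ |ρ 3| ≤ B ∧ 0 < B := by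
  obtain ⟨h1, h2, h3, h4, h5⟩ := hρ
  have := abs_nonneg (ρ 1)
  exact ⟨by linarith, h3, by linarith, h2, h4, h5, by linarith⟩

lemma le_gam (hc : 0 < c) (hρ : ρ ∈ box c B) : c ≤ gam ρ := by
  obtain ⟨h1, h2, h3, h4, h5⟩ := hρ
  apply le_sqrt_of_sq_le
  have : ρ 1 ^ 2 = |ρ 1| ^ 2 := (sq_abs _).symm
  nlinarith [abs_nonneg (ρ 1)]

lemma gam_le (hc : 0 < c) (hρ : ρ ∈ box c B) : gam ρ ≤ B := by
  obtain ⟨h0, h0B, -⟩ := box_bounds hc hρ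
  apply sqrt_le_iff.2 ⟨by linarith, ?_⟩
  nlinarith [sq_nonneg (ρ 1)]

lemma msize_pos (hh : 0 < h) (y : ℝ) : 0 < msize h y := by unfold msize; positivity

lemma le_msize (h y : ℝ) : h ≤ msize h y := by unfold msize; linarith [abs_nonneg y]

/-- Together with `dsq_le` this makes `dsq` comparable to `m²`: the lower bound on `δ` controls `h`,
and then `|y|` is controlled by `|y - μ h|` and `h`. -/
lemma sq_msize_le (hc : 0 < c) (hρ : ρ ∈ box c B) (h y : ℝ) :
    msize h y ^ 2 ≤ ((2 + 4 * B ^ 2) / c ^ 2 + 4) * dsq h y ρ := by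
  obtain ⟨-, -, -, h2, h2B, h3, hB⟩ := box_bounds hc hρ
  have e1 : c ^ 2 * h ^ 2 ≤ (ρ 2 * h) ^ 2 := by rw [mul_pow]; gcongr
  have e2 : msize h y ^ 2 ≤ 2 * h ^ 2 + 2 * y ^ 2 := by
    unfold msize
    nlinarith [sq_nonneg (h - |y|), sq_abs y]
  have e3 : (ρ 3) ^ 2 ≤ B ^ 2 := by
    rw [← sq_abs]; gcongr
  have e4 : y ^ 2 ≤ 2 * (y - ρ 3 * h) ^ 2 + 2 * B ^ 2 * h ^ 2 := by
    nlinarith [sq_nonneg (y - 2 * (ρ 3 * h)), sq_nonneg h]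
  have e5 : h ^ 2 ≤ (ρ 2 * h) ^ 2 / c ^ 2 := by
    rw [le_div_iff₀ (by positivity)]; linarith
  calc msize h y ^ 2 ≤ (2 + 4 * B ^ 2) * h ^ 2 + 4 * (y - ρ 3 * h) ^ 2 := by linarith
    _ ≤ (2 + 4 * B ^ 2) * ((ρ 2 * h) ^ 2 / c ^ 2) + 4 * (y - ρ 3 * h) ^ 2 := by gcongr
    _ ≤ ((2 + 4 * B ^ 2) * ((ρ 2 * h) ^ 2 / c ^ 2) + 4 * (y - ρ 3 * h) ^ 2) +
        (4 * (ρ 2 * h) ^ 2 + (2 + 4 * B ^ 2) / c ^ 2 * (y - ρ 3 * h) ^ 2) :=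
        le_add_of_nonneg_right (by positivity)
    _ = _ := by unfold dsq; ring

lemma dsq_le (hc : 0 < c) (hρ : ρ ∈ box c B) (hh : 0 ≤ h) (y : ℝ) :
    dsq h y ρ ≤ (3 * B ^ 2 + 2) * msize h y ^ 2 := by
  obtain ⟨-, -, -, h2, h2B, h3, hB⟩ := box_bounds hc hρ
  have e1 : (ρ 2 * h) ^ 2 ≤ B ^ 2 * h ^ 2 := by rw [mul_pow]; gcongr; linarith
  have e3 : (ρ 3) ^ 2 ≤ B ^ 2 := by
    rw [← sq_abs]; gcongr
  have e4 : (y - ρ 3 * h) ^ 2 ≤ 2 * y ^ 2 + 2 * B ^ 2 * h ^ 2 := by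
    nlinarith [sq_nonneg (y + (ρ 3 * h)), sq_nonneg h]
  have e5 : h ^ 2 + y ^ 2 ≤ msize h y ^ 2 := by
    unfold msize
    nlinarith [sq_abs y, abs_nonneg y]
  unfold dsq
  nlinarith [sq_nonneg h, sq_nonneg y, sq_nonneg B]

lemma barg_le (hc : 0 < c) (hρ : ρ ∈ box c B) (hh : 0 ≤ h) (y : ℝ) :
    barg h y ρ ≤ (B ^ 2 * (3 * B ^ 2 + 2)) * msize h y ^ 2 := by
  obtain ⟨h0, h0B, -⟩ := box_bounds hc hρ
  unfold barg
  rw [mul_assoc]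
  have := dsq_le hc hρ hh y
  have hd : 0 ≤ dsq h y ρ := by unfold dsq; positivity
  have h0' : ρ 0 ^ 2 ≤ B ^ 2 := by gcongr; linarith
  exact mul_le_mul h0' this hd (sq_nonneg B)

lemma norm_pr_le (k : Fin 4) : ‖pr k‖ ≤ 1 :=
  ContinuousLinearMap.opNorm_le_bound _ zero_le_one fun v => by
    simpa using PiLp.norm_apply_le v k

/-- `f` and its derivative in the parameter are bounded by a multiple of `b`, uniformly over the
parameters in a box. -/
def Tame (c B : ℝ) (f : ℝ → ℝ → E4 → ℝ) (b : ℝ → ℝ → ℝ) : Prop :=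
  ∃ C, 0 ≤ C ∧ ∀ h y ρ, 0 < h → ρ ∈ box c B → |f h y ρ| ≤ C * b h y ∧
    ∃ f' : E4 →L[ℝ] ℝ, HasFDerivAt (f h y) f' ρ ∧ ‖f'‖ ≤ C * b h y

namespace Tame

variable {f g : ℝ → ℝ → E4 → ℝ} {b b' : ℝ → ℝ → ℝ}

lemma add (hf : Tame c B f b) (hg : Tame c B g b) :
    Tame c B (fun h y ρ => f h y ρ + g h y ρ) b := by
  obtain ⟨C, hC, H⟩ := hf
  obtain ⟨D, hD, K⟩ := hg
  refine ⟨C + D, by positivity, fun h y ρ hh hρ => ?_⟩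
  obtain ⟨h1, f', hf', h2⟩ := H h y ρ hh hρ
  obtain ⟨k1, g', hg', k2⟩ := K h y ρ hh hρ
  rw [add_mul]
  exact ⟨(abs_add_le _ _).trans (add_le_add h1 k1), f' + g', hf'.add hg',
    (norm_add_le _ _).trans (add_le_add h2 k2)⟩

lemma neg (hf : Tame c B f b) : Tame c B (fun h y ρ => -f h y ρ) b := by
  obtain ⟨C, hC, H⟩ := hf
  refine ⟨C, hC, fun h y ρ hh hρ => ?_⟩
  obtain ⟨h1, f', hf', h2⟩ := H h y ρ hh hρ
  exact ⟨by rwa [abs_neg], -f', hf'.neg, by rwa [norm_neg]⟩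

lemma sub (hf : Tame c B f b) (hg : Tame c B g b) :
    Tame c B (fun h y ρ => f h y ρ - g h y ρ) b := by
  simpa only [sub_eq_add_neg] using hf.add hg.neg

lemma mul (hf : Tame c B f b) (hg : Tame c B g b') :
    Tame c B (fun h y ρ => f h y ρ * g h y ρ) (fun h y => b h y * b' h y) := by
  obtain ⟨C, hC, H⟩ := hf
  obtain ⟨D, hD, K⟩ := hg
  -- The factor `2` accounts for the two terms of the product rule.
  refine ⟨2 * C * D, by positivity, fun h y ρ hh hρ => ?_⟩
  obtain ⟨h1, f', hf', h2⟩ := H h y ρ hh hρ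
  obtain ⟨k1, g', hg', k2⟩ := K h y ρ hh hρ
  have hCb : 0 ≤ C * b h y := (abs_nonneg _).trans h1
  have hDb : 0 ≤ D * b' h y := (abs_nonneg _).trans k1
  have hprod : |f h y ρ| * |g h y ρ| ≤ (C * b h y) * (D * b' h y) := by gcongr
  refine ⟨?_, _, hf'.mul hg', ?_⟩
  · rw [abs_mul]
    nlinarith [mul_nonneg hCb hDb]
  · refine (norm_add_le _ _).trans ?_
    rw [norm_smul, norm_smul, norm_eq_abs, norm_eq_abs]
    have e1 : |f h y ρ| * ‖g'‖ ≤ (C * b h y) * (D * b' h y) := by gcongr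
    have e2 : |g h y ρ| * ‖f'‖ ≤ (D * b' h y) * (C * b h y) := by gcongr
    linarith

lemma mono (hf : Tame c B f b) {K : ℝ} (hK : 0 ≤ K)
    (hb : ∀ h y, 0 < h → b h y ≤ K * b' h y) : Tame c B f b' := by
  obtain ⟨C, hC, H⟩ := hf
  refine ⟨C * K, by positivity, fun h y ρ hh hρ => ?_⟩
  obtain ⟨h1, f', hf', h2⟩ := H h y ρ hh hρ
  have e : C * b h y ≤ C * K * b' h y := by
    rw [mul_assoc]; exact mul_le_mul_of_nonneg_left (hb h y hh) hC
  exact ⟨h1.trans e, f', hf', h2.trans e⟩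

lemma const (a : ℝ) : Tame c B (fun _ _ _ => a) (fun _ _ => 1) :=
  ⟨|a|, abs_nonneg a, fun h y ρ _ _ => ⟨by simp, 0, hasFDerivAt_const _ _, by simp⟩⟩

lemma time : Tame c B (fun h _ _ => h) (fun h _ => h) :=
  ⟨1, zero_le_one, fun h y ρ hh _ =>
    ⟨by rw [abs_of_pos hh, one_mul], 0, hasFDerivAt_const _ _, by simp [hh.le]⟩⟩

lemma coord (hc : 0 < c) (k : Fin 4) : Tame c B (fun _ _ ρ => ρ k) (fun _ _ => 1) := by
  refine ⟨max B 1, by positivity, fun h y ρ hh hρ => ⟨?_, pr k, hasFDerivAt_coord k ρ, ?_⟩⟩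
  · obtain ⟨h0, h0B, h1, h2, h2B, h3, -⟩ := box_bounds hc hρ
    rw [mul_one]
    refine le_max_of_le_left ?_
    fin_cases k
    · exact abs_le.2 ⟨by simp; linarith, h0B⟩
    · exact h1
    · exact abs_le.2 ⟨by simp; linarith, h2B⟩
    · exact h3
  · rw [mul_one]
    exact (norm_pr_le k).trans (le_max_right _ _)

lemma inv_of_le {k : Fin 4} (hc : 0 < c) (hk : ∀ ρ ∈ box c B, c ≤ ρ k) :
    Tame c B (fun _ _ ρ => (ρ k)⁻¹) (fun _ _ => 1) := by
  refine ⟨c⁻¹ + (c ^ 2)⁻¹, by positivity, fun h y ρ hh hρ => ?_⟩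
  have hρk := hk ρ hρ
  have hp : 0 < ρ k := by linarith
  have e1 : (ρ k)⁻¹ ≤ c⁻¹ := inv_anti₀ hc hρk
  have e2 : (ρ k ^ 2)⁻¹ ≤ (c ^ 2)⁻¹ := by gcongr
  have p1 : 0 < c⁻¹ := by positivity
  have p2 : 0 < (c ^ 2)⁻¹ := by positivity
  refine ⟨?_, _, hasFDerivAt_inv_coord hp.ne', ?_⟩
  · rw [abs_of_pos (by positivity)]; linarith
  · rw [norm_smul, norm_neg, norm_eq_abs, abs_of_pos (by positivity)]
    nlinarith [norm_pr_le k, norm_nonneg (pr k), mul_le_mul e2 (norm_pr_le k) (norm_nonneg _) p2.le]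

end Tame

lemma norm_smul_pr_le (a : ℝ) (k : Fin 4) : ‖a • pr k‖ ≤ |a| := by
  rw [norm_smul, norm_eq_abs]
  exact mul_le_of_le_one_right (abs_nonneg _) (norm_pr_le k)

lemma tame_inv_gam (hc : 0 < c) : Tame c B (fun _ _ ρ => (gam ρ)⁻¹) (fun _ _ => 1) := by
  refine ⟨c⁻¹ + 2 * |B| / c ^ 3, by positivity, fun h y ρ hh hρ => ?_⟩
  obtain ⟨h0, h0B, h1, h2, h2B, h3, hB⟩ := box_bounds hc hρ
  have hg := le_gam hc hρ
  have hgp : 0 < gam ρ := by linarith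
  rw [abs_of_pos hB, mul_one]
  have p : 0 ≤ 2 * B / c ^ 3 := by positivity
  have p' : 0 ≤ c⁻¹ := by positivity
  refine ⟨?_, _, hasFDerivAt_inv_gam (box_subset_region hc hρ), ?_⟩
  · rw [abs_of_pos (by positivity)]
    have : (gam ρ)⁻¹ ≤ c⁻¹ := inv_anti₀ hc hg
    linarith
  · refine (norm_add_le _ _).trans ((add_le_add (norm_smul_pr_le _ _) (norm_smul_pr_le _ _)).trans ?_)
    rw [abs_neg, abs_div, abs_div, abs_of_pos (pow_pos hgp 3), abs_of_pos (by linarith : 0 < ρ 0)]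
    have e1 : ρ 0 / gam ρ ^ 3 ≤ B / c ^ 3 := by gcongr
    have e2 : |ρ 1| / gam ρ ^ 3 ≤ B / c ^ 3 := by gcongr
    have : 2 * B / c ^ 3 = B / c ^ 3 + B / c ^ 3 := by ring
    linarith

/-- Constant in the comparison of `dsq` with the squared size. -/
def cmpC (c B : ℝ) : ℝ := (2 + 4 * B ^ 2) / c ^ 2 + 4

lemma cmpC_pos (c B : ℝ) : 0 < cmpC c B := by unfold cmpC; positivity

lemma uf_le (hc : 0 < c) (hρ : ρ ∈ box c B) (hh : 0 < h) (y : ℝ) :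
    0 < uf h y ρ ∧ uf h y ρ ≤ cmpC c B * (h / msize h y) ^ 2 := by
  have hs := dsq_pos (y := y) hh (box_subset_region hc hρ)
  have hm := msize_pos hh y
  have hle : msize h y ^ 2 ≤ cmpC c B * dsq h y ρ := sq_msize_le hc hρ h y
  unfold uf
  refine ⟨by positivity, ?_⟩
  rw [div_le_iff₀ hs, div_pow]
  calc h ^ 2 = h ^ 2 / msize h y ^ 2 * msize h y ^ 2 := by field_simp
    _ ≤ h ^ 2 / msize h y ^ 2 * (cmpC c B * dsq h y ρ) := by gcongr
    _ = _ := by ring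

lemma abs_vf_le (hc : 0 < c) (hρ : ρ ∈ box c B) (hh : 0 < h) (y : ℝ) :
    |vf h y ρ| ≤ √(cmpC c B) * (h / msize h y) := by
  have hs := dsq_pos (y := y) hh (box_subset_region hc hρ)
  have hm := msize_pos hh y
  have hC := cmpC_pos c B
  apply abs_le_of_sq_le_sq _ (by positivity)
  rw [mul_pow, sq_sqrt hC.le]
  refine le_trans ?_ (uf_le hc hρ hh y).2
  unfold vf uf
  rw [div_pow, div_le_div_iff₀ (by positivity) hs, mul_pow]
  have : (y - ρ 3 * h) ^ 2 ≤ dsq h y ρ := by unfold dsq; nlinarith [sq_nonneg (ρ 2 * h)]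
  calc h ^ 2 * (y - ρ 3 * h) ^ 2 * dsq h y ρ ≤ h ^ 2 * dsq h y ρ * dsq h y ρ := by gcongr
    _ = _ := by ring

lemma div_msize_le_one (hh : 0 < h) (y : ℝ) : h / msize h y ≤ 1 :=
  div_le_one_of_le₀ (le_msize h y) (msize_pos hh y).le

lemma exists_norm_dlogS_le (hc : 0 < c) : ∃ C, 0 ≤ C ∧ ∀ h y ρ, 0 < h → ρ ∈ box c B →
    ‖dlogS h y ρ‖ ≤ C ∧ ‖dlogW h y ρ‖ ≤ C := by
  have hC := cmpC_pos c B
  refine ⟨2 * (|B| * cmpC c B) + 2 * √(cmpC c B) + 2 / c, by positivity, fun h y ρ hh hρ => ?_⟩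
  obtain ⟨h0, h0B, h1, h2, h2B, h3, hB⟩ := box_bounds hc hρ
  have hd := div_msize_le_one hh y
  have hdp : 0 < h / msize h y := div_pos hh (msize_pos hh y)
  obtain ⟨u0, u1⟩ := uf_le hc hρ hh y
  have v1 := abs_vf_le hc hρ hh y
  have u2 : uf h y ρ ≤ cmpC c B := u1.trans (by
    calc _ ≤ cmpC c B * 1 := by gcongr; exact pow_le_one₀ hdp.le hd
      _ = _ := mul_one _)
  have v2 : |vf h y ρ| ≤ √(cmpC c B) := v1.trans (mul_le_of_le_one_right (sqrt_nonneg _) hd)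
  have hS : ‖dlogS h y ρ‖ ≤ 2 * (|B| * cmpC c B) + 2 * √(cmpC c B) := by
    refine (norm_sub_le _ _).trans ((add_le_add (norm_smul_pr_le _ _) (norm_smul_pr_le _ _)).trans ?_)
    rw [abs_mul, abs_mul, abs_mul, abs_two, abs_of_pos u0, abs_of_pos (by linarith : 0 < ρ 2),
      abs_of_pos hB]
    gcongr
  have p : 0 ≤ 2 / c := by positivity
  refine ⟨by linarith, ?_⟩
  refine (norm_add_le _ _).trans ?_
  have : ‖(2 / ρ 0) • pr 0‖ ≤ 2 / c := by
    refine (norm_smul_pr_le _ _).trans ?_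
    rw [abs_of_pos (by have : 0 < ρ 0 := by linarith
                       positivity)]
    gcongr
  linarith

lemma tame_uf (hc : 0 < c) : Tame c B uf (fun h y => (h / msize h y) ^ 2) := by
  obtain ⟨D, hD, H⟩ := exists_norm_dlogS_le (B := B) hc
  have hC := cmpC_pos c B
  refine ⟨cmpC c B * (1 + D), by positivity, fun h y ρ hh hρ => ?_⟩
  obtain ⟨u0, u1⟩ := uf_le hc hρ hh y
  have p : 0 ≤ cmpC c B * (h / msize h y) ^ 2 := by positivity
  refine ⟨?_, _, hasFDerivAt_uf hh (box_subset_region hc hρ), ?_⟩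
  · rw [abs_of_pos u0]; nlinarith
  · rw [norm_smul, norm_neg, norm_eq_abs, abs_of_pos u0]
    have := mul_le_mul u1 (H h y ρ hh hρ).1 (norm_nonneg _) p
    nlinarith

lemma tame_vf (hc : 0 < c) : Tame c B vf (fun h y => h / msize h y) := by
  obtain ⟨D, hD, H⟩ := exists_norm_dlogS_le (B := B) hc
  have hC := cmpC_pos c B
  refine ⟨√(cmpC c B) * (1 + D) + cmpC c B, by positivity, fun h y ρ hh hρ => ?_⟩
  obtain ⟨u0, u1⟩ := uf_le hc hρ hh y
  have v1 := abs_vf_le hc hρ hh y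
  have hd := div_msize_le_one hh y
  have hdp : 0 < h / msize h y := div_pos hh (msize_pos hh y)
  have p : 0 ≤ √(cmpC c B) * (h / msize h y) := by positivity
  have p2 : 0 ≤ cmpC c B * (h / msize h y) := by positivity
  refine ⟨?_, _, hasFDerivAt_vf hh (box_subset_region hc hρ), ?_⟩
  · nlinarith
  · refine (norm_sub_le _ _).trans ?_
    have e1 : ‖-uf h y ρ • pr 3‖ ≤ cmpC c B * (h / msize h y) := by
      refine (norm_smul_pr_le _ _).trans ?_
      rw [abs_neg, abs_of_pos u0]
      refine u1.trans ?_
      gcongr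
      nlinarith
    have e2 : ‖vf h y ρ • dlogS h y ρ‖ ≤ √(cmpC c B) * (h / msize h y) * D := by
      rw [norm_smul, norm_eq_abs]
      exact mul_le_mul v1 (H h y ρ hh hρ).1 (norm_nonneg _) p
    nlinarith

/-- Size of the Bessel ratio terms. -/
def qsize (m : ℝ) : ℝ := √m * m + m ^ 3

lemma qsize_nonneg {m : ℝ} (hm : 0 ≤ m) : 0 ≤ qsize m := by unfold qsize; positivity

lemma sq_le_qsize {m : ℝ} (hm : 0 ≤ m) : m ^ 2 ≤ qsize m := by
  unfold qsize
  rcases le_total m 1 with h | h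
  · have : m ≤ √m := le_sqrt_of_sq_le (by nlinarith)
    nlinarith [pow_nonneg hm 3]
  · nlinarith [mul_nonneg (sqrt_nonneg m) hm, sq_nonneg m]

lemma mul_sqrt_mul_le_qsize {m : ℝ} (hm : 0 ≤ m) : m * (√m * m) ≤ qsize m := by
  rcases le_total m 1 with h | h
  · have : m * (√m * m) ≤ 1 * (√m * m) := by gcongr
    have := pow_nonneg hm 3
    unfold qsize; linarith
  · have : √m ≤ m := by rw [sqrt_le_left hm]; nlinarith
    have : m * (√m * m) ≤ m * (m * m) := by gcongr
    have := mul_nonneg (sqrt_nonneg m) hm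
    unfold qsize; nlinarith

lemma exists_qf_le (hc : 0 < c) : ∃ C, 0 ≤ C ∧ ∀ h y ρ, 0 < h → ρ ∈ box c B →
    0 < qf h y ρ ∧ qf h y ρ ≤ C * (√(msize h y) * msize h y) ∧ qf h y ρ ≤ C * msize h y ∧
      0 < barg h y ρ ∧ barg h y ρ ≤ C * msize h y ^ 2 := by
  obtain ⟨D, hD, H⟩ := exists_kratio_le
  set A := B ^ 2 * (3 * B ^ 2 + 2) with hA
  have hA0 : 0 ≤ A := by positivity
  refine ⟨D * A ^ (3 / 4 : ℝ) + √A + A, by positivity, fun h y ρ hh hρ => ?_⟩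
  have hm := msize_pos hh y
  have hw := barg_pos (y := y) hh (box_subset_region hc hρ)
  have hwA : barg h y ρ ≤ A * msize h y ^ 2 := barg_le hc hρ hh.le y
  have p1 : 0 ≤ D * A ^ (3 / 4 : ℝ) := by positivity
  have p2 := sqrt_nonneg A
  refine ⟨kratio_pos hw, ?_, ?_, hw, ?_⟩
  · have e1 : (barg h y ρ) ^ (3 / 4 : ℝ) ≤ A ^ (3 / 4 : ℝ) * (√(msize h y) * msize h y) := by
      calc (barg h y ρ) ^ (3 / 4 : ℝ) ≤ (A * msize h y ^ 2) ^ (3 / 4 : ℝ) := by gcongr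
        _ = A ^ (3 / 4 : ℝ) * (msize h y ^ 2) ^ (3 / 4 : ℝ) := mul_rpow hA0 (by positivity)
        _ = _ := by
          congr 1
          rw [← rpow_natCast, ← rpow_mul hm.le, sqrt_eq_rpow, ← rpow_add_one hm.ne']
          norm_num
    have := H _ hw
    have p3 : 0 ≤ √(msize h y) * msize h y := by positivity
    calc qf h y ρ ≤ D * (barg h y ρ) ^ (3 / 4 : ℝ) := this
      _ ≤ D * (A ^ (3 / 4 : ℝ) * (√(msize h y) * msize h y)) := by gcongr
      _ ≤ _ := by nlinarith
  · have e1 : √(barg h y ρ) ≤ √A * msize h y := by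
      calc √(barg h y ρ) ≤ √(A * msize h y ^ 2) := sqrt_le_sqrt hwA
        _ = _ := by rw [sqrt_mul hA0, sqrt_sq hm.le]
    have := kratio_le_sqrt hw
    unfold qf
    nlinarith
  · nlinarith [sq_nonneg (msize h y)]

/-- The second quantity is the coefficient in the differential of `wf`. For small `m` the term `2
q`, of order `m^(3/2)`, dominates; for large `m` the product `q * wf` can grow like `m³`. This
accounts for the form of `qsize`. -/
lemma exists_wf_le (hc : 0 < c) : ∃ C, 0 ≤ C ∧ ∀ h y ρ, 0 < h → ρ ∈ box c B →
    |wf h y ρ| ≤ C * qsize (msize h y) ∧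
    |(qf h y ρ + 1) * wf h y ρ - barg h y ρ| ≤ C * qsize (msize h y) := by
  obtain ⟨D, hD, H⟩ := exists_qf_le (B := B) hc
  refine ⟨(D + 1) * (2 * D + D ^ 2 + D) * 2 + D, by positivity, fun h y ρ hh hρ => ?_⟩
  obtain ⟨q0, q1, q2, w0, w1⟩ := H h y ρ hh hρ
  have hm := msize_pos hh y
  set m := msize h y
  have s1 := sq_le_qsize hm.le
  have s2 := mul_sqrt_mul_le_qsize hm.le
  have s3 : √m * m ≤ qsize m := by unfold qsize; nlinarith [pow_pos hm 3]
  have s4 : m ^ 3 ≤ qsize m := by unfold qsize; nlinarith [mul_nonneg (sqrt_nonneg m) hm.le]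
  have s0 := qsize_nonneg hm.le
  have hq2 : qf h y ρ ^ 2 ≤ D ^ 2 * m ^ 2 := by rw [← mul_pow]; gcongr
  have hw : |wf h y ρ| ≤ 2 * D * (√m * m) + (D ^ 2 + D) * m ^ 2 := by
    have : wf h y ρ = qf h y ρ ^ 2 + 2 * qf h y ρ - barg h y ρ := rfl
    rw [this, abs_le]
    constructor <;> nlinarith [sq_nonneg (qf h y ρ), sq_nonneg m, sq_nonneg D,
      mul_nonneg (sqrt_nonneg m) hm.le, mul_nonneg hD (mul_nonneg (sqrt_nonneg m) hm.le)]
  have hw1 : |wf h y ρ| ≤ (2 * D + D ^ 2 + D) * qsize m := by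
    calc _ ≤ 2 * D * qsize m + (D ^ 2 + D) * qsize m := by
          refine hw.trans ?_; gcongr
      _ = _ := by ring
  have hw2 : m * |wf h y ρ| ≤ (2 * D + D ^ 2 + D) * qsize m := by
    calc _ ≤ m * (2 * D * (√m * m) + (D ^ 2 + D) * m ^ 2) := by gcongr
      _ = 2 * D * (m * (√m * m)) + (D ^ 2 + D) * m ^ 3 := by ring
      _ ≤ 2 * D * qsize m + (D ^ 2 + D) * qsize m := by gcongr
      _ = _ := by ring
  have hD2 : 0 ≤ (2 * D + D ^ 2 + D) * qsize m := by positivity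
  constructor
  · refine hw1.trans ?_
    nlinarith [mul_nonneg hD hD2, mul_nonneg hD s0]
  · have e1 : |(qf h y ρ + 1) * wf h y ρ| ≤ (D + 1) * ((2 * D + D ^ 2 + D) * qsize m) := by
      rw [abs_mul, abs_of_pos (by linarith : 0 < qf h y ρ + 1)]
      calc (qf h y ρ + 1) * |wf h y ρ| ≤ (D * m + 1) * |wf h y ρ| := by gcongr
        _ = D * (m * |wf h y ρ|) + |wf h y ρ| := by ring
        _ ≤ D * ((2 * D + D ^ 2 + D) * qsize m) + (2 * D + D ^ 2 + D) * qsize m := by gcongr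
        _ = _ := by ring
    have e2 : |barg h y ρ| ≤ D * qsize m := by
      rw [abs_of_pos w0]; exact w1.trans (by gcongr)
    have := abs_sub (((qf h y ρ + 1) * wf h y ρ)) (barg h y ρ)
    nlinarith [mul_nonneg hD hD2]

lemma tame_qf (hc : 0 < c) : Tame c B qf (fun h y => qsize (msize h y)) := by
  obtain ⟨D, hD, H⟩ := exists_qf_le (B := B) hc
  obtain ⟨A, hA, K⟩ := exists_wf_le (B := B) hc
  obtain ⟨G, hG, L⟩ := exists_norm_dlogS_le (B := B) hc
  refine ⟨D + A * G, by positivity, fun h y ρ hh hρ => ?_⟩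
  obtain ⟨q0, q1, q2, w0, w1⟩ := H h y ρ hh hρ
  obtain ⟨k1, k2⟩ := K h y ρ hh hρ
  have hm := msize_pos hh y
  have s0 := qsize_nonneg hm.le
  have s3 : √(msize h y) * msize h y ≤ qsize (msize h y) := by
    unfold qsize; nlinarith [pow_pos hm 3]
  have p : 0 ≤ A * qsize (msize h y) := by positivity
  have p2 : 0 ≤ D * qsize (msize h y) := by positivity
  refine ⟨?_, _, hasFDerivAt_qf hh (box_subset_region hc hρ), ?_⟩
  · rw [abs_of_pos q0]
    have : D * (√(msize h y) * msize h y) ≤ D * qsize (msize h y) := by gcongr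
    nlinarith [mul_nonneg p hG]
  · rw [norm_smul, norm_eq_abs, abs_div, abs_two]
    have := mul_le_mul k1 (L h y ρ hh hρ).2 (norm_nonneg _) p
    have h3 : 0 ≤ |wf h y ρ| * ‖dlogW h y ρ‖ := by positivity
    nlinarith

lemma tame_wf (hc : 0 < c) : Tame c B wf (fun h y => qsize (msize h y)) := by
  obtain ⟨A, hA, K⟩ := exists_wf_le (B := B) hc
  obtain ⟨G, hG, L⟩ := exists_norm_dlogS_le (B := B) hc
  refine ⟨A + A * G, by positivity, fun h y ρ hh hρ => ?_⟩
  obtain ⟨k1, k2⟩ := K h y ρ hh hρ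
  have hm := msize_pos hh y
  have s0 := qsize_nonneg hm.le
  have p : 0 ≤ A * qsize (msize h y) := by positivity
  refine ⟨?_, _, hasFDerivAt_wf hh (box_subset_region hc hρ), ?_⟩
  · nlinarith [mul_nonneg p hG]
  · rw [norm_smul, norm_eq_abs]
    have := mul_le_mul k2 (L h y ρ hh hρ).2 (norm_nonneg _) p
    nlinarith

end NIG
end

/-! ### Sizes of the Hessian entries and of the scores -/

noncomputable section

namespace NIG

open Set Real

variable {c B h y : ℝ} {ρ : E4}

namespace Tame

variable {f g : ℝ → ℝ → E4 → ℝ} {b b' : ℝ → ℝ → ℝ}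

lemma congr (hf : Tame c B f b) (hfg : ∀ h y ρ, g h y ρ = f h y ρ) : Tame c B g b := by
  have : g = f := by ext h y ρ; exact hfg h y ρ
  rwa [this]

lemma mul_bdd (hf : Tame c B f b) (hg : Tame c B g fun _ _ => 1) :
    Tame c B (fun h y ρ => f h y ρ * g h y ρ) b :=
  (hf.mul hg).mono zero_le_one fun h y _ => by simp

/-- The box is convex, so the bound on the derivative gives a Lipschitz bound by the mean value
inequality. -/
lemma lipschitz (hf : Tame c B f b) : ∃ C, 0 ≤ C ∧ ∀ h y, 0 < h → ∀ ρ ∈ box c B, ∀ σ ∈ box c B,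
    |f h y ρ| ≤ C * b h y ∧ |f h y ρ - f h y σ| ≤ C * b h y * ‖ρ - σ‖ := by
  obtain ⟨C, hC, H⟩ := hf
  refine ⟨C, hC, fun h y hh ρ hρ σ hσ => ⟨(H h y ρ hh hρ).1, ?_⟩⟩
  classical
  choose f' hf' hn using fun ρ : box c B => (H h y ρ hh ρ.2).2
  refine (convex_box c B).norm_image_sub_le_of_norm_hasFDerivWithin_le
    (f' := fun ρ => if hρ : ρ ∈ box c B then f' ⟨ρ, hρ⟩ else 0) (fun ρ hρ => ?_) (fun ρ hρ => ?_)
    hσ hρ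
  · simp only [hρ, dif_pos]
    exact (hf' ⟨ρ, hρ⟩).hasFDerivWithinAt
  · simp only [hρ, dif_pos]
    exact hn ⟨ρ, hρ⟩

end Tame

/-- Size of the entries of the Hessian. -/
def zsize (k l : Fin 4) (h y : ℝ) : ℝ :=
  if k < 2 then (if l < 2 then h + qsize (msize h y) else h * (1 + msize h y ^ 3))
  else (if l < 2 then h * (1 + msize h y ^ 3) else 1 + msize h y ^ 3)

/-- The entries are polynomials in quantities already known to be tame; the point is their weights.
In a mixed entry `wf` is multiplied by `vf` or `uf`, of order `h/m` and `(h/m)²`. Since `qsize m / m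
= √m + m²`, the factor `h` comes out in full and no singularity is left at `m = 0`. -/
lemma tame_hess1 (hc : 0 < c) (k l : Fin 4) :
    Tame c B (fun h y ρ => hess1 h y ρ k l) (zsize k l) := by
  have p := fun k => Tame.coord (B := B) hc k
  have i0 : Tame c B (fun _ _ ρ => (ρ 0)⁻¹) (fun _ _ => 1) :=
    Tame.inv_of_le hc fun ρ hρ => (box_bounds hc hρ).1
  have i2 : Tame c B (fun _ _ ρ => (ρ 2)⁻¹) (fun _ _ => 1) :=
    Tame.inv_of_le hc fun ρ hρ => (box_bounds hc hρ).2.2.2.1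
  have ig := tame_inv_gam (B := B) hc
  have ig3 := (ig.mul_bdd ig).mul_bdd ig
  have tt : Tame c B (fun h _ _ => h) (fun h _ => h) := Tame.time
  have tq := tame_qf (B := B) hc
  have tw := tame_wf (B := B) hc
  have u2 := tame_uf (B := B) hc
  have v1 := tame_vf (B := B) hc
  have u0 : Tame c B uf (fun _ _ => 1) := u2.mono zero_le_one fun h y hh => by
    rw [mul_one]; exact pow_le_one₀ (div_pos hh (msize_pos hh y)).le (div_msize_le_one hh y)
  have v0 : Tame c B vf (fun _ _ => 1) := v1.mono zero_le_one fun h y hh => by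
    rw [mul_one]; exact div_msize_le_one hh y
  have sq1 : ∀ m : ℝ, 0 < m → √m ≤ 1 + m ^ 3 := fun m hm => by
    rcases le_total m 1 with h1 | h1
    · have : √m ≤ 1 := sqrt_le_one.2 h1
      have := pow_pos hm 3
      linarith
    · have h2 : √m ≤ m := by rw [sqrt_le_left hm.le]; nlinarith
      have : m ≤ m ^ 3 := le_self_pow₀ h1 (by norm_num)
      linarith
  have sq2 : ∀ m : ℝ, 0 < m → m ^ 2 ≤ 1 + m ^ 3 := fun m hm => by
    rcases le_total m 1 with h1 | h1
    · have : m ^ 2 ≤ 1 := pow_le_one₀ hm.le h1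
      have := pow_pos hm 3
      linarith
    · have : m ^ 2 ≤ m ^ 3 := pow_le_pow_right₀ h1 (by norm_num)
      linarith
  have sq3 : ∀ m : ℝ, 0 < m → qsize m ≤ 3 * (1 + m ^ 3) := fun m hm => by
    have h1 := sq1 m hm
    have h2 := sq2 m hm
    have : √m * m ≤ (m + m ^ 2) / 2 := by
      nlinarith [sq_nonneg (√m - m), sq_sqrt hm.le]
    have : m ≤ 1 + m ^ 2 := by nlinarith [sq_nonneg (m - 1)]
    have := pow_pos hm 3
    unfold qsize; linarith
  have one3 : Tame c B (fun _ _ _ => (2 : ℝ)) (fun h y => 1 + msize h y ^ 3) :=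
    (Tame.const 2).mono zero_le_one fun h y hh => by
      have := pow_pos (msize_pos hh y) 3
      linarith
  have tq3 : Tame c B qf (fun h y => 1 + msize h y ^ 3) :=
    tq.mono (by norm_num : (0 : ℝ) ≤ 3) fun h y hh => sq3 _ (msize_pos hh y)
  have tw3 : Tame c B wf (fun h y => 1 + msize h y ^ 3) :=
    tw.mono (by norm_num : (0 : ℝ) ≤ 3) fun h y hh => sq3 _ (msize_pos hh y)
  have twv : Tame c B (fun h y ρ => wf h y ρ * vf h y ρ) (fun h y => h * (1 + msize h y ^ 3)) := by
    refine (tw.mul v1).mono (by norm_num : (0 : ℝ) ≤ 2) fun h y hh => ?_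
    have hm := msize_pos hh y
    have h1 := sq1 _ hm
    have h2 := sq2 _ hm
    have e : qsize (msize h y) * (h / msize h y) = h * (√(msize h y) + msize h y ^ 2) := by
      unfold qsize; field_simp
    rw [e]
    nlinarith
  have twu : Tame c B (fun h y ρ => wf h y ρ * uf h y ρ) (fun h y => h * (1 + msize h y ^ 3)) := by
    refine (tw.mul u2).mono (by norm_num : (0 : ℝ) ≤ 2) fun h y hh => ?_
    have hm := msize_pos hh y
    have h1 := sq1 _ hm
    have h2 := sq2 _ hm
    have h3 := div_msize_le_one hh y
    have h4 := div_pos hh hm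
    have e : qsize (msize h y) * (h / msize h y) = h * (√(msize h y) + msize h y ^ 2) := by
      unfold qsize; field_simp
    have e' : qsize (msize h y) * (h / msize h y) ^ 2 ≤ qsize (msize h y) * (h / msize h y) := by
      have := qsize_nonneg hm.le
      gcongr
      nlinarith
    refine e'.trans ?_
    rw [e]
    nlinarith
  have t1 : ∀ {f}, Tame c B f (fun h _ => h) → Tame c B f (fun h y => h + qsize (msize h y)) :=
    fun hf => hf.mono zero_le_one fun h y hh => by
      have := qsize_nonneg (msize_pos hh y).le
      linarith
  have tqq : ∀ {f}, Tame c B f (fun h y => qsize (msize h y)) →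
      Tame c B f (fun h y => h + qsize (msize h y)) :=
    fun hf => hf.mono zero_le_one fun h y hh => by linarith
  have tm : ∀ {f}, Tame c B f (fun h _ => h) → Tame c B f (fun h y => h * (1 + msize h y ^ 3)) :=
    fun hf => hf.mono zero_le_one fun h y hh => by
      have := mul_pos hh (pow_pos (msize_pos hh y) 3)
      linarith
  have T00 : Tame c B (fun h y ρ => hess1 h y ρ 0 0) (fun h y => h + qsize (msize h y)) :=
    ((t1 (((tt.mul_bdd (p 2)).mul_bdd ((p 1).mul_bdd (p 1))).mul_bdd ig3)).neg.add
      (tqq ((tq.sub tw).mul_bdd (i0.mul_bdd i0)))).congr fun h y ρ => by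
        simp [hess1]; ring
  have T01 : Tame c B (fun h y ρ => hess1 h y ρ 0 1) (fun h y => h + qsize (msize h y)) :=
    (t1 (((tt.mul_bdd (p 2)).mul_bdd ((p 0).mul_bdd (p 1))).mul_bdd ig3)).congr fun h y ρ => by
        simp [hess1]; ring
  have T11 : Tame c B (fun h y ρ => hess1 h y ρ 1 1) (fun h y => h + qsize (msize h y)) :=
    (t1 (((tt.mul_bdd (p 2)).mul_bdd ((p 0).mul_bdd (p 0))).mul_bdd ig3)).neg.congr fun h y ρ => by
        simp [hess1]; ring
  have T02 : Tame c B (fun h y ρ => hess1 h y ρ 0 2) (fun h y => h * (1 + msize h y ^ 3)) :=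
    ((tm ((tt.mul_bdd (p 0)).mul_bdd ig)).sub (twu.mul_bdd ((p 2).mul_bdd i0))).congr
      fun h y ρ => by simp [hess1]; ring
  have T03 : Tame c B (fun h y ρ => hess1 h y ρ 0 3) (fun h y => h * (1 + msize h y ^ 3)) :=
    (twv.mul_bdd i0).congr fun h y ρ => by simp [hess1]; ring
  have T12 : Tame c B (fun h y ρ => hess1 h y ρ 1 2) (fun h y => h * (1 + msize h y ^ 3)) :=
    (tm ((tt.mul_bdd (p 1)).mul_bdd ig)).neg.congr fun h y ρ => by simp [hess1]; ring
  have T13 : Tame c B (fun h y ρ => hess1 h y ρ 1 3) (fun h y => h * (1 + msize h y ^ 3)) :=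
    (tm tt).neg.congr fun h y ρ => by simp [hess1]
  have i22 : Tame c B (fun _ _ ρ => (ρ 2)⁻¹ * (ρ 2)⁻¹) (fun h y => 1 + msize h y ^ 3) :=
    (i2.mul_bdd i2).mono zero_le_one fun h y hh => by
      have := pow_pos (msize_pos hh y) 3
      linarith
  have tq2 := tq3.add one3
  have tqw := (tq2.add tq2).sub tw3
  have pu := (p 2).mul_bdd u0
  have T22 : Tame c B (fun h y ρ => hess1 h y ρ 2 2) (fun h y => 1 + msize h y ^ 3) :=
    ((i22.neg.sub (tq2.mul_bdd u0)).add (tqw.mul_bdd (pu.mul_bdd pu))).congr fun h y ρ => by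
      simp [hess1]; ring
  have T23 : Tame c B (fun h y ρ => hess1 h y ρ 2 3) (fun h y => 1 + msize h y ^ 3) :=
    (tqw.mul_bdd (pu.mul_bdd v0)).neg.congr fun h y ρ => by
      simp [hess1]; ring
  have T33 : Tame c B (fun h y ρ => hess1 h y ρ 3 3) (fun h y => 1 + msize h y ^ 3) :=
    ((tq2.mul_bdd u0).neg.add (tqw.mul_bdd (v0.mul_bdd v0))).congr fun h y ρ => by
      simp [hess1]; ring
  fin_cases k <;> fin_cases l
  · exact T00
  · exact T01
  · exact T02
  · exact T03
  · exact T01.congr fun h y ρ => by simp [hess1]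
  · exact T11
  · exact T12
  · exact T13
  · exact T02.congr fun h y ρ => by simp [hess1]
  · exact T12.congr fun h y ρ => by simp [hess1]
  · exact T22
  · exact T23
  · exact T03.congr fun h y ρ => by simp [hess1]
  · exact T13.congr fun h y ρ => by simp [hess1]
  · exact T23.congr fun h y ρ => by simp [hess1]
  · exact T33

/-- One constant for the bounds on all the entries of the Hessian. -/
lemma exists_hess1_lipschitz (hc : 0 < c) (B : ℝ) : ∃ C, 0 ≤ C ∧ ∀ k l h y, 0 < h →
    ∀ ρ ∈ box c B, ∀ σ ∈ box c B, |hess1 h y ρ k l| ≤ C * zsize k l h y ∧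
      |hess1 h y ρ k l - hess1 h y σ k l| ≤ C * zsize k l h y * ‖ρ - σ‖ := by
  choose C hC H using fun k l => (tame_hess1 (B := B) hc k l).lipschitz
  refine ⟨∑ k, ∑ l, C k l, Finset.sum_nonneg fun k _ => Finset.sum_nonneg fun l _ => hC k l,
    fun k l h y hh ρ hρ σ hσ => ?_⟩
  have hle : C k l ≤ ∑ k, ∑ l, C k l :=
    (Finset.single_le_sum (f := fun l => C k l) (fun l _ => hC k l) (Finset.mem_univ l)).trans
      (Finset.single_le_sum (f := fun k => ∑ l, C k l)
        (fun k _ => Finset.sum_nonneg fun l _ => hC k l) (Finset.mem_univ k))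
  have hz : 0 ≤ zsize k l h y := by
    have := msize_pos hh y
    have := qsize_nonneg this.le
    unfold zsize
    split_ifs <;> positivity
  obtain ⟨h1, h2⟩ := H k l h y hh ρ hρ σ hσ
  exact ⟨h1.trans (by gcongr), h2.trans (by gcongr)⟩

/-- In the `δ`- and `μ`-scores the Bessel ratio occurs only in the products `q * uf` and `q * vf`.
As `q` is of order `m`, `uf` of order `(h/m)²` and `vf` of order `h/m`, these are `O(h)`, and what
remains is the score of a Cauchy law. -/
lemma exists_score1_le (hc : 0 < c) (B : ℝ) : ∃ C, 0 ≤ C ∧ ∀ h y, 0 < h → h ≤ 1 →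
    ∀ ρ ∈ box c B, |score1 h y ρ 0| ≤ C * msize h y ∧ |score1 h y ρ 1| ≤ C * msize h y ∧
      |score1 h y ρ 2| ≤ C ∧ |score1 h y ρ 3| ≤ C ∧
      |score1 h y ρ 2 - (1 / ρ 2 - 2 * ρ 2 * uf h y ρ)| ≤ C * h ∧
      |score1 h y ρ 3 - 2 * vf h y ρ| ≤ C * h ∧ uf h y ρ ≤ C ∧ |vf h y ρ| ≤ C := by
  obtain ⟨D, hD, H⟩ := exists_qf_le (B := B) hc
  have hK := cmpC_pos c B
  set K := cmpC c B
  set R := √K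
  have hR : 0 ≤ R := sqrt_nonneg _
  refine ⟨|B| * (|B| / c) + D / c + 1 + |B| + 1 / c + |B| + (D + 2) * |B| * K + (D + 2) * R + K,
    by positivity, fun h y hh h1 ρ hρ => ?_⟩
  obtain ⟨b0, b0B, b1, b2, b2B, b3, hB⟩ := box_bounds hc hρ
  rw [abs_of_pos hB]
  obtain ⟨q0, -, q2, -, -⟩ := H h y ρ hh hρ
  obtain ⟨u0, u1⟩ := uf_le hc hρ hh y
  have v1 := abs_vf_le hc hρ hh y
  have hm := msize_pos hh y
  have hhm := le_msize h y
  have hg := le_gam hc hρ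
  have hgp : 0 < gam ρ := by linarith
  have hgB := gam_le hc hρ
  have hr := div_msize_le_one hh y
  have hrp := div_pos hh hm
  have p0 : 0 < ρ 0 := by linarith
  have p2 : 0 < ρ 2 := by linarith
  set m := msize h y
  have a1 : ρ 0 / gam ρ ≤ B / c := by gcongr
  have a2 : |ρ 1| / gam ρ ≤ B / c := by gcongr
  have u2 : uf h y ρ ≤ K := u1.trans (by
    calc K * (h / m) ^ 2 ≤ K * 1 := by gcongr; exact pow_le_one₀ hrp.le hr
      _ = K := mul_one _)
  have v2 : |vf h y ρ| ≤ R := v1.trans (mul_le_of_le_one_right hR hr)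
  have qu : qf h y ρ * uf h y ρ ≤ D * K * h := by
    calc qf h y ρ * uf h y ρ ≤ (D * m) * (K * (h / m) ^ 2) := by gcongr
      _ = D * K * h * (h / m) := by field_simp
      _ ≤ D * K * h * 1 := by gcongr
      _ = _ := mul_one _
  have qv : qf h y ρ * |vf h y ρ| ≤ D * R * h := by
    calc qf h y ρ * |vf h y ρ| ≤ (D * m) * (R * (h / m)) := by gcongr
      _ = D * R * h := by field_simp
  have pa : 0 ≤ B * (B / c) := by positivity
  have pb : 0 ≤ D / c := by positivity
  have pc : 0 ≤ 1 / c := by positivity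
  have pd : 0 ≤ D * B * K := by positivity
  have pe : 0 ≤ B * K := by positivity
  have pf : 0 ≤ D * R := by positivity
  set A := B * (B / c) + D / c + 1 + B + 1 / c + B + (D + 2) * B * K + (D + 2) * R + K with hA
  have hA' : A = B * (B / c) + D / c + 1 + B + 1 / c + B + D * B * K + 2 * (B * K) + D * R +
    2 * R + K := by rw [hA]; ring
  have e2 : |score1 h y ρ 2 - (1 / ρ 2 - 2 * ρ 2 * uf h y ρ)| ≤ (B + D * B * K) * h := by
    have e : score1 h y ρ 2 - (1 / ρ 2 - 2 * ρ 2 * uf h y ρ) =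
        h * gam ρ - ρ 2 * (qf h y ρ * uf h y ρ) := by simp [score1]; ring
    rw [e]
    refine (abs_sub _ _).trans ?_
    rw [abs_of_pos (by positivity), abs_of_pos (by positivity)]
    have f1 : h * gam ρ ≤ h * B := by gcongr
    have f2 : ρ 2 * (qf h y ρ * uf h y ρ) ≤ B * (D * K * h) := by gcongr
    linarith
  have e3 : |score1 h y ρ 3 - 2 * vf h y ρ| ≤ (B + D * R) * h := by
    have e : score1 h y ρ 3 - 2 * vf h y ρ = -(ρ 1 * h) + qf h y ρ * vf h y ρ := by
      simp [score1]; ring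
    rw [e]
    refine (abs_add_le _ _).trans ?_
    rw [abs_neg, abs_mul, abs_mul, abs_of_pos hh, abs_of_pos q0]
    nlinarith
  refine ⟨?_, ?_, ?_, ?_, ?_, ?_, ?_, ?_⟩
  · have e : score1 h y ρ 0 = ρ 2 * h * (ρ 0 / gam ρ) - qf h y ρ / ρ 0 := by simp [score1]
    rw [e]
    refine (abs_sub _ _).trans ?_
    rw [abs_of_pos (by positivity), abs_of_pos (by positivity)]
    have f1 : ρ 2 * h * (ρ 0 / gam ρ) ≤ B * m * (B / c) := by gcongr
    have f2 : qf h y ρ / ρ 0 ≤ D * m / c := by gcongr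
    calc _ ≤ B * m * (B / c) + D * m / c := add_le_add f1 f2
      _ = (B * (B / c) + D / c) * m := by ring
      _ ≤ A * m := by gcongr; linarith
  · have e : score1 h y ρ 1 = -(ρ 2 * h * (ρ 1 / gam ρ)) + (y - ρ 3 * h) := by simp [score1]
    rw [e]
    refine (abs_add_le _ _).trans ?_
    rw [abs_neg, abs_mul, abs_of_pos (by positivity), abs_div, abs_of_pos hgp]
    have f1 : ρ 2 * h * (|ρ 1| / gam ρ) ≤ B * m * (B / c) := by gcongr
    have f2 : |y - ρ 3 * h| ≤ |y| + B * h := by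
      refine (abs_sub _ _).trans ?_
      rw [abs_mul, abs_of_pos hh]
      gcongr
    have f3 : |y| ≤ m := by simp only [m, msize]; linarith
    have f4 : B * h ≤ B * m := by gcongr
    calc _ ≤ B * m * (B / c) + (m + B * m) := add_le_add f1 (f2.trans (add_le_add f3 f4))
      _ = (B * (B / c) + 1 + B) * m := by ring
      _ ≤ A * m := by gcongr; linarith
  · have f1 : |1 / ρ 2 - 2 * ρ 2 * uf h y ρ| ≤ 1 / c + 2 * B * K := by
      refine (abs_sub _ _).trans ?_
      rw [abs_of_pos (by positivity), abs_of_pos (by positivity)]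
      gcongr
    have := abs_sub_abs_le_abs_sub (score1 h y ρ 2) (1 / ρ 2 - 2 * ρ 2 * uf h y ρ)
    have f2 : (B + D * B * K) * h ≤ B + D * B * K := mul_le_of_le_one_right (by positivity) h1
    linarith
  · have := abs_sub_abs_le_abs_sub (score1 h y ρ 3) (2 * vf h y ρ)
    rw [abs_mul, abs_two] at this
    have f2 : (B + D * R) * h ≤ B + D * R := mul_le_of_le_one_right (by positivity) h1
    linarith
  · refine e2.trans ?_
    gcongr
    linarith
  · refine e3.trans ?_
    gcongr
    linarith
  · linarith
  · linarith

end NIG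
end

/-! ### Density bounds and moments of an increment -/

noncomputable section

namespace NIG

open Set Real

variable {c B h y : ℝ} {ρ : E4}

/-- The density of one increment over a time step `h`. -/
def pd (h : ℝ) (ρ : E4) (y : ℝ) : ℝ := density (ρ 0) (ρ 1) (ρ 2 * h) (ρ 3 * h) y

/-- The law of one increment over a time step `h`. -/
def inc (h : ℝ) (ρ : E4) : Measure ℝ := law (ρ 0) (ρ 1) (ρ 2 * h) (ρ 3 * h)

/-- The density of the Lévy measure. -/
def lev (ρ : E4) (y : ℝ) : ℝ :=
  ρ 2 / π * exp (ρ 1 * y) * (kone (ρ 0 ^ 2 * y ^ 2) / y ^ 2)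

/-- The density of the Cauchy distribution with scale `δ` and location `μ`. -/
def cauchyD (ρ : E4) (z : ℝ) : ℝ := ρ 2 / π / (ρ 2 ^ 2 + (z - ρ 3) ^ 2)

/-- The weight controlling the functions of an increment whose mean is of the order of `h`. -/
def mom (m : ℝ) : ℝ := √m * m + m ^ 6

lemma mom_nonneg {m : ℝ} (hm : 0 ≤ m) : 0 ≤ mom m := by unfold mom; positivity

/-- The powers go up to the sixth because second moments of the cubic bounds on the Hessian entries
are needed. -/
lemma pow_le_mom {m : ℝ} (hm : 0 ≤ m) {p : ℕ} (h2 : 2 ≤ p) (h6 : p ≤ 6) : m ^ p ≤ mom m := by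
  unfold mom
  rcases le_total m 1 with h | h
  · have : m ^ p ≤ m ^ 2 := pow_le_pow_of_le_one hm h h2
    have h3 : m ≤ √m := by
      apply le_sqrt_of_sq_le; nlinarith
    nlinarith [pow_nonneg hm 6]
  · have : m ^ p ≤ m ^ 6 := pow_le_pow_right₀ h h6
    have : 0 ≤ √m * m := by positivity
    linarith

lemma pd_eq (hh : 0 < h) (hρ : ρ ∈ region) : pd h ρ y =
    ρ 2 * h / π * exp (ρ 2 * h * gam ρ + ρ 1 * (y - ρ 3 * h)) *
      (kone (barg h y ρ) / dsq h y ρ) := by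
  obtain ⟨h0, h2, h01⟩ := region_pos hρ
  unfold pd
  rw [density_eq h0 (by positivity)]
  rfl

lemma pd_pos (hh : 0 < h) (hρ : ρ ∈ region) : 0 < pd h ρ y :=
  density_pos (region_pos hρ).1 (mul_pos (region_pos hρ).2.1 hh) _ _ _

lemma continuous_pd (hh : 0 < h) (hρ : ρ ∈ region) : Continuous (pd h ρ) :=
  continuous_density (region_pos hρ).1 (mul_pos (region_pos hρ).2.1 hh) _ _

lemma isProbabilityMeasure_inc (hh : 0 < h) (hρ : ρ ∈ region) : IsProbabilityMeasure (inc h ρ) :=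
  isProbabilityMeasure_law hρ.2.1 (mul_pos hρ.2.2 hh) _

lemma integral_inc (hh : 0 < h) (hρ : ρ ∈ region) (f : ℝ → ℝ) :
    ∫ y, f y ∂(inc h ρ) = ∫ y, pd h ρ y * f y := by
  change ∫ y, f y ∂(volume.withDensity fun y => ENNReal.ofReal (pd h ρ y)) = _
  rw [integral_withDensity_eq_integral_toReal_smul
    ((continuous_pd hh hρ).measurable.ennreal_ofReal) (by simp)]
  refine integral_congr_ae (ae_of_all _ fun y => ?_)
  simp only [smul_eq_mul]
  rw [ENNReal.toReal_ofReal (pd_pos hh hρ).le]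

lemma integrable_inc_iff (hh : 0 < h) (hρ : ρ ∈ region) (f : ℝ → ℝ) :
    Integrable f (inc h ρ) ↔ Integrable (fun y => pd h ρ y * f y) := by
  change Integrable f (volume.withDensity fun y => ENNReal.ofReal (pd h ρ y)) ↔ _
  rw [integrable_withDensity_iff_integrable_smul'
    ((continuous_pd hh hρ).measurable.ennreal_ofReal) (by simp)]
  refine integrable_congr (ae_of_all _ fun y => ?_)
  simp only [smul_eq_mul]
  rw [ENNReal.toReal_ofReal (pd_pos hh hρ).le]

/-- The factor `h / m²` is that of the Cauchy density. The exponential decay survives the tilt by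
`β` because `|β|` stays below `α` by the margin `c`. -/
lemma exists_pd_le (hc : 0 < c) (B : ℝ) : ∃ C a, 0 ≤ C ∧ 0 < a ∧ ∀ h y, 0 < h → h ≤ 1 →
    ∀ ρ ∈ box c B, pd h ρ y ≤ C * h / msize h y ^ 2 * exp (-(a * msize h y)) := by
  have hK := cmpC_pos c B
  set K := cmpC c B with hKdef
  refine ⟨|B| / π * exp (B ^ 2) * (2 * |B| / c) * K, c / 2 / √K, by positivity, by positivity,
    fun h y hh h1 ρ hρ => ?_⟩
  have hreg := box_subset_region hc hρ
  obtain ⟨b0, b0B, b1, b2, b2B, b3, hB⟩ := box_bounds hc hρ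
  have hm := msize_pos hh y
  have hs := dsq_pos (y := y) hh hreg
  have hms : msize h y ^ 2 ≤ K * dsq h y ρ := sq_msize_le hc hρ h y
  have hmr : msize h y ≤ √K * √(dsq h y ρ) := by
    rw [← sqrt_mul hK.le]
    exact le_sqrt_of_sq_le hms
  have hr : 0 ≤ √(dsq h y ρ) := sqrt_nonneg _
  have hyr : |y - ρ 3 * h| ≤ √(dsq h y ρ) := by
    rw [← sqrt_sq_eq_abs]
    apply sqrt_le_sqrt
    unfold dsq
    nlinarith [sq_nonneg (ρ 2 * h)]
  have hg := gam_le hc hρ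
  have hg0 := gam_pos hreg
  -- With this `ε` the loss `ε α` in the decay rate is at most `c/2`, that is half of the margin
  -- between `α` and `|β|`.
  have hk := kone_le_exp (barg_pos (y := y) hh hreg).le (ε := c / (2 * B)) (by positivity)
    (by rw [div_le_one (by positivity)]; linarith)
  have hsb : √(barg h y ρ) = ρ 0 * √(dsq h y ρ) := by
    unfold barg
    rw [sqrt_mul (by positivity), sqrt_sq (by linarith)]
  have hk0 := kone_pos (barg_pos (y := y) hh hreg)
  have hα1 : |ρ 1| ≤ ρ 0 - c := by linarith [hρ.1]
  have e1 : ρ 1 * (y - ρ 3 * h) ≤ (ρ 0 - c) * √(dsq h y ρ) := by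
    calc ρ 1 * (y - ρ 3 * h) ≤ |ρ 1| * |y - ρ 3 * h| := by
          rw [← abs_mul]; exact le_abs_self _
      _ ≤ _ := mul_le_mul hα1 hyr (abs_nonneg _) ((abs_nonneg _).trans hα1)
  have e2 : ρ 2 * h * gam ρ ≤ B ^ 2 := by
    have : ρ 2 * h ≤ B * 1 := mul_le_mul b2B h1 hh.le hB.le
    nlinarith
  have e3 : c / (2 * B) * ρ 0 ≤ c / 2 := by
    rw [div_mul_eq_mul_div, div_le_div_iff₀ (by positivity) (by positivity)]
    nlinarith
  rw [pd_eq hh hreg]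
  have hexp : exp (ρ 2 * h * gam ρ + ρ 1 * (y - ρ 3 * h)) * kone (barg h y ρ) ≤
      exp (B ^ 2) * (2 * B / c) * exp (-(c / 2 / √K * msize h y)) := by
    calc _ ≤ exp (B ^ 2 + (ρ 0 - c) * √(dsq h y ρ)) *
          ((c / (2 * B))⁻¹ * exp (-((1 - c / (2 * B)) * √(barg h y ρ)))) := by gcongr
      _ = exp (B ^ 2) * (2 * B / c) * exp (-((c - c / (2 * B) * ρ 0) * √(dsq h y ρ))) := by
          rw [inv_div, hsb, exp_add]
          have : exp ((ρ 0 - c) * √(dsq h y ρ)) *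
            exp (-((1 - c / (2 * B)) * (ρ 0 * √(dsq h y ρ)))) =
            exp (-((c - c / (2 * B) * ρ 0) * √(dsq h y ρ))) := by
            rw [← exp_add]; congr 1; ring
          rw [← this]; ring
      _ ≤ _ := by
          refine mul_le_mul_of_nonneg_left (exp_le_exp.2 (neg_le_neg ?_)) (by positivity)
          calc c / 2 / √K * msize h y ≤ c / 2 / √K * (√K * √(dsq h y ρ)) := by gcongr
            _ = c / 2 * √(dsq h y ρ) := by field_simp
            _ ≤ _ := by gcongr; linarith
  have hinv : 1 / dsq h y ρ ≤ K / msize h y ^ 2 := by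
    rw [div_le_div_iff₀ hs (by positivity)]; linarith
  rw [abs_of_pos hB]
  calc _ = ρ 2 * h / π * (exp (ρ 2 * h * gam ρ + ρ 1 * (y - ρ 3 * h)) * kone (barg h y ρ)) *
        (1 / dsq h y ρ) := by ring
    _ ≤ B * h / π * (exp (B ^ 2) * (2 * B / c) * exp (-(c / 2 / √K * msize h y))) *
        (K / msize h y ^ 2) := by gcongr
    _ = _ := by ring

/-- An integrable function dominating `mom` against the density of an increment. -/
def majorant (a y : ℝ) : ℝ := (√|y|)⁻¹ * exp (-(a * |y|))

lemma integrable_comp_abs_of_Ioi {f : ℝ → ℝ} (hf : IntegrableOn f (Ioi 0)) :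
    Integrable fun x => f |x| := by
  have h1 : IntegrableOn (fun x => f |x|) (Ioi 0) :=
    hf.congr_fun (fun x (hx : 0 < x) => by simp only [abs_of_pos hx]) measurableSet_Ioi
  have h2 : IntegrableOn (fun x => f |x|) (Iio 0) := by
    have h3 : IntegrableOn (fun x => f |-x|) (Iio 0) := by
      have := IntegrableOn.comp_neg_Iio (c := (0 : ℝ)) (f := fun x => f |x|) (by simpa using h1)
      simpa using this
    simpa using h3
  have h3 : IntegrableOn (fun x => f |x|) (Iic 0) := (integrableOn_Iic_iff_integrableOn_Iio (by simp)).2 h2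
  rw [← integrableOn_univ, ← Iic_union_Ioi (a := (0 : ℝ))]
  exact h3.union h1

lemma integrable_majorant {a : ℝ} (ha : 0 < a) : Integrable (majorant a) := by
  refine integrable_comp_abs_of_Ioi (f := fun x => (√x)⁻¹ * exp (-(a * x))) ?_
  have := integrableOn_rpow_mul_exp_neg_mul_rpow (p := 1) (s := -(1 / 2)) (by norm_num) one_pos ha
  refine this.congr_fun (fun x (hx : 0 < x) => ?_) measurableSet_Ioi
  simp only [rpow_one]
  rw [rpow_neg hx.le, sqrt_eq_rpow, neg_mul]

/-- Near the origin `mom m / m²` is of order `m^(-1/2)`, at most `|y|^(-1/2)`, which is integrable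
and free of `h`. The origin is excluded because `majorant` takes the value `0` there, the inverse of
`0` being `0`. -/
lemma exists_pd_mul_mom_le (hc : 0 < c) (B : ℝ) : ∃ C a, 0 ≤ C ∧ 0 < a ∧ ∀ h y, 0 < h → h ≤ 1 →
    y ≠ 0 → ∀ ρ ∈ box c B, pd h ρ y * mom (msize h y) ≤ h * (C * majorant a y) := by
  obtain ⟨C, a, hC, ha, H⟩ := exists_pd_le hc B
  refine ⟨C * (2 + Nat.factorial 5 * (2 / a) ^ 5), a / 2, by positivity, by positivity,
    fun h y hh h1 hy ρ hρ => ?_⟩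
  have hm := msize_pos hh y
  have hym : |y| ≤ msize h y := by unfold msize; linarith
  have hy0 : 0 < |y| := abs_pos.2 hy
  set m := msize h y
  have hs : 0 < √m := sqrt_pos.2 hm
  have hss : √m * √m = m := mul_self_sqrt hm.le
  have hp : m ^ 5 * exp (-(a / 2 * m)) ≤ Nat.factorial 5 * (2 / a) ^ 5 := by
    have := pow_div_factorial_le_exp (x := a / 2 * m) (by positivity) 5
    rw [exp_neg]
    rw [div_le_iff₀ (by positivity)] at this
    rw [mul_inv_le_iff₀ (exp_pos _)]
    calc m ^ 5 = (2 / a) ^ 5 * (a / 2 * m) ^ 5 := by field_simp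
      _ ≤ (2 / a) ^ 5 * (exp (a / 2 * m) * Nat.factorial 5) := by gcongr
      _ = _ := by ring
  have hsm : √m * m ^ 4 ≤ 1 + m ^ 5 := by
    rcases le_total m 1 with h | h
    · have : √m ≤ 1 := sqrt_le_one.2 h
      have : m ^ 4 ≤ 1 := pow_le_one₀ hm.le h
      nlinarith [pow_nonneg hm.le 5, pow_nonneg hm.le 4]
    · have : √m ≤ m := by rw [sqrt_le_left hm.le]; nlinarith
      nlinarith [pow_nonneg hm.le 4]
  have key : mom m / m ^ 2 * exp (-(a * m)) ≤
      (2 + Nat.factorial 5 * (2 / a) ^ 5) * ((√m)⁻¹ * exp (-(a / 2 * m))) := by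
    have e1 : mom m / m ^ 2 = (√m)⁻¹ * (1 + √m * m ^ 4) := by
      unfold mom
      have hm4 : m ^ 2 = √m * √m * m := by rw [hss]; ring
      rw [div_eq_iff (by positivity)]
      rw [hm4]
      field_simp
      linear_combination (-(m ^ 4)) * hss
    have e2 : exp (-(a * m)) = exp (-(a / 2 * m)) * exp (-(a / 2 * m)) := by
      rw [← exp_add]; congr 1; ring
    have e3 : exp (-(a / 2 * m)) ≤ 1 := exp_le_one_iff.2 (by have := mul_pos ha hm; linarith)
    rw [e1, e2]
    calc _ = (√m)⁻¹ * exp (-(a / 2 * m)) * ((1 + √m * m ^ 4) * exp (-(a / 2 * m))) := by ring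
      _ ≤ (√m)⁻¹ * exp (-(a / 2 * m)) * ((2 + m ^ 5) * exp (-(a / 2 * m))) := by
          refine mul_le_mul_of_nonneg_left (mul_le_mul_of_nonneg_right ?_ (exp_pos _).le)
            (by positivity)
          linarith
      _ = (√m)⁻¹ * exp (-(a / 2 * m)) * (2 * exp (-(a / 2 * m)) + m ^ 5 * exp (-(a / 2 * m))) := by
          ring
      _ ≤ (√m)⁻¹ * exp (-(a / 2 * m)) * (2 * 1 + Nat.factorial 5 * (2 / a) ^ 5) := by gcongr
      _ = _ := by ring
  have key2 : (√m)⁻¹ * exp (-(a / 2 * m)) ≤ majorant (a / 2) y := by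
    unfold majorant
    gcongr
  calc _ ≤ C * h / m ^ 2 * exp (-(a * m)) * mom m := by
        have := H h y hh h1 ρ hρ
        exact mul_le_mul_of_nonneg_right this (mom_nonneg hm.le)
    _ = C * h * (mom m / m ^ 2 * exp (-(a * m))) := by ring
    _ ≤ C * h * ((2 + Nat.factorial 5 * (2 / a) ^ 5) * majorant (a / 2) y) := by
        exact mul_le_mul_of_nonneg_left (key.trans (by gcongr)) (by positivity)
    _ = _ := by ring

/-- A function of one increment that is small near the origin has a mean of the order of `h`. -/
lemma exists_moment (hc : 0 < c) (B : ℝ) : ∃ C, 0 ≤ C ∧ ∀ h, 0 < h → h ≤ 1 → ∀ ρ ∈ box c B,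
    ∀ f : ℝ → ℝ, Measurable f → ∀ A, 0 ≤ A → (∀ y, |f y| ≤ A * mom (msize h y)) →
      Integrable f (inc h ρ) ∧ ∫ y, |f y| ∂(inc h ρ) ≤ C * A * h := by
  obtain ⟨C, a, hC, ha, H⟩ := exists_pd_mul_mom_le hc B
  refine ⟨C * ∫ y, majorant a y, by
    have : 0 ≤ ∫ y, majorant a y := integral_nonneg fun y => by unfold majorant; positivity
    positivity, fun h hh h1 ρ hρ f hf A hA hfA => ?_⟩
  have hreg := box_subset_region hc hρ
  have hae : ∀ᵐ y : ℝ, ‖pd h ρ y * f y‖ ≤ A * (h * (C * majorant a y)) := by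
    filter_upwards [compl_mem_ae_iff.2 (measure_singleton (0 : ℝ))] with y hy
    have hp := pd_pos (y := y) hh hreg
    rw [norm_mul, norm_of_nonneg hp.le, norm_eq_abs]
    calc _ ≤ pd h ρ y * (A * mom (msize h y)) := by gcongr; exact hfA y
      _ = A * (pd h ρ y * mom (msize h y)) := by ring
      _ ≤ _ := mul_le_mul_of_nonneg_left (H h y hh h1 hy ρ hρ) hA
  have hint : Integrable fun y => A * (h * (C * majorant a y)) :=
    (((integrable_majorant ha).const_mul _).const_mul _).const_mul _
  have hm : AEStronglyMeasurable (fun y => pd h ρ y * f y) :=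
    ((continuous_pd hh hreg).measurable.mul hf).aestronglyMeasurable
  refine ⟨(integrable_inc_iff hh hreg f).2 (hint.mono' hm hae), ?_⟩
  rw [integral_inc hh hreg]
  calc _ ≤ ∫ y, A * (h * (C * majorant a y)) := by
        refine integral_mono_of_nonneg (ae_of_all _ fun y =>
          mul_nonneg (pd_pos hh hreg).le (abs_nonneg _)) hint ?_
        filter_upwards [hae] with y hy
        rwa [norm_mul, norm_of_nonneg (pd_pos hh hreg).le, norm_eq_abs] at hy
    _ = _ := by
      rw [integral_const_mul, integral_const_mul, integral_const_mul]; ring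

end NIG

end

/-! ### Limits of means: the Lévy measure and the Cauchy law -/

noncomputable section

namespace NIG

open Set Real

variable {c B h y : ℝ} {ρ : E4}

lemma tendsto_coord {θ : ℕ → E4} {θ₀ : E4} (ht : Tendsto θ atTop (𝓝 θ₀)) (k : Fin 4) :
    Tendsto (fun i => θ i k) atTop (𝓝 (θ₀ k)) :=
  ((pr k).continuous.tendsto θ₀).comp ht

lemma tendsto_gam {θ : ℕ → E4} {θ₀ : E4} (ht : Tendsto θ atTop (𝓝 θ₀)) :
    Tendsto (fun i => gam (θ i)) atTop (𝓝 (gam θ₀)) :=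
  (((tendsto_coord ht 0).pow 2).sub ((tendsto_coord ht 1).pow 2)).sqrt

lemma continuous_dsq (h : ℝ) (ρ : E4) : Continuous fun y => dsq h y ρ := by
  unfold dsq; fun_prop

lemma continuous_barg (h : ℝ) (ρ : E4) : Continuous fun y => barg h y ρ :=
  continuous_const.mul (continuous_dsq h ρ)

lemma continuousOn_kratio : ContinuousOn kratio (Ioi 0) := fun _ hw =>
  (hasDerivAt_kratio hw).continuousAt.continuousWithinAt

lemma continuous_qf (hh : 0 < h) (hρ : ρ ∈ region) : Continuous fun y => qf h y ρ :=
  continuousOn_kratio.comp_continuous (continuous_barg h ρ) fun _ => barg_pos hh hρ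

lemma continuous_wf (hh : 0 < h) (hρ : ρ ∈ region) : Continuous fun y => wf h y ρ := by
  have h1 := continuous_qf hh hρ
  have h2 := continuous_barg h ρ
  exact ((h1.pow 2).add (h1.const_mul 2)).sub h2

lemma continuous_uf (hh : 0 < h) (hρ : ρ ∈ region) : Continuous fun y => uf h y ρ :=
  continuous_const.div (continuous_dsq h ρ) fun _ => (dsq_pos hh hρ).ne'

lemma continuous_vf (hh : 0 < h) (hρ : ρ ∈ region) : Continuous fun y => vf h y ρ :=
  (continuous_const.mul (continuous_id.sub continuous_const)).div (continuous_dsq h ρ)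
    fun _ => (dsq_pos hh hρ).ne'

lemma continuous_score1 (hh : 0 < h) (hρ : ρ ∈ region) (k : Fin 4) :
    Continuous fun y => score1 h y ρ k := by
  have h1 := continuous_qf hh hρ
  have h2 := continuous_uf hh hρ
  have h3 := continuous_vf hh hρ
  fin_cases k <;> simp only [score1] <;> simp <;> fun_prop

lemma continuous_hess1 (hh : 0 < h) (hρ : ρ ∈ region) (k l : Fin 4) :
    Continuous fun y => hess1 h y ρ k l := by
  have h1 := continuous_qf hh hρ
  have h2 := continuous_uf hh hρ
  have h3 := continuous_vf hh hρ
  have h4 := continuous_wf hh hρ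
  fin_cases k <;> fin_cases l <;> simp only [hess1] <;> simp <;> fun_prop

lemma tendsto_dsq {h : ℕ → ℝ} {θ : ℕ → E4} {θ₀ : E4} (h0 : Tendsto h atTop (𝓝 0))
    (ht : Tendsto θ atTop (𝓝 θ₀)) (y : ℝ) :
    Tendsto (fun i => dsq (h i) y (θ i)) atTop (𝓝 (y ^ 2)) := by
  have := (((tendsto_coord ht 2).mul h0).pow 2).add
    ((tendsto_const_nhds (x := y)).sub ((tendsto_coord ht 3).mul h0) |>.pow 2)
  simpa [dsq] using this

lemma tendsto_barg {h : ℕ → ℝ} {θ : ℕ → E4} {θ₀ : E4} (h0 : Tendsto h atTop (𝓝 0))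
    (ht : Tendsto θ atTop (𝓝 θ₀)) (y : ℝ) :
    Tendsto (fun i => barg (h i) y (θ i)) atTop (𝓝 (θ₀ 0 ^ 2 * y ^ 2)) :=
  ((tendsto_coord ht 0).pow 2).mul (tendsto_dsq h0 ht y)

lemma tendsto_qf {h : ℕ → ℝ} {θ : ℕ → E4} {θ₀ : E4} (h0 : Tendsto h atTop (𝓝 0))
    (ht : Tendsto θ atTop (𝓝 θ₀)) (hθ₀ : θ₀ ∈ region) {y : ℝ} (hy : y ≠ 0) :
    Tendsto (fun i => qf (h i) y (θ i)) atTop (𝓝 (kratio (θ₀ 0 ^ 2 * y ^ 2))) := by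
  have h00 := (region_pos hθ₀).1
  exact ((hasDerivAt_kratio (by positivity)).continuousAt.tendsto).comp (tendsto_barg h0 ht y)

lemma tendsto_pd_div {h : ℕ → ℝ} (hh : ∀ i, 0 < h i) {θ : ℕ → E4} (hθ : ∀ i, θ i ∈ region) {θ₀ : E4}
    (h0 : Tendsto h atTop (𝓝 0)) (ht : Tendsto θ atTop (𝓝 θ₀)) (hθ₀ : θ₀ ∈ region)
    {y : ℝ} (hy : y ≠ 0) :
    Tendsto (fun i => pd (h i) (θ i) y / h i) atTop (𝓝 (lev θ₀ y)) := by
  have h00 := (region_pos hθ₀).1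
  have e : ∀ i, pd (h i) (θ i) y / h i = θ i 2 / π *
      exp (θ i 2 * h i * gam (θ i) + θ i 1 * (y - θ i 3 * h i)) *
      (kone (barg (h i) y (θ i)) / dsq (h i) y (θ i)) := fun i => by
    rw [pd_eq (hh i) (hθ i)]
    have := (hh i).ne'
    field_simp
  simp_rw [e]
  have hk : Tendsto (fun i => kone (barg (h i) y (θ i))) atTop (𝓝 (kone (θ₀ 0 ^ 2 * y ^ 2))) :=
    ((hasDerivAt_kone (by positivity)).continuousAt.tendsto).comp (tendsto_barg h0 ht y)
  have he : Tendsto (fun i => θ i 2 * h i * gam (θ i) + θ i 1 * (y - θ i 3 * h i)) atTop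
      (𝓝 (θ₀ 2 * 0 * gam θ₀ + θ₀ 1 * (y - θ₀ 3 * 0))) :=
    (((tendsto_coord ht 2).mul h0).mul (tendsto_gam ht)).add
      ((tendsto_coord ht 1).mul (tendsto_const_nhds.sub ((tendsto_coord ht 3).mul h0)))
  have := (((tendsto_coord ht 2).div_const π).mul ((continuous_exp.tendsto _).comp he)).mul
    (hk.div (tendsto_dsq h0 ht y) (by positivity))
  simpa [lev] using this

lemma lev_nonneg (hρ : ρ ∈ region) (y : ℝ) : 0 ≤ lev ρ y := by
  have := (region_pos hρ).2.1
  have := kone_pos' (w := ρ 0 ^ 2 * y ^ 2) (by positivity)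
  unfold lev; positivity

lemma lev_pos (hρ : ρ ∈ region) {y : ℝ} (hy : y ≠ 0) : 0 < lev ρ y := by
  have := (region_pos hρ).2.1
  have := kone_pos' (w := ρ 0 ^ 2 * y ^ 2) (by positivity)
  unfold lev; positivity

lemma continuousOn_lev (ρ : E4) : ContinuousOn (lev ρ) {0}ᶜ := by
  have hk : Continuous fun y : ℝ => kone (ρ 0 ^ 2 * y ^ 2) :=
    continuousOn_kone.comp_continuous (by fun_prop) fun y => by
      rw [mem_Ici]
      positivity
  unfold lev
  refine ContinuousOn.mul (by fun_prop) (hk.continuousOn.div (by fun_prop) fun y hy => ?_)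
  exact pow_ne_zero _ hy

lemma continuous_mom : Continuous mom := by unfold mom; fun_prop

lemma tendsto_one_div_nat_succ : Tendsto (fun i : ℕ => 1 / ((i : ℝ) + 1)) atTop (𝓝 0) :=
  tendsto_one_div_add_atTop_nhds_zero_nat

/-- The bound on the densities divided by `h` is uniform in `h`, so it passes to their limit. -/
lemma exists_lev_mul_mom_le (hc : 0 < c) (B : ℝ) : ∃ C a, 0 ≤ C ∧ 0 < a ∧ ∀ y, y ≠ 0 →
    ∀ ρ ∈ box c B, lev ρ y * mom |y| ≤ C * majorant a y := by
  obtain ⟨C, a, hC, ha, H⟩ := exists_pd_mul_mom_le hc B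
  refine ⟨C, a, hC, ha, fun y hy ρ hρ => ?_⟩
  have hreg := box_subset_region hc hρ
  have hpos : ∀ i : ℕ, 0 < 1 / ((i : ℝ) + 1) := fun i => by positivity
  have h1 := tendsto_pd_div hpos (fun _ => hreg) tendsto_one_div_nat_succ tendsto_const_nhds hreg hy
  have h2 : Tendsto (fun i : ℕ => mom (msize (1 / ((i : ℝ) + 1)) y)) atTop (𝓝 (mom |y|)) := by
    have : Tendsto (fun i : ℕ => msize (1 / ((i : ℝ) + 1)) y) atTop (𝓝 (0 + |y|)) :=
      tendsto_one_div_nat_succ.add_const _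
    rw [zero_add] at this
    exact (continuous_mom.tendsto _).comp this
  refine le_of_tendsto (h1.mul h2) (Eventually.of_forall fun i => ?_)
  rw [div_mul_eq_mul_div, div_le_iff₀ (hpos i), mul_comm (C * _)]
  exact H _ y (hpos i) (by rw [div_le_one (by positivity)]; linarith [Nat.cast_nonneg (α := ℝ) i])
    hy ρ hρ

/-- Rescaled means of functions of an increment converge to integrals against the Lévy measure. -/
lemma tendsto_integral_inc_div (hc : 0 < c) {h : ℕ → ℝ} (hh : ∀ i, 0 < h i) (h1 : ∀ i, h i ≤ 1)
    (h0 : Tendsto h atTop (𝓝 0)) {θ : ℕ → E4} (hθ : ∀ i, θ i ∈ box c B) {θ₀ : E4}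
    (hθ₀ : θ₀ ∈ region) (ht : Tendsto θ atTop (𝓝 θ₀)) {φ : ℕ → ℝ → ℝ} (hφm : ∀ i, Measurable (φ i))
    {A : ℝ} (hA : 0 ≤ A) (hφ : ∀ i y, |φ i y| ≤ A * mom (msize (h i) y)) {φ₀ : ℝ → ℝ}
    (hl : ∀ y, y ≠ 0 → Tendsto (fun i => φ i y) atTop (𝓝 (φ₀ y))) :
    Tendsto (fun i => (∫ y, φ i y ∂(inc (h i) (θ i))) / h i) atTop (𝓝 (∫ y, lev θ₀ y * φ₀ y)) := by
  obtain ⟨C, a, hC, ha, H⟩ := exists_pd_mul_mom_le hc B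
  have hreg := fun i => box_subset_region hc (hθ i)
  have e : ∀ i, (∫ y, φ i y ∂(inc (h i) (θ i))) / h i = ∫ y, pd (h i) (θ i) y / h i * φ i y :=
    fun i => by
      rw [integral_inc (hh i) (hreg i), ← integral_div]
      congr 1; ext y; ring
  simp_rw [e]
  refine tendsto_integral_of_dominated_convergence (fun y => A * (C * majorant a y)) (fun i => ?_)
    (((integrable_majorant ha).const_mul _).const_mul _) (fun i => ?_) ?_
  · exact (((continuous_pd (hh i) (hreg i)).measurable.div_const _).mul (hφm i)).aestronglyMeasurable
  · filter_upwards [compl_mem_ae_iff.2 (measure_singleton (0 : ℝ))] with y hy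
    have hp := pd_pos (y := y) (hh i) (hreg i)
    have hi := hh i
    rw [norm_mul, norm_of_nonneg (by positivity), norm_eq_abs]
    calc _ ≤ pd (h i) (θ i) y / h i * (A * mom (msize (h i) y)) := by gcongr; exact hφ i y
      _ = A * (pd (h i) (θ i) y * mom (msize (h i) y) / h i) := by ring
      _ ≤ A * (h i * (C * majorant a y) / h i) := by
        refine mul_le_mul_of_nonneg_left ?_ hA
        exact div_le_div_of_nonneg_right (H _ y hi (h1 i) hy _ (hθ i)) hi.le
      _ = _ := by field_simp
  · filter_upwards [compl_mem_ae_iff.2 (measure_singleton (0 : ℝ))] with y hy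
    exact (tendsto_pd_div hh hreg h0 ht hθ₀ hy).mul (hl y hy)

/-- At `y = h z` one has `m = h (1 + |z|)`, so the powers of `h` cancel and a Cauchy tail is left.
This is the domination on the scale `h`. -/
lemma exists_mul_pd_mul_le (hc : 0 < c) (B : ℝ) : ∃ C, 0 ≤ C ∧ ∀ h z, 0 < h → h ≤ 1 →
    ∀ ρ ∈ box c B, h * pd h ρ (h * z) ≤ C * (1 + z ^ 2)⁻¹ := by
  obtain ⟨C, a, hC, ha, H⟩ := exists_pd_le hc B
  refine ⟨C, hC, fun h z hh h1 ρ hρ => ?_⟩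
  have hm := msize_pos hh (h * z)
  have e : msize h (h * z) = h * (1 + |z|) := by
    unfold msize; rw [abs_mul, abs_of_pos hh]; ring
  calc _ ≤ h * (C * h / msize h (h * z) ^ 2 * exp (-(a * msize h (h * z)))) := by
        gcongr; exact H _ _ hh h1 ρ hρ
    _ ≤ h * (C * h / msize h (h * z) ^ 2 * 1) := by
        gcongr
        exact exp_le_one_iff.2 (by have := mul_pos ha hm; linarith)
    _ = C * ((1 + |z|) ^ 2)⁻¹ := by rw [e]; field_simp
    _ ≤ _ := by
        gcongr
        nlinarith [abs_nonneg z, sq_abs z]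

lemma integral_inc_comp (hh : 0 < h) (hρ : ρ ∈ region) (f : ℝ → ℝ) :
    ∫ y, f y ∂(inc h ρ) = ∫ z, h * pd h ρ (h * z) * f (h * z) := by
  rw [integral_inc hh hρ]
  have := Measure.integral_comp_mul_left (fun y => pd h ρ y * f y) h
  simp_rw [mul_assoc, integral_const_mul]
  rw [this, abs_inv, abs_of_pos hh, smul_eq_mul, ← mul_assoc, mul_inv_cancel₀ hh.ne', one_mul]

/-- Means of functions of a rescaled increment converge to integrals against a Cauchy law. -/
lemma tendsto_integral_inc (hc : 0 < c) {h : ℕ → ℝ} (hh : ∀ i, 0 < h i) (h1 : ∀ i, h i ≤ 1)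
    (h0 : Tendsto h atTop (𝓝 0)) {θ : ℕ → E4} (hθ : ∀ i, θ i ∈ box c B) {θ₀ : E4}
    (hθ₀ : θ₀ ∈ region) (ht : Tendsto θ atTop (𝓝 θ₀)) {φ : ℕ → ℝ → ℝ} (hφm : ∀ i, Measurable (φ i))
    {A : ℝ} (hφ : ∀ i y, |φ i y| ≤ A) {φ₀ : ℝ → ℝ}
    (hl : ∀ z, Tendsto (fun i => φ i (h i * z)) atTop (𝓝 (φ₀ z))) :
    Tendsto (fun i => ∫ y, φ i y ∂(inc (h i) (θ i))) atTop (𝓝 (∫ z, cauchyD θ₀ z * φ₀ z)) := by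
  obtain ⟨C, hC, H⟩ := exists_mul_pd_mul_le hc B
  have hreg := fun i => box_subset_region hc (hθ i)
  simp_rw [fun i => integral_inc_comp (hh i) (hreg i) (φ i)]
  refine tendsto_integral_of_dominated_convergence (fun z => C * (1 + z ^ 2)⁻¹ * A) (fun i => ?_)
    ((integrable_inv_one_add_sq.const_mul _).mul_const _) (fun i => ?_) ?_
  · have := (continuous_pd (hh i) (hreg i)).measurable
    have := hφm i
    exact (by fun_prop : Measurable _).aestronglyMeasurable
  · refine ae_of_all _ fun z => ?_
    have hp := pd_pos (y := h i * z) (hh i) (hreg i)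
    have hi := hh i
    rw [norm_mul, norm_of_nonneg (by positivity), norm_eq_abs]
    exact mul_le_mul (H _ z hi (h1 i) _ (hθ i)) (hφ i _) (abs_nonneg _) (by positivity)
  · refine ae_of_all _ fun z => Tendsto.mul ?_ (hl z)
    have e : ∀ i, h i * pd (h i) (θ i) (h i * z) = θ i 2 / π *
        exp (θ i 2 * h i * gam (θ i) + θ i 1 * (h i * (z - θ i 3))) *
        (kone (θ i 0 ^ 2 * (h i ^ 2 * (θ i 2 ^ 2 + (z - θ i 3) ^ 2))) /
          (θ i 2 ^ 2 + (z - θ i 3) ^ 2)) := fun i => by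
      have e1 : dsq (h i) (h i * z) (θ i) = h i ^ 2 * (θ i 2 ^ 2 + (z - θ i 3) ^ 2) := by
        unfold dsq; ring
      rw [pd_eq (hh i) (hreg i), barg, e1]
      have := (hh i).ne'
      have : h i * z - θ i 3 * h i = h i * (z - θ i 3) := by ring
      rw [this]
      field_simp
    simp_rw [e]
    have hs : Tendsto (fun i => θ i 2 ^ 2 + (z - θ i 3) ^ 2) atTop
        (𝓝 (θ₀ 2 ^ 2 + (z - θ₀ 3) ^ 2)) :=
      ((tendsto_coord ht 2).pow 2).add ((tendsto_const_nhds.sub (tendsto_coord ht 3)).pow 2)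
    have h2 := (region_pos hθ₀).2.1
    -- On the scale `h` the Bessel argument tends to `0`, where `kone` is continuous with value `1`,
    -- so `α` and `β` disappear from the limit.
    have hk : Tendsto (fun i => kone (θ i 0 ^ 2 * (h i ^ 2 * (θ i 2 ^ 2 + (z - θ i 3) ^ 2)))) atTop
        (𝓝 1) := by
      rw [← kone_zero]
      refine ((continuousOn_kone 0 self_mem_Ici).tendsto).comp
        (tendsto_nhdsWithin_iff.2 ⟨?_, Eventually.of_forall fun i => by
          rw [mem_Ici]
          positivity⟩)
      have := ((tendsto_coord ht 0).pow 2).mul ((h0.pow 2).mul hs)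
      simpa using this
    have he : Tendsto (fun i => θ i 2 * h i * gam (θ i) + θ i 1 * (h i * (z - θ i 3))) atTop
        (𝓝 (θ₀ 2 * 0 * gam θ₀ + θ₀ 1 * (0 * (z - θ₀ 3)))) :=
      (((tendsto_coord ht 2).mul h0).mul (tendsto_gam ht)).add
        ((tendsto_coord ht 1).mul (h0.mul (tendsto_const_nhds.sub (tendsto_coord ht 3))))
    have := (((tendsto_coord ht 2).div_const π).mul ((continuous_exp.tendsto _).comp he)).mul
      (hk.div hs (by positivity))
    refine (this.congr fun i => by simp).trans (le_of_eq ?_)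
    congr 1
    simp [cauchyD]
    ring

end NIG

end

/-! ### Integrability and the Bartlett identities -/

noncomputable section

namespace NIG

open Set Real

variable {c B h y : ℝ} {ρ : E4}

lemma continuous_msize (h : ℝ) : Continuous (msize h) := by unfold msize; fun_prop

lemma integrable_inc_of_le (hc : 0 < c) (hh : 0 < h) (h1 : h ≤ 1) (hρ : ρ ∈ box c B) {f : ℝ → ℝ}
    (hf : Measurable f) {A : ℝ} (hA : ∀ y, |f y| ≤ A * (1 + msize h y ^ 6)) :
    Integrable f (inc h ρ) := by
  obtain ⟨C, -, H⟩ := exists_moment hc B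
  have := isProbabilityMeasure_inc hh (box_subset_region hc hρ)
  have h6 : Integrable (fun y => msize h y ^ 6) (inc h ρ) :=
    (H h hh h1 ρ hρ (fun y => msize h y ^ 6) ((continuous_msize h).pow 6).measurable 1 zero_le_one fun y => by
      have := (msize_pos hh y).le
      rw [abs_of_nonneg (by positivity), one_mul]
      exact pow_le_mom this (by norm_num) le_rfl).1
  exact (((integrable_const 1).add h6).const_mul A).mono' hf.aestronglyMeasurable
    (ae_of_all _ fun y => hA y)

/-- The moments of an increment are of the order of `h`. -/
lemma exists_integral_pow_le (hc : 0 < c) (B : ℝ) : ∃ C, 0 ≤ C ∧ ∀ h, 0 < h → h ≤ 1 →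
    ∀ ρ ∈ box c B, ∀ p : ℕ, 2 ≤ p → p ≤ 6 →
      Integrable (fun y => msize h y ^ p) (inc h ρ) ∧ ∫ y, msize h y ^ p ∂(inc h ρ) ≤ C * h := by
  obtain ⟨C, hC, H⟩ := exists_moment hc B
  refine ⟨C, hC, fun h hh h1 ρ hρ p h2 h6 => ?_⟩
  have hnn : ∀ y, |msize h y ^ p| = msize h y ^ p := fun y =>
    abs_of_nonneg (pow_nonneg (msize_pos hh y).le p)
  have := H h hh h1 ρ hρ (fun y => msize h y ^ p) ((continuous_msize h).pow p).measurable 1 zero_le_one fun y => by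
      rw [hnn, one_mul]
      exact pow_le_mom (msize_pos hh y).le h2 h6
  simp_rw [hnn, mul_one] at this
  exact this

lemma zsize_nonneg (hh : 0 < h) (k l : Fin 4) (y : ℝ) : 0 ≤ zsize k l h y := by
  have hm := (msize_pos hh y).le
  have := qsize_nonneg hm
  unfold zsize
  split_ifs <;> positivity

lemma qsize_le {m : ℝ} (hm : 0 ≤ m) : qsize m ≤ 1 + 2 * m ^ 3 := by
  unfold qsize
  have : √m * m ≤ 1 + m ^ 3 := by
    rcases le_total m 1 with h | h
    · have : √m ≤ 1 := sqrt_le_one.2 h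
      nlinarith [pow_nonneg hm 3, sqrt_nonneg m]
    · have : √m ≤ m := by rw [sqrt_le_left hm]; nlinarith
      nlinarith [pow_nonneg hm 3, mul_nonneg hm hm]
  linarith

lemma zsize_le (hh : 0 < h) (h1 : h ≤ 1) (k l : Fin 4) (y : ℝ) :
    zsize k l h y ≤ 2 * (1 + msize h y ^ 3) := by
  have hm := (msize_pos hh y).le
  have := qsize_le hm
  have h3 : 0 ≤ msize h y ^ 3 := by positivity
  unfold zsize
  split_ifs <;> nlinarith

lemma exists_abs_score1_le (hc : 0 < c) (B : ℝ) : ∃ C, 0 ≤ C ∧ ∀ h y, 0 < h → h ≤ 1 →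
    ∀ ρ ∈ box c B, ∀ k, |score1 h y ρ k| ≤ C * (1 + msize h y) := by
  obtain ⟨C, hC, H⟩ := exists_score1_le hc B
  refine ⟨C, hC, fun h y hh h1 ρ hρ k => ?_⟩
  have hm := (msize_pos hh y).le
  obtain ⟨a0, a1, a2, a3, -⟩ := H h y hh h1 ρ hρ
  have := mul_nonneg hC hm
  fin_cases k <;> simp <;> linarith

/-- A continuous family of functions whose integrals do not vary has a mean-zero derivative. -/
lemma integral_deriv_eq_zero {f f' : ℝ → ℝ → ℝ} {r : ℝ} (hr : 0 < r)
    (hd : ∀ y, ∀ t ∈ Ioo (-r) r, HasDerivAt (fun t => f t y) (f' t y) t)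
    (hm : ∀ t ∈ Ioo (-r) r, Measurable (f t)) (hm' : Measurable (f' 0))
    {b : ℝ → ℝ} (hb : Integrable b) (hfb : ∀ t ∈ Ioo (-r) r, ∀ y, |f t y| ≤ b y)
    (hfb' : ∀ t ∈ Ioo (-r) r, ∀ y, |f' t y| ≤ b y) {a : ℝ} (ha : ∀ t ∈ Ioo (-r) r, ∫ y, f t y = a) :
    ∫ y, f' 0 y = 0 := by
  have h0 : (0 : ℝ) ∈ Ioo (-r) r := ⟨by linarith, hr⟩
  have hnb : Ioo (-r) r ∈ 𝓝 (0 : ℝ) := Ioo_mem_nhds h0.1 h0.2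
  have key := hasDerivAt_integral_of_dominated_loc_of_deriv_le (μ := volume) (F := f) (F' := f')
    (x₀ := (0 : ℝ)) hnb
    (by filter_upwards [hnb] with t ht using (hm t ht).aestronglyMeasurable)
    (hb.mono' (hm 0 h0).aestronglyMeasurable (ae_of_all _ (hfb 0 h0)))
    hm'.aestronglyMeasurable (ae_of_all _ fun y t ht => hfb' t ht y) hb
    (ae_of_all _ fun y t ht => hd y t ht)
  have hconst : (fun t => ∫ y, f t y) =ᶠ[𝓝 0] fun _ => a := by
    filter_upwards [hnb] with t ht using ha t ht
  exact key.2.unique ((hasDerivAt_const (0 : ℝ) a).congr_of_eventuallyEq hconst)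

/-- Serves for differentiation under the integral at a fixed `h`. The dominating function depends on
`h` and may blow up as `h → 0`. -/
lemma exists_pd_mul_cube_le (hc : 0 < c) (B : ℝ) (hh : 0 < h) (h1 : h ≤ 1) :
    ∃ b : ℝ → ℝ, Integrable b ∧ ∀ ρ ∈ box c B, ∀ y, pd h ρ y * (1 + msize h y ^ 3) ≤ b y := by
  obtain ⟨C, a, hC, ha, H⟩ := exists_pd_le hc B
  refine ⟨fun y => C / h * (1 + Nat.factorial 3 * (2 / a) ^ 3) * exp (-(a / 2 * |y|)), ?_,
    fun ρ hρ y => ?_⟩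
  · refine Integrable.const_mul ?_ _
    refine integrable_comp_abs_of_Ioi (f := fun x => exp (-(a / 2 * x))) ?_
    simpa [neg_mul] using exp_neg_integrableOn_Ioi 0 (b := a / 2) (by positivity)
  have hm := msize_pos hh y
  have hym : |y| ≤ msize h y := by unfold msize; linarith
  have hle := le_msize h y
  set m := msize h y
  have hp : m ^ 3 * exp (-(a / 2 * m)) ≤ Nat.factorial 3 * (2 / a) ^ 3 := by
    have := pow_div_factorial_le_exp (x := a / 2 * m) (by positivity) 3
    rw [exp_neg]
    rw [div_le_iff₀ (by positivity)] at this
    rw [mul_inv_le_iff₀ (exp_pos _)]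
    calc m ^ 3 = (2 / a) ^ 3 * (a / 2 * m) ^ 3 := by field_simp
      _ ≤ (2 / a) ^ 3 * (exp (a / 2 * m) * Nat.factorial 3) := by gcongr
      _ = _ := by ring
  have e2 : exp (-(a * m)) = exp (-(a / 2 * m)) * exp (-(a / 2 * m)) := by
    rw [← exp_add]; congr 1; ring
  have e3 : exp (-(a / 2 * m)) ≤ 1 := exp_le_one_iff.2 (by have := mul_pos ha hm; linarith)
  calc _ ≤ C * h / m ^ 2 * exp (-(a * m)) * (1 + m ^ 3) := by
        gcongr; exact H h y hh h1 ρ hρ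
    _ = C * h / m ^ 2 * (exp (-(a / 2 * m)) + m ^ 3 * exp (-(a / 2 * m))) * exp (-(a / 2 * m)) := by
        rw [e2]; ring
    _ ≤ C * h / h ^ 2 * (1 + Nat.factorial 3 * (2 / a) ^ 3) * exp (-(a / 2 * |y|)) := by gcongr
    _ = _ := by field_simp

lemma add_single_mem_box (hc : 0 < c) (hρ : ρ ∈ box c B) (k : Fin 4) {t : ℝ} (ht : |t| ≤ c / 2) :
    ρ + t • EuclideanSpace.single k (1 : ℝ) ∈ box (c / 2) (B + c) := by
  obtain ⟨r1, r2, r3, r4, r5⟩ := hρ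
  obtain ⟨t1, t2⟩ := abs_le.1 ht
  have e : ∀ l, (ρ + t • EuclideanSpace.single k (1 : ℝ)) l = ρ l + t * (if l = k then 1 else 0) :=
    fun l => by simp
  have a1 : |ρ 1 + t| ≤ |ρ 1| + c / 2 := (abs_add_le _ _).trans (by linarith)
  have a3 : |ρ 3 + t| ≤ B + c := (abs_add_le _ _).trans (by linarith)
  simp only [box, Set.mem_ofPred_eq, e]
  fin_cases k <;> simp <;> refine ⟨?_, ?_, ?_, ?_, ?_⟩ <;> linarith

lemma hasDerivAt_line (ρ : E4) (k : Fin 4) (t : ℝ) :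
    HasDerivAt (fun t : ℝ => ρ + t • EuclideanSpace.single k (1 : ℝ))
      (EuclideanSpace.single k (1 : ℝ) : E4) t := by
  simpa using ((hasDerivAt_id t).smul_const (EuclideanSpace.single k (1 : ℝ) : E4)).const_add ρ

lemma hasFDerivAt_pd (hh : 0 < h) (hρ : ρ ∈ region) (y : ℝ) :
    HasFDerivAt (fun ρ => pd h ρ y) (pd h ρ y • lin (score1 h y ρ)) ρ := by
  have h1 := (hasFDerivAt_logDens (y := y) hh hρ).exp
  rw [exp_logDens hh hρ] at h1
  refine h1.congr_of_eventuallyEq ?_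
  filter_upwards [isOpen_region.mem_nhds hρ] with σ hσ using (exp_logDens hh hσ).symm

section Bartlett

variable (hc : 0 < c) (hh : 0 < h) (h1 : h ≤ 1) (hρ : ρ ∈ box c B)
include hc hh h1 hρ

lemma integrable_hess1 (k l : Fin 4) : Integrable (fun y => hess1 h y ρ k l) (inc h ρ) := by
  have hreg := box_subset_region hc hρ
  obtain ⟨D, hD, HD⟩ := exists_hess1_lipschitz hc B
  refine integrable_inc_of_le hc hh h1 hρ (continuous_hess1 hh hreg k l).measurable
    (A := 4 * D) fun y => ?_
  have h2 := (HD k l h y hh _ hρ _ hρ).1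
  have hm := msize_pos hh y
  have : 1 + msize h y ^ 3 ≤ 2 * (1 + msize h y ^ 6) := by
    have : (msize h y ^ 3) ^ 2 = msize h y ^ 6 := by ring
    nlinarith [sq_nonneg (msize h y ^ 3 - 1), sq_nonneg (msize h y ^ 3)]
  have := zsize_le hh h1 k l y
  calc _ ≤ D * zsize k l h y := h2
    _ ≤ D * (4 * (1 + msize h y ^ 6)) := by gcongr; linarith
    _ = _ := by ring

lemma integrable_score1_mul (k l : Fin 4) :
    Integrable (fun y => score1 h y ρ k * score1 h y ρ l) (inc h ρ) := by
  have hreg := box_subset_region hc hρ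
  obtain ⟨C, hC, HC⟩ := exists_abs_score1_le hc B
  refine integrable_inc_of_le hc hh h1 hρ
    ((continuous_score1 hh hreg k).mul (continuous_score1 hh hreg l)).measurable
    (A := 8 * C ^ 2) fun y => ?_
  have h2 := HC h y hh h1 _ hρ k
  have h3 := HC h y hh h1 _ hρ l
  have hm := msize_pos hh y
  have h4 : (1 + msize h y) * (1 + msize h y) ≤ 8 * (1 + msize h y ^ 6) := by
    have e1 : msize h y ^ 2 ≤ 1 + msize h y ^ 6 := by
      nlinarith [sq_nonneg (msize h y ^ 3 - msize h y), sq_nonneg (msize h y ^ 2 - 1),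
        sq_nonneg (msize h y ^ 2), pow_pos hm 4, pow_pos hm 6]
    nlinarith [sq_nonneg (msize h y - 1), pow_pos hm 6]
  rw [abs_mul]
  calc _ ≤ (C * (1 + msize h y)) * (C * (1 + msize h y)) := by gcongr
    _ = C ^ 2 * ((1 + msize h y) * (1 + msize h y)) := by ring
    _ ≤ C ^ 2 * (8 * (1 + msize h y ^ 6)) := by gcongr
    _ = _ := by ring

lemma integrable_score1 (k : Fin 4) : Integrable (fun y => score1 h y ρ k) (inc h ρ) := by
  have hreg := box_subset_region hc hρ
  have := isProbabilityMeasure_inc hh hreg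
  refine ((integrable_const 1).add (integrable_score1_mul hc hh h1 hρ k k)).mono'
    (continuous_score1 hh hreg k).aestronglyMeasurable (ae_of_all _ fun y => ?_)
  rw [norm_eq_abs, Pi.add_apply]
  nlinarith [sq_nonneg (|score1 h y ρ k| - 1), abs_mul_abs_self (score1 h y ρ k)]

/-- The derivative of the density is the density times the score, and the density has constant mass
one. -/
lemma integral_score1 (k : Fin 4) : ∫ y, score1 h y ρ k ∂(inc h ρ) = 0 := by
  have hreg := box_subset_region hc hρ
  -- The parameter is moved along a coordinate line by less than `c/2`; the line segment lies in a
  -- slightly larger box, whose constants are the ones used.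
  have hc2 : 0 < c / 2 := by positivity
  obtain ⟨C, hC, HC⟩ := exists_abs_score1_le hc2 (B + c)
  obtain ⟨b, hb, Hb⟩ := exists_pd_mul_cube_le hc2 (B + c) hh h1
  set L := fun t : ℝ => ρ + t • EuclideanSpace.single k (1 : ℝ) with hL
  have hbox : ∀ t ∈ Ioo (-(c / 2)) (c / 2), L t ∈ box (c / 2) (B + c) := fun t ht =>
    add_single_mem_box hc hρ k (abs_le.2 ⟨ht.1.le, ht.2.le⟩)
  have hreg' := fun t ht => box_subset_region hc2 (hbox t ht)
  have hL0 : L 0 = ρ := by simp [hL]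
  have key := integral_deriv_eq_zero (f := fun t y => pd h (L t) y)
    (f' := fun t y => pd h (L t) y * score1 h y (L t) k) (r := c / 2) hc2
    (b := fun y => (1 + 2 * C) * b y) (a := 1) ?_ ?_ ?_ (hb.const_mul _) ?_ ?_ ?_
  · rw [integral_inc hh hreg]
    simpa [hL0] using key
  · intro y t ht
    have := (hasFDerivAt_pd hh (hreg' t ht) y).comp_hasDerivAt t (hasDerivAt_line ρ k t)
    simpa [lin_single] using! this
  · exact fun t ht => (continuous_pd hh (hreg' t ht)).measurable
  · rw [hL0]
    exact ((continuous_pd hh hreg).mul (continuous_score1 hh hreg k)).measurable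
  · intro t ht y
    have hp := pd_pos (y := y) hh (hreg' t ht)
    have hm := msize_pos hh y
    have h2 := Hb _ (hbox t ht) y
    rw [abs_of_pos hp]
    have : pd h (L t) y * 1 ≤ pd h (L t) y * (1 + msize h y ^ 3) := by
      gcongr; linarith [pow_pos hm 3]
    have hb0 : 0 ≤ b y := le_trans (by positivity) h2
    nlinarith
  · intro t ht y
    have hp := pd_pos (y := y) hh (hreg' t ht)
    have hm := msize_pos hh y
    have h2 := Hb _ (hbox t ht) y
    have h3 := HC h y hh h1 _ (hbox t ht) k
    have h4 : 1 + msize h y ≤ 2 * (1 + msize h y ^ 3) := by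
      nlinarith [sq_nonneg (msize h y - 1), sq_nonneg (msize h y)]
    have hb0 : 0 ≤ b y := le_trans (by positivity) h2
    rw [abs_mul, abs_of_pos hp]
    calc _ ≤ pd h (L t) y * (C * (2 * (1 + msize h y ^ 3))) := by
          gcongr; exact h3.trans (by gcongr)
      _ = 2 * C * (pd h (L t) y * (1 + msize h y ^ 3)) := by ring
      _ ≤ 2 * C * b y := by gcongr
      _ ≤ _ := by linarith
  · intro t ht
    have := isProbabilityMeasure_inc hh (hreg' t ht)
    have h2 := integral_inc hh (hreg' t ht) (fun _ => 1)
    simp at h2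
    exact h2.symm

/-- The derivative of density times score is density times `hess + score * score`, and its integral
vanishes by `integral_score1`. The identity is used in both directions: it gives the mean of the
observed information from the covariances, and it evaluates the covariances of the `β`-score with
itself and with the `α`-score, whose Hessian entries do not depend on `y`. -/
lemma integral_hess1 (k l : Fin 4) :
    ∫ y, hess1 h y ρ k l ∂(inc h ρ) = -∫ y, score1 h y ρ k * score1 h y ρ l ∂(inc h ρ) := by
  have hreg := box_subset_region hc hρ
  have hc2 : 0 < c / 2 := by positivity
  obtain ⟨C, hC, HC⟩ := exists_abs_score1_le hc2 (B + c)
  obtain ⟨D, hD, HD⟩ := exists_hess1_lipschitz hc2 (B + c)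
  obtain ⟨b, hb, Hb⟩ := exists_pd_mul_cube_le hc2 (B + c) hh h1
  set L := fun t : ℝ => ρ + t • EuclideanSpace.single k (1 : ℝ) with hL
  have hbox : ∀ t ∈ Ioo (-(c / 2)) (c / 2), L t ∈ box (c / 2) (B + c) := fun t ht =>
    add_single_mem_box hc hρ k (abs_le.2 ⟨ht.1.le, ht.2.le⟩)
  have hreg' := fun t ht => box_subset_region hc2 (hbox t ht)
  have hL0 : L 0 = ρ := by simp [hL]
  have h0mem : (0 : ℝ) ∈ Ioo (-(c / 2)) (c / 2) := ⟨by linarith, hc2⟩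
  have hS : ∀ y, ∀ t ∈ Ioo (-(c / 2)) (c / 2),
      |pd h (L t) y * score1 h y (L t) l| ≤ 2 * C * b y := by
    intro y t ht
    have hp := pd_pos (y := y) hh (hreg' t ht)
    have hm := msize_pos hh y
    have h2 := Hb _ (hbox t ht) y
    have h3 := HC h y hh h1 _ (hbox t ht) l
    have h4 : 1 + msize h y ≤ 2 * (1 + msize h y ^ 3) := by
      nlinarith [sq_nonneg (msize h y - 1), sq_nonneg (msize h y)]
    have hb0 : 0 ≤ b y := le_trans (by positivity) h2
    rw [abs_mul, abs_of_pos hp]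
    calc _ ≤ pd h (L t) y * (C * (2 * (1 + msize h y ^ 3))) := by
          gcongr; exact h3.trans (by gcongr)
      _ = 2 * C * (pd h (L t) y * (1 + msize h y ^ 3)) := by ring
      _ ≤ 2 * C * b y := by gcongr
  have hb0 : ∀ y, 0 ≤ b y := fun y => le_trans (by
    have := pd_pos (y := y) hh (hreg' 0 h0mem)
    have hm := msize_pos hh y
    positivity) (Hb _ (hbox 0 h0mem) y)
  have key := integral_deriv_eq_zero (f := fun t y => pd h (L t) y * score1 h y (L t) l)
    (f' := fun t y => pd h (L t) y * (hess1 h y (L t) k l + score1 h y (L t) k * score1 h y (L t) l))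
    (r := c / 2) hc2 (b := fun y => (2 * C + (2 * D + 4 * C ^ 2)) * b y) (a := 0)
    ?_ ?_ ?_ (hb.const_mul _) ?_ ?_ ?_
  · rw [eq_neg_iff_add_eq_zero, ← integral_add, integral_inc hh hreg]
    · simpa [hL0] using key
    · exact integrable_hess1 hc hh h1 hρ k l
    · exact integrable_score1_mul hc hh h1 hρ k l
  · intro y t ht
    have e1 := (hasFDerivAt_pd hh (hreg' t ht) y).comp_hasDerivAt t (hasDerivAt_line ρ k t)
    have e2 := (hasFDerivAt_score1 (y := y) hh (hreg' t ht) l).comp_hasDerivAt t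
      (hasDerivAt_line ρ k t)
    have e3 := e1.mul e2
    simp only [smul_apply, lin_single, smul_eq_mul, Function.comp_apply] at e3
    convert! e3 using 1
    ring
  · exact fun t ht => ((continuous_pd hh (hreg' t ht)).mul
      (continuous_score1 hh (hreg' t ht) l)).measurable
  · rw [hL0]
    exact ((continuous_pd hh hreg).mul ((continuous_hess1 hh hreg k l).add
      ((continuous_score1 hh hreg k).mul (continuous_score1 hh hreg l)))).measurable
  · intro t ht y
    have := hb0 y
    refine (hS y t ht).trans ?_
    gcongr
    have := sq_nonneg C
    linarith
  · intro t ht y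
    have hp := pd_pos (y := y) hh (hreg' t ht)
    have hm := msize_pos hh y
    have h2 := Hb _ (hbox t ht) y
    have h3 := HC h y hh h1 _ (hbox t ht) l
    have h3' := HC h y hh h1 _ (hbox t ht) k
    have hz := zsize_le hh h1 k l y
    have h5 := (HD k l h y hh _ (hbox t ht) _ (hbox t ht)).1
    have h4 : (1 + msize h y) * (1 + msize h y) ≤ 4 * (1 + msize h y ^ 3) := by
      nlinarith [sq_nonneg (msize h y - 1), sq_nonneg (msize h y), mul_pos hm hm]
    rw [abs_mul, abs_of_pos hp]
    calc _ ≤ pd h (L t) y * (D * (2 * (1 + msize h y ^ 3)) +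
          (C * (1 + msize h y)) * (C * (1 + msize h y))) := by
          gcongr
          refine (abs_add_le _ _).trans (add_le_add (h5.trans (by gcongr)) ?_)
          rw [abs_mul]; gcongr
      _ = pd h (L t) y * (D * (2 * (1 + msize h y ^ 3)) +
          C ^ 2 * ((1 + msize h y) * (1 + msize h y))) := by ring
      _ ≤ pd h (L t) y * (D * (2 * (1 + msize h y ^ 3)) +
          C ^ 2 * (4 * (1 + msize h y ^ 3))) := by gcongr
      _ = (2 * D + 4 * C ^ 2) * (pd h (L t) y * (1 + msize h y ^ 3)) := by ring
      _ ≤ (2 * D + 4 * C ^ 2) * b y := by gcongr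
      _ ≤ _ := by
          have := hb0 y
          refine mul_le_mul_of_nonneg_right ?_ this
          linarith
  · intro t ht
    rw [← integral_inc hh (hreg' t ht)]
    exact integral_score1 hc2 hh h1 (hbox t ht) l

end Bartlett

end NIG

end

/-! ### The information on `(α, β)` and positive definiteness -/

noncomputable section

namespace NIG

open Set Real

variable {c B h y : ℝ} {ρ : E4}

/-- The limit of the `α`-score divided by its scale, as a function of a jump. -/
def jumpScore (ρ : E4) (y : ℝ) : ℝ := -(kratio (ρ 0 ^ 2 * y ^ 2) / ρ 0)

lemma continuousOn_jumpScore (hρ : ρ ∈ region) : ContinuousOn (jumpScore ρ) {0}ᶜ := by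
  have h0 := (region_pos hρ).1
  unfold jumpScore
  refine ((continuousOn_kratio.comp (by fun_prop) fun y hy => ?_).div_const _).neg
  have : y ≠ 0 := hy
  rw [mem_Ioi]
  positivity

lemma aestronglyMeasurable_of_continuousOn_compl_zero {f : ℝ → ℝ} (hf : ContinuousOn f {0}ᶜ) :
    AEStronglyMeasurable f := by
  have := hf.aestronglyMeasurable (μ := volume) (measurableSet_singleton (0 : ℝ)).compl
  have e : (volume : Measure ℝ).restrict {0}ᶜ = volume :=
    Measure.restrict_eq_self_of_ae_mem (compl_mem_ae_iff.2 (measure_singleton (0 : ℝ)))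
  rwa [e] at this

lemma kratio_sq_le {w : ℝ} (hw : 0 < w) : kratio w ^ 2 ≤ w := by
  have h1 := kratio_le_sqrt hw
  have h2 := kratio_pos hw
  calc kratio w ^ 2 ≤ √w ^ 2 := by gcongr
    _ = w := sq_sqrt hw.le

lemma jumpScore_sq_le (hρ : ρ ∈ region) (hy : y ≠ 0) : jumpScore ρ y ^ 2 ≤ y ^ 2 := by
  have h0 := (region_pos hρ).1
  have := kratio_sq_le (w := ρ 0 ^ 2 * y ^ 2) (by positivity)
  unfold jumpScore
  rw [neg_sq, div_pow, div_le_iff₀ (by positivity)]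
  linarith

lemma abs_jumpScore_le (hρ : ρ ∈ region) (hy : y ≠ 0) : |jumpScore ρ y| ≤ |y| :=
  sq_le_sq.1 (jumpScore_sq_le hρ hy)

lemma jumpScore_neg (hρ : ρ ∈ region) (hy : y ≠ 0) : jumpScore ρ y < 0 := by
  have h0 := (region_pos hρ).1
  have := kratio_pos (w := ρ 0 ^ 2 * y ^ 2) (by positivity)
  unfold jumpScore
  exact neg_neg_of_pos (by positivity)

lemma integrable_lev_mul (hc : 0 < c) (hρ : ρ ∈ box c B) {f : ℝ → ℝ} (hf : ContinuousOn f {0}ᶜ)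
    {A : ℝ} (hA : 0 ≤ A) (hfA : ∀ y, y ≠ 0 → |f y| ≤ A * y ^ 2) :
    Integrable fun y => lev ρ y * f y := by
  obtain ⟨C, a, hC, ha, H⟩ := exists_lev_mul_mom_le hc B
  refine ((integrable_majorant ha).const_mul (A * C)).mono'
    ((aestronglyMeasurable_of_continuousOn_compl_zero ((continuousOn_lev ρ).mul hf))) ?_
  filter_upwards [compl_mem_ae_iff.2 (measure_singleton (0 : ℝ))] with y hy
  have hl := lev_nonneg (box_subset_region hc hρ) y
  have hm : y ^ 2 ≤ mom |y| := by
    rw [← sq_abs]; exact pow_le_mom (abs_nonneg y) le_rfl (by norm_num)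
  rw [norm_mul, norm_of_nonneg hl, norm_eq_abs]
  calc _ ≤ lev ρ y * (A * mom |y|) := by
        refine mul_le_mul_of_nonneg_left ((hfA y hy).trans ?_) hl
        gcongr
    _ = A * (lev ρ y * mom |y|) := by ring
    _ ≤ A * (C * majorant a y) := mul_le_mul_of_nonneg_left (H y hy ρ hρ) hA
    _ = _ := by ring

lemma lev_mul_jumpScore_sq_add (hρ : ρ ∈ region) {x : ℝ} (hx : 0 < x) :
    lev ρ x * jumpScore ρ x ^ 2 + lev ρ (-x) * jumpScore ρ (-x) ^ 2 =
      ρ 2 / π * integrand ρ (ρ 0 * x) := by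
  have h0 := (region_pos hρ).1
  have hk := kone_pos (w := ρ 0 ^ 2 * x ^ 2) (by positivity)
  unfold lev jumpScore integrand
  rw [besselK_one (by positivity), besselK_zero (by positivity), mul_pow]
  have e : ρ 1 / ρ 0 * (ρ 0 * x) = ρ 1 * x := by field_simp
  rw [e]
  have hπ := pi_pos
  simp only [kratio, neg_sq, mul_neg]
  field_simp

lemma integral_eq_Ioi_add_neg {f : ℝ → ℝ} (hf : Integrable f) :
    ∫ y, f y = ∫ y in Ioi (0 : ℝ), (f y + f (-y)) := by
  have h1 : IntegrableOn (fun y => f (-y)) (Ioi 0) := hf.comp_neg.integrableOn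
  rw [integral_add hf.integrableOn h1, integral_comp_neg_Ioi, neg_zero, add_comm]
  exact (intervalIntegral.integral_Iic_add_Ioi hf.integrableOn hf.integrableOn).symm

lemma integrable_lev_mul_jumpScore_sq (hc : 0 < c) (hρ : ρ ∈ box c B) :
    Integrable fun y => lev ρ y * jumpScore ρ y ^ 2 := by
  have hreg := box_subset_region hc hρ
  refine integrable_lev_mul hc hρ ((continuousOn_jumpScore hreg).pow 2) zero_le_one fun y hy => ?_
  rw [abs_of_nonneg (sq_nonneg _), one_mul]
  exact jumpScore_sq_le hreg hy

lemma integrableOn_integrand (hc : 0 < c) (hρ : ρ ∈ box c B) :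
    IntegrableOn (integrand ρ) (Ioi 0) := by
  have hreg := box_subset_region hc hρ
  obtain ⟨h0, h2, -⟩ := region_pos hreg
  have h1 := integrable_lev_mul_jumpScore_sq hc hρ
  have h3 : IntegrableOn (fun x => lev ρ x * jumpScore ρ x ^ 2 +
      lev ρ (-x) * jumpScore ρ (-x) ^ 2) (Ioi 0) :=
    h1.integrableOn.add h1.comp_neg.integrableOn
  have h4 : IntegrableOn (fun x => ρ 2 / π * integrand ρ (ρ 0 * x)) (Ioi 0) :=
    h3.congr_fun (fun x hx => lev_mul_jumpScore_sq_add hreg hx) measurableSet_Ioi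
  have h5 : IntegrableOn (fun x => integrand ρ (ρ 0 * x)) (Ioi 0) := by
    have hπ := pi_pos
    have h6 : IntegrableOn (fun x => π / ρ 2 * (ρ 2 / π * integrand ρ (ρ 0 * x))) (Ioi 0) :=
      h4.const_mul (π / ρ 2)
    refine h6.congr_fun (fun x _ => ?_) measurableSet_Ioi
    field_simp
  simpa using (integrableOn_Ioi_comp_mul_left_iff (integrand ρ) 0 h0).1 h5

/-- Folding the line at the origin produces the sum of the two exponentials in `integrand`, and the
change of variable `y ↦ α y` removes `α` from the Bessel functions. -/
lemma fisher_zero_zero (hc : 0 < c) (hρ : ρ ∈ box c B) :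
    fisher ρ 0 0 = ∫ y, lev ρ y * jumpScore ρ y ^ 2 := by
  have hreg := box_subset_region hc hρ
  obtain ⟨h0, h2, -⟩ := region_pos hreg
  rw [integral_eq_Ioi_add_neg (integrable_lev_mul_jumpScore_sq hc hρ),
    setIntegral_congr_fun measurableSet_Ioi fun x hx => lev_mul_jumpScore_sq_add hreg hx,
    integral_const_mul, integral_comp_mul_left_Ioi (integrand ρ) 0 h0, mul_zero, smul_eq_mul]
  simp [fisher]
  ring

lemma gam_pow_three (hρ : ρ ∈ region) : gam ρ ^ 3 = (ρ 0 ^ 2 - ρ 1 ^ 2) ^ (3 / 2 : ℝ) := by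
  have := (region_pos hρ).2.2
  unfold gam
  rw [sqrt_eq_rpow, ← rpow_natCast, ← rpow_mul this.le]
  norm_num

lemma fisher_zero_one (hρ : ρ ∈ region) : fisher ρ 0 1 = -(ρ 2 * (ρ 0 * ρ 1 / gam ρ ^ 3)) := by
  rw [gam_pow_three hρ]
  simp [fisher]
  ring

lemma fisher_one_one (hρ : ρ ∈ region) : fisher ρ 1 1 = ρ 2 * (ρ 0 ^ 2 / gam ρ ^ 3) := by
  rw [gam_pow_three hρ]
  simp [fisher]
  ring

lemma fisher_symm (ρ : E4) (k l : Fin 4) : fisher ρ k l = fisher ρ l k := by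
  fin_cases k <;> fin_cases l <;> simp [fisher]

/-- A sequence of sampling schemes with converging parameters. -/
structure Regime (c B : ℝ) (N : ℕ → ℕ) (h : ℕ → ℝ) (θ : ℕ → E4) (θ₀ : E4) : Prop where
  c_pos : 0 < c
  pos : ∀ i, 0 < h i
  le_one : ∀ i, h i ≤ 1
  tendsto_zero : Tendsto h atTop (𝓝 0)
  mem : ∀ i, θ i ∈ box c B
  mem_lim : θ₀ ∈ box c B
  tendsto : Tendsto θ atTop (𝓝 θ₀)
  N_pos : ∀ i, 0 < N i
  tendsto_T : Tendsto (fun i => (N i : ℝ) * h i) atTop atTop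

namespace Regime

variable {N : ℕ → ℕ} {h : ℕ → ℝ} {θ : ℕ → E4} {θ₀ : E4} (R : Regime c B N h θ θ₀)
include R

lemma reg (i : ℕ) : θ i ∈ region := box_subset_region R.c_pos (R.mem i)

lemma reg_lim : θ₀ ∈ region := box_subset_region R.c_pos R.mem_lim

lemma tendsto_score1_zero {y : ℝ} (hy : y ≠ 0) :
    Tendsto (fun i => score1 (h i) y (θ i) 0) atTop (𝓝 (jumpScore θ₀ y)) := by
  have hg := (gam_pos R.reg_lim).ne'
  have h0 := (region_pos R.reg_lim).1.ne'
  have := ((tendsto_coord R.tendsto 2).mul R.tendsto_zero).mul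
    ((tendsto_coord R.tendsto 0).div (tendsto_gam R.tendsto) hg) |>.sub
    ((tendsto_qf R.tendsto_zero R.tendsto R.reg_lim hy).div (tendsto_coord R.tendsto 0) h0)
  simpa [score1, jumpScore] using this

lemma tendsto_score1_one (y : ℝ) :
    Tendsto (fun i => score1 (h i) y (θ i) 1) atTop (𝓝 y) := by
  have hg := (gam_pos R.reg_lim).ne'
  have := (((tendsto_coord R.tendsto 2).mul R.tendsto_zero).mul
    ((tendsto_coord R.tendsto 1).div (tendsto_gam R.tendsto) hg)).neg.add
    ((tendsto_const_nhds (x := y)).sub ((tendsto_coord R.tendsto 3).mul R.tendsto_zero))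
  simpa [score1] using this

/-- Limits of the rescaled covariances of the first two scores, in terms of the Lévy measure. -/
lemma tendsto_cov_jump {k l : Fin 4} (hk : k < 2) (hl : l < 2) {f g : ℝ → ℝ}
    (hf : ∀ y, y ≠ 0 → Tendsto (fun i => score1 (h i) y (θ i) k) atTop (𝓝 (f y)))
    (hg : ∀ y, y ≠ 0 → Tendsto (fun i => score1 (h i) y (θ i) l) atTop (𝓝 (g y))) :
    Tendsto (fun i => (∫ y, score1 (h i) y (θ i) k * score1 (h i) y (θ i) l ∂(inc (h i) (θ i))) / h i)
      atTop (𝓝 (∫ y, lev θ₀ y * (f y * g y))) := by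
  obtain ⟨C, hC, H⟩ := exists_score1_le R.c_pos B
  have hS : ∀ k : Fin 4, k < 2 → ∀ i y, |score1 (h i) y (θ i) k| ≤ C * msize (h i) y := by
    intro k hk i y
    obtain ⟨a0, a1, -⟩ := H (h i) y (R.pos i) (R.le_one i) _ (R.mem i)
    fin_cases k
    · exact a0
    · exact a1
    · exact absurd hk (by decide)
    · exact absurd hk (by decide)
  refine tendsto_integral_inc_div R.c_pos R.pos R.le_one R.tendsto_zero R.mem R.reg_lim R.tendsto
    (A := C ^ 2) (fun i => ?_) (sq_nonneg C) (fun i y => ?_) fun y hy => (hf y hy).mul (hg y hy)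
  · exact ((continuous_score1 (R.pos i) (R.reg i) k).mul
      (continuous_score1 (R.pos i) (R.reg i) l)).measurable
  · have hm := (msize_pos (R.pos i) y).le
    rw [abs_mul]
    calc _ ≤ (C * msize (h i) y) * (C * msize (h i) y) := by
          have := hS k hk i y
          have := hS l hl i y
          gcongr
      _ = C ^ 2 * msize (h i) y ^ 2 := by ring
      _ ≤ _ := by
          gcongr
          exact pow_le_mom hm le_rfl (by norm_num)

/-- No direct integration against the Lévy measure is needed. The Hessian entry is nonrandom, so the
Bartlett identity gives the covariance before the limit in closed form, and uniqueness of limits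
does the rest. The same argument applies to the product with `jumpScore` below. -/
lemma integral_lev_mul_sq : ∫ y, lev θ₀ y * (y * y) = fisher θ₀ 1 1 := by
  have h1 := R.tendsto_cov_jump (k := 1) (l := 1) (by decide) (by decide)
    (fun y _ => R.tendsto_score1_one y) (fun y _ => R.tendsto_score1_one y)
  have h2 : ∀ i, (∫ y, score1 (h i) y (θ i) 1 * score1 (h i) y (θ i) 1 ∂(inc (h i) (θ i))) / h i =
      θ i 2 * (θ i 0 ^ 2 / gam (θ i) ^ 3) := fun i => by
    have := isProbabilityMeasure_inc (R.pos i) (R.reg i)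
    rw [← neg_neg (∫ y, score1 (h i) y (θ i) 1 * score1 (h i) y (θ i) 1 ∂(inc (h i) (θ i))),
      ← integral_hess1 R.c_pos (R.pos i) (R.le_one i) (R.mem i)]
    have hi := (R.pos i).ne'
    simp [hess1]
    field_simp
  simp_rw [h2] at h1
  rw [fisher_one_one R.reg_lim]
  refine tendsto_nhds_unique h1 ?_
  exact (tendsto_coord R.tendsto 2).mul (((tendsto_coord R.tendsto 0).pow 2).div
    ((tendsto_gam R.tendsto).pow 3) (pow_ne_zero _ (gam_pos R.reg_lim).ne'))

lemma integral_lev_mul_jumpScore : ∫ y, lev θ₀ y * (jumpScore θ₀ y * y) = fisher θ₀ 0 1 := by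
  have h1 := R.tendsto_cov_jump (k := 0) (l := 1) (by decide) (by decide)
    (fun y hy => R.tendsto_score1_zero hy) (fun y _ => R.tendsto_score1_one y)
  have h2 : ∀ i, (∫ y, score1 (h i) y (θ i) 0 * score1 (h i) y (θ i) 1 ∂(inc (h i) (θ i))) / h i =
      -(θ i 2 * (θ i 0 * θ i 1 / gam (θ i) ^ 3)) := fun i => by
    have := isProbabilityMeasure_inc (R.pos i) (R.reg i)
    rw [← neg_neg (∫ y, score1 (h i) y (θ i) 0 * score1 (h i) y (θ i) 1 ∂(inc (h i) (θ i))),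
      ← integral_hess1 R.c_pos (R.pos i) (R.le_one i) (R.mem i)]
    have hi := (R.pos i).ne'
    simp [hess1]
    field_simp
  simp_rw [h2] at h1
  rw [fisher_zero_one R.reg_lim]
  refine tendsto_nhds_unique h1 ?_
  exact ((tendsto_coord R.tendsto 2).mul (((tendsto_coord R.tendsto 0).mul
    (tendsto_coord R.tendsto 1)).div
    ((tendsto_gam R.tendsto).pow 3) (pow_ne_zero _ (gam_pos R.reg_lim).ne'))).neg

end Regime

/-- An auxiliary scheme with a fixed parameter and `T = i + 1`; it makes identities obtained through
limits available at every single parameter. -/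
lemma regime_const (hc : 0 < c) (hρ : ρ ∈ box c B) :
    Regime c B (fun i => (i + 1) ^ 2) (fun i => 1 / ((i : ℝ) + 1)) (fun _ => ρ) ρ where
  c_pos := hc
  pos i := by positivity
  le_one i := by rw [div_le_one (by positivity)]; linarith [Nat.cast_nonneg (α := ℝ) i]
  tendsto_zero := tendsto_one_div_nat_succ
  mem _ := hρ
  mem_lim := hρ
  tendsto := tendsto_const_nhds
  N_pos i := by positivity
  tendsto_T := by
    have : Tendsto (fun i : ℕ => (i : ℝ) + 1) atTop atTop :=
      tendsto_atTop_add_const_right _ _ tendsto_natCast_atTop_atTop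
    refine this.congr fun i => ?_
    push_cast
    field_simp

lemma integral_lev_mul_sq (hc : 0 < c) (hρ : ρ ∈ box c B) :
    ∫ y, lev ρ y * (y * y) = fisher ρ 1 1 := (regime_const hc hρ).integral_lev_mul_sq

lemma integral_lev_mul_jumpScore (hc : 0 < c) (hρ : ρ ∈ box c B) :
    ∫ y, lev ρ y * (jumpScore ρ y * y) = fisher ρ 0 1 :=
  (regime_const hc hρ).integral_lev_mul_jumpScore

lemma integral_lev_quadratic (hc : 0 < c) (hρ : ρ ∈ box c B) (a b : ℝ) :
    Integrable (fun y => lev ρ y * (a * jumpScore ρ y + b * y) ^ 2) ∧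
    ∫ y, lev ρ y * (a * jumpScore ρ y + b * y) ^ 2 =
      a ^ 2 * fisher ρ 0 0 + 2 * (a * b) * fisher ρ 0 1 + b ^ 2 * fisher ρ 1 1 := by
  have hreg := box_subset_region hc hρ
  have i1 := integrable_lev_mul_jumpScore_sq hc hρ
  have i2 : Integrable fun y => lev ρ y * (jumpScore ρ y * y) := by
    refine integrable_lev_mul hc hρ ((continuousOn_jumpScore hreg).mul continuousOn_id) zero_le_one
      fun y hy => ?_
    rw [abs_mul, one_mul, ← sq_abs y, sq]
    exact mul_le_mul_of_nonneg_right (abs_jumpScore_le hreg hy) (abs_nonneg y)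
  have i3 : Integrable fun y => lev ρ y * (y * y) := by
    refine integrable_lev_mul hc hρ (by fun_prop) zero_le_one fun y hy => ?_
    rw [abs_mul, one_mul, ← sq_abs y, sq]
  have e : (fun y => lev ρ y * (a * jumpScore ρ y + b * y) ^ 2) = fun y =>
      (a ^ 2 * (lev ρ y * jumpScore ρ y ^ 2) + 2 * (a * b) * (lev ρ y * (jumpScore ρ y * y))) +
        b ^ 2 * (lev ρ y * (y * y)) := by
    ext y; ring
  rw [e]
  have i12 : Integrable fun y => a ^ 2 * (lev ρ y * jumpScore ρ y ^ 2) +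
      2 * (a * b) * (lev ρ y * (jumpScore ρ y * y)) := (i1.const_mul _).add (i2.const_mul _)
  refine ⟨i12.add (i3.const_mul _), ?_⟩
  rw [integral_add i12 (i3.const_mul _),
    integral_add (i1.const_mul _) (i2.const_mul _), integral_const_mul, integral_const_mul,
    integral_const_mul, ← fisher_zero_zero hc hρ, integral_lev_mul_jumpScore hc hρ,
    integral_lev_mul_sq hc hρ]

/-- `jumpScore` is negative on both half-lines while `b y` changes sign. On one of the half-lines `a
* jumpScore` and `b y` have the same sign, so their sum vanishes there only if both do. -/
lemma integral_lev_quadratic_pos (hc : 0 < c) (hρ : ρ ∈ box c B) {a b : ℝ} (hab : a ≠ 0 ∨ b ≠ 0) :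
    0 < a ^ 2 * fisher ρ 0 0 + 2 * (a * b) * fisher ρ 0 1 + b ^ 2 * fisher ρ 1 1 := by
  have hreg := box_subset_region hc hρ
  obtain ⟨hi, he⟩ := integral_lev_quadratic hc hρ a b
  rw [← he, integral_pos_iff_support_of_nonneg
    (fun y => mul_nonneg (lev_nonneg hreg y) (sq_nonneg _)) hi]
  have key : ∀ y, y ≠ 0 → a * b * y ≤ 0 →
      y ∈ Function.support fun y => lev ρ y * (a * jumpScore ρ y + b * y) ^ 2 := by
    intro y hy hs
    have hj := jumpScore_neg hreg hy
    refine mul_ne_zero (lev_pos hreg hy).ne' (pow_ne_zero _ fun h0 => ?_)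
    have h1 : 0 ≤ (a * jumpScore ρ y) * (b * y) := by nlinarith
    have h2 : (a * jumpScore ρ y) ^ 2 + (b * y) ^ 2 ≤ 0 := by nlinarith
    have h3 : a * jumpScore ρ y = 0 := by nlinarith [sq_nonneg (a * jumpScore ρ y), sq_nonneg (b * y)]
    have h4 : b * y = 0 := by nlinarith [sq_nonneg (a * jumpScore ρ y), sq_nonneg (b * y)]
    rcases hab with h | h
    · exact (mul_ne_zero h hj.ne) h3
    · exact (mul_ne_zero h hy) h4
  rcases le_total (a * b) 0 with h | h
  · refine lt_of_lt_of_le ?_ (measure_mono (s := Ioi (0 : ℝ)) fun y hy => key y (ne_of_gt hy)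
      (mul_nonpos_of_nonpos_of_nonneg h (le_of_lt hy)))
    simp
  · refine lt_of_lt_of_le ?_ (measure_mono (s := Iio (0 : ℝ)) fun y hy => key y (ne_of_lt hy)
      (mul_nonpos_of_nonneg_of_nonpos h (le_of_lt hy)))
    simp

lemma fisher_posDef (hc : 0 < c) (hρ : ρ ∈ box c B) : (fisher ρ).PosDef := by
  have hreg := box_subset_region hc hρ
  obtain ⟨h0, h2, -⟩ := region_pos hreg
  refine Matrix.PosDef.of_dotProduct_mulVec_pos ?_ fun x hx => ?_
  · ext k l
    simp [fisher_symm ρ k l]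
  have e : star x ⬝ᵥ (fisher ρ).mulVec x =
      (x 0 ^ 2 * fisher ρ 0 0 + 2 * (x 0 * x 1) * fisher ρ 0 1 + x 1 ^ 2 * fisher ρ 1 1) +
        (x 2 ^ 2 + x 3 ^ 2) / (2 * ρ 2 ^ 2) := by
    simp [Matrix.mulVec, dotProduct, Fin.sum_univ_four, fisher]
    ring
  rw [e]
  by_cases hab : x 0 ≠ 0 ∨ x 1 ≠ 0
  · have := integral_lev_quadratic_pos hc hρ hab
    positivity
  · push Not at hab
    rw [hab.1, hab.2]
    have : 0 < x 2 ^ 2 + x 3 ^ 2 := by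
      by_contra hcon
      apply hx
      have h3 : x 2 = 0 := by nlinarith [sq_nonneg (x 2), sq_nonneg (x 3)]
      have h4 : x 3 = 0 := by nlinarith [sq_nonneg (x 2), sq_nonneg (x 3)]
      ext k
      fin_cases k <;> simp [hab.1, hab.2, h3, h4]
    simp only [ne_eq, OfNat.ofNat_ne_zero, not_false_eq_true, zero_pow, zero_mul, mul_zero,
      add_zero, zero_add]
    positivity

/-- The first entry is a Lévy integral, continuous by domination with `majorant`; all other entries
are elementary functions of the parameter. -/
lemma tendsto_fisher (hc : 0 < c) {θ : ℕ → E4} (hθ : ∀ i, θ i ∈ box c B) {θ₀ : E4}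
    (hθ₀ : θ₀ ∈ box c B) (ht : Tendsto θ atTop (𝓝 θ₀)) (k l : Fin 4) :
    Tendsto (fun i => fisher (θ i) k l) atTop (𝓝 (fisher θ₀ k l)) := by
  have hreg := fun i => box_subset_region hc (hθ i)
  have hreg₀ := box_subset_region hc hθ₀
  obtain ⟨h0, h2, -⟩ := region_pos hreg₀
  have hg := (gam_pos hreg₀).ne'
  have h00 : Tendsto (fun i => fisher (θ i) 0 0) atTop (𝓝 (fisher θ₀ 0 0)) := by
    simp_rw [fun i => fisher_zero_zero hc (hθ i), fisher_zero_zero hc hθ₀]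
    obtain ⟨C, a, hC, ha, H⟩ := exists_lev_mul_mom_le hc B
    refine tendsto_integral_of_dominated_convergence (fun y => C * majorant a y)
      (fun i => (integrable_lev_mul_jumpScore_sq hc (hθ i)).aestronglyMeasurable)
      ((integrable_majorant ha).const_mul _) (fun i => ?_) ?_
    · filter_upwards [compl_mem_ae_iff.2 (measure_singleton (0 : ℝ))] with y hy
      have hl := lev_nonneg (hreg i) y
      rw [norm_of_nonneg (by positivity)]
      refine le_trans (mul_le_mul_of_nonneg_left ?_ hl) (H y hy _ (hθ i))
      refine (jumpScore_sq_le (hreg i) hy).trans ?_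
      rw [← sq_abs]; exact pow_le_mom (abs_nonneg y) le_rfl (by norm_num)
    · filter_upwards [compl_mem_ae_iff.2 (measure_singleton (0 : ℝ))] with y hy
      have hy' : y ≠ 0 := hy
      have hw : Tendsto (fun i => θ i 0 ^ 2 * y ^ 2) atTop (𝓝 (θ₀ 0 ^ 2 * y ^ 2)) :=
        ((tendsto_coord ht 0).pow 2).mul_const _
      have hpos : 0 < θ₀ 0 ^ 2 * y ^ 2 := by positivity
      have hk := ((hasDerivAt_kone hpos).continuousAt.tendsto).comp hw
      have hq := ((hasDerivAt_kratio hpos).continuousAt.tendsto).comp hw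
      refine Tendsto.mul ?_ (((hq.div (tendsto_coord ht 0) h0.ne').neg).pow 2)
      exact (((tendsto_coord ht 2).div_const π).mul ((continuous_exp.tendsto _).comp
        ((tendsto_coord ht 1).mul_const y))).mul (hk.div_const _)
  have h01 : Tendsto (fun i => fisher (θ i) 0 1) atTop (𝓝 (fisher θ₀ 0 1)) := by
    simp_rw [fun i => fisher_zero_one (hreg i), fisher_zero_one hreg₀]
    exact ((tendsto_coord ht 2).mul (((tendsto_coord ht 0).mul (tendsto_coord ht 1)).div
      ((tendsto_gam ht).pow 3) (pow_ne_zero _ hg))).neg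
  have h11 : Tendsto (fun i => fisher (θ i) 1 1) atTop (𝓝 (fisher θ₀ 1 1)) := by
    simp_rw [fun i => fisher_one_one (hreg i), fisher_one_one hreg₀]
    exact (tendsto_coord ht 2).mul (((tendsto_coord ht 0).pow 2).div
      ((tendsto_gam ht).pow 3) (pow_ne_zero _ hg))
  have h22 : Tendsto (fun i => 1 / (2 * θ i 2 ^ 2)) atTop (𝓝 (1 / (2 * θ₀ 2 ^ 2))) :=
    tendsto_const_nhds.div (((tendsto_coord ht 2).pow 2).const_mul 2) (by positivity)
  have h10 : Tendsto (fun i => fisher (θ i) 1 0) atTop (𝓝 (fisher θ₀ 1 0)) := by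
    simp_rw [fun ρ => fisher_symm ρ 1 0]; exact h01
  fin_cases k <;> fin_cases l
  · exact h00
  · exact h01
  · simp [fisher]
  · simp [fisher]
  · exact h10
  · exact h11
  · simp [fisher]
  · simp [fisher]
  · simp [fisher]
  · simp [fisher]
  · simpa [fisher] using h22
  · simp [fisher]
  · simp [fisher]
  · simp [fisher]
  · simp [fisher]
  · simpa [fisher] using h22

end NIG

end

/-! ### The Cauchy information on `(δ, μ)` and the limits of the covariances -/

noncomputable section

namespace NIG

open Set Real

variable {c B h y : ℝ} {ρ : E4}

/-- The limit of the `δ`-score as a function of a rescaled increment. -/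
def scaleScore (ρ : E4) (z : ℝ) : ℝ := 1 / ρ 2 - 2 * ρ 2 * (1 / (ρ 2 ^ 2 + (z - ρ 3) ^ 2))

/-- The limit of the `μ`-score as a function of a rescaled increment. -/
def locScore (ρ : E4) (z : ℝ) : ℝ := 2 * ((z - ρ 3) / (ρ 2 ^ 2 + (z - ρ 3) ^ 2))

lemma integral_cauchyD_mul (hρ : ρ ∈ region) (f : ℝ → ℝ) :
    ∫ z, cauchyD ρ z * f z = ∫ x, (π * (1 + x ^ 2))⁻¹ * f (ρ 3 + ρ 2 * x) := by
  have h2 := (region_pos hρ).2.1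
  have e1 : ∫ z, cauchyD ρ z * f z = ∫ z, cauchyD ρ (z + ρ 3) * f (z + ρ 3) :=
    (integral_add_right_eq_self (fun z => cauchyD ρ z * f z) (ρ 3)).symm
  have e2 := Measure.integral_comp_mul_left (fun z => cauchyD ρ (z + ρ 3) * f (z + ρ 3)) (ρ 2)
  rw [abs_inv, abs_of_pos h2, smul_eq_mul] at e2
  have e3 : ∫ z, cauchyD ρ (z + ρ 3) * f (z + ρ 3) =
      ρ 2 * ∫ x, cauchyD ρ (ρ 2 * x + ρ 3) * f (ρ 2 * x + ρ 3) := by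
    rw [e2, ← mul_assoc, mul_inv_cancel₀ h2.ne', one_mul]
  rw [e1, e3, ← integral_const_mul]
  refine integral_congr_ae (ae_of_all _ fun x => ?_)
  have hπ := pi_pos
  have h3 : ρ 2 ^ 2 + (ρ 2 * x + ρ 3 - ρ 3) ^ 2 = ρ 2 ^ 2 * (1 + x ^ 2) := by ring
  simp only [cauchyD, h3, add_comm (ρ 3)]
  field_simp

lemma tendsto_ratio_atTop : Tendsto (fun x : ℝ => x * (1 - x ^ 2) / (2 * (1 + x ^ 2) ^ 2))
    atTop (𝓝 0) := by
  refine squeeze_zero_norm' (a := fun x : ℝ => x⁻¹) ?_ tendsto_inv_atTop_zero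
  filter_upwards [eventually_gt_atTop 0] with x hx
  rw [norm_eq_abs, abs_div, abs_of_pos (by positivity : 0 < 2 * (1 + x ^ 2) ^ 2),
    div_le_iff₀ (by positivity), abs_mul, abs_of_pos hx]
  have h1 : |1 - x ^ 2| ≤ 1 + x ^ 2 := abs_le.2 ⟨by nlinarith, by nlinarith⟩
  have h2 : x * |1 - x ^ 2| ≤ x * (1 + x ^ 2) := by gcongr
  refine h2.trans ?_
  rw [inv_mul_eq_div, le_div_iff₀ hx]
  nlinarith [sq_nonneg x, sq_nonneg (x ^ 2)]

lemma hasDerivAt_ratio (x : ℝ) : HasDerivAt (fun x : ℝ => x * (1 - x ^ 2) / (2 * (1 + x ^ 2) ^ 2))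
    (1 / 2 * ((x ^ 4 - 6 * x ^ 2 + 1) / (1 + x ^ 2) ^ 3)) x := by
  have hx : (1 + x ^ 2) ≠ 0 := by positivity
  have h1 : HasDerivAt (fun x : ℝ => x ^ 2) (2 * x) x := by simpa using hasDerivAt_pow 2 x
  have h2 := ((hasDerivAt_id x).mul (h1.const_sub 1)).div (((h1.const_add 1).pow 2).const_mul 2)
    (mul_ne_zero two_ne_zero (pow_ne_zero 2 hx))
  convert! h2 using 1
  simp only [Pi.mul_apply, Pi.pow_apply, id]
  push_cast
  field_simp
  ring

/-- The antiderivatives are half the arctangent plus or minus one rational function, which vanishes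
at both ends. Each integral is half the total variation `π` of the arctangent. -/
lemma integral_cauchy_moments :
    ∫ x : ℝ, (x ^ 2 - 1) ^ 2 / (1 + x ^ 2) ^ 3 = π / 2 ∧
    ∫ x : ℝ, 4 * x ^ 2 / (1 + x ^ 2) ^ 3 = π / 2 := by
  have hbot : Tendsto (fun x : ℝ => x * (1 - x ^ 2) / (2 * (1 + x ^ 2) ^ 2)) atBot (𝓝 0) := by
    have := (tendsto_ratio_atTop.comp tendsto_neg_atBot_atTop).neg
    simp only [neg_zero] at this
    refine this.congr fun x => ?_
    simp only [Function.comp]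
    ring
  have hat := tendsto_nhds_of_tendsto_nhdsWithin tendsto_arctan_atTop
  have hab := tendsto_nhds_of_tendsto_nhdsWithin tendsto_arctan_atBot
  have hint : ∀ f : ℝ → ℝ, Continuous f → (∀ x, |f x| ≤ (1 + x ^ 2)⁻¹) → Integrable f :=
    fun f hf hb => integrable_inv_one_add_sq.mono' hf.aestronglyMeasurable (ae_of_all _ hb)
  have hcont : ∀ f : ℝ → ℝ, Continuous f → Continuous fun x => f x / (1 + x ^ 2) ^ 3 :=
    fun f hf => hf.div (by fun_prop) fun x => by positivity
  have ha : ∀ x : ℝ, HasDerivAt (fun x => 1 / 2 * arctan x) (1 / 2 * (1 / (1 + x ^ 2))) x :=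
    fun x => (hasDerivAt_arctan x).const_mul _
  constructor
  · rw [integral_of_hasDerivAt_of_tendsto
      (f := fun x => 1 / 2 * arctan x + x * (1 - x ^ 2) / (2 * (1 + x ^ 2) ^ 2))
      (m := 1 / 2 * (-(π / 2)) + 0) (n := 1 / 2 * (π / 2) + 0)]
    · ring
    · intro x
      have := (ha x).add (hasDerivAt_ratio x)
      convert! this using 1
      field_simp
      ring
    · refine hint _ (hcont _ (by fun_prop)) fun x => ?_
      rw [abs_of_nonneg (by positivity), div_le_iff₀ (by positivity)]
      have : (1 + x ^ 2)⁻¹ * (1 + x ^ 2) ^ 3 = (1 + x ^ 2) ^ 2 := by field_simp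
      rw [this]
      nlinarith [sq_nonneg x]
    · exact (hab.const_mul _).add hbot
    · exact (hat.const_mul _).add tendsto_ratio_atTop
  · rw [integral_of_hasDerivAt_of_tendsto
      (f := fun x => 1 / 2 * arctan x - x * (1 - x ^ 2) / (2 * (1 + x ^ 2) ^ 2))
      (m := 1 / 2 * (-(π / 2)) - 0) (n := 1 / 2 * (π / 2) - 0)]
    · ring
    · intro x
      have := (ha x).sub (hasDerivAt_ratio x)
      convert! this using 1
      field_simp
      ring
    · refine hint _ (hcont _ (by fun_prop)) fun x => ?_
      rw [abs_of_nonneg (by positivity), div_le_iff₀ (by positivity)]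
      have : (1 + x ^ 2)⁻¹ * (1 + x ^ 2) ^ 3 = (1 + x ^ 2) ^ 2 := by field_simp
      rw [this]
      nlinarith [sq_nonneg (x ^ 2 - 1)]
    · exact (hab.const_mul _).sub hbot
    · exact (hat.const_mul _).sub tendsto_ratio_atTop

lemma integral_cauchyD_score (hρ : ρ ∈ region) :
    ∫ z, cauchyD ρ z * (scaleScore ρ z * scaleScore ρ z) = 1 / (2 * ρ 2 ^ 2) ∧
    ∫ z, cauchyD ρ z * (locScore ρ z * locScore ρ z) = 1 / (2 * ρ 2 ^ 2) ∧
    ∫ z, cauchyD ρ z * (scaleScore ρ z * locScore ρ z) = 0 := by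
  have h2 := (region_pos hρ).2.1
  have hπ := pi_pos
  have h3 : ∀ x, ρ 2 ^ 2 + (ρ 3 + ρ 2 * x - ρ 3) ^ 2 = ρ 2 ^ 2 * (1 + x ^ 2) := fun x => by ring
  refine ⟨?_, ?_, ?_⟩ <;> rw [integral_cauchyD_mul hρ] <;> simp only [scaleScore, locScore, h3]
  · have : ∀ x : ℝ, (π * (1 + x ^ 2))⁻¹ * ((1 / ρ 2 - 2 * ρ 2 * (1 / (ρ 2 ^ 2 * (1 + x ^ 2)))) *
        (1 / ρ 2 - 2 * ρ 2 * (1 / (ρ 2 ^ 2 * (1 + x ^ 2))))) =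
        (1 / (π * ρ 2 ^ 2)) * ((x ^ 2 - 1) ^ 2 / (1 + x ^ 2) ^ 3) := fun x => by
      field_simp
      ring
    simp_rw [this]
    rw [integral_const_mul, integral_cauchy_moments.1]
    field_simp
  · have : ∀ x : ℝ, (π * (1 + x ^ 2))⁻¹ * (2 * ((ρ 3 + ρ 2 * x - ρ 3) / (ρ 2 ^ 2 * (1 + x ^ 2))) *
        (2 * ((ρ 3 + ρ 2 * x - ρ 3) / (ρ 2 ^ 2 * (1 + x ^ 2))))) =
        (1 / (π * ρ 2 ^ 2)) * (4 * x ^ 2 / (1 + x ^ 2) ^ 3) := fun x => by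
      field_simp
      ring
    simp_rw [this]
    rw [integral_const_mul, integral_cauchy_moments.2]
    field_simp
  -- In the standardized variable the `δ`-score is even and the `μ`-score odd.
  · set g : ℝ → ℝ := fun x => (π * (1 + x ^ 2))⁻¹ *
      ((1 / ρ 2 - 2 * ρ 2 * (1 / (ρ 2 ^ 2 * (1 + x ^ 2)))) *
        (2 * ((ρ 3 + ρ 2 * x - ρ 3) / (ρ 2 ^ 2 * (1 + x ^ 2))))) with hg
    have hodd : ∀ x, g (-x) = -g x := fun x => by
      simp only [hg, neg_sq]
      ring
    have := integral_neg_eq_self g volume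
    simp_rw [hodd, integral_neg] at this
    linarith

/-- The mean of `m` is not reached by `exists_moment`, as `|y|` is not integrable against `y⁻²` at
`0`. It is split at a level `l`: above it, `m ≤ mom m / √l`. -/
lemma exists_integral_msize_le (hc : 0 < c) (B : ℝ) : ∃ C, 0 ≤ C ∧ ∀ h, 0 < h → h ≤ 1 →
    ∀ ρ ∈ box c B, Integrable (msize h) (inc h ρ) ∧
      ∀ l, 0 < l → ∫ y, msize h y ∂(inc h ρ) ≤ l + C * h / √l := by
  obtain ⟨C, hC, H⟩ := exists_moment hc B
  refine ⟨C, hC, fun h hh h1 ρ hρ => ?_⟩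
  have := isProbabilityMeasure_inc hh (box_subset_region hc hρ)
  have hnn : ∀ y, 0 ≤ mom (msize h y) := fun y => mom_nonneg (msize_pos hh y).le
  obtain ⟨hi, hle⟩ := H h hh h1 ρ hρ (fun y => mom (msize h y))
    (continuous_mom.comp (continuous_msize h)).measurable 1 zero_le_one
    fun y => by rw [abs_of_nonneg (hnn y), one_mul]
  simp_rw [fun y => abs_of_nonneg (hnn y), mul_one] at hle
  have key : ∀ l, 0 < l → ∀ y, msize h y ≤ l + 1 / √l * mom (msize h y) := fun l hl y => by
    have hm := msize_pos hh y
    have hsl := sqrt_pos.2 hl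
    have h6 := pow_pos hm 6
    rcases le_total (msize h y) l with hml | hml
    · have : 0 ≤ 1 / √l * mom (msize h y) := mul_nonneg (by positivity) (hnn y)
      linarith
    · have : √l ≤ √(msize h y) := sqrt_le_sqrt hml
      have : msize h y ≤ 1 / √l * mom (msize h y) := by
        rw [one_div, inv_mul_eq_div, le_div_iff₀ hsl, mom]
        nlinarith
      linarith
  have him : Integrable (msize h) (inc h ρ) := by
    refine ((integrable_const 1).add (hi.const_mul (1 / √1))).mono'
      (continuous_msize h).aestronglyMeasurable (ae_of_all _ fun y => ?_)
    rw [norm_of_nonneg (msize_pos hh y).le]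
    exact key 1 one_pos y
  refine ⟨him, fun l hl => ?_⟩
  calc _ ≤ ∫ y, (l + 1 / √l * mom (msize h y)) ∂(inc h ρ) :=
        integral_mono him ((integrable_const l).add (hi.const_mul _)) (key l hl)
    _ = l + 1 / √l * ∫ y, mom (msize h y) ∂(inc h ρ) := by
        rw [integral_add (integrable_const l) (hi.const_mul _), integral_const_mul]
        simp
    _ ≤ l + 1 / √l * (C * h) := by gcongr
    _ = _ := by ring

lemma rate_pos {n : ℕ} (hn : 0 < n) (hh : 0 < h) (k : Fin 4) : 0 < rate h n k := by
  have : (0 : ℝ) < n := Nat.cast_pos.2 hn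
  fin_cases k <;> simp [rate] <;> positivity

/-- The order of magnitude `n a_k a_l` of the covariance of two scores. -/
def covScale (k l : Fin 4) (h : ℝ) : ℝ :=
  if k < 2 then (if l < 2 then 1 / h else 1 / √h) else (if l < 2 then 1 / √h else 1)

lemma nat_mul_rate_mul {n : ℕ} (hn : 0 < n) (hh : 0 < h) (k l : Fin 4) :
    n * (rate h n k * rate h n l) = covScale k l h := by
  have hn' : (0 : ℝ) < n := Nat.cast_pos.2 hn
  have e1 : √(n * h) * √(n * h) = n * h := mul_self_sqrt (by positivity)
  have e2 : √(n : ℝ) * √(n : ℝ) = n := mul_self_sqrt hn'.le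
  have e3 : √(n * h) = √n * √h := sqrt_mul hn'.le h
  have s1 := sqrt_pos.2 hn'
  have s2 := sqrt_pos.2 hh
  have r1 : (n : ℝ) * (1 / √(n * h) * (1 / √(n * h))) = 1 / h := by
    rw [div_mul_div_comm, e1]; field_simp
  have r2 : (n : ℝ) * (1 / √(n * h) * (1 / √n)) = 1 / √h := by
    rw [e3, div_mul_div_comm, mul_right_comm, e2]; field_simp
  have r3 : (n : ℝ) * (1 / √n * (1 / √(n * h))) = 1 / √h := by rw [mul_comm (1 / √(n : ℝ)), r2]
  have r4 : (n : ℝ) * (1 / √n * (1 / √n)) = 1 := by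
    rw [div_mul_div_comm, e2]; field_simp
  fin_cases k <;> fin_cases l <;> simp only [rate, covScale]
  exacts [r1, r1, r2, r2, r1, r1, r2, r2, r3, r3, r4, r4, r3, r3, r4, r4]

namespace Regime

variable {N : ℕ → ℕ} {h : ℕ → ℝ} {θ : ℕ → E4} {θ₀ : E4} (R : Regime c B N h θ θ₀)
include R

lemma tendsto_score1_two (z : ℝ) :
    Tendsto (fun i => score1 (h i) (h i * z) (θ i) 2) atTop (𝓝 (scaleScore θ₀ z)) := by
  obtain ⟨C, hC, H⟩ := exists_score1_le R.c_pos B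
  have h2 := (region_pos R.reg_lim).2.1
  have hu : ∀ i, uf (h i) (h i * z) (θ i) = 1 / (θ i 2 ^ 2 + (z - θ i 3) ^ 2) := fun i => by
    have := (R.pos i).ne'
    have e1 : dsq (h i) (h i * z) (θ i) = h i ^ 2 * (θ i 2 ^ 2 + (z - θ i 3) ^ 2) := by
      unfold dsq; ring
    unfold uf
    rw [e1]
    field_simp
  have hlim : Tendsto (fun i => 1 / θ i 2 - 2 * θ i 2 * uf (h i) (h i * z) (θ i)) atTop
      (𝓝 (scaleScore θ₀ z)) := by
    simp_rw [hu]
    have hs : Tendsto (fun i => θ i 2 ^ 2 + (z - θ i 3) ^ 2) atTop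
        (𝓝 (θ₀ 2 ^ 2 + (z - θ₀ 3) ^ 2)) :=
      ((tendsto_coord R.tendsto 2).pow 2).add
        ((tendsto_const_nhds.sub (tendsto_coord R.tendsto 3)).pow 2)
    exact (tendsto_const_nhds.div (tendsto_coord R.tendsto 2) h2.ne').sub
      (((tendsto_coord R.tendsto 2).const_mul 2).mul (tendsto_const_nhds.div hs (by positivity)))
  have hd : Tendsto (fun i => score1 (h i) (h i * z) (θ i) 2 -
      (1 / θ i 2 - 2 * θ i 2 * uf (h i) (h i * z) (θ i))) atTop (𝓝 0) := by
    refine squeeze_zero_norm (fun i => (H _ (h i * z) (R.pos i) (R.le_one i) _ (R.mem i)).2.2.2.2.1) ?_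
    simpa using R.tendsto_zero.const_mul C
  simpa using hd.add hlim

lemma tendsto_score1_three (z : ℝ) :
    Tendsto (fun i => score1 (h i) (h i * z) (θ i) 3) atTop (𝓝 (locScore θ₀ z)) := by
  obtain ⟨C, hC, H⟩ := exists_score1_le R.c_pos B
  have h2 := (region_pos R.reg_lim).2.1
  have hu : ∀ i, vf (h i) (h i * z) (θ i) = (z - θ i 3) / (θ i 2 ^ 2 + (z - θ i 3) ^ 2) := fun i => by
    have := (R.pos i).ne'
    have e1 : dsq (h i) (h i * z) (θ i) = h i ^ 2 * (θ i 2 ^ 2 + (z - θ i 3) ^ 2) := by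
      unfold dsq; ring
    have e2 : h i * (h i * z - θ i 3 * h i) = h i ^ 2 * (z - θ i 3) := by ring
    unfold vf
    rw [e1, e2]
    field_simp
  have hlim : Tendsto (fun i => 2 * vf (h i) (h i * z) (θ i)) atTop (𝓝 (locScore θ₀ z)) := by
    simp_rw [hu]
    have hs : Tendsto (fun i => θ i 2 ^ 2 + (z - θ i 3) ^ 2) atTop
        (𝓝 (θ₀ 2 ^ 2 + (z - θ₀ 3) ^ 2)) :=
      ((tendsto_coord R.tendsto 2).pow 2).add
        ((tendsto_const_nhds.sub (tendsto_coord R.tendsto 3)).pow 2)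
    exact ((tendsto_const_nhds.sub (tendsto_coord R.tendsto 3)).div hs (by positivity)).const_mul 2
  have hd : Tendsto (fun i => score1 (h i) (h i * z) (θ i) 3 - 2 * vf (h i) (h i * z) (θ i))
      atTop (𝓝 0) := by
    refine squeeze_zero_norm
      (fun i => (H _ (h i * z) (R.pos i) (R.le_one i) _ (R.mem i)).2.2.2.2.2.1) ?_
    simpa using R.tendsto_zero.const_mul C
  simpa using hd.add hlim

lemma tendsto_cov_cauchy {k l : Fin 4} (hk : ¬ k < 2) (hl : ¬ l < 2) {f g : ℝ → ℝ}
    (hf : ∀ z, Tendsto (fun i => score1 (h i) (h i * z) (θ i) k) atTop (𝓝 (f z)))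
    (hg : ∀ z, Tendsto (fun i => score1 (h i) (h i * z) (θ i) l) atTop (𝓝 (g z))) :
    Tendsto (fun i => ∫ y, score1 (h i) y (θ i) k * score1 (h i) y (θ i) l ∂(inc (h i) (θ i)))
      atTop (𝓝 (∫ z, cauchyD θ₀ z * (f z * g z))) := by
  obtain ⟨C, hC, H⟩ := exists_score1_le R.c_pos B
  have hS : ∀ k : Fin 4, ¬ k < 2 → ∀ i y, |score1 (h i) y (θ i) k| ≤ C := by
    intro k hk i y
    obtain ⟨-, -, a2, a3, -⟩ := H (h i) y (R.pos i) (R.le_one i) _ (R.mem i)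
    fin_cases k
    · exact absurd hk (by decide)
    · exact absurd hk (by decide)
    · exact a2
    · exact a3
  refine tendsto_integral_inc R.c_pos R.pos R.le_one R.tendsto_zero R.mem R.reg_lim R.tendsto
    (A := C * C) (fun i => ?_) (fun i y => ?_) fun z => (hf z).mul (hg z)
  · exact ((continuous_score1 (R.pos i) (R.reg i) k).mul
      (continuous_score1 (R.pos i) (R.reg i) l)).measurable
  · rw [abs_mul]
    exact mul_le_mul (hS k hk i y) (hS l hl i y) (abs_nonneg _) hC

lemma tendsto_integral_msize_div :
    Tendsto (fun i => (∫ y, msize (h i) y ∂(inc (h i) (θ i))) / √(h i)) atTop (𝓝 0) := by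
  obtain ⟨C, hC, H⟩ := exists_integral_msize_le R.c_pos B
  have hq0 : Tendsto (fun i => √(√(√(h i)))) atTop (𝓝 0) := by
    simpa using R.tendsto_zero.sqrt.sqrt.sqrt
  refine squeeze_zero (g := fun i => √(√(√(h i))) ^ 2 + C * √(√(√(h i)))) (fun i => ?_)
    (fun i => ?_) ?_
  · exact div_nonneg (integral_nonneg fun y => (msize_pos (R.pos i) y).le) (sqrt_nonneg _)
  · have hi := R.pos i
    have hq : 0 < √(√(√(h i))) := by positivity
    have e1 : √(√(√(h i))) ^ 2 = √(√(h i)) := sq_sqrt (by positivity)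
    have e2 : √(√(h i)) ^ 2 = √(h i) := sq_sqrt (by positivity)
    have e3 : √(h i) ^ 2 = h i := sq_sqrt (by positivity)
    set q := √(√(√(h i)))
    have e4 : √(h i) = q ^ 4 := by rw [← e2, ← e1]; ring
    have e5 : h i = q ^ 8 := by rw [← e3, e4]; ring
    -- The level is `l = h^(3/4) = q⁶`, with `q = h^(1/8)`. Divided by `√h = q⁴`, the bound `l + C h
    -- / √l` becomes `q² + C q`.
    have hle := (H _ hi (R.le_one i) _ (R.mem i)).2 (q ^ 6) (by positivity)
    have e6 : √(q ^ 6) = q ^ 3 := by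
      rw [show q ^ 6 = (q ^ 3) ^ 2 by ring, sqrt_sq (by positivity)]
    rw [e6] at hle
    rw [e4, div_le_iff₀ (by positivity)]
    refine hle.trans (le_of_eq ?_)
    have e7 : C * h i / q ^ 3 = C * q ^ 5 := by rw [e5]; field_simp
    rw [e7]
    ring
  · simpa using (hq0.pow 2).add (hq0.const_mul C)

/-- Within the first block the limit is an integral against the Lévy measure, within the second one
against the Cauchy law. In a mixed entry the product of scores is at most `C² m` and the scale is
`1/√h`, so the limit is `0`. -/
lemma tendsto_cov (k l : Fin 4) :
    Tendsto (fun i => covScale k l (h i) *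
      ∫ y, score1 (h i) y (θ i) k * score1 (h i) y (θ i) l ∂(inc (h i) (θ i)))
      atTop (𝓝 (fisher θ₀ k l)) := by
  obtain ⟨C, hC, H⟩ := exists_score1_le R.c_pos B
  have e2 : ∀ (k l : Fin 4) (i : ℕ),
      ∫ y, score1 (h i) y (θ i) k * score1 (h i) y (θ i) l ∂(inc (h i) (θ i)) =
      ∫ y, score1 (h i) y (θ i) l * score1 (h i) y (θ i) k ∂(inc (h i) (θ i)) := fun k l i => by
    simp_rw [mul_comm]
  have hmix : ∀ k l : Fin 4, k < 2 → ¬ l < 2 → Tendsto (fun i => (∫ y, score1 (h i) y (θ i) k *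
      score1 (h i) y (θ i) l ∂(inc (h i) (θ i))) / √(h i)) atTop (𝓝 0) := by
    intro k l hk hl
    refine squeeze_zero_norm (a := fun i => C ^ 2 *
      ((∫ y, msize (h i) y ∂(inc (h i) (θ i))) / √(h i))) (fun i => ?_) ?_
    · obtain ⟨D, -, HD⟩ := exists_integral_msize_le R.c_pos B
      have hi := (HD _ (R.pos i) (R.le_one i) _ (R.mem i)).1
      rw [norm_div, norm_of_nonneg (sqrt_nonneg _), ← mul_div_assoc]
      gcongr
      rw [← integral_const_mul]
      refine norm_integral_le_of_norm_le (hi.const_mul _) (ae_of_all _ fun y => ?_)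
      obtain ⟨a0, a1, a2, a3, -⟩ := H (h i) y (R.pos i) (R.le_one i) _ (R.mem i)
      have b1 : |score1 (h i) y (θ i) k| ≤ C * msize (h i) y := by
        fin_cases k
        exacts [a0, a1, absurd hk (by decide), absurd hk (by decide)]
      have b2 : |score1 (h i) y (θ i) l| ≤ C := by
        fin_cases l
        exacts [absurd hl (by decide), absurd hl (by decide), a2, a3]
      have hm := (msize_pos (R.pos i) y).le
      rw [norm_mul, norm_eq_abs, norm_eq_abs]
      calc _ ≤ (C * msize (h i) y) * C := by gcongr
        _ = _ := by ring
    · simpa using R.tendsto_integral_msize_div.const_mul (C ^ 2)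
  have hmix' : ∀ k l : Fin 4, ¬ k < 2 → l < 2 → Tendsto (fun i => (∫ y, score1 (h i) y (θ i) k *
      score1 (h i) y (θ i) l ∂(inc (h i) (θ i))) / √(h i)) atTop (𝓝 0) := by
    intro k l hk hl
    simp_rw [e2 k l]
    exact hmix l k hl hk
  have j0 := fun y (hy : y ≠ 0) => R.tendsto_score1_zero hy
  have j1 := fun y (_ : y ≠ 0) => R.tendsto_score1_one y
  have c2 := R.tendsto_score1_two
  have c3 := R.tendsto_score1_three
  obtain ⟨k22, k33, k23⟩ := integral_cauchyD_score R.reg_lim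
  have k32 : ∫ z, cauchyD θ₀ z * (locScore θ₀ z * scaleScore θ₀ z) = 0 := by
    rw [← k23]; congr 1; ext z; ring
  have t00 := R.tendsto_cov_jump (k := 0) (l := 0) (by decide) (by decide) j0 j0
  have t01 := R.tendsto_cov_jump (k := 0) (l := 1) (by decide) (by decide) j0 j1
  have t11 := R.tendsto_cov_jump (k := 1) (l := 1) (by decide) (by decide) j1 j1
  have t22 := R.tendsto_cov_cauchy (k := 2) (l := 2) (by decide) (by decide) c2 c2
  have t23 := R.tendsto_cov_cauchy (k := 2) (l := 3) (by decide) (by decide) c2 c3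
  have t32 := R.tendsto_cov_cauchy (k := 3) (l := 2) (by decide) (by decide) c3 c2
  have t33 := R.tendsto_cov_cauchy (k := 3) (l := 3) (by decide) (by decide) c3 c3
  rw [R.integral_lev_mul_jumpScore] at t01
  rw [R.integral_lev_mul_sq] at t11
  simp_rw [← sq (jumpScore θ₀ _)] at t00
  rw [← fisher_zero_zero R.c_pos R.mem_lim] at t00
  have f22 : fisher θ₀ 2 2 = 1 / (2 * θ₀ 2 ^ 2) := by simp [fisher]
  have f33 : fisher θ₀ 3 3 = 1 / (2 * θ₀ 2 ^ 2) := by simp [fisher]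
  have f23 : fisher θ₀ 2 3 = 0 := by simp [fisher]
  have f32 : fisher θ₀ 3 2 = 0 := by simp [fisher]
  rw [k22, ← f22] at t22
  rw [k33, ← f33] at t33
  rw [k23, ← f23] at t23
  rw [k32, ← f32] at t32
  have t10 := t01
  simp_rw [e2 0 1] at t10
  rw [fisher_symm θ₀ 0 1] at t10
  fin_cases k <;> fin_cases l <;> simp only [covScale]
  · simpa [div_eq_inv_mul] using t00
  · simpa [div_eq_inv_mul] using t01
  · simpa [div_eq_inv_mul, fisher] using hmix 0 2 (by decide) (by decide)
  · simpa [div_eq_inv_mul, fisher] using hmix 0 3 (by decide) (by decide)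
  · simpa [div_eq_inv_mul] using t10
  · simpa [div_eq_inv_mul] using t11
  · simpa [div_eq_inv_mul, fisher] using hmix 1 2 (by decide) (by decide)
  · simpa [div_eq_inv_mul, fisher] using hmix 1 3 (by decide) (by decide)
  · simpa [div_eq_inv_mul, fisher] using hmix' 2 0 (by decide) (by decide)
  · simpa [div_eq_inv_mul, fisher] using hmix' 2 1 (by decide) (by decide)
  · simpa using t22
  · simpa using t23
  · simpa [div_eq_inv_mul, fisher] using hmix' 3 0 (by decide) (by decide)
  · simpa [div_eq_inv_mul, fisher] using hmix' 3 1 (by decide) (by decide)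
  · simpa using t32
  · simpa using t33

end Regime

end NIG

end

noncomputable section

namespace NIG

open Set Real

/-! ### Uniform convergence along sequences -/

/-- If uniform convergence failed, there would be indices tending to infinity and points of `K` at
which the values stay away from `0`; by compactness the points may be taken to converge. The bound
`n₀` discards finitely many indices, later those with `n = 0` or `h > 1`. -/
lemma tendstoUniformlyOn_zero_of_seq {E : Type*} [PseudoMetricSpace E] {F : ℕ → E → ℝ} {K : Set E}
    (hK : IsCompact K) (n₀ : ℕ)
    (H : ∀ φ : ℕ → ℕ, Tendsto φ atTop atTop → (∀ i, n₀ ≤ φ i) → ∀ θ : ℕ → E, (∀ i, θ i ∈ K) →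
      ∀ θ₀ ∈ K, Tendsto θ atTop (𝓝 θ₀) → Tendsto (fun i => F (φ i) (θ i)) atTop (𝓝 0)) :
    TendstoUniformlyOn F 0 atTop K := by
  rw [Metric.tendstoUniformlyOn_iff]
  by_contra! hcon
  obtain ⟨ε, hε, hfr⟩ := hcon
  have hfr' : ∀ m, ∃ n ≥ max m n₀, ∃ x ∈ K, ε ≤ dist ((0 : E → ℝ) x) (F n x) := fun m => by
    obtain ⟨n, hn, h⟩ := (Filter.frequently_atTop.1 hfr) (max m n₀)
    exact ⟨n, hn, h⟩
  choose φ hφ θ hθ hd using hfr'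
  obtain ⟨θ₀, hθ₀, ψ, hψ, ht⟩ := hK.tendsto_subseq hθ
  have hφt : Tendsto φ atTop atTop :=
    tendsto_atTop_mono (fun m => (le_max_left _ _).trans (hφ m)) tendsto_id
  have := H (φ ∘ ψ) (hφt.comp hψ.tendsto_atTop) (fun i => (le_max_right _ _).trans (hφ _)) (θ ∘ ψ)
    (fun i => hθ _) θ₀ hθ₀ ht
  obtain ⟨i, hi⟩ := ((Metric.tendsto_nhds.1 this) ε hε).exists
  have h2 := hd (ψ i)
  rw [Pi.zero_apply, dist_comm] at h2
  exact absurd hi (not_lt.2 h2)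

/-! ### The bounded-Lipschitz distance -/

section BL

variable {F : Type*} [PseudoMetricSpace F]

lemma InUnitBL.le_one {f : F → ℝ} (hf : InUnitBL f) (x : F) : |f x| ≤ 1 := by
  obtain ⟨L, M, hLM, -, hM⟩ := hf
  refine (hM x).trans ?_
  have : M ≤ 1 := le_trans le_add_self hLM
  exact_mod_cast this

lemma InUnitBL.lipschitz {f : F → ℝ} (hf : InUnitBL f) : LipschitzWith 1 f := by
  obtain ⟨L, M, hLM, hL, -⟩ := hf
  exact hL.weaken (le_trans le_self_add hLM)

variable [MeasurableSpace F]

lemma blDist_le {μ ν : Measure F} {r : ℝ} (hr : 0 ≤ r)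
    (H : ∀ f : F → ℝ, InUnitBL f → |∫ x, f x ∂μ - ∫ x, f x ∂ν| ≤ r) : blDist μ ν ≤ r := by
  refine Real.sSup_le ?_ hr
  rintro _ ⟨f, hf, rfl⟩
  exact H f hf

lemma blDist_nonneg (μ ν : Measure F) : 0 ≤ blDist μ ν :=
  Real.sSup_nonneg (by rintro _ ⟨f, hf, rfl⟩; exact abs_nonneg _)

lemma blDist_comm (μ ν : Measure F) : blDist μ ν = blDist ν μ := by
  unfold blDist
  simp_rw [abs_sub_comm]

lemma InUnitBL.abs_integral_le {f : F → ℝ} (hf : InUnitBL f) (μ : Measure F)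
    [IsProbabilityMeasure μ] : |∫ x, f x ∂μ| ≤ 1 := by
  have := norm_integral_le_of_norm_le_const (μ := μ) (f := f) (C := 1) (ae_of_all _ hf.le_one)
  simpa using this

lemma le_blDist (μ ν : Measure F) [IsProbabilityMeasure μ] [IsProbabilityMeasure ν] {f : F → ℝ}
    (hf : InUnitBL f) : |∫ x, f x ∂μ - ∫ x, f x ∂ν| ≤ blDist μ ν := by
  refine le_csSup ⟨2, ?_⟩ ⟨f, hf, rfl⟩
  rintro _ ⟨g, hg, rfl⟩
  refine (abs_sub _ _).trans ?_
  linarith [hg.abs_integral_le μ, hg.abs_integral_le ν]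

lemma blDist_triangle (μ ν κ : Measure F) [IsProbabilityMeasure μ] [IsProbabilityMeasure ν]
    [IsProbabilityMeasure κ] : blDist μ κ ≤ blDist μ ν + blDist κ ν := by
  refine blDist_le (add_nonneg (blDist_nonneg _ _) (blDist_nonneg _ _)) fun f hf => ?_
  have h1 := le_blDist μ ν hf
  have h2 := le_blDist κ ν hf
  rw [abs_le] at *
  constructor <;> linarith [h1.1, h1.2, h2.1, h2.2]

variable [BorelSpace F]

lemma InUnitBL.integrable {f : F → ℝ} (hf : InUnitBL f) (μ : Measure F) [IsFiniteMeasure μ] :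
    Integrable f μ :=
  (integrable_const (1 : ℝ)).mono' hf.lipschitz.continuous.measurable.aestronglyMeasurable
    (ae_of_all _ hf.le_one)

/-- As `f` is 1-Lipschitz, the `ε`-thickening of a superlevel set of `f + 1` lies in the one of `f +
1 + ε` at the same level. The layer-cake formula costs `ε` for this shift and `ε ‖f + 1‖ ≤ 2 ε` for
the Lévy-Prokhorov distance. -/
lemma integral_le_add_of_levyProkhorov {μ ν : Measure F} [IsProbabilityMeasure μ]
    [IsProbabilityMeasure ν] {ε : ℝ} (hε : 0 < ε)
    (hlt : levyProkhorovEDist μ ν < ENNReal.ofReal ε) {f : F → ℝ} (hf : InUnitBL f) :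
    ∫ x, f x ∂μ ≤ ∫ x, f x ∂ν + 3 * ε := by
  have hb : ∀ x, ‖f x + 1‖ ≤ 2 := fun x => by
    have := abs_le.1 (hf.le_one x)
    rw [norm_eq_abs, abs_le]; constructor <;> linarith
  set g : BoundedContinuousFunction F ℝ :=
    BoundedContinuousFunction.ofNormedAddCommGroup (fun x => f x + 1)
      (hf.lipschitz.continuous.add continuous_const) 2 hb with hg
  set g' : BoundedContinuousFunction F ℝ := g + BoundedContinuousFunction.const F ε with hg'
  have hgx : ∀ x, g x = f x + 1 := fun x => rfl
  have hgx' : ∀ x, g' x = f x + 1 + ε := fun x => rfl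
  have hgn : ∀ x, 0 ≤ g x := fun x => by rw [hgx]; linarith [(abs_le.1 (hf.le_one x)).1]
  have hgn' : ∀ x, 0 ≤ g' x := fun x => by rw [hgx']; linarith [(abs_le.1 (hf.le_one x)).1]
  have hnorm : ‖g‖ ≤ 2 := BoundedContinuousFunction.norm_ofNormedAddCommGroup_le _ zero_le_two hb
  have hnorm' : ‖g‖ ≤ ‖g'‖ := by
    refine (BoundedContinuousFunction.norm_le (norm_nonneg _)).2 fun x => ?_
    refine le_trans ?_ (g'.norm_coe_le_norm x)
    rw [norm_of_nonneg (hgn x), norm_of_nonneg (hgn' x), hgx, hgx']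
    linarith
  have h1 := BoundedContinuousFunction.integral_le_of_levyProkhorovEDist_lt μ ν hε hlt g
    (ae_of_all _ hgn)
  have h2 := BoundedContinuousFunction.integral_eq_integral_meas_le g' ν (ae_of_all _ hgn')
  have hint : ∀ a : ℝ, IntegrableOn (fun t => ν.real {x | t ≤ g' x}) (Ioc 0 a) := fun a => by
    refine Measure.integrableOn_of_bounded (M := 1) measure_Ioc_lt_top.ne ?_ ?_
    · refine (Measurable.ennreal_toReal (Antitone.measurable ?_)).aestronglyMeasurable
      exact fun _ _ hst ↦ measure_mono (fun _ h ↦ hst.trans h)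
    · exact ae_of_all _ fun t => by
        rw [norm_of_nonneg measureReal_nonneg]; exact measureReal_le_one
  have h3 : ∫ t in Ioc 0 ‖g‖, ν.real (Metric.thickening ε {a | t ≤ g a}) ≤
      ∫ t in Ioc 0 ‖g‖, ν.real {x | t ≤ g' x} := by
    refine integral_mono_of_nonneg (ae_of_all _ fun t => measureReal_nonneg) (hint _)
      (ae_of_all _ fun t => measureReal_mono ?_)
    intro x hx
    obtain ⟨z, hz, hxz⟩ := Metric.mem_thickening_iff.1 hx
    have hz' : t ≤ f z + 1 := hz
    have := hf.lipschitz.dist_le_mul x z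
    rw [Real.dist_eq, NNReal.coe_one, one_mul] at this
    have := (abs_le.1 this).1
    show t ≤ f x + 1 + ε
    linarith
  have h4 : ∫ t in Ioc 0 ‖g‖, ν.real {x | t ≤ g' x} ≤ ∫ t in Ioc 0 ‖g'‖, ν.real {x | t ≤ g' x} :=
    setIntegral_mono_set (hint _) (ae_of_all _ fun t => measureReal_nonneg)
      (Ioc_subset_Ioc_right hnorm').eventuallyLE
  have e1 : ∫ x, g x ∂μ = ∫ x, f x ∂μ + 1 := by
    simp_rw [hgx]
    rw [integral_add (hf.integrable μ) (integrable_const _)]; simp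
  have e2 : ∫ x, g' x ∂ν = ∫ x, f x ∂ν + 1 + ε := by
    simp_rw [hgx', add_assoc]
    rw [integral_add (hf.integrable ν) (integrable_const _)]; simp
  have h5 : ε * ‖g‖ ≤ ε * 2 := by gcongr
  linarith

lemma blDist_le_of_levyProkhorov {μ ν : Measure F} [IsProbabilityMeasure μ]
    [IsProbabilityMeasure ν] {ε : ℝ} (hε : 0 < ε)
    (hlt : levyProkhorovEDist μ ν < ENNReal.ofReal ε) : blDist μ ν ≤ 3 * ε := by
  refine blDist_le (by positivity) fun f hf => ?_
  have h1 := integral_le_add_of_levyProkhorov hε hlt hf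
  have h2 := integral_le_add_of_levyProkhorov hε (levyProkhorovEDist_comm μ ν ▸ hlt) hf
  rw [abs_le]
  constructor <;> linarith

lemma tendsto_blDist_of_tendsto [SecondCountableTopology F] {μ : ℕ → ProbabilityMeasure F}
    {ν : ProbabilityMeasure F} (h : Tendsto μ atTop (𝓝 ν)) :
    Tendsto (fun i => blDist (μ i : Measure F) ν) atTop (𝓝 0) := by
  have h1 := (LevyProkhorov.continuous_ofMeasure_probabilityMeasure.tendsto ν).comp h
  rw [Metric.tendsto_atTop]
  intro ε hε
  have h2 := (EMetric.tendsto_nhds.1 h1) (ENNReal.ofReal (ε / 4)) (by simpa using hε)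
  obtain ⟨i₀, hi₀⟩ := eventually_atTop.1 h2
  refine ⟨i₀, fun i hi => ?_⟩
  have h3 := hi₀ i hi
  rw [Function.comp, LevyProkhorov.edist_probabilityMeasure_def] at h3
  have h4 := blDist_le_of_levyProkhorov (by positivity) h3
  rw [Real.dist_0_eq_abs, abs_of_nonneg (blDist_nonneg _ _)]
  linarith

end BL

/-- The limiting normal law moves with the parameter, so two moving laws are compared; Lévy's
continuity theorem brings both to the same fixed `κ`. -/
lemma tendsto_blDist_of_charFun {E : Type*} [NormedAddCommGroup E] [InnerProductSpace ℝ E]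
    [FiniteDimensional ℝ E] [MeasurableSpace E] [BorelSpace E] {μ ν : ℕ → Measure E} {κ : Measure E}
    [∀ i, IsProbabilityMeasure (μ i)] [∀ i, IsProbabilityMeasure (ν i)] [IsProbabilityMeasure κ]
    (hμ : ∀ t, Tendsto (fun i => charFun (μ i) t) atTop (𝓝 (charFun κ t)))
    (hν : ∀ t, Tendsto (fun i => charFun (ν i) t) atTop (𝓝 (charFun κ t))) :
    Tendsto (fun i => blDist (μ i) (ν i)) atTop (𝓝 0) := by
  have h1 := tendsto_blDist_of_tendsto (μ := fun i => ⟨μ i, inferInstance⟩) (ν := ⟨κ, inferInstance⟩)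
    (ProbabilityMeasure.tendsto_iff_tendsto_charFun.2 hμ)
  have h2 := tendsto_blDist_of_tendsto (μ := fun i => ⟨ν i, inferInstance⟩) (ν := ⟨κ, inferInstance⟩)
    (ProbabilityMeasure.tendsto_iff_tendsto_charFun.2 hν)
  refine squeeze_zero (fun i => blDist_nonneg _ _) (fun i => blDist_triangle (μ i) κ (ν i)) ?_
  simpa using h1.add h2

/-! ### A central limit theorem for triangular arrays -/

lemma norm_pow_sub_pow_le_nat_mul {z w : ℂ} (hz : ‖z‖ ≤ 1) (hw : ‖w‖ ≤ 1) (n : ℕ) :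
    ‖z ^ n - w ^ n‖ ≤ n * ‖z - w‖ := by
  induction n with
  | zero => simp
  | succ n ih =>
    have e : z ^ (n + 1) - w ^ (n + 1) = z ^ n * (z - w) + (z ^ n - w ^ n) * w := by ring
    have h1 : ‖z ^ n * (z - w)‖ ≤ 1 * ‖z - w‖ := by
      rw [norm_mul, norm_pow]
      gcongr
      exact pow_le_one₀ (norm_nonneg _) hz
    have h2 : ‖(z ^ n - w ^ n) * w‖ ≤ n * ‖z - w‖ * 1 := by
      rw [norm_mul]; gcongr
    rw [e]
    push_cast
    linarith [norm_add_le (z ^ n * (z - w)) ((z ^ n - w ^ n) * w)]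

lemma norm_exp_I_sub_taylor_le (x : ℝ) :
    ‖Complex.exp (x * Complex.I) - (1 + x * Complex.I - (x : ℂ) ^ 2 / 2)‖ ≤ 4 * |x| ^ 3 := by
  have hn : ‖(x : ℂ) * Complex.I‖ = |x| := by simp
  rcases le_total |x| 1 with h | h
  · have h1 := Complex.exp_bound (x := (x : ℂ) * Complex.I) (by rw [hn]; exact h) (n := 3)
      (by norm_num)
    rw [hn] at h1
    have e : ∑ m ∈ Finset.range 3, ((x : ℂ) * Complex.I) ^ m / m.factorial =
        1 + x * Complex.I - (x : ℂ) ^ 2 / 2 := by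
      simp [Finset.sum_range_succ, mul_pow, Nat.factorial]
      ring
    rw [e] at h1
    refine h1.trans ?_
    rw [mul_comm]
    gcongr
    norm_num [Nat.factorial]
  · have h1 : ‖Complex.exp (x * Complex.I)‖ = 1 := Complex.norm_exp_ofReal_mul_I x
    have h2 : ‖(1 + x * Complex.I - (x : ℂ) ^ 2 / 2)‖ ≤ 1 + |x| + |x| ^ 2 / 2 := by
      refine (norm_sub_le _ _).trans (add_le_add ((norm_add_le _ _).trans ?_) ?_)
      · rw [hn]; simp
      · simp
    have h3 := norm_sub_le (Complex.exp (x * Complex.I)) (1 + x * Complex.I - (x : ℂ) ^ 2 / 2)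
    have h4 : 1 ≤ |x| ^ 3 := one_le_pow₀ h
    have h5 : |x| ≤ |x| ^ 3 := le_self_pow₀ h (by norm_num)
    have h6 : |x| ^ 2 ≤ |x| ^ 3 := pow_le_pow_right₀ h (by norm_num)
    linarith

/-- Lyapunov's argument. The characteristic function of one summand differs from `exp (-V/2)` by at
most four times the third absolute moment plus `V²`, and `N`-th powers of numbers in the unit disc
multiply the error by at most `N`. Since `N V` converges, `N V²` tends to `0`. -/
lemma tendsto_pow_integral_exp {N : ℕ → ℕ} (hN : Tendsto N atTop atTop) {ν : ℕ → Measure ℝ}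
    [∀ i, IsProbabilityMeasure (ν i)] {ξ : ℕ → ℝ → ℝ} (hm : ∀ i, Measurable (ξ i))
    (h2i : ∀ i, Integrable (fun y => ξ i y ^ 2) (ν i))
    (h3i : ∀ i, Integrable (fun y => |ξ i y| ^ 3) (ν i))
    (h1 : ∀ i, ∫ y, ξ i y ∂(ν i) = 0) {v : ℝ}
    (h2 : Tendsto (fun i => N i * ∫ y, ξ i y ^ 2 ∂(ν i)) atTop (𝓝 v))
    (h3 : Tendsto (fun i => N i * ∫ y, |ξ i y| ^ 3 ∂(ν i)) atTop (𝓝 0)) :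
    Tendsto (fun i => (∫ y, Complex.exp (ξ i y * Complex.I) ∂(ν i)) ^ N i) atTop
      (𝓝 (Complex.exp (-(v / 2 : ℝ)))) := by
  set V : ℕ → ℝ := fun i => ∫ y, ξ i y ^ 2 ∂(ν i) with hV
  have hV0 : ∀ i, 0 ≤ V i := fun i => integral_nonneg fun y => sq_nonneg _
  have hNr : Tendsto (fun i => (N i : ℝ)) atTop atTop := tendsto_natCast_atTop_atTop.comp hN
  have hVt : Tendsto V atTop (𝓝 0) := by
    have := h2.mul hNr.inv_tendsto_atTop
    rw [mul_zero] at this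
    refine this.congr' ?_
    filter_upwards [hN.eventually (eventually_gt_atTop 0)] with i hi
    have : (N i : ℝ) ≠ 0 := by exact_mod_cast hi.ne'
    simp only [Pi.inv_apply, hV]
    field_simp
  have hNV : Tendsto (fun i => N i * V i ^ 2) atTop (𝓝 0) := by
    have := h2.mul hVt
    rw [mul_zero] at this
    exact this.congr fun i => by ring
  have i1 : ∀ i, Integrable (ξ i) (ν i) := fun i => by
    refine ((integrable_const 1).add (h2i i)).mono' (hm i).aestronglyMeasurable
      (ae_of_all _ fun y => ?_)
    rw [norm_eq_abs, Pi.add_apply]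
    nlinarith [sq_nonneg (|ξ i y| - 1), sq_abs (ξ i y)]
  have iexp : ∀ i, Integrable (fun y => Complex.exp (ξ i y * Complex.I)) (ν i) := fun i => by
    have := hm i
    refine (integrable_const (1 : ℝ)).mono' (by fun_prop) (ae_of_all _ fun y => ?_)
    rw [Complex.norm_exp_ofReal_mul_I]
  set w : ℕ → ℂ := fun i => Complex.exp (-(V i / 2 : ℝ)) with hw
  have hwpow : Tendsto (fun i => w i ^ N i) atTop (𝓝 (Complex.exp (-(v / 2 : ℝ)))) := by
    have : Tendsto (fun i => Real.exp (-(N i * V i / 2))) atTop (𝓝 (Real.exp (-(v / 2)))) :=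
      (Real.continuous_exp.tendsto _).comp ((h2.div_const 2).neg)
    have h' := (Complex.continuous_ofReal.tendsto _).comp this
    rw [Complex.ofReal_exp, Complex.ofReal_neg] at h'
    refine h'.congr fun i => ?_
    simp only [Function.comp, hw]
    rw [← Complex.exp_nat_mul, Complex.ofReal_exp]
    push_cast
    congr 1
    ring
  have hz1 : ∀ i, ‖∫ y, Complex.exp (ξ i y * Complex.I) ∂(ν i)‖ ≤ 1 := fun i => by
    have := norm_integral_le_of_norm_le_const (μ := ν i)
      (f := fun y => Complex.exp (ξ i y * Complex.I)) (C := 1)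
      (ae_of_all _ fun y => (Complex.norm_exp_ofReal_mul_I _).le)
    simpa using this
  have hw1 : ∀ i, ‖w i‖ ≤ 1 := fun i => by
    rw [hw]
    simp only [← Complex.ofReal_neg]
    rw [Complex.norm_exp_ofReal, Real.exp_le_one_iff]
    linarith [hV0 i]
  have hzw : ∀ᶠ i in atTop, ‖(∫ y, Complex.exp (ξ i y * Complex.I) ∂(ν i)) - w i‖ ≤
      4 * (∫ y, |ξ i y| ^ 3 ∂(ν i)) + V i ^ 2 := by
    filter_upwards [hVt.eventually (ge_mem_nhds (show (0 : ℝ) < 1 by norm_num))] with i hi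
    have e1 : ∫ y, (1 + ξ i y * Complex.I - (ξ i y : ℂ) ^ 2 / 2) ∂(ν i) = 1 - (V i : ℂ) / 2 := by
      have j1 : Integrable (fun y => (ξ i y : ℂ) * Complex.I) (ν i) := (i1 i).ofReal.mul_const _
      have j2 : Integrable (fun y => (ξ i y : ℂ) ^ 2 / 2) (ν i) := by
        simpa using (h2i i).ofReal.div_const (2 : ℂ)
      have j3 : Integrable (fun y => 1 + (ξ i y : ℂ) * Complex.I) (ν i) :=
        (integrable_const _).add j1
      rw [integral_sub j3 j2, integral_add (integrable_const _) j1,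
        integral_mul_const, integral_div]
      have k1 : ∫ y, (ξ i y : ℂ) ∂(ν i) = 0 := by
        rw [integral_complex_ofReal, h1 i]; simp
      have k2 : ∫ y, (ξ i y : ℂ) ^ 2 ∂(ν i) = V i := by
        rw [hV, ← integral_complex_ofReal]
        simp
      rw [k1, k2]
      simp
    have j0 : Integrable (fun y => 1 + (ξ i y : ℂ) * Complex.I - (ξ i y : ℂ) ^ 2 / 2) (ν i) := by
      refine ((integrable_const _).add ((i1 i).ofReal.mul_const _)).sub ?_
      simpa using (h2i i).ofReal.div_const (2 : ℂ)
    have e2 : ‖(∫ y, Complex.exp (ξ i y * Complex.I) ∂(ν i)) - (1 - (V i : ℂ) / 2)‖ ≤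
        4 * ∫ y, |ξ i y| ^ 3 ∂(ν i) := by
      rw [← e1, ← integral_sub (iexp i) j0, ← integral_const_mul]
      exact norm_integral_le_of_norm_le ((h3i i).const_mul _)
        (ae_of_all _ fun y => norm_exp_I_sub_taylor_le _)
    have e3 : ‖w i - (1 - (V i : ℂ) / 2)‖ ≤ V i ^ 2 := by
      have hn : ‖(-(V i / 2 : ℝ) : ℂ)‖ = V i / 2 := by
        rw [norm_neg, Complex.norm_real, norm_of_nonneg (by linarith [hV0 i])]
      have := Complex.norm_exp_sub_one_sub_id_le (x := (-(V i / 2 : ℝ) : ℂ))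
        (by rw [hn]; linarith)
      rw [hn] at this
      have e : w i - (1 - (V i : ℂ) / 2) = Complex.exp (-(V i / 2 : ℝ)) - 1 - -(V i / 2 : ℝ) := by
        simp only [hw]; push_cast; ring
      rw [e]
      refine this.trans ?_
      nlinarith [hV0 i, sq_nonneg (V i)]
    calc _ = ‖((∫ y, Complex.exp (ξ i y * Complex.I) ∂(ν i)) - (1 - (V i : ℂ) / 2)) -
          (w i - (1 - (V i : ℂ) / 2))‖ := by congr 1; ring
      _ ≤ _ := (norm_sub_le _ _).trans (add_le_add e2 e3)
  have hdiff : Tendsto (fun i => (∫ y, Complex.exp (ξ i y * Complex.I) ∂(ν i)) ^ N i - w i ^ N i)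
      atTop (𝓝 0) := by
    refine squeeze_zero_norm' (a := fun i => 4 * (N i * ∫ y, |ξ i y| ^ 3 ∂(ν i)) + N i * V i ^ 2) ?_ ?_
    · filter_upwards [hzw] with i hi
      refine (norm_pow_sub_pow_le_nat_mul (hz1 i) (hw1 i) (N i)).trans ?_
      calc _ ≤ N i * (4 * (∫ y, |ξ i y| ^ 3 ∂(ν i)) + V i ^ 2) := by gcongr
        _ = _ := by ring
    · simpa using (h3.const_mul 4).add hNV
  simpa using hdiff.add hwpow

/-! ### Sums of independent variables and convergence in probability -/

/-- Variance plus squared bias, the variance of one summand being bounded by its second moment. -/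
lemma integral_sum_sub_sq_le {n : ℕ} (ν : Measure ℝ) [IsProbabilityMeasure ν] {g : ℝ → ℝ}
    (hg : MemLp g 2 ν) (b : ℝ) :
    Integrable (fun x : Fin n → ℝ => (∑ j, g (x j) - b) ^ 2) (Measure.pi fun _ => ν) ∧
    ∫ x : Fin n → ℝ, (∑ j, g (x j) - b) ^ 2 ∂(Measure.pi fun _ => ν) ≤
      n * ∫ y, g y ^ 2 ∂ν + (n * ∫ y, g y ∂ν - b) ^ 2 := by
  set P := Measure.pi fun _ : Fin n => ν
  have hj : ∀ j : Fin n, MemLp (fun x : Fin n → ℝ => g (x j)) 2 P := fun j =>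
    hg.comp_measurePreserving (measurePreserving_eval (fun _ => ν) j)
  have hS : MemLp (fun x : Fin n → ℝ => ∑ j, g (x j)) 2 P := memLp_finsetSum _ fun j _ => hj j
  have hSb : MemLp (fun x : Fin n → ℝ => ∑ j, g (x j) - b) 2 P := hS.sub (memLp_const b)
  refine ⟨hSb.integrable_sq, ?_⟩
  have hvar := variance_sum_pi (μ := fun _ : Fin n => ν) (X := fun _ => g) fun _ => hg
  have e0 : (∑ i : Fin n, fun ω : Fin n → ℝ => g (ω i)) = fun ω => ∑ i, g (ω i) := by
    ext; simp
  rw [e0] at hvar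
  have hES : ∫ x, ∑ j, g (x j) ∂P = n * ∫ y, g y ∂ν := by
    rw [integral_finsetSum _ fun j _ => (hj j).integrable one_le_two]
    have : ∀ j : Fin n, ∫ x : Fin n → ℝ, g (x j) ∂P = ∫ y, g y ∂ν := fun j => by
      have := (measurePreserving_eval (fun _ : Fin n => ν) j).map_eq
      conv_rhs => rw [← this]
      rw [integral_map (measurable_pi_apply j).aemeasurable (by rw [this]; exact hg.1)]
    simp [this]
  have hv1 := variance_eq_sub hSb
  have hv2 : Var[fun x : Fin n → ℝ => ∑ j, g (x j) - b; P] = Var[fun x => ∑ j, g (x j); P] :=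
    variance_sub_const hS.1 b
  have hE : ∫ x, (∑ j, g (x j) - b) ∂P = n * ∫ y, g y ∂ν - b := by
    rw [integral_sub (hS.integrable one_le_two) (integrable_const _), hES]; simp
  rw [hv2, hvar] at hv1
  have hvg : Var[g; ν] ≤ ∫ y, g y ^ 2 ∂ν := by
    rw [variance_eq_sub hg]
    have : ν[g ^ 2] = ∫ y, g y ^ 2 ∂ν := rfl
    rw [this]
    linarith [sq_nonneg (ν[g])]
  have e1 : P[(fun x : Fin n → ℝ => ∑ j, g (x j) - b) ^ 2] = ∫ x, (∑ j, g (x j) - b) ^ 2 ∂P := rfl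
  rw [e1, hE] at hv1
  simp only [Finset.sum_const, Finset.card_univ, Fintype.card_fin, nsmul_eq_mul] at hv1
  have : (n : ℝ) * Var[g; ν] ≤ n * ∫ y, g y ^ 2 ∂ν := by gcongr
  linarith

lemma probDist_nonneg {S : Type*} [MeasurableSpace S] (μ : Measure S) (Y : S → ℝ) :
    0 ≤ probDist μ Y := ENNReal.toReal_nonneg

lemma probDist_le_integral {S : Type*} [MeasurableSpace S] {μ : Measure S} {Y Z : S → ℝ}
    (hZ : Integrable Z μ) (h : ∀ x, |Y x| ≤ Z x) : probDist μ Y ≤ ∫ x, Z x ∂μ := by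
  have hZ0 : ∀ x, 0 ≤ Z x := fun x => (abs_nonneg _).trans (h x)
  unfold probDist
  rw [integral_eq_lintegral_of_nonneg_ae (ae_of_all _ hZ0) hZ.1]
  have hfin : ∫⁻ x, ENNReal.ofReal (Z x) ∂μ ≠ ⊤ := by
    have := hZ.2
    rw [hasFiniteIntegral_iff_ofReal (ae_of_all _ hZ0)] at this
    exact this.ne
  refine ENNReal.toReal_mono hfin (lintegral_mono fun x => ENNReal.ofReal_le_ofReal ?_)
  refine le_trans ?_ (h x)
  exact div_le_self (abs_nonneg _) (by linarith [abs_nonneg (Y x)])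

lemma tendsto_probDist_of_sq {S : ℕ → Type*} [∀ i, MeasurableSpace (S i)] {μ : ∀ i, Measure (S i)}
    [∀ i, IsProbabilityMeasure (μ i)] {Y : ∀ i, S i → ℝ}
    (hi : ∀ i, Integrable (fun x => Y i x ^ 2) (μ i))
    (h : Tendsto (fun i => ∫ x, Y i x ^ 2 ∂(μ i)) atTop (𝓝 0)) :
    Tendsto (fun i => probDist (μ i) (Y i)) atTop (𝓝 0) := by
  rw [Metric.tendsto_atTop]
  intro ε hε
  obtain ⟨i₀, h₀⟩ := (Metric.tendsto_atTop.1 h) (ε ^ 2 / 4) (by positivity)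
  refine ⟨i₀, fun i hi' => ?_⟩
  have h1 := h₀ i hi'
  rw [Real.dist_0_eq_abs] at h1
  have h2 := (le_abs_self _).trans_lt h1
  rw [Real.dist_0_eq_abs, abs_of_nonneg (probDist_nonneg _ _)]
  -- The elementary inequality `|Y| ≤ ε/2 + Y²/ε` trades the first moment for the second.
  have hint : Integrable (fun x => ε / 2 + 1 / ε * Y i x ^ 2) (μ i) :=
    (integrable_const _).add ((hi i).const_mul _)
  have h3 := probDist_le_integral hint (Y := Y i) fun x => by
    have e : ε / 2 + 1 / ε * Y i x ^ 2 = (ε ^ 2 / 2 + |Y i x| ^ 2) / ε := by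
      rw [sq_abs]; field_simp
    rw [e, le_div_iff₀ hε]
    nlinarith [sq_nonneg (|Y i x| - ε / 2), sq_nonneg (|Y i x|), sq_nonneg ε]
  rw [integral_add (integrable_const _) ((hi i).const_mul _), integral_const_mul] at h3
  simp only [integral_const, probReal_univ, one_smul] at h3
  have h4 : 1 / ε * ∫ x, Y i x ^ 2 ∂(μ i) < 1 / ε * (ε ^ 2 / 4) := by gcongr
  have h5 : 1 / ε * (ε ^ 2 / 4) = ε / 4 := by field_simp
  linarith

/-- Chebyshev's inequality. -/
lemma measure_le_abs_le {S : Type*} [MeasurableSpace S] {μ : Measure S} {Y : S → ℝ}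
    (hi : Integrable (fun x => Y x ^ 2) μ) {ε : ℝ} (hε : 0 < ε) :
    μ {x | ε ≤ |Y x|} ≤ ENNReal.ofReal ((∫ x, Y x ^ 2 ∂μ) / ε ^ 2) := by
  have h1 : μ {x | ε ≤ |Y x|} ≤ μ {x | ENNReal.ofReal (ε ^ 2) ≤ ENNReal.ofReal (Y x ^ 2)} := by
    refine measure_mono fun x hx => ENNReal.ofReal_le_ofReal ?_
    have hx' : ε ≤ |Y x| := hx
    rw [← sq_abs (Y x)]
    gcongr
  have h2 := meas_ge_le_lintegral_div (μ := μ) hi.1.aemeasurable.ennreal_ofReal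
    (ε := ENNReal.ofReal (ε ^ 2)) (by simpa using hε.ne') ENNReal.ofReal_ne_top
  refine h1.trans (h2.trans ?_)
  rw [ENNReal.ofReal_div_of_pos (by positivity),
    ofReal_integral_eq_lintegral_ofReal hi (ae_of_all _ fun x => sq_nonneg _)]

/-- The events `E i` become negligible. -/
def Negligible {S : ℕ → Type*} [∀ i, MeasurableSpace (S i)] (μ : ∀ i, Measure (S i))
    (E : ∀ i, Set (S i)) : Prop :=
  Tendsto (fun i => μ i (E i)) atTop (𝓝 0)

namespace Negligible

variable {S : ℕ → Type*} [∀ i, MeasurableSpace (S i)] {μ : ∀ i, Measure (S i)} {E E' : ∀ i, Set (S i)}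

lemma mono (h : Negligible μ E') (hE : ∀ᶠ i in atTop, E i ⊆ E' i) : Negligible μ E := by
  refine tendsto_of_tendsto_of_tendsto_of_le_of_le' tendsto_const_nhds h
    (Eventually.of_forall fun i => zero_le) ?_
  filter_upwards [hE] with i hi using measure_mono hi

lemma union (h : Negligible μ E) (h' : Negligible μ E') : Negligible μ fun i => E i ∪ E' i := by
  have := Tendsto.add h h'
  rw [add_zero] at this
  exact tendsto_of_tendsto_of_tendsto_of_le_of_le tendsto_const_nhds this (fun i => zero_le)
    fun i => measure_union_le _ _

lemma iUnion {ι : Type*} [Fintype ι] {E : ι → ∀ i, Set (S i)} (h : ∀ k, Negligible μ (E k)) :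
    Negligible μ fun i => ⋃ k, E k i := by
  have := tendsto_finsetSum Finset.univ fun k _ => h k
  rw [Finset.sum_const_zero] at this
  exact tendsto_of_tendsto_of_tendsto_of_le_of_le tendsto_const_nhds this (fun i => zero_le)
    fun i => measure_iUnion_fintype_le _ _

lemma of_sq {Y : ∀ i, S i → ℝ} (hi : ∀ i, Integrable (fun x => Y i x ^ 2) (μ i))
    (h : Tendsto (fun i => ∫ x, Y i x ^ 2 ∂(μ i)) atTop (𝓝 0)) {ε : ℝ} (hε : 0 < ε) :
    Negligible μ fun i => {x | ε ≤ |Y i x|} := by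
  have h2 : Tendsto (fun i => ENNReal.ofReal ((∫ x, Y i x ^ 2 ∂(μ i)) / ε ^ 2)) atTop (𝓝 0) := by
    have := (ENNReal.continuous_ofReal.tendsto _).comp (h.div_const (ε ^ 2))
    simpa [Function.comp_def] using this
  exact tendsto_of_tendsto_of_tendsto_of_le_of_le tendsto_const_nhds h2 (fun i => zero_le)
    fun i => measure_le_abs_le (hi i) hε

end Negligible

end NIG

end

noncomputable section

namespace NIG

open Set Real

variable {c B h : ℝ} {ρ θ : E4} {n : ℕ}

/-! ### Second order expansions of the log-likelihood -/

/-- Two integrations of a one-sided bound, in the form of monotonicity. Applied to a function and to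
its negative it gives the upper and the lower quadratic bounds for the log-likelihood. -/
lemma le_quadratic_of_deriv2_le {g g' g'' : ℝ → ℝ} {b : ℝ}
    (hg : ∀ t ∈ Icc (0 : ℝ) 1, HasDerivAt g (g' t) t)
    (hg' : ∀ t ∈ Icc (0 : ℝ) 1, HasDerivAt g' (g'' t) t)
    (hb : ∀ t ∈ Icc (0 : ℝ) 1, g'' t ≤ b) : g 1 ≤ g 0 + g' 0 + b / 2 := by
  have anti : ∀ f f' : ℝ → ℝ, (∀ t ∈ Icc (0 : ℝ) 1, HasDerivAt f (f' t) t) →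
      (∀ t ∈ Icc (0 : ℝ) 1, f' t ≤ 0) → AntitoneOn f (Icc 0 1) := fun f f' hf hf' => by
    refine antitoneOn_of_deriv_nonpos (convex_Icc 0 1)
      (fun t ht => (hf t ht).continuousAt.continuousWithinAt) ?_ ?_
    · rw [interior_Icc]
      exact fun t ht => (hf t (Ioo_subset_Icc_self ht)).differentiableAt.differentiableWithinAt
    · rw [interior_Icc]
      intro t ht
      rw [(hf t (Ioo_subset_Icc_self ht)).deriv]
      exact hf' t (Ioo_subset_Icc_self ht)
  have h1 : ∀ t ∈ Icc (0 : ℝ) 1, g' t ≤ g' 0 + b * t := fun t ht => by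
    have := anti (fun t => g' t - b * t) (fun t => g'' t - b)
      (fun t ht => by
        convert! (hg' t ht).sub ((hasDerivAt_id t).const_mul b) using 1
        simp)
      (fun t ht => by linarith [hb t ht]) (left_mem_Icc.2 zero_le_one) ht ht.1
    simp only [mul_zero, sub_zero] at this
    linarith
  have := anti (fun t => g t - (g' 0 * t + b / 2 * t ^ 2)) (fun t => g' t - (g' 0 + b * t))
    (fun t ht => by
      have h2 : HasDerivAt (fun t : ℝ => t ^ 2) (2 * t) t := by simpa using hasDerivAt_pow 2 t
      convert! (hg t ht).sub (((hasDerivAt_id t).const_mul (g' 0)).add (h2.const_mul (b / 2))) using 1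
      ring)
    (fun t ht => by linarith [h1 t ht]) (left_mem_Icc.2 zero_le_one) (right_mem_Icc.2 zero_le_one)
    zero_le_one
  norm_num at this
  linarith

/-- The score of the sample. -/
def scoreL (h : ℝ) {n : ℕ} (x : Fin n → ℝ) (ρ : E4) (k : Fin 4) : ℝ := ∑ j, score1 h (x j) ρ k

/-- The Hessian of the log-likelihood of the sample. -/
def hessL (h : ℝ) {n : ℕ} (x : Fin n → ℝ) (ρ : E4) (k l : Fin 4) : ℝ := ∑ j, hess1 h (x j) ρ k l

/-- The quadratic form of the Hessian of the log-likelihood. -/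
def hessQ (h : ℝ) {n : ℕ} (x : Fin n → ℝ) (ρ v : E4) : ℝ := ∑ k, ∑ l, hessL h x ρ k l * v k * v l

lemma hasDerivAt_segment (θ v : E4) (t : ℝ) : HasDerivAt (fun t : ℝ => θ + t • v) v t := by
  simpa using ((hasDerivAt_id t).smul_const v).const_add θ

lemma hasDerivAt_logLik_line (hh : 0 < h) (x : Fin n → ℝ) (v : E4) {t : ℝ}
    (ht : θ + t • v ∈ region) :
    HasDerivAt (fun t => logLik h n (θ + t • v) x) (∑ k, scoreL h x (θ + t • v) k * v k) t := by
  have := (hasFDerivAt_logLik hh ht n x).comp_hasDerivAt t (hasDerivAt_segment θ v t)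
  rw [lin_apply] at this
  exact this

lemma hasDerivAt_scoreL_line (hh : 0 < h) (x : Fin n → ℝ) (v : E4) {t : ℝ}
    (ht : θ + t • v ∈ region) (l : Fin 4) :
    HasDerivAt (fun t => scoreL h x (θ + t • v) l) (∑ k, hessL h x (θ + t • v) k l * v k) t := by
  have := (hasFDerivAt_score_sum hh ht n x l).comp_hasDerivAt t (hasDerivAt_segment θ v t)
  rw [lin_apply] at this
  exact this

lemma logLik_le_quadratic (hh : 0 < h) (x : Fin n → ℝ) {v : E4} {b : ℝ}
    (hreg : ∀ t ∈ Icc (0 : ℝ) 1, θ + t • v ∈ region)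
    (hb : ∀ t ∈ Icc (0 : ℝ) 1, hessQ h x (θ + t • v) v ≤ b) :
    logLik h n (θ + v) x ≤ logLik h n θ x + ∑ k, scoreL h x θ k * v k + b / 2 := by
  have := le_quadratic_of_deriv2_le (g := fun t => logLik h n (θ + t • v) x)
    (g' := fun t => ∑ k, scoreL h x (θ + t • v) k * v k)
    (g'' := fun t => hessQ h x (θ + t • v) v) (b := b)
    (fun t ht => hasDerivAt_logLik_line hh x v (hreg t ht)) (fun t ht => ?_) hb
  · simpa using this
  · have h1 := HasDerivAt.fun_sum (u := Finset.univ) fun l _ =>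
      (hasDerivAt_scoreL_line hh x v (hreg t ht) l).mul_const (v l)
    convert! h1 using 1
    unfold hessQ
    simp_rw [Finset.sum_mul]
    exact Finset.sum_comm

lemma quadratic_le_logLik (hh : 0 < h) (x : Fin n → ℝ) {v : E4} {b : ℝ}
    (hreg : ∀ t ∈ Icc (0 : ℝ) 1, θ + t • v ∈ region)
    (hb : ∀ t ∈ Icc (0 : ℝ) 1, b ≤ hessQ h x (θ + t • v) v) :
    logLik h n θ x + ∑ k, scoreL h x θ k * v k + b / 2 ≤ logLik h n (θ + v) x := by
  have := le_quadratic_of_deriv2_le (g := fun t => -logLik h n (θ + t • v) x)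
    (g' := fun t => -∑ k, scoreL h x (θ + t • v) k * v k)
    (g'' := fun t => -hessQ h x (θ + t • v) v) (b := -b)
    (fun t ht => (hasDerivAt_logLik_line hh x v (hreg t ht)).neg) (fun t ht => ?_)
    (fun t ht => neg_le_neg (hb t ht))
  · simp at this
    linarith
  · have h1 := HasDerivAt.fun_sum (u := Finset.univ) fun l _ =>
      (hasDerivAt_scoreL_line hh x v (hreg t ht) l).mul_const (v l)
    convert! h1.neg using 1
    unfold hessQ
    simp_rw [Finset.sum_mul]
    rw [Finset.sum_comm]

/-- The intermediate point depends on the component `l`. This is harmless, as the Hessian is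
controlled along the whole segment. -/
lemma exists_scoreL_sub_eq (hh : 0 < h) (x : Fin n → ℝ) {v : E4}
    (hreg : ∀ t ∈ Icc (0 : ℝ) 1, θ + t • v ∈ region) (l : Fin 4) :
    ∃ t ∈ Icc (0 : ℝ) 1, scoreL h x (θ + v) l - scoreL h x θ l =
      ∑ k, hessL h x (θ + t • v) k l * v k := by
  obtain ⟨t, ht, he⟩ := exists_hasDerivAt_eq_slope (fun t => scoreL h x (θ + t • v) l)
    (fun t => ∑ k, hessL h x (θ + t • v) k l * v k) (zero_lt_one (α := ℝ))
    (fun t ht => (hasDerivAt_scoreL_line hh x v (hreg t ht) l).continuousAt.continuousWithinAt)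
    (fun t ht => hasDerivAt_scoreL_line hh x v (hreg t (Ioo_subset_Icc_self ht)) l)
  refine ⟨t, Ioo_subset_Icc_self ht, ?_⟩
  rw [he]
  simp

/-- The random Lipschitz constant of an entry of the rescaled Hessian. -/
def zsum (h : ℝ) {n : ℕ} (x : Fin n → ℝ) (k l : Fin 4) : ℝ :=
  rate h n k * rate h n l * ∑ j, zsize k l h (x j)

lemma exists_hessL_lipschitz (hc : 0 < c) (B : ℝ) : ∃ C, 0 ≤ C ∧ ∀ (n : ℕ) (x : Fin n → ℝ) k l h,
    0 < n → 0 < h → ∀ ρ ∈ box c B, ∀ σ ∈ box c B,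
      |rate h n k * rate h n l * (hessL h x ρ k l - hessL h x σ k l)| ≤
        C * zsum h x k l * ‖ρ - σ‖ := by
  obtain ⟨C, hC, H⟩ := exists_hess1_lipschitz hc B
  refine ⟨C, hC, fun n x k l h hn hh ρ hρ σ hσ => ?_⟩
  have hr := mul_pos (rate_pos hn hh k) (rate_pos hn hh l)
  rw [abs_mul, abs_of_pos hr, hessL, hessL, ← Finset.sum_sub_distrib]
  calc _ ≤ rate h n k * rate h n l * ∑ j, C * zsize k l h (x j) * ‖ρ - σ‖ := by
        refine mul_le_mul_of_nonneg_left ?_ hr.le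
        refine (Finset.abs_sum_le_sum_abs _ _).trans (Finset.sum_le_sum fun j _ => ?_)
        exact (H k l h (x j) hh ρ hρ σ hσ).2
    _ = _ := by rw [← Finset.sum_mul, ← Finset.mul_sum, zsum]; ring

/-! ### Moments of the Lipschitz constants -/

lemma measurable_zsize (k l : Fin 4) (h : ℝ) : Measurable (zsize k l h) := by
  have h1 := continuous_msize h
  unfold zsize qsize
  split_ifs <;> fun_prop

lemma covScale_pos (hh : 0 < h) (k l : Fin 4) : 0 < covScale k l h := by
  unfold covScale
  split_ifs <;> positivity

lemma qsize_le_mom {m : ℝ} (hm : 0 ≤ m) : qsize m ≤ 2 * mom m := by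
  have h3 := pow_le_mom hm (p := 3) (by norm_num) (by norm_num)
  have h6 : 0 ≤ m ^ 6 := by positivity
  unfold qsize mom at *
  have : 0 ≤ √m * m := by positivity
  linarith

lemma qsize_sq_le_mom {m : ℝ} (hm : 0 ≤ m) : qsize m ^ 2 ≤ 4 * mom m := by
  have h3 := pow_le_mom hm (p := 3) (by norm_num) (by norm_num)
  have h6 := pow_le_mom hm (p := 6) (by norm_num) (by norm_num)
  have e : (√m * m) ^ 2 = m ^ 3 := by rw [mul_pow, sq_sqrt hm]; ring
  have e2 : (m ^ 3) ^ 2 = m ^ 6 := by ring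
  unfold qsize
  nlinarith [sq_nonneg (√m * m - m ^ 3)]

/-- `zsize` and its square are bounded by affine functions of `mom`, whose mean is `O(h)`. The scale
`covScale` keeps the first moment bounded, while the second may grow like `1/h`; after division by
the sample size this becomes `1/T`. -/
lemma exists_zsize_moments (hc : 0 < c) (B : ℝ) : ∃ C, 0 ≤ C ∧ ∀ h, 0 < h → h ≤ 1 →
    ∀ ρ ∈ box c B, ∀ k l, MemLp (zsize k l h) 2 (inc h ρ) ∧
      covScale k l h * ∫ y, zsize k l h y ∂(inc h ρ) ≤ C ∧
      covScale k l h ^ 2 * ∫ y, zsize k l h y ^ 2 ∂(inc h ρ) ≤ C / h := by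
  obtain ⟨C, hC, H⟩ := exists_moment hc B
  refine ⟨8 * (1 + C), by positivity, fun h hh h1 ρ hρ k l => ?_⟩
  have hpr := isProbabilityMeasure_inc hh (box_subset_region hc hρ)
  have hm0 : ∀ y, 0 ≤ msize h y := fun y => (msize_pos hh y).le
  have hmom0 : ∀ y, 0 ≤ mom (msize h y) := fun y => mom_nonneg (hm0 y)
  obtain ⟨hi, hle⟩ := H h hh h1 ρ hρ (fun y => mom (msize h y))
    (continuous_mom.comp (continuous_msize h)).measurable 1 zero_le_one
    fun y => by rw [abs_of_nonneg (hmom0 y), one_mul]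
  simp_rw [fun y => abs_of_nonneg (hmom0 y), mul_one] at hle
  have hz0 : ∀ y, 0 ≤ zsize k l h y := zsize_nonneg hh k l
  -- all sizes are affine in `mom`
  have bound : ∀ f : ℝ → ℝ, Measurable f → (∀ y, 0 ≤ f y) → ∀ a b : ℝ, 0 ≤ b →
      (∀ y, f y ≤ a + b * mom (msize h y)) →
      Integrable f (inc h ρ) ∧ ∫ y, f y ∂(inc h ρ) ≤ a + b * (C * h) := by
    intro f hf hf0 a b hb hfab
    have hint : Integrable (fun y => a + b * mom (msize h y)) (inc h ρ) :=
      (integrable_const a).add (hi.const_mul b)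
    have hfi : Integrable f (inc h ρ) := hint.mono' hf.aestronglyMeasurable
      (ae_of_all _ fun y => by rw [norm_of_nonneg (hf0 y)]; exact hfab y)
    refine ⟨hfi, (integral_mono hfi hint hfab).trans ?_⟩
    rw [integral_add (integrable_const a) (hi.const_mul b), integral_const_mul]
    simp only [integral_const, probReal_univ, one_smul]
    gcongr
  have hmz := measurable_zsize k l h
  have h3 : ∀ y, msize h y ^ 3 ≤ mom (msize h y) := fun y => pow_le_mom (hm0 y) (by norm_num)
    (by norm_num)
  have h6 : ∀ y, (1 + msize h y ^ 3) ^ 2 ≤ 2 + 2 * mom (msize h y) := fun y => by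
    have := pow_le_mom (hm0 y) (p := 6) (by norm_num) (by norm_num)
    nlinarith [sq_nonneg (msize h y ^ 3 - 1)]
  have hhC : C * h ≤ C := by nlinarith
  have hss : √h * √h = h := mul_self_sqrt hh.le
  have hs1 : √h ≤ 1 := sqrt_le_one.2 h1
  have hs0 := sqrt_pos.2 hh
  have main : ∃ a b a' b' : ℝ, 0 ≤ b ∧ 0 ≤ b' ∧ (∀ y, zsize k l h y ≤ a + b * mom (msize h y)) ∧
      (∀ y, zsize k l h y ^ 2 ≤ a' + b' * mom (msize h y)) ∧
      covScale k l h * (a + b * (C * h)) ≤ 8 * (1 + C) ∧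
      covScale k l h ^ 2 * (a' + b' * (C * h)) ≤ 8 * (1 + C) / h := by
    -- In the mixed blocks `zsize` carries the factor `h`, against a scale of only `1/√h`, so both
    -- bounds hold with room to spare.
    have mixed : (∀ y, zsize k l h y = h * (1 + msize h y ^ 3)) → covScale k l h = 1 / √h →
        ∃ a b a' b' : ℝ, 0 ≤ b ∧ 0 ≤ b' ∧ (∀ y, zsize k l h y ≤ a + b * mom (msize h y)) ∧
      (∀ y, zsize k l h y ^ 2 ≤ a' + b' * mom (msize h y)) ∧
      covScale k l h * (a + b * (C * h)) ≤ 8 * (1 + C) ∧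
      covScale k l h ^ 2 * (a' + b' * (C * h)) ≤ 8 * (1 + C) / h := by
      intro hz hcs
      refine ⟨h, h, h ^ 2 * 2, h ^ 2 * 2, hh.le, by positivity, fun y => ?_, fun y => ?_, ?_, ?_⟩
      · rw [hz]; nlinarith [h3 y]
      · rw [hz, mul_pow]
        have := h6 y
        have : h ^ 2 * (1 + msize h y ^ 3) ^ 2 ≤ h ^ 2 * (2 + 2 * mom (msize h y)) := by gcongr
        linarith
      · rw [hcs, one_div, inv_mul_eq_div, div_le_iff₀ hs0]
        have : h * (1 + C * h) ≤ √h * (1 * (1 + C)) := by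
          nth_rewrite 1 [← hss]
          rw [mul_assoc]
          gcongr
        nlinarith [mul_nonneg hs0.le (add_nonneg zero_le_one hC)]
      · rw [hcs, one_div, inv_pow, sq_sqrt hh.le, inv_mul_eq_div]
        gcongr
        have : h ^ 2 ≤ 1 := pow_le_one₀ hh.le h1
        have e : h ^ 2 * 2 + h ^ 2 * 2 * (C * h) = h ^ 2 * (2 + 2 * (C * h)) := by ring
        rw [e]
        have : h ^ 2 * (2 + 2 * (C * h)) ≤ 1 * (2 + 2 * (C * h)) := by gcongr
        linarith
    by_cases hk : k < 2 <;> by_cases hl : l < 2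
    · have hz : ∀ y, zsize k l h y = h + qsize (msize h y) := fun y => by simp [zsize, hk, hl]
      have hcs : covScale k l h = 1 / h := by simp [covScale, hk, hl]
      refine ⟨h, 2, 2 * h ^ 2, 8, by norm_num, by norm_num, fun y => ?_, fun y => ?_, ?_, ?_⟩
      · rw [hz]; linarith [qsize_le_mom (hm0 y)]
      · rw [hz]
        nlinarith [qsize_sq_le_mom (hm0 y), sq_nonneg (h - qsize (msize h y))]
      · rw [hcs, one_div, inv_mul_eq_div, div_le_iff₀ hh]
        nlinarith
      · rw [hcs, one_div, inv_pow, inv_mul_eq_div, div_le_div_iff₀ (by positivity) hh]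
        have : 0 < h * h := by positivity
        nlinarith
    · exact mixed (fun y => by simp [zsize, hk, hl]) (by simp [covScale, hk, hl])
    · exact mixed (fun y => by simp [zsize, hk, hl]) (by simp [covScale, hk, hl])
    · have hz : ∀ y, zsize k l h y = 1 + msize h y ^ 3 := fun y => by simp [zsize, hk, hl]
      have hcs : covScale k l h = 1 := by simp [covScale, hk, hl]
      refine ⟨1, 1, 2, 2, by norm_num, by norm_num, fun y => ?_, fun y => ?_, ?_, ?_⟩
      · rw [hz]; linarith [h3 y]
      · rw [hz]; exact h6 y
      · rw [hcs]; linarith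
      · rw [hcs, one_pow, one_mul, le_div_iff₀ hh]
        nlinarith
  obtain ⟨a, b, a', b', hb, hb', hz1, hz2, hm1, hm2⟩ := main
  obtain ⟨i1, l1⟩ := bound _ hmz hz0 a b hb hz1
  obtain ⟨i2, l2⟩ := bound _ (hmz.pow_const 2) (fun y => sq_nonneg _) a' b' hb' hz2
  have hcp := covScale_pos hh k l
  refine ⟨(memLp_two_iff_integrable_sq hmz.aestronglyMeasurable).2 i2, le_trans ?_ hm1,
    le_trans ?_ hm2⟩ <;> gcongr

end NIG

end

/-! ### Central limit theorem for the score, law of large numbers for the information -/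

noncomputable section

namespace NIG

open Set Real

variable {c B : ℝ}

/-- The law of the sample of `n` increments. -/
def dat (h : ℝ) (n : ℕ) (ρ : E4) : Measure (Fin n → ℝ) := Measure.pi fun _ => inc h ρ

lemma isProbabilityMeasure_dat {h : ℝ} (hh : 0 < h) (n : ℕ) {ρ : E4} (hρ : ρ ∈ region) :
    IsProbabilityMeasure (dat h n ρ) := by
  have := isProbabilityMeasure_inc hh hρ
  unfold dat
  infer_instance

namespace Regime

variable {N : ℕ → ℕ} {h : ℕ → ℝ} {θ : ℕ → E4} {θ₀ : E4} (R : Regime c B N h θ θ₀)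
include R

lemma tendsto_N_real : Tendsto (fun i => (N i : ℝ)) atTop atTop := by
  refine tendsto_atTop_mono (fun i => ?_) R.tendsto_T
  exact mul_le_of_le_one_right (Nat.cast_nonneg _) (R.le_one i)

lemma tendsto_N : Tendsto N atTop atTop := tendsto_natCast_atTop_iff.1 R.tendsto_N_real

lemma prob_inc (i : ℕ) : IsProbabilityMeasure (inc (h i) (θ i)) :=
  isProbabilityMeasure_inc (R.pos i) (R.reg i)

lemma prob_dat (i : ℕ) : IsProbabilityMeasure (dat (h i) (N i) (θ i)) :=
  isProbabilityMeasure_dat (R.pos i) _ (R.reg i)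

lemma tendsto_rate (k : Fin 4) : Tendsto (fun i => rate (h i) (N i) k) atTop (𝓝 0) := by
  have h1 : Tendsto (fun i => 1 / √((N i : ℝ) * h i)) atTop (𝓝 0) := by
    simp_rw [one_div]
    exact (tendsto_sqrt_atTop.comp R.tendsto_T).inv_tendsto_atTop
  have h2 : Tendsto (fun i => 1 / √(N i : ℝ)) atTop (𝓝 0) := by
    simp_rw [one_div]
    exact (tendsto_sqrt_atTop.comp R.tendsto_N_real).inv_tendsto_atTop
  fin_cases k
  exacts [h1, h1, h2, h2]

/-- Characteristic functions of the rescaled score. -/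
lemma tendsto_integral_exp_score {t : ℕ → Fin 4 → ℝ} {t₀ : Fin 4 → ℝ}
    (ht : ∀ k, Tendsto (fun i => t i k) atTop (𝓝 (t₀ k))) :
    Tendsto (fun i => ∫ x, Complex.exp (((∑ k, t i k *
        (rate (h i) (N i) k * scoreL (h i) x (θ i) k) : ℝ) : ℂ) * Complex.I)
        ∂(dat (h i) (N i) (θ i))) atTop
      (𝓝 (Complex.exp (-(((∑ k, ∑ l, t₀ k * t₀ l * fisher θ₀ k l) / 2 : ℝ) : ℂ)))) := by
  have hpr := R.prob_inc
  set ξ : ℕ → ℝ → ℝ := fun i y => ∑ k, t i k * (rate (h i) (N i) k * score1 (h i) y (θ i) k) with hξ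
  have hξc : ∀ i, Continuous (ξ i) := fun i => by
    refine continuous_finsetSum _ fun k _ => ?_
    exact continuous_const.mul (continuous_const.mul (continuous_score1 (R.pos i) (R.reg i) k))
  obtain ⟨C, hC, H⟩ := exists_score1_le R.c_pos B
  obtain ⟨D, hD, HD⟩ := exists_integral_pow_le R.c_pos B
  set s : ℕ → ℝ := fun i => ∑ k, |t i k| with hs
  have hs0 : ∀ i, 0 ≤ s i := fun i => Finset.sum_nonneg fun k _ => abs_nonneg _
  have hst : Tendsto s atTop (𝓝 (∑ k, |t₀ k|)) := tendsto_finsetSum _ fun k _ => (ht k).abs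
  set a : ℕ → ℝ := fun i => 1 / √((N i : ℝ) * h i) with ha
  set b : ℕ → ℝ := fun i => 1 / √(N i : ℝ) with hb
  have ha0 : ∀ i, 0 ≤ a i := fun i => by positivity
  have hb0 : ∀ i, 0 ≤ b i := fun i => by positivity
  have hat : Tendsto a atTop (𝓝 0) := R.tendsto_rate 0
  have hbt : Tendsto b atTop (𝓝 0) := R.tendsto_rate 2
  have haN : ∀ i, N i * (a i * a i) = 1 / h i := fun i => by
    exact nat_mul_rate_mul (R.N_pos i) (R.pos i) 0 0
  have hbN : ∀ i, N i * (b i * b i) = 1 := fun i => by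
    exact nat_mul_rate_mul (R.N_pos i) (R.pos i) 2 2
  have hle : ∀ i y, |ξ i y| ≤ s i * (C * (a i * msize (h i) y + b i)) := fun i y => by
    obtain ⟨a0, a1, a2, a3, -⟩ := H (h i) y (R.pos i) (R.le_one i) _ (R.mem i)
    have hm := (msize_pos (R.pos i) y).le
    rw [hs, Finset.sum_mul]
    refine (Finset.abs_sum_le_sum_abs _ _).trans (Finset.sum_le_sum fun k _ => ?_)
    rw [abs_mul]
    gcongr
    have h1 : ∀ u, |u| ≤ C * msize (h i) y → |a i * u| ≤ C * (a i * msize (h i) y + b i) :=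
      fun u hu => by
        rw [abs_mul, abs_of_nonneg (ha0 i)]
        calc _ ≤ a i * (C * msize (h i) y) := mul_le_mul_of_nonneg_left hu (ha0 i)
          _ ≤ _ := by nlinarith [mul_nonneg hC (hb0 i)]
    have h2 : ∀ u, |u| ≤ C → |b i * u| ≤ C * (a i * msize (h i) y + b i) := fun u hu => by
        rw [abs_mul, abs_of_nonneg (hb0 i)]
        calc _ ≤ b i * C := mul_le_mul_of_nonneg_left hu (hb0 i)
          _ ≤ _ := by nlinarith [mul_nonneg hC (mul_nonneg (ha0 i) hm)]
    fin_cases k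
    exacts [h1 _ a0, h1 _ a1, h2 _ a2, h2 _ a3]
  have hle3 : ∀ i y, |ξ i y| ^ 3 ≤ 4 * (s i * C) ^ 3 * (a i ^ 3 * msize (h i) y ^ 3 + b i ^ 3) :=
    fun i y => by
      have hm := (msize_pos (R.pos i) y).le
      have h1 : 0 ≤ a i * msize (h i) y := mul_nonneg (ha0 i) hm
      have h2 : (a i * msize (h i) y + b i) ^ 3 ≤
          4 * ((a i * msize (h i) y) ^ 3 + b i ^ 3) := by
        nlinarith [mul_nonneg (add_nonneg h1 (hb0 i)) (sq_nonneg (a i * msize (h i) y - b i))]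
      have hsC : 0 ≤ s i * C := mul_nonneg (hs0 i) hC
      calc |ξ i y| ^ 3 ≤ (s i * (C * (a i * msize (h i) y + b i))) ^ 3 := by
            gcongr; exact hle i y
        _ = (s i * C) ^ 3 * (a i * msize (h i) y + b i) ^ 3 := by ring
        _ ≤ (s i * C) ^ 3 * (4 * ((a i * msize (h i) y) ^ 3 + b i ^ 3)) := by gcongr
        _ = _ := by ring
  have im3 : ∀ i, Integrable (fun y => msize (h i) y ^ 3) (inc (h i) (θ i)) := fun i =>
    (HD _ (R.pos i) (R.le_one i) _ (R.mem i) 3 (by norm_num) (by norm_num)).1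
  have i3b : ∀ i, Integrable
      (fun y => 4 * (s i * C) ^ 3 * (a i ^ 3 * msize (h i) y ^ 3 + b i ^ 3)) (inc (h i) (θ i)) :=
    fun i => (((im3 i).const_mul _).add (integrable_const _)).const_mul _
  have i3 : ∀ i, Integrable (fun y => |ξ i y| ^ 3) (inc (h i) (θ i)) := fun i =>
    (i3b i).mono' ((hξc i).abs.pow 3).aestronglyMeasurable (ae_of_all _ fun y => by
      rw [norm_of_nonneg (by positivity)]; exact hle3 i y)
  have hsq : ∀ i y, ξ i y ^ 2 = ∑ k, ∑ l, (t i k * t i l * (rate (h i) (N i) k * rate (h i) (N i) l)) *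
      (score1 (h i) y (θ i) k * score1 (h i) y (θ i) l) := fun i y => by
    rw [hξ, sq, Finset.sum_mul_sum]
    refine Finset.sum_congr rfl fun k _ => Finset.sum_congr rfl fun l _ => ?_
    ring
  have iS := fun i k l => integrable_score1_mul R.c_pos (R.pos i) (R.le_one i) (R.mem i) k l
  have i2 : ∀ i, Integrable (fun y => ξ i y ^ 2) (inc (h i) (θ i)) := fun i => by
    simp_rw [hsq i]
    exact integrable_finsetSum _ fun k _ => integrable_finsetSum _ fun l _ => (iS i k l).const_mul _
  have e1 : ∀ i, ∫ y, ξ i y ∂(inc (h i) (θ i)) = 0 := fun i => by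
    have i1 := integrable_score1 R.c_pos (R.pos i) (R.le_one i) (R.mem i)
    simp only [hξ]
    rw [integral_finsetSum _ fun k _ => ((i1 k).const_mul _).const_mul _]
    refine Finset.sum_eq_zero fun k _ => ?_
    rw [integral_const_mul, integral_const_mul,
      integral_score1 R.c_pos (R.pos i) (R.le_one i) (R.mem i), mul_zero, mul_zero]
  have e2 : Tendsto (fun i => N i * ∫ y, ξ i y ^ 2 ∂(inc (h i) (θ i))) atTop
      (𝓝 (∑ k, ∑ l, t₀ k * t₀ l * fisher θ₀ k l)) := by
    have h1 : ∀ i, N i * ∫ y, ξ i y ^ 2 ∂(inc (h i) (θ i)) = ∑ k, ∑ l, t i k * t i l *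
        (covScale k l (h i) *
          ∫ y, score1 (h i) y (θ i) k * score1 (h i) y (θ i) l ∂(inc (h i) (θ i))) := fun i => by
      simp_rw [hsq i]
      rw [integral_finsetSum _ fun k _ => integrable_finsetSum _ fun l _ => (iS i k l).const_mul _,
        Finset.mul_sum]
      refine Finset.sum_congr rfl fun k _ => ?_
      rw [integral_finsetSum _ fun l _ => (iS i k l).const_mul _, Finset.mul_sum]
      refine Finset.sum_congr rfl fun l _ => ?_
      rw [integral_const_mul, ← nat_mul_rate_mul (R.N_pos i) (R.pos i)]
      ring
    simp_rw [h1]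
    exact tendsto_finsetSum _ fun k _ => tendsto_finsetSum _ fun l _ =>
      ((ht k).mul (ht l)).mul (R.tendsto_cov k l)
  -- Lyapunov's condition: as `N a² = 1/h` and `N b² = 1`, the third moment `D h` of `m` contributes
  -- `N a³ D h = a D`, and the bounded scores contribute `N b³ = b`.
  have e3 : Tendsto (fun i => N i * ∫ y, |ξ i y| ^ 3 ∂(inc (h i) (θ i))) atTop (𝓝 0) := by
    refine squeeze_zero (g := fun i => 4 * (s i * C) ^ 3 * (a i * D + b i)) (fun i => ?_)
      (fun i => ?_) ?_
    · exact mul_nonneg (Nat.cast_nonneg _) (integral_nonneg fun y => by positivity)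
    · have hm3 := (HD _ (R.pos i) (R.le_one i) _ (R.mem i) 3 (by norm_num) (by norm_num)).2
      have hsC : 0 ≤ s i * C := mul_nonneg (hs0 i) hC
      have hi := (R.pos i)
      have := ha0 i
      calc _ ≤ (N i : ℝ) * ∫ y, 4 * (s i * C) ^ 3 * (a i ^ 3 * msize (h i) y ^ 3 + b i ^ 3)
            ∂(inc (h i) (θ i)) := by
            exact mul_le_mul_of_nonneg_left (integral_mono (i3 i) (i3b i) (hle3 i))
              (Nat.cast_nonneg _)
        _ = N i * (4 * (s i * C) ^ 3 * (a i ^ 3 * (∫ y, msize (h i) y ^ 3 ∂(inc (h i) (θ i))) +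
            b i ^ 3)) := by
            rw [integral_const_mul, integral_add ((im3 i).const_mul _) (integrable_const _),
              integral_const_mul]
            simp
        _ ≤ N i * (4 * (s i * C) ^ 3 * (a i ^ 3 * (D * h i) + b i ^ 3)) := by gcongr
        _ = 4 * (s i * C) ^ 3 * ((N i * (a i * a i)) * a i * (D * h i) +
            (N i * (b i * b i)) * b i) := by ring
        _ = _ := by
            rw [haN, hbN]
            field_simp
    · have := (((hst.mul_const C).pow 3).const_mul 4).mul ((hat.mul_const D).add hbt)
      simpa using this
  have key := tendsto_pow_integral_exp R.tendsto_N (fun i => (hξc i).measurable) i2 i3 e1 e2 e3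
  refine key.congr fun i => ?_
  have hprod := integral_fintype_prod_eq_prod (𝕜 := ℂ) (ι := Fin (N i)) (E := fun _ => ℝ)
    (fun _ y => Complex.exp (ξ i y * Complex.I)) (μ := fun _ => inc (h i) (θ i))
  rw [Finset.prod_const, Finset.card_univ, Fintype.card_fin] at hprod
  rw [← hprod]
  refine integral_congr_ae (ae_of_all _ fun x => ?_)
  simp only
  rw [← Complex.exp_sum, ← Finset.sum_mul, ← Complex.ofReal_sum]
  congr 3
  simp only [hξ, scoreL]
  rw [Finset.sum_comm]
  refine Finset.sum_congr rfl fun k _ => ?_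
  rw [Finset.mul_sum, Finset.mul_sum]

lemma integral_sq_score_le (k : Fin 4) (i : ℕ) :
    Integrable (fun x => (rate (h i) (N i) k * scoreL (h i) x (θ i) k) ^ 2)
      (dat (h i) (N i) (θ i)) ∧
    ∫ x, (rate (h i) (N i) k * scoreL (h i) x (θ i) k) ^ 2 ∂(dat (h i) (N i) (θ i)) ≤
      covScale k k (h i) *
        ∫ y, score1 (h i) y (θ i) k * score1 (h i) y (θ i) k ∂(inc (h i) (θ i)) := by
  have hpr := R.prob_inc i
  have hS2 := integrable_score1_mul R.c_pos (R.pos i) (R.le_one i) (R.mem i) k k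
  have hm : MemLp (fun y => rate (h i) (N i) k * score1 (h i) y (θ i) k) 2 (inc (h i) (θ i)) := by
    refine MemLp.const_mul ?_ _
    refine (memLp_two_iff_integrable_sq
      (continuous_score1 (R.pos i) (R.reg i) k).aestronglyMeasurable).2 ?_
    simpa [sq] using hS2
  obtain ⟨h1, h2⟩ := integral_sum_sub_sq_le (n := N i) (inc (h i) (θ i)) hm 0
  have e : ∀ x : Fin (N i) → ℝ, ∑ j, rate (h i) (N i) k * score1 (h i) (x j) (θ i) k - 0 =
      rate (h i) (N i) k * scoreL (h i) x (θ i) k := fun x => by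
    rw [sub_zero, scoreL, Finset.mul_sum]
  simp_rw [e] at h1 h2
  refine ⟨h1, h2.trans (le_of_eq ?_)⟩
  rw [integral_const_mul, integral_score1 R.c_pos (R.pos i) (R.le_one i) (R.mem i),
    ← nat_mul_rate_mul (R.N_pos i) (R.pos i)]
  have e3 : ∀ y, (rate (h i) (N i) k * score1 (h i) y (θ i) k) ^ 2 =
      (rate (h i) (N i) k * rate (h i) (N i) k) *
        (score1 (h i) y (θ i) k * score1 (h i) y (θ i) k) := fun y => by ring
  simp_rw [e3]
  rw [integral_const_mul]
  ring

/-- Mean square convergence of rescaled sums whose second moments are controlled by `zsize`. -/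
lemma tendsto_sum_sub_sq {k l : Fin 4} {g : ℕ → ℝ → ℝ} (hg : ∀ i, Measurable (g i)) {A : ℝ}
    (hA : ∀ i y, |g i y| ≤ A * zsize k l (h i) y) {b : ℕ → ℝ}
    (hm : Tendsto (fun i => covScale k l (h i) * ∫ y, g i y ∂(inc (h i) (θ i)) - b i) atTop (𝓝 0)) :
    (∀ i, Integrable (fun x : Fin (N i) → ℝ =>
      (rate (h i) (N i) k * rate (h i) (N i) l * ∑ j, g i (x j) - b i) ^ 2)
        (dat (h i) (N i) (θ i))) ∧
    Tendsto (fun i => ∫ x : Fin (N i) → ℝ,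
      (rate (h i) (N i) k * rate (h i) (N i) l * ∑ j, g i (x j) - b i) ^ 2
        ∂(dat (h i) (N i) (θ i))) atTop (𝓝 0) := by
  obtain ⟨C, hC, H⟩ := exists_zsize_moments R.c_pos B
  have hpr := R.prob_inc
  have hz := fun i => H _ (R.pos i) (R.le_one i) _ (R.mem i) k l
  have hg2 : ∀ i, MemLp (g i) 2 (inc (h i) (θ i)) := fun i =>
    ((hz i).1.const_mul A).mono' (hg i).aestronglyMeasurable (ae_of_all _ (hA i))
  have key := fun i => integral_sum_sub_sq_le (n := N i) (inc (h i) (θ i))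
    ((hg2 i).const_mul (rate (h i) (N i) k * rate (h i) (N i) l)) (b i)
  simp_rw [← Finset.mul_sum] at key
  refine ⟨fun i => (key i).1, squeeze_zero (fun i => integral_nonneg fun x => sq_nonneg _)
    (fun i => (key i).2) ?_⟩
  -- The variance part. As `N a_k a_l = covScale`, it is at most `A² covScale² E[zsize²] / N`, that
  -- is `O(1/T)`.
  have t1 : Tendsto (fun i => (N i : ℝ) * ∫ y, (rate (h i) (N i) k * rate (h i) (N i) l * g i y) ^ 2
      ∂(inc (h i) (θ i))) atTop (𝓝 0) := by
    refine squeeze_zero (g := fun i => A ^ 2 * C * ((N i : ℝ) * h i)⁻¹) (fun i =>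
      mul_nonneg (Nat.cast_nonneg _) (integral_nonneg fun y => sq_nonneg _)) (fun i => ?_) ?_
    · have hNi : (0 : ℝ) < N i := Nat.cast_pos.2 (R.N_pos i)
      have hi := R.pos i
      have e0 := nat_mul_rate_mul (R.N_pos i) (R.pos i) k l
      have h1 : ∫ y, (rate (h i) (N i) k * rate (h i) (N i) l * g i y) ^ 2 ∂(inc (h i) (θ i)) ≤
          (rate (h i) (N i) k * rate (h i) (N i) l) ^ 2 * A ^ 2 *
            ∫ y, zsize k l (h i) y ^ 2 ∂(inc (h i) (θ i)) := by
        rw [← integral_const_mul]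
        refine integral_mono ((hg2 i).const_mul _).integrable_sq ((hz i).1.integrable_sq.const_mul _)
          fun y => ?_
        simp only
        rw [mul_pow, mul_assoc _ (A ^ 2)]
        gcongr
        rw [← sq_abs, ← mul_pow]
        gcongr
        exact hA i y
      calc _ ≤ (N i : ℝ) * ((rate (h i) (N i) k * rate (h i) (N i) l) ^ 2 * A ^ 2 *
            ∫ y, zsize k l (h i) y ^ 2 ∂(inc (h i) (θ i))) := by gcongr
        _ = A ^ 2 * (covScale k l (h i) ^ 2 *
            ∫ y, zsize k l (h i) y ^ 2 ∂(inc (h i) (θ i))) / N i := by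
            rw [← e0]; field_simp
        _ ≤ A ^ 2 * (C / h i) / N i := by
            gcongr
            exact (hz i).2.2
        _ = _ := by field_simp
    · simpa using R.tendsto_T.inv_tendsto_atTop.const_mul (A ^ 2 * C)
  have t2 : Tendsto (fun i => ((N i : ℝ) * ∫ y, rate (h i) (N i) k * rate (h i) (N i) l * g i y
      ∂(inc (h i) (θ i)) - b i) ^ 2) atTop (𝓝 0) := by
    have e : ∀ i, (N i : ℝ) * ∫ y, rate (h i) (N i) k * rate (h i) (N i) l * g i y
        ∂(inc (h i) (θ i)) = covScale k l (h i) * ∫ y, g i y ∂(inc (h i) (θ i)) := fun i => by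
      rw [integral_const_mul, ← nat_mul_rate_mul (R.N_pos i) (R.pos i)]; ring
    simp_rw [e]
    simpa using hm.pow 2
  simpa using t1.add t2

lemma tendsto_sum_sq {k l : Fin 4} {g : ℕ → ℝ → ℝ} (hg : ∀ i, Measurable (g i)) {A : ℝ}
    (hA : ∀ i y, |g i y| ≤ A * zsize k l (h i) y) {b : ℕ → ℝ} {β : ℝ} (hb : Tendsto b atTop (𝓝 β))
    (hm : Tendsto (fun i => covScale k l (h i) * ∫ y, g i y ∂(inc (h i) (θ i))) atTop (𝓝 β)) :
    (∀ i, Integrable (fun x : Fin (N i) → ℝ =>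
      (rate (h i) (N i) k * rate (h i) (N i) l * ∑ j, g i (x j) - b i) ^ 2)
        (dat (h i) (N i) (θ i))) ∧
    Tendsto (fun i => ∫ x : Fin (N i) → ℝ,
      (rate (h i) (N i) k * rate (h i) (N i) l * ∑ j, g i (x j) - b i) ^ 2
        ∂(dat (h i) (N i) (θ i))) atTop (𝓝 0) :=
  R.tendsto_sum_sub_sq hg hA (by simpa using hm.sub hb)

/-- Mean square convergence of the rescaled observed information. -/
lemma tendsto_info_sq (k l : Fin 4) :
    (∀ i, Integrable (fun x => (rate (h i) (N i) k * rate (h i) (N i) l *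
      (-hessL (h i) x (θ i) k l) - fisher (θ i) k l) ^ 2) (dat (h i) (N i) (θ i))) ∧
    Tendsto (fun i => ∫ x, (rate (h i) (N i) k * rate (h i) (N i) l *
      (-hessL (h i) x (θ i) k l) - fisher (θ i) k l) ^ 2 ∂(dat (h i) (N i) (θ i))) atTop (𝓝 0) := by
  obtain ⟨C, hC, H⟩ := exists_hess1_lipschitz R.c_pos B
  have := R.tendsto_sum_sq (k := k) (l := l) (g := fun i y => -hess1 (h i) y (θ i) k l) (A := C)
    (fun i => (continuous_hess1 (R.pos i) (R.reg i) k l).neg.measurable)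
    (fun i y => by rw [abs_neg]; exact (H k l _ y (R.pos i) _ (R.mem i) _ (R.mem i)).1)
    (tendsto_fisher R.c_pos R.mem R.mem_lim R.tendsto k l) (by
      simp_rw [integral_neg, fun i => integral_hess1 R.c_pos (R.pos i) (R.le_one i) (R.mem i) k l,
        neg_neg]
      exact R.tendsto_cov k l)
  simpa only [Finset.sum_neg_distrib] using! this

lemma tendsto_probDist_info (k l : Fin 4) :
    Tendsto (fun i => probDist (dat (h i) (N i) (θ i)) fun x => rate (h i) (N i) k *
      rate (h i) (N i) l * (-hessL (h i) x (θ i) k l) - fisher (θ i) k l) atTop (𝓝 0) := by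
  have hpr := R.prob_dat
  obtain ⟨h1, h2⟩ := R.tendsto_info_sq k l
  exact tendsto_probDist_of_sq h1 h2

end Regime

end NIG

end

noncomputable section

namespace NIG

open Set Real

variable {c B : ℝ}

/-! ### The likelihood -/

lemma exp_logLik {h : ℝ} (hh : 0 < h) {ρ : E4} (hρ : ρ ∈ region) {n : ℕ} (x : Fin n → ℝ) :
    exp (logLik h n ρ x) = ∏ j, pd h ρ (x j) := by
  unfold logLik
  rw [exp_sum]
  exact Finset.prod_congr rfl fun j _ => exp_logDens hh hρ

lemma dat_eq_withDensity {h : ℝ} (hh : 0 < h) (n : ℕ) {ρ : E4} (hρ : ρ ∈ region) :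
    dat h n ρ = volume.withDensity fun x => ENNReal.ofReal (exp (logLik h n ρ x)) := by
  have := isProbabilityMeasure_inc hh hρ
  have hpd := (continuous_pd hh hρ).measurable
  have hpd0 : ∀ y, 0 ≤ pd h ρ y := fun y => (pd_pos hh hρ).le
  have hpdi : Integrable (pd h ρ) := by
    have := (integrable_inc_iff hh hρ fun _ => 1).1 (integrable_const 1)
    simpa using this
  refine Measure.pi_eq fun s hs => ?_
  have hgi : ∀ j, Integrable ((s j).indicator (pd h ρ)) := fun j => hpdi.indicator (hs j)
  have hg0 : ∀ j y, 0 ≤ (s j).indicator (pd h ρ) y := fun j => indicator_nonneg fun y _ => hpd0 y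
  have e1 : ∀ j, inc h ρ (s j) = ENNReal.ofReal (∫ y, (s j).indicator (pd h ρ) y) := fun j => by
    rw [ofReal_integral_eq_lintegral_ofReal (hgi j) (ae_of_all _ (hg0 j))]
    change (volume.withDensity fun y => ENNReal.ofReal (pd h ρ y)) (s j) = _
    rw [withDensity_apply _ (hs j), ← lintegral_indicator (hs j)]
    congr 1; ext y
    by_cases hy : y ∈ s j <;> simp [hy]
  have hprod : Integrable (fun x : Fin n → ℝ => ∏ j, (s j).indicator (pd h ρ) (x j)) :=
    Integrable.fintype_prod hgi
  simp_rw [e1]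
  rw [← ENNReal.ofReal_prod_of_nonneg fun j _ => integral_nonneg (hg0 j),
    ← integral_fintype_prod_volume_eq_prod (fun j => (s j).indicator (pd h ρ)),
    ofReal_integral_eq_lintegral_ofReal hprod
      (ae_of_all _ fun x => Finset.prod_nonneg fun j _ => hg0 j _),
    withDensity_apply _ (MeasurableSet.univ_pi hs), ← lintegral_indicator (MeasurableSet.univ_pi hs)]
  congr 1; ext x
  by_cases hx : x ∈ univ.pi s
  · rw [indicator_of_mem hx, exp_logLik hh hρ]
    congr 1
    exact Finset.prod_congr rfl fun j _ => (indicator_of_mem (hx j trivial) _).symm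
  · rw [indicator_of_notMem hx]
    obtain ⟨j, hj⟩ : ∃ j, x j ∉ s j := by simpa [Set.mem_pi] using hx
    rw [Finset.prod_eq_zero (Finset.mem_univ j) (indicator_of_notMem hj _), ENNReal.ofReal_zero]

lemma IsLevyProcess.map_increments_eq_dat {Ω : Type*} [MeasurableSpace Ω] {X : ℝ≥0 → Ω → ℝ}
    {P : Measure Ω} (hX : IsLevyProcess X P) {ρ : E4} (hρ : ρ ∈ region)
    (hlaw : P.map (X 1) = law (ρ 0) (ρ 1) (ρ 2) (ρ 3)) {h : ℝ≥0} (hh : 0 < h) (n : ℕ) :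
    P.map (increments X h n) = dat h n ρ := by
  rw [hX.map_increments, hX.map_eq_law hρ.2.1 hρ.2.2 hlaw hh]
  rfl

/-! ### Asymptotics of the score and of the log-likelihood ratio -/

lemma continuous_scoreL {h : ℝ} (hh : 0 < h) {ρ : E4} (hρ : ρ ∈ region) {n : ℕ} (k : Fin 4) :
    Continuous fun x : Fin n → ℝ => scoreL h x ρ k :=
  continuous_finsetSum _ fun j _ => (continuous_score1 hh hρ k).comp (continuous_apply j)

lemma charFun_multivariateGaussian_zero {S : Matrix (Fin 4) (Fin 4) ℝ} (hS : S.PosSemidef) (t : E4) :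
    charFun (multivariateGaussian 0 S) t =
      Complex.exp (-(((∑ k, ∑ l, t k * t l * S k l) / 2 : ℝ) : ℂ)) := by
  rw [charFun_multivariateGaussian hS]
  congr 1
  have : (t.ofLp ⬝ᵥ S.mulVec t.ofLp) = ∑ k, ∑ l, t k * t l * S k l := by
    simp only [dotProduct, Matrix.mulVec, Finset.mul_sum]
    exact Finset.sum_congr rfl fun k _ => Finset.sum_congr rfl fun l _ => by ring
  rw [this]
  simp

/-- The rescaled score `A_n S_n(ρ)`. -/
def nscore (h : ℝ) {n : ℕ} (ρ : E4) (x : Fin n → ℝ) (k : Fin 4) : ℝ :=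
  rate h n k * scoreL h x ρ k

lemma continuous_nscore {h : ℝ} (hh : 0 < h) {ρ : E4} (hρ : ρ ∈ region) {n : ℕ} :
    Continuous fun x : Fin n → ℝ => nscore h ρ x :=
  continuous_pi fun k => (continuous_scoreL hh hρ k).const_mul _

lemma measurable_toLp_mulVec_nscore {h : ℝ} (hh : 0 < h) {ρ : E4} (hρ : ρ ∈ region) {n : ℕ}
    (M : Matrix (Fin 4) (Fin 4) ℝ) :
    Measurable fun x : Fin n → ℝ => (WithLp.toLp 2 (M.mulVec (nscore h ρ x)) : E4) := by
  have h1 := continuous_nscore (n := n) hh hρ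
  have h2 : Continuous fun x : Fin n → ℝ => M.mulVec (nscore h ρ x) :=
    Continuous.matrix_mulVec continuous_const h1
  exact ((PiLp.continuous_toLp 2 _).comp h2).measurable

namespace Regime

variable {N : ℕ → ℕ} {h : ℕ → ℝ} {θ : ℕ → E4} {θ₀ : E4} (R : Regime c B N h θ θ₀)
include R

/-- `hq` says that `M₀ F M₀ᵀ` and `S₀` have the same quadratic form. The matrix is kept general to
cover both the score itself, with `M = 1`, and the linearized estimator, with `M = F⁻¹`. -/
lemma tendsto_blDist_score {M : ℕ → Matrix (Fin 4) (Fin 4) ℝ} {M₀ : Matrix (Fin 4) (Fin 4) ℝ}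
    (hM : ∀ k l, Tendsto (fun i => M i k l) atTop (𝓝 (M₀ k l)))
    {S : ℕ → Matrix (Fin 4) (Fin 4) ℝ} {S₀ : Matrix (Fin 4) (Fin 4) ℝ}
    (hS : ∀ i, (S i).PosSemidef) (hS₀ : S₀.PosSemidef)
    (hSt : ∀ k l, Tendsto (fun i => S i k l) atTop (𝓝 (S₀ k l)))
    (hq : ∀ t : Fin 4 → ℝ, ∑ k, ∑ l, (∑ j, t j * M₀ j k) * (∑ j, t j * M₀ j l) * fisher θ₀ k l =
      ∑ k, ∑ l, t k * t l * S₀ k l) :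
    Tendsto (fun i => blDist ((dat (h i) (N i) (θ i)).map fun x =>
      (WithLp.toLp 2 ((M i).mulVec (nscore (h i) (θ i) x)) : E4))
        (multivariateGaussian 0 (S i))) atTop (𝓝 0) := by
  have hpr := R.prob_dat
  have hmeas := fun i => measurable_toLp_mulVec_nscore (n := N i) (R.pos i) (R.reg i) (M i)
  have := fun i => Measure.isProbabilityMeasure_map (μ := dat (h i) (N i) (θ i)) (hmeas i).aemeasurable
  refine tendsto_blDist_of_charFun (κ := multivariateGaussian 0 S₀) (fun t => ?_) fun t => ?_
  · rw [charFun_multivariateGaussian_zero hS₀, ← hq]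
    have key := R.tendsto_integral_exp_score (t := fun i k => ∑ j, t j * M i j k)
      (t₀ := fun k => ∑ j, t j * M₀ j k)
      (fun k => tendsto_finsetSum _ fun j _ => (hM j k).const_mul _)
    refine key.congr fun i => ?_
    rw [charFun_apply, integral_map (hmeas i).aemeasurable (by fun_prop)]
    refine integral_congr_ae (ae_of_all _ fun x => ?_)
    simp only
    congr 3
    simp only [PiLp.inner_apply, RCLike.inner_apply, conj_trivial, Matrix.mulVec, dotProduct, nscore]
    simp_rw [Finset.sum_mul, Finset.mul_sum]
    rw [Finset.sum_comm]
    refine Finset.sum_congr rfl fun j _ => Finset.sum_congr rfl fun k _ => ?_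
    ring
  · simp_rw [fun i => charFun_multivariateGaussian_zero (hS i) t,
      charFun_multivariateGaussian_zero hS₀ t]
    refine (Complex.continuous_exp.tendsto _).comp (Tendsto.neg ?_)
    refine (Complex.continuous_ofReal.tendsto _).comp (Tendsto.div_const ?_ 2)
    exact tendsto_finsetSum _ fun k _ => tendsto_finsetSum _ fun l _ => (hSt k l).const_mul _

lemma tendsto_blDist_score_fisher :
    Tendsto (fun i => blDist ((dat (h i) (N i) (θ i)).map fun x =>
      (WithLp.toLp 2 (nscore (h i) (θ i) x) : E4))
        (multivariateGaussian 0 (fisher (θ i)))) atTop (𝓝 0) := by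
  have := R.tendsto_blDist_score (M := fun _ => 1) (M₀ := 1) (fun k l => tendsto_const_nhds)
    (S := fun i => fisher (θ i)) (S₀ := fisher θ₀)
    (fun i => (fisher_posDef R.c_pos (R.mem i)).posSemidef)
    (fisher_posDef R.c_pos R.mem_lim).posSemidef
    (tendsto_fisher R.c_pos R.mem R.mem_lim R.tendsto) fun t => by simp [Matrix.one_apply]
  simpa using this

lemma tendsto_blDist_score_inv :
    Tendsto (fun i => blDist ((dat (h i) (N i) (θ i)).map fun x =>
      (WithLp.toLp 2 ((fisher (θ i))⁻¹.mulVec (nscore (h i) (θ i) x)) : E4))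
        (multivariateGaussian 0 (fisher (θ i))⁻¹)) atTop (𝓝 0) := by
  have hp₀ := fisher_posDef R.c_pos R.mem_lim
  have hp := fun i => fisher_posDef R.c_pos (R.mem i)
  have hFt : Tendsto (fun i => fisher (θ i)) atTop (𝓝 (fisher θ₀)) :=
    tendsto_pi_nhds.2 fun k => tendsto_pi_nhds.2 fun l =>
      tendsto_fisher R.c_pos R.mem R.mem_lim R.tendsto k l
  have hdet : Tendsto (fun i => (fisher (θ i)).det) atTop (𝓝 (fisher θ₀).det) :=
    ((continuous_id.matrix_det).tendsto _).comp hFt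
  have hinv : Tendsto (fun i => (fisher (θ i))⁻¹) atTop (𝓝 (fisher θ₀)⁻¹) := by
    have hadj := ((continuous_id.matrix_adjugate).tendsto (fisher θ₀)).comp hFt
    have := (hdet.inv₀ hp₀.det_pos.ne').smul hadj
    simpa [Matrix.inv_def, Function.comp_def] using this
  have hinv' : ∀ k l, Tendsto (fun i => (fisher (θ i))⁻¹ k l) atTop (𝓝 ((fisher θ₀)⁻¹ k l)) :=
    fun k l => tendsto_pi_nhds.1 (tendsto_pi_nhds.1 hinv k) l
  refine R.tendsto_blDist_score hinv' (fun i => (hp i).inv.posSemidef) hp₀.inv.posSemidef hinv'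
    fun t => ?_
  set F := fisher θ₀
  have hsymm : (F⁻¹).transpose = F⁻¹ := by
    have := hp₀.inv.isHermitian.eq
    rwa [Matrix.conjTranspose_eq_transpose_of_trivial] at this
  have hFF : F⁻¹ * F * F⁻¹ = F⁻¹ := by
    rw [Matrix.nonsing_inv_mul _ hp₀.det_pos.ne'.isUnit, one_mul]
  have e1 : ∑ k, ∑ l, t k * t l * F⁻¹ k l = t ⬝ᵥ F⁻¹.mulVec t := by
    simp only [dotProduct, Matrix.mulVec, Finset.mul_sum]
    exact Finset.sum_congr rfl fun k _ => Finset.sum_congr rfl fun l _ => by ring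
  have e2 : ∑ k, ∑ l, (∑ j, t j * F⁻¹ j k) * (∑ j, t j * F⁻¹ j l) * F k l =
      (Matrix.vecMul t F⁻¹) ⬝ᵥ F.mulVec (Matrix.vecMul t F⁻¹) := by
    simp only [dotProduct, Matrix.mulVec, Matrix.vecMul]
    refine Finset.sum_congr rfl fun k _ => ?_
    rw [Finset.mul_sum]
    exact Finset.sum_congr rfl fun l _ => by ring
  have e3 : Matrix.vecMul t F⁻¹ = F⁻¹.mulVec t := by
    rw [← Matrix.mulVec_transpose, hsymm]
  rw [e2, e1, ← Matrix.dotProduct_mulVec, Matrix.mulVec_mulVec, e3, Matrix.mulVec_mulVec, hFF]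

lemma exists_integral_zsum_le : ∃ C, 0 ≤ C ∧ ∀ i k l,
    Integrable (fun x => zsum (h i) x k l) (dat (h i) (N i) (θ i)) ∧
      ∫ x, zsum (h i) x k l ∂(dat (h i) (N i) (θ i)) ≤ C := by
  obtain ⟨C, hC, H⟩ := exists_zsize_moments R.c_pos B
  refine ⟨C, hC, fun i k l => ?_⟩
  have hpr := R.prob_inc i
  obtain ⟨hz, h1, -⟩ := H _ (R.pos i) (R.le_one i) _ (R.mem i) k l
  have hzi := hz.integrable one_le_two
  have hmp := fun j : Fin (N i) => measurePreserving_eval (fun _ : Fin (N i) => inc (h i) (θ i)) j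
  have hj : ∀ j : Fin (N i), Integrable (fun x : Fin (N i) → ℝ => zsize k l (h i) (x j))
      (dat (h i) (N i) (θ i)) := fun j => (hmp j).integrable_comp_of_integrable hzi
  have hjv : ∀ j : Fin (N i), ∫ x : Fin (N i) → ℝ, zsize k l (h i) (x j) ∂(dat (h i) (N i) (θ i)) =
      ∫ y, zsize k l (h i) y ∂(inc (h i) (θ i)) := fun j => by
    have := (hmp j).map_eq
    conv_rhs => rw [← this]
    rw [integral_map (measurable_pi_apply j).aemeasurable (by rw [this]; exact hz.1)]
    rfl
  refine ⟨(integrable_finsetSum _ fun j _ => hj j).const_mul _, ?_⟩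
  unfold zsum
  rw [integral_const_mul, integral_finsetSum _ fun j _ => hj j]
  simp_rw [hjv]
  rw [Finset.sum_const, Finset.card_univ, Fintype.card_fin, nsmul_eq_mul, ← mul_assoc,
    mul_comm _ (N i : ℝ), nat_mul_rate_mul (R.N_pos i) (R.pos i)]
  exact h1

lemma tendsto_diagMul_rate {u : ℕ → E4} {U : ℝ} (hu : ∀ i, ‖u i‖ ≤ U) :
    Tendsto (fun i => diagMul (rate (h i) (N i)) (u i)) atTop (𝓝 0) := by
  have h1 : ∀ k, Tendsto (fun i => rate (h i) (N i) k * u i k) atTop (𝓝 0) := fun k => by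
    refine squeeze_zero_norm (a := fun i => rate (h i) (N i) k * U) (fun i => ?_) ?_
    · have hr := rate_pos (R.N_pos i) (R.pos i) k
      rw [norm_mul, norm_of_nonneg hr.le]
      gcongr
      exact (PiLp.norm_apply_le (u i) k).trans (hu i)
    · simpa using (R.tendsto_rate k).mul_const U
  have h2 : Tendsto (fun i k => rate (h i) (N i) k * u i k) atTop (𝓝 (0 : Fin 4 → ℝ)) :=
    tendsto_pi_nhds.2 h1
  exact ((PiLp.continuous_toLp 2 _).tendsto _).comp h2

/-- By Taylor's formula the remainder is half the difference of two Hessian forms along the segment.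
It is at most a constant times `‖v‖ * zsum`, summed over the entries; `zsum` has bounded mean and `v
= A_n u` tends to `0`. The ball condition keeps the segment inside the box. -/
lemma tendsto_probDist_expansion {r : ℝ} (hr : 0 < r) (hball : ∀ i, Metric.ball (θ i) r ⊆ box c B)
    {u : ℕ → E4} {U : ℝ} (hu : ∀ i, ‖u i‖ ≤ U) :
    Tendsto (fun i => probDist (dat (h i) (N i) (θ i)) fun x =>
      logLik (h i) (N i) (θ i + diagMul (rate (h i) (N i)) (u i)) x - logLik (h i) (N i) (θ i) x
        - (∑ k, scoreL (h i) x (θ i) k * (rate (h i) (N i) k * u i k)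
          - 1 / 2 * ∑ k, ∑ l, (-hessL (h i) x (θ i) k l)
              * (rate (h i) (N i) k * u i k) * (rate (h i) (N i) l * u i l))) atTop (𝓝 0) := by
  obtain ⟨C, hC, H⟩ := exists_hessL_lipschitz R.c_pos B
  obtain ⟨D, hD, HD⟩ := R.exists_integral_zsum_le
  have hU : 0 ≤ U := (norm_nonneg _).trans (hu 0)
  set v : ℕ → E4 := fun i => diagMul (rate (h i) (N i)) (u i) with hv
  have hvt : Tendsto v atTop (𝓝 0) := R.tendsto_diagMul_rate hu
  have hnt : Tendsto (fun i => ‖v i‖) atTop (𝓝 0) := by simpa using hvt.norm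
  set Z : ∀ i, (Fin (N i) → ℝ) → ℝ := fun i x => ∑ k, ∑ l, U ^ 2 * C * ‖v i‖ * zsum (h i) x k l
    with hZ
  have hZi : ∀ i, Integrable (Z i) (dat (h i) (N i) (θ i)) := fun i =>
    integrable_finsetSum _ fun k _ => integrable_finsetSum _ fun l _ => ((HD i k l).1).const_mul _
  have hZle : ∀ i, ∫ x, Z i x ∂(dat (h i) (N i) (θ i)) ≤ 16 * (U ^ 2 * C * D) * ‖v i‖ := fun i => by
    simp only [hZ]
    rw [integral_finsetSum _ fun k _ => integrable_finsetSum _ fun l _ =>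
      ((HD i k l).1).const_mul _]
    have : ∀ k, ∫ x, ∑ l, U ^ 2 * C * ‖v i‖ * zsum (h i) x k l ∂(dat (h i) (N i) (θ i)) ≤
        ∑ _l : Fin 4, U ^ 2 * C * ‖v i‖ * D := fun k => by
      rw [integral_finsetSum _ fun l _ => ((HD i k l).1).const_mul _]
      refine Finset.sum_le_sum fun l _ => ?_
      rw [integral_const_mul]
      gcongr
      exact (HD i k l).2
    refine (Finset.sum_le_sum fun k _ => this k).trans (le_of_eq ?_)
    simp only [Finset.sum_const, Finset.card_univ, Fintype.card_fin, nsmul_eq_mul]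
    push_cast
    ring
  refine squeeze_zero' (Eventually.of_forall fun i => probDist_nonneg _ _)
    (g := fun i => 16 * (U ^ 2 * C * D) * ‖v i‖) ?_ (by simpa using hnt.const_mul _)
  filter_upwards [hnt.eventually (gt_mem_nhds hr)] with i hi
  refine (probDist_le_integral (hZi i) fun x => ?_).trans (hZle i)
  have hNi := R.N_pos i
  have hhi := R.pos i
  have hbox : ∀ t ∈ Icc (0 : ℝ) 1, θ i + t • v i ∈ box c B := fun t ht => hball i (by
    rw [Metric.mem_ball, dist_eq_norm, add_sub_cancel_left, norm_smul, norm_of_nonneg ht.1]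
    have := mul_le_of_le_one_left (norm_nonneg (v i)) ht.2
    linarith)
  have hreg : ∀ t ∈ Icc (0 : ℝ) 1, θ i + t • v i ∈ region := fun t ht =>
    box_subset_region R.c_pos (hbox t ht)
  have hz0 : ∀ k l, 0 ≤ zsum (h i) x k l := fun k l => mul_nonneg
    (mul_pos (rate_pos hNi hhi k) (rate_pos hNi hhi l)).le
    (Finset.sum_nonneg fun j _ => zsize_nonneg hhi k l _)
  have huk : ∀ k, |u i k| ≤ U := fun k => (PiLp.norm_apply_le (u i) k).trans (hu i)
  have hdiff : ∀ t ∈ Icc (0 : ℝ) 1,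
      |hessQ (h i) x (θ i + t • v i) (v i) - hessQ (h i) x (θ i) (v i)| ≤ Z i x := fun t ht => by
    unfold hessQ
    rw [← Finset.sum_sub_distrib]
    refine (Finset.abs_sum_le_sum_abs _ _).trans (Finset.sum_le_sum fun k _ => ?_)
    rw [← Finset.sum_sub_distrib]
    refine (Finset.abs_sum_le_sum_abs _ _).trans (Finset.sum_le_sum fun l _ => ?_)
    have h1 := H (N i) x k l (h i) hNi hhi _ (hbox t ht) _ (R.mem i)
    have h2 : ‖θ i + t • v i - θ i‖ ≤ ‖v i‖ := by
      rw [add_sub_cancel_left, norm_smul, norm_of_nonneg ht.1]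
      exact mul_le_of_le_one_left (norm_nonneg _) ht.2
    have e : hessL (h i) x (θ i + t • v i) k l * v i k * v i l - hessL (h i) x (θ i) k l * v i k * v i l
        = (u i k * u i l) * (rate (h i) (N i) k * rate (h i) (N i) l *
          (hessL (h i) x (θ i + t • v i) k l - hessL (h i) x (θ i) k l)) := by
      simp only [hv, diagMul]; ring
    rw [e, abs_mul, abs_mul]
    calc _ ≤ (U * U) * (C * zsum (h i) x k l * ‖v i‖) := by
          have := huk k
          have := huk l
          have := hz0 k l
          gcongr
          exact h1.trans (by gcongr)
      _ = _ := by ring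
  have hup := logLik_le_quadratic hhi x (v := v i) (b := hessQ (h i) x (θ i) (v i) + Z i x) hreg
    fun t ht => by linarith [(abs_le.1 (hdiff t ht)).2]
  have hlo := quadratic_le_logLik hhi x (v := v i) (b := hessQ (h i) x (θ i) (v i) - Z i x) hreg
    fun t ht => by linarith [(abs_le.1 (hdiff t ht)).1]
  have e1 : ∑ k, scoreL (h i) x (θ i) k * (rate (h i) (N i) k * u i k) =
      ∑ k, scoreL (h i) x (θ i) k * v i k := rfl
  have e2 : ∑ k, ∑ l, (-hessL (h i) x (θ i) k l) * (rate (h i) (N i) k * u i k) *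
      (rate (h i) (N i) l * u i l) = -hessQ (h i) x (θ i) (v i) := by
    unfold hessQ
    rw [← Finset.sum_neg_distrib]
    refine Finset.sum_congr rfl fun k _ => ?_
    rw [← Finset.sum_neg_distrib]
    refine Finset.sum_congr rfl fun l _ => ?_
    simp only [hv, diagMul]; ring
  have hZ0 : 0 ≤ Z i x := Finset.sum_nonneg fun k _ => Finset.sum_nonneg fun l _ =>
    mul_nonneg (by positivity) (hz0 k l)
  rw [e1, e2, abs_le]
  constructor <;> linarith

end Regime

end NIG

end

noncomputable section

namespace NIG

open Set Real

variable {c B : ℝ}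

/-! ### Preliminary statistics that identify the parameter -/

/-- The limits of the preliminary statistics. -/
def ident (ρ : E4) : Fin 4 → ℝ :=
  ![arctan (-ρ 3 / ρ 2), arctan ((1 - ρ 3) / ρ 2), ρ 3 + ρ 2 * (ρ 1 / gam ρ),
    ρ 2 * (ρ 0 ^ 2 / gam ρ ^ 3)]

lemma continuousOn_ident : ContinuousOn ident region := by
  intro ρ hρ
  obtain ⟨h0, h2, h01⟩ := region_pos hρ
  have hg := (gam_pos hρ).ne'
  have p : ∀ k, ContinuousAt (fun ρ : E4 => ρ k) ρ := fun k => (pr k).continuous.continuousAt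
  have g : ContinuousAt gam ρ := (((p 0).pow 2).sub ((p 1).pow 2)).sqrt
  refine (continuousAt_pi.2 fun k => ?_).continuousWithinAt
  fin_cases k
  · exact continuous_arctan.continuousAt.comp ((p 3).neg.div (p 2) h2.ne')
  · exact continuous_arctan.continuousAt.comp ((continuousAt_const.sub (p 3)).div (p 2) h2.ne')
  · exact (p 3).add ((p 2).mul ((p 1).div g hg))
  · exact (p 2).mul (((p 0).pow 2).div (g.pow 3) (pow_ne_zero 3 hg))

/-- The first two coordinates give `μ/δ` and `(1 - μ)/δ`, whose sum is `1/δ`, hence `δ` and `μ`. The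
third then gives `β/γ`, and the fourth, equal to `δ (1 + (β/γ)²)/γ`, gives `γ`; finally `β` and `α`
follow. -/
lemma injOn_ident : InjOn ident region := by
  intro ρ hρ σ hσ he
  obtain ⟨h0, h2, h01⟩ := region_pos hρ
  obtain ⟨k0, k2, k01⟩ := region_pos hσ
  have hg := gam_pos hρ
  have kg := gam_pos hσ
  have hg2 := gam_sq hρ
  have kg2 := gam_sq hσ
  have e0 : -ρ 3 / ρ 2 = -σ 3 / σ 2 := arctan_injective (congrFun he 0)
  have e1 : (1 - ρ 3) / ρ 2 = (1 - σ 3) / σ 2 := arctan_injective (congrFun he 1)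
  have e2 : ρ 3 + ρ 2 * (ρ 1 / gam ρ) = σ 3 + σ 2 * (σ 1 / gam σ) := congrFun he 2
  have e3 : ρ 2 * (ρ 0 ^ 2 / gam ρ ^ 3) = σ 2 * (σ 0 ^ 2 / gam σ ^ 3) := congrFun he 3
  have d2 : ρ 2 = σ 2 := by
    have : (1 : ℝ) / ρ 2 = 1 / σ 2 := by
      calc (1 : ℝ) / ρ 2 = (1 - ρ 3) / ρ 2 - -ρ 3 / ρ 2 := by ring
        _ = (1 - σ 3) / σ 2 - -σ 3 / σ 2 := by rw [e0, e1]
        _ = 1 / σ 2 := by ring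
    field_simp at this
    exact this.symm
  have d3 : ρ 3 = σ 3 := by
    rw [d2] at e0
    field_simp at e0
    linarith
  rw [d2, d3] at e2
  have d1 : ρ 1 / gam ρ = σ 1 / gam σ := mul_left_cancel₀ k2.ne' (by linarith)
  rw [d2] at e3
  have e3' := mul_left_cancel₀ k2.ne' e3
  have f : ∀ τ : E4, 0 < gam τ → gam τ ^ 2 = τ 0 ^ 2 - τ 1 ^ 2 →
      τ 0 ^ 2 / gam τ ^ 3 = (1 + (τ 1 / gam τ) ^ 2) / gam τ := fun τ hτ hτ2 => by
    have : τ 0 ^ 2 = gam τ ^ 2 + τ 1 ^ 2 := by linarith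
    rw [this]
    field_simp
  rw [f ρ hg hg2, f σ kg kg2, d1] at e3'
  have dg : gam ρ = gam σ := by
    have hp : 0 < 1 + (σ 1 / gam σ) ^ 2 := by positivity
    field_simp at e3'
    exact e3'.symm
  rw [dg] at d1 hg2
  have d1' : ρ 1 = σ 1 := by field_simp at d1; exact d1
  have d0 : ρ 0 = σ 0 := by
    refine (sq_eq_sq₀ h0.le k0.le).1 ?_
    rw [d1'] at hg2
    linarith
  ext k
  fin_cases k
  exacts [d0, d1', d2, d3]

/-- Uniform continuity of the inverse of `ident` on a compact set: on the compact set of pairs at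
distance at least `η` the distance of the images has a positive minimum. -/
lemma exists_ident_modulus {K : Set E4} (hK : IsCompact K) (hreg : K ⊆ region) {η : ℝ} (hη : 0 < η) :
    ∃ ε > 0, ∀ ρ ∈ K, ∀ σ ∈ K, dist (ident ρ) (ident σ) < ε → dist ρ σ < η := by
  set S : Set (E4 × E4) := (K ×ˢ K) ∩ {p | η ≤ dist p.1 p.2} with hS
  have hSc : IsCompact S := (hK.prod hK).inter_right (isClosed_le continuous_const continuous_dist)
  have hcont : ContinuousOn (fun p : E4 × E4 => dist (ident p.1) (ident p.2)) S := by
    have h1 := continuousOn_ident.mono hreg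
    have h2 : ContinuousOn (fun p : E4 × E4 => ident p.1) S :=
      h1.comp continuousOn_fst fun p hp => hp.1.1
    have h3 : ContinuousOn (fun p : E4 × E4 => ident p.2) S :=
      h1.comp continuousOn_snd fun p hp => hp.1.2
    exact continuous_dist.comp_continuousOn (h2.prodMk h3)
  rcases S.eq_empty_or_nonempty with he | hne
  · refine ⟨1, one_pos, fun ρ hρ σ hσ _ => ?_⟩
    by_contra hcon
    have : (ρ, σ) ∈ S := ⟨⟨hρ, hσ⟩, not_lt.1 hcon⟩
    simp [he] at this
  · obtain ⟨p, hp, hmin⟩ := hSc.exists_isMinOn hne hcont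
    replace hmin := isMinOn_iff.1 hmin
    refine ⟨dist (ident p.1) (ident p.2), dist_pos.2 fun h => ?_, fun ρ hρ σ hσ hlt => ?_⟩
    · have := injOn_ident (hreg hp.1.1) (hreg hp.1.2) h
      have h2 : η ≤ dist p.1 p.2 := hp.2
      rw [this, dist_self] at h2
      linarith
    · by_contra hcon
      have : (ρ, σ) ∈ S := ⟨⟨hρ, hσ⟩, not_lt.1 hcon⟩
      exact absurd hlt (not_lt.2 (hmin (ρ, σ) this))

/-- The functions of one increment whose averages are the preliminary statistics. -/
def prelimFun (h y : ℝ) : Fin 4 → ℝ :=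
  ![if y ≤ 0 then π / 2 else -(π / 2), if y ≤ h then π / 2 else -(π / 2), y, y ^ 2]

/-- The weights of the preliminary statistics are `1 / n`, `1 / n`, `1 / T`, `1 / T`, the squares of
these entries of the rate matrix. -/
def prelimIdx : Fin 4 → Fin 4 := ![2, 2, 0, 0]

/-- The preliminary statistics. -/
def prelim (h : ℝ) {n : ℕ} (x : Fin n → ℝ) (k : Fin 4) : ℝ :=
  rate h n (prelimIdx k) * rate h n (prelimIdx k) * ∑ j, prelimFun h (x j) k

lemma measurable_prelimFun (h : ℝ) (k : Fin 4) : Measurable fun y => prelimFun h y k := by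
  fin_cases k
  · exact Measurable.ite measurableSet_Iic measurable_const measurable_const
  · exact Measurable.ite measurableSet_Iic measurable_const measurable_const
  · exact measurable_id
  · exact measurable_id.pow_const 2

lemma measurable_prelim (h : ℝ) (n : ℕ) : Measurable fun x : Fin n → ℝ => prelim h x :=
  measurable_pi_iff.2 fun k => (Finset.measurable_sum _ fun j _ =>
    (measurable_prelimFun h k).comp (measurable_pi_apply j)).const_mul _

/-- With `F` the Cauchy distribution function, the mean of the sign variable is `π (F(a) - 1/2)`,
which is the arctangent. -/
lemma integral_cauchyD_sign {ρ : E4} (hρ : ρ ∈ region) (a : ℝ) :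
    ∫ z, cauchyD ρ z * (if z ≤ a then π / 2 else -(π / 2)) = arctan ((a - ρ 3) / ρ 2) := by
  have h2 := (region_pos hρ).2.1
  have hπ := pi_pos
  rw [integral_cauchyD_mul hρ]
  set b := (a - ρ 3) / ρ 2 with hb
  have e : ∀ x : ℝ, (π * (1 + x ^ 2))⁻¹ * (if ρ 3 + ρ 2 * x ≤ a then π / 2 else -(π / 2)) =
      (Iic b).indicator (fun x => (1 + x ^ 2)⁻¹) x - 1 / 2 * (1 + x ^ 2)⁻¹ := fun x => by
    have hx : ρ 3 + ρ 2 * x ≤ a ↔ x ≤ b := by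
      rw [hb, le_div_iff₀ h2]
      constructor <;> intro h <;> linarith
    have h1 : (1 : ℝ) + x ^ 2 ≠ 0 := by positivity
    by_cases hxb : x ≤ b
    · rw [if_pos (hx.2 hxb), indicator_of_mem (by exact hxb)]
      field_simp; ring
    · rw [if_neg (fun h => hxb (hx.1 h)), indicator_of_notMem (by exact hxb)]
      field_simp; ring
  simp_rw [e]
  have hi := integrable_inv_one_add_sq
  rw [integral_sub (hi.indicator measurableSet_Iic) (hi.const_mul _), integral_const_mul,
    integral_indicator measurableSet_Iic, integral_Iic_inv_one_add_sq, integral_univ_inv_one_add_sq]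
  ring

lemma tendsto_ident {θ : ℕ → E4} {θ₀ : E4} (hθ₀ : θ₀ ∈ region)
    (ht : Tendsto θ atTop (𝓝 θ₀)) (k : Fin 4) :
    Tendsto (fun i => ident (θ i) k) atTop (𝓝 (ident θ₀ k)) := by
  have h1 := continuousOn_ident.continuousAt (isOpen_region.mem_nhds hθ₀)
  exact tendsto_pi_nhds.1 (h1.tendsto.comp ht) k

namespace Regime

variable {N : ℕ → ℕ} {h : ℕ → ℝ} {θ : ℕ → E4} {θ₀ : E4} (R : Regime c B N h θ θ₀)
include R

lemma tendsto_prelim_sign {k : Fin 4} {a : ℝ} (hk : prelimIdx k = 2)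
    (ha : ∀ i y, prelimFun (h i) y k = if y ≤ a * h i then π / 2 else -(π / 2))
    (hid : ∀ ρ, ident ρ k = arctan ((a - ρ 3) / ρ 2)) :
    (∀ i, Integrable (fun x => (prelim (h i) x k - ident (θ i) k) ^ 2) (dat (h i) (N i) (θ i))) ∧
    Tendsto (fun i => ∫ x, (prelim (h i) x k - ident (θ i) k) ^ 2 ∂(dat (h i) (N i) (θ i)))
      atTop (𝓝 0) := by
  unfold prelim
  rw [hk]
  have hπ := pi_pos
  have hbd : ∀ i y, |prelimFun (h i) y k| ≤ π / 2 := fun i y => by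
    rw [ha]
    split_ifs
    · rw [abs_of_pos (by positivity)]
    · rw [abs_neg, abs_of_pos (by positivity)]
  refine R.tendsto_sum_sq (A := π / 2) (fun i => measurable_prelimFun _ k) (fun i y => ?_)
    (tendsto_ident R.reg_lim R.tendsto k) ?_
  · refine (hbd i y).trans (le_mul_of_one_le_right (by positivity) ?_)
    have := (msize_pos (R.pos i) y).le
    rw [zsize, if_neg (by decide), if_neg (by decide)]
    exact le_add_of_nonneg_right (by positivity)
  · have hcs : ∀ i, covScale 2 2 (h i) = 1 := fun i => by
      rw [covScale, if_neg (by decide), if_neg (by decide)]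
    simp_rw [hcs, one_mul]
    rw [hid, ← integral_cauchyD_sign R.reg_lim]
    refine tendsto_integral_inc R.c_pos R.pos R.le_one R.tendsto_zero R.mem R.reg_lim R.tendsto
      (fun i => measurable_prelimFun _ k) hbd fun z => ?_
    refine tendsto_const_nhds.congr fun i => ?_
    rw [ha]
    have hi := R.pos i
    have : h i * z ≤ a * h i ↔ z ≤ a := by rw [mul_comm, mul_le_mul_iff_left₀ hi]
    simp only [this]

lemma tendsto_prelim_sq (k : Fin 4) :
    (∀ i, Integrable (fun x => (prelim (h i) x k - ident (θ i) k) ^ 2) (dat (h i) (N i) (θ i))) ∧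
    Tendsto (fun i => ∫ x, (prelim (h i) x k - ident (θ i) k) ^ 2 ∂(dat (h i) (N i) (θ i)))
      atTop (𝓝 0) := by
  fin_cases k
  · exact R.tendsto_prelim_sign (k := 0) (a := 0) rfl (fun i y => by simp [prelimFun])
      fun ρ => by simp [ident]
  · exact R.tendsto_prelim_sign (k := 1) (a := 1) rfl (fun i y => by simp [prelimFun])
      fun ρ => by simp [ident]
  -- The centred sum of the increments is exactly the `β`-score of the sample, so the second moment
  -- of this statistic is that of the rescaled score times `1/T`.
  · have e : ∀ i (x : Fin (N i) → ℝ), (prelim (h i) x 2 - ident (θ i) 2) ^ 2 =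
        rate (h i) (N i) 1 ^ 2 * (rate (h i) (N i) 1 * scoreL (h i) x (θ i) 1) ^ 2 := fun i x => by
      have hT : rate (h i) (N i) 0 * rate (h i) (N i) 0 * (N i * h i) = 1 := by
        have := nat_mul_rate_mul (R.N_pos i) (R.pos i) 0 0
        have h1 := (R.pos i).ne'
        rw [covScale, if_pos (by decide), if_pos (by decide)] at this
        rw [mul_comm _ ((N i : ℝ) * h i), mul_right_comm, this]
        field_simp
      have hs : scoreL (h i) x (θ i) 1 = ∑ j, x j - N i * h i * ident (θ i) 2 := by
        simp only [scoreL, score1, ident]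
        simp [Finset.sum_add_distrib]
        ring
      have hp : prelim (h i) x 2 = rate (h i) (N i) 0 * rate (h i) (N i) 0 * ∑ j, x j := rfl
      have hr : rate (h i) (N i) 1 = rate (h i) (N i) 0 := rfl
      rw [hp, hs, hr, ← mul_pow]
      congr 1
      linear_combination ident (θ i) 2 * hT
    change (∀ i, Integrable (fun x => (prelim (h i) x 2 - ident (θ i) 2) ^ 2) _) ∧
      Tendsto (fun i => ∫ x, (prelim (h i) x 2 - ident (θ i) 2) ^ 2 ∂_) _ _
    simp_rw [e]
    refine ⟨fun i => (R.integral_sq_score_le 1 i).1.const_mul _, ?_⟩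
    simp_rw [integral_const_mul]
    refine squeeze_zero (fun i => mul_nonneg (sq_nonneg _) (integral_nonneg fun x => sq_nonneg _))
      (fun i => mul_le_mul_of_nonneg_left (R.integral_sq_score_le 1 i).2 (sq_nonneg _)) ?_
    simpa using ((R.tendsto_rate 1).pow 2).mul (R.tendsto_cov 1 1)
  · refine R.tendsto_sum_sq (k := 0) (l := 0) (A := 1) (fun i => measurable_prelimFun _ 3)
      (fun i y => ?_) (tendsto_ident R.reg_lim R.tendsto 3) ?_
    · have hm := (msize_pos (R.pos i) y).le
      have h1 := sq_le_qsize hm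
      have h2 : y ^ 2 ≤ msize (h i) y ^ 2 := by
        rw [← sq_abs y]
        have := (R.pos i).le
        unfold msize
        gcongr
        linarith
      change |y ^ 2| ≤ _
      rw [zsize, if_pos (by decide), if_pos (by decide), abs_of_nonneg (sq_nonneg y)]
      linarith [(R.pos i).le]
    · have hid : ident θ₀ 3 = ∫ y, lev θ₀ y * (y * y) := by
        rw [R.integral_lev_mul_sq, fisher_one_one R.reg_lim]; rfl
      rw [hid]
      have := tendsto_integral_inc_div R.c_pos R.pos R.le_one R.tendsto_zero R.mem R.reg_lim
        R.tendsto (φ := fun _ y => y * y) (φ₀ := fun y => y * y)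
        (fun i => measurable_id.mul measurable_id) (A := 1) zero_le_one (fun i y => ?_)
        (fun y _ => tendsto_const_nhds)
      · refine this.congr fun i => ?_
        rw [covScale, if_pos (by decide), if_pos (by decide), div_eq_mul_one_div, mul_comm]
        congr 2
        ext y
        exact (sq y).symm
      · have hm := (msize_pos (R.pos i) y).le
        have h1 := pow_le_mom hm (p := 2) le_rfl (by norm_num)
        have h2 : y ^ 2 ≤ msize (h i) y ^ 2 := by
          rw [← sq_abs y]
          have := (R.pos i).le
          unfold msize
          gcongr
          linarith
        rw [← sq, abs_of_nonneg (sq_nonneg y)]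
        linarith

/-- The preliminary statistics are close to their limits with probability tending to one. -/
lemma negligible_prelim {ε : ℝ} (hε : 0 < ε) :
    Negligible (fun i => dat (h i) (N i) (θ i))
      fun i => {x | ε ≤ dist (prelim (h i) x) (ident (θ i))} := by
  refine (Negligible.iUnion fun k => Negligible.of_sq (R.tendsto_prelim_sq k).1
    (R.tendsto_prelim_sq k).2 hε).mono (Eventually.of_forall fun i x hx => ?_)
  rw [mem_iUnion]
  by_contra! hcon
  have : dist (prelim (h i) x) (ident (θ i)) < ε := (dist_pi_lt_iff hε).2 fun k => by
    rw [dist_eq]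
    exact not_le.1 (hcon k)
  exact absurd hx (not_le.2 this)

end Regime

end NIG

end

noncomputable section

namespace NIG

open Set Real

/-! ### Measurable selection of a maximizer -/

/-- Among the members of a dense sequence lying in `S`, the `i`-th one maximizes `L` up to
`1 / (k + 1)`. -/
def IsNearMax (S : Set E4) (L : E4 → ℝ) (k i : ℕ) : Prop :=
  TopologicalSpace.denseSeq E4 i ∈ S ∧ ∀ j, TopologicalSpace.denseSeq E4 j ∈ S →
    L (TopologicalSpace.denseSeq E4 j) ≤ L (TopologicalSpace.denseSeq E4 i) + 1 / ((k : ℝ) + 1)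

/-- The second alternative only makes the search for the first index total. -/
lemma exists_isNearMax_or (S : Set E4) (L : E4 → ℝ) (k : ℕ) :
    ∃ i, IsNearMax S L k i ∨ ∀ j, ¬ IsNearMax S L k j := by
  by_cases h : ∃ i, IsNearMax S L k i
  · exact h.imp fun i hi => Or.inl hi
  · exact ⟨0, Or.inr (not_exists.1 h)⟩

open Classical in
/-- The first near-maximizer of `L` over `S` in a dense sequence. -/
def nearMax (S : Set E4) (L : E4 → ℝ) (k : ℕ) : E4 :=
  TopologicalSpace.denseSeq E4 (Nat.find (exists_isNearMax_or S L k))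

/-- A measurable choice of a maximizer of `L` over `S`. -/
def argmaxOn (S : Set E4) (L : E4 → ℝ) : E4 := limUnder atTop (nearMax S L)

/-- Near-maximality involves countably many values of `L`, and a pointwise limit chosen by
`limUnder` is measurable whether or not the sequence converges. -/
lemma measurable_argmaxOn {α : Type*} [MeasurableSpace α] {S : α → Set E4} {L : α → E4 → ℝ}
    (hS : ∀ ρ, MeasurableSet {x | ρ ∈ S x}) (hL : ∀ ρ, (∃ x, ρ ∈ S x) → Measurable fun x => L x ρ) :
    Measurable fun x => argmaxOn (S x) (L x) := by
  have hnm : ∀ k i, MeasurableSet {x | IsNearMax (S x) (L x) k i} := fun k i => by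
    set q := TopologicalSpace.denseSeq E4
    by_cases hi : ∃ x, q i ∈ S x
    · have e : {x | IsNearMax (S x) (L x) k i} = {x | q i ∈ S x} ∩
          ⋂ j, ({x | q j ∈ S x}ᶜ ∪ {x | q j ∈ S x ∧ L x (q j) ≤ L x (q i) + 1 / ((k : ℝ) + 1)}) := by
        ext x
        simp only [IsNearMax, mem_ofPred_eq, mem_inter_iff, mem_iInter, mem_union, mem_compl_iff]
        refine and_congr_right fun _ => forall_congr' fun j => ?_
        by_cases hj : q j ∈ S x <;> simp [hj, q]
      rw [e]
      refine (hS _).inter (MeasurableSet.iInter fun j => (hS _).compl.union ?_)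
      by_cases hj : ∃ x, q j ∈ S x
      · exact (hS _).inter (measurableSet_le (hL _ hj) ((hL _ hi).add_const _))
      · have : {x | q j ∈ S x ∧ L x (q j) ≤ L x (q i) + 1 / ((k : ℝ) + 1)} = ∅ :=
          eq_empty_of_forall_notMem fun x hx => hj ⟨x, hx.1⟩
        rw [this]
        exact MeasurableSet.empty
    · have : {x | IsNearMax (S x) (L x) k i} = ∅ :=
        eq_empty_of_forall_notMem fun x hx => hi ⟨x, hx.1⟩
      rw [this]
      exact MeasurableSet.empty
  have hk : ∀ k, Measurable fun x => nearMax (S x) (L x) k := fun k => by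
    classical
    refine Measurable.find (f := fun i _ => TopologicalSpace.denseSeq E4 i)
      (p := fun i x => IsNearMax (S x) (L x) k i ∨ ∀ j, ¬ IsNearMax (S x) (L x) k j)
      (fun i => measurable_const) (fun i => ?_) fun x => exists_isNearMax_or _ _ _
    have e : {x | IsNearMax (S x) (L x) k i ∨ ∀ j, ¬ IsNearMax (S x) (L x) k j} =
        {x | IsNearMax (S x) (L x) k i} ∪ ⋂ j, {x | IsNearMax (S x) (L x) k j}ᶜ := by
      ext x; simp
    rw [e]
    exact (hnm k i).union (MeasurableSet.iInter fun j => (hnm k j).compl)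
  exact (StronglyMeasurable.limUnder fun k => (hk k).stronglyMeasurable).measurable

/-- An open subset of `S` around `σ` meets the dense sequence, so near-maximizers exist at every
level; the quadratic separation forces them to converge to `σ`. The set `S` itself need not be open.
-/
lemma argmaxOn_eq {S V : Set E4} {L : E4 → ℝ} {σ : E4} {m : ℝ} (hm : 0 < m) (hV : IsOpen V)
    (hσ : σ ∈ V) (hVS : V ⊆ S) (hL : ContinuousAt L σ)
    (hmax : ∀ ρ ∈ S, m * ‖ρ - σ‖ ^ 2 ≤ L σ - L ρ) : argmaxOn S L = σ := by
  have hnear : ∀ k : ℕ, ∃ i, TopologicalSpace.denseSeq E4 i ∈ S ∧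
      L σ - 1 / ((k : ℝ) + 1) < L (TopologicalSpace.denseSeq E4 i) := fun k => by
    have hk : (0 : ℝ) < 1 / ((k : ℝ) + 1) := by positivity
    have h1 : ∀ᶠ ρ in 𝓝 σ, ρ ∈ V ∧ L σ - 1 / ((k : ℝ) + 1) < L ρ :=
      Eventually.and (hV.mem_nhds hσ) (hL.eventually (lt_mem_nhds (by linarith)))
    obtain ⟨W, hW, hWo, hσW⟩ := mem_nhds_iff.1 h1
    obtain ⟨i, hi⟩ := (TopologicalSpace.denseRange_denseSeq E4).exists_mem_open hWo ⟨σ, hσW⟩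
    exact ⟨i, hVS (hW hi).1, (hW hi).2⟩
  have hle : ∀ ρ ∈ S, L ρ ≤ L σ := fun ρ hρ => by
    have := hmax ρ hρ
    have : 0 ≤ m * ‖ρ - σ‖ ^ 2 := by positivity
    linarith
  have hspec : ∀ k : ℕ, m * ‖nearMax S L k - σ‖ ^ 2 ≤ 2 * (1 / ((k : ℝ) + 1)) := fun k => by
    classical
    obtain ⟨i, hi, hLi⟩ := hnear k
    have hnm : IsNearMax S L k i := ⟨hi, fun j hj => by linarith [hle _ hj]⟩
    have hf : IsNearMax S L k (Nat.find (exists_isNearMax_or S L k)) :=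
      (Nat.find_spec (exists_isNearMax_or S L k)).resolve_right fun h => h i hnm
    have h1 := hf.2 i hi
    have h2 := hmax _ hf.1
    have e : nearMax S L k = TopologicalSpace.denseSeq E4 (Nat.find (exists_isNearMax_or S L k)) := by
      unfold nearMax
      congr!
    rw [e]
    linarith
  refine Tendsto.limUnder_eq (tendsto_iff_norm_sub_tendsto_zero.2 ?_)
  have h1 : Tendsto (fun k : ℕ => 2 * (1 / ((k : ℝ) + 1)) / m) atTop (𝓝 0) := by
    simpa using (tendsto_one_div_add_atTop_nhds_zero_nat.const_mul 2).div_const m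
  have h2 := squeeze_zero (fun k => sq_nonneg ‖nearMax S L k - σ‖)
    (fun k => (le_div_iff₀ hm).2 (by rw [mul_comm]; exact hspec k)) h1
  simpa using h2.sqrt

/-! ### Local maximizers under strong concavity -/

section diagMul

variable (a : Fin 4 → ℝ)

lemma continuous_diagMul : Continuous (diagMul a : E4 → E4) := by
  unfold diagMul
  fun_prop

variable {a}

lemma norm_diagMul_le {b : ℝ} (hb : 0 ≤ b) (ha : ∀ k, |a k| ≤ b) (u : E4) :
    ‖diagMul a u‖ ≤ b * ‖u‖ := by
  rw [EuclideanSpace.norm_eq, EuclideanSpace.norm_eq, ← sqrt_sq hb, ← sqrt_mul (sq_nonneg b)]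
  refine sqrt_le_sqrt ?_
  rw [Finset.mul_sum]
  refine Finset.sum_le_sum fun k _ => ?_
  simp only [diagMul, norm_mul, mul_pow, norm_eq_abs]
  have := ha k
  gcongr

lemma diagMul_inv (ha : ∀ k, a k ≠ 0) (u : E4) : diagMul a (diagMul (fun k => (a k)⁻¹) u) = u := by
  ext k
  simp [diagMul, ha k]

lemma inv_diagMul (ha : ∀ k, a k ≠ 0) (u : E4) : diagMul (fun k => (a k)⁻¹) (diagMul a u) = u := by
  ext k
  simp [diagMul, ha k]

end diagMul

lemma continuousAt_logLik {h : ℝ} (hh : 0 < h) {n : ℕ} (x : Fin n → ℝ) {ρ : E4} (hρ : ρ ∈ region) :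
    ContinuousAt (fun ρ => logLik h n ρ x) ρ := (hasFDerivAt_logLik hh hρ n x).continuousAt

/-- In the coordinates `ρ = θ + A w` the gain on the sphere `‖w‖ = r` is at most `A r - m r²/2 < 0`,
where the scalar `A` bounds the score. The maximum over the ball is therefore interior, and the
score vanishes there. Concavity on all of `U`, not only on the ball, makes it dominate the whole of
`U` quadratically. -/
lemma exists_localMax {h : ℝ} (hh : 0 < h) {n : ℕ} (x : Fin n → ℝ) {a : Fin 4 → ℝ}
    (ha : ∀ k, 0 < a k) {U : Set E4} (hconv : Convex ℝ U) (hreg : U ⊆ region) {θ : E4}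
    {m r A : ℝ} (hr : 0 < r) (hA : 2 * A < m * r)
    (hconc : ∀ ρ ∈ U, ∀ w, hessQ h x ρ (diagMul a w) ≤ -(m * ‖w‖ ^ 2))
    (hs : ∀ w : E4, ∑ k, scoreL h x θ k * diagMul a w k ≤ A * ‖w‖)
    (hD : ∀ w : E4, ‖w‖ ≤ r → θ + diagMul a w ∈ U) :
    ∃ w : E4, ‖w‖ < r ∧ (∀ k, scoreL h x (θ + diagMul a w) k = 0) ∧
      IsLocalMax (fun ρ => logLik h n ρ x) (θ + diagMul a w) ∧
      ∀ v, θ + diagMul a w + diagMul a v ∈ U →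
        logLik h n (θ + diagMul a w + diagMul a v) x ≤
          logLik h n (θ + diagMul a w) x - m / 2 * ‖v‖ ^ 2 := by
  have hquad : ∀ ρ ∈ U, ∀ v, ρ + diagMul a v ∈ U → logLik h n (ρ + diagMul a v) x ≤
      logLik h n ρ x + ∑ k, scoreL h x ρ k * diagMul a v k + -(m * ‖v‖ ^ 2) / 2 := by
    intro ρ hρ v hv
    have hseg : ∀ t ∈ Icc (0 : ℝ) 1, ρ + t • diagMul a v ∈ U := fun t ht =>
      hconv.add_smul_mem hρ hv ht
    exact logLik_le_quadratic hh x (fun t ht => hreg (hseg t ht)) fun t ht => hconc _ (hseg t ht) v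
  have hθ : θ ∈ U := by
    have := hD 0 (by simpa using hr.le)
    have e : diagMul a (0 : E4) = 0 := by ext k; simp [diagMul]
    rwa [e, add_zero] at this
  set g : E4 → ℝ := fun w => logLik h n (θ + diagMul a w) x with hg
  have hgc : ContinuousOn g (Metric.closedBall 0 r) := fun w hw => by
    have hw' : ‖w‖ ≤ r := by simpa using hw
    have h1 := continuousAt_logLik hh x (hreg (hD w hw'))
    have h2 : ContinuousAt (fun w : E4 => θ + diagMul a w) w :=
      (continuous_const.add (continuous_diagMul a)).continuousAt
    exact (ContinuousAt.comp (f := fun w : E4 => θ + diagMul a w) h1 h2).continuousWithinAt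
  obtain ⟨w, hw, hmax⟩ := (isCompact_closedBall (0 : E4) r).exists_isMaxOn
    ⟨0, Metric.mem_closedBall_self hr.le⟩ hgc
  replace hmax := isMaxOn_iff.1 hmax
  have hwr : ‖w‖ ≤ r := by simpa using hw
  have hg0 : g 0 = logLik h n θ x := by
    have e : diagMul a (0 : E4) = 0 := by ext k; simp [diagMul]
    simp only [hg, e, add_zero]
  have hlt : ‖w‖ < r := by
    refine lt_of_le_of_ne hwr fun he => ?_
    have h1 := hmax 0 (Metric.mem_closedBall_self hr.le)
    have h2 := hquad θ hθ w (hD w hwr)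
    have h3 := hs w
    rw [hg0] at h1
    rw [he] at h2 h3
    have h4 : g w = logLik h n (θ + diagMul a w) x := rfl
    have h5 : A * r < m * r ^ 2 / 2 := by nlinarith
    linarith
  have hlocg : IsLocalMax g w := by
    filter_upwards [Metric.isOpen_ball.mem_nhds (show w ∈ Metric.ball (0 : E4) r by simpa using hlt)]
      with v hv
    exact hmax v (Metric.ball_subset_closedBall hv)
  have hane : ∀ k, a k ≠ 0 := fun k => (ha k).ne'
  have hloc : IsLocalMax (fun ρ => logLik h n ρ x) (θ + diagMul a w) := by
    set ψ : E4 → E4 := fun ρ => diagMul (fun k => (a k)⁻¹) (ρ - θ) with hψ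
    have hψw : ψ (θ + diagMul a w) = w := by
      simp only [hψ, add_sub_cancel_left]
      exact inv_diagMul hane w
    have hψc : ContinuousAt ψ (θ + diagMul a w) :=
      ((continuous_diagMul _).comp (continuous_id.sub continuous_const)).continuousAt
    have h1 : IsLocalMax (g ∘ ψ) (θ + diagMul a w) :=
      IsLocalMax.comp_continuous (hψw.symm ▸ hlocg) hψc
    have h2 : g ∘ ψ = fun ρ => logLik h n ρ x := by
      ext ρ
      simp only [hg, hψ, Function.comp]
      rw [diagMul_inv hane, add_sub_cancel]
    rwa [h2] at h1
  have hwU := hD w hwr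
  have hzero : ∀ k, scoreL h x (θ + diagMul a w) k = 0 := fun k => by
    have h1 := hloc.hasFDerivAt_eq_zero (hasFDerivAt_logLik hh (hreg hwU) n x)
    have h2 := lin_single (fun k => scoreL h x (θ + diagMul a w) k) k
    have h3 : lin (fun k => scoreL h x (θ + diagMul a w) k) = 0 := h1
    rw [h3] at h2
    simpa using h2.symm
  refine ⟨w, hlt, hzero, hloc, fun v hv => ?_⟩
  have := hquad _ hwU v hv
  simp only [hzero, zero_mul, Finset.sum_const_zero, add_zero] at this
  linarith

lemma abs_apply_le_norm (w : E4) (k : Fin 4) : |w k| ≤ ‖w‖ := PiLp.norm_apply_le w k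

/-- Sixteen entries, each off by at most `ε`, change the form by at most `16 ε ‖w‖² ≤ m ‖w‖²`, half
of the coercivity `2 m`. -/
lemma hessQ_le {h : ℝ} {n : ℕ} {x : Fin n → ℝ} {ρ : E4} {a : Fin 4 → ℝ} {F : Fin 4 → Fin 4 → ℝ}
    {m ε : ℝ} (hε : 16 * ε ≤ m) (hF : ∀ w : E4, 2 * m * ‖w‖ ^ 2 ≤ ∑ k, ∑ l, F k l * w k * w l)
    (hH : ∀ k l, |a k * a l * hessL h x ρ k l + F k l| ≤ ε) (w : E4) :
    hessQ h x ρ (diagMul a w) ≤ -(m * ‖w‖ ^ 2) := by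
  have h1 : hessQ h x ρ (diagMul a w) + ∑ k, ∑ l, F k l * w k * w l ≤
      ∑ _k : Fin 4, ∑ _l : Fin 4, ε * (‖w‖ * ‖w‖) := by
    unfold hessQ
    rw [← Finset.sum_add_distrib]
    refine Finset.sum_le_sum fun k _ => ?_
    rw [← Finset.sum_add_distrib]
    refine Finset.sum_le_sum fun l _ => ?_
    have e : hessL h x ρ k l * diagMul a w k * diagMul a w l + F k l * w k * w l =
        (a k * a l * hessL h x ρ k l + F k l) * (w k * w l) := by
      simp only [diagMul]; ring
    rw [e]
    refine (le_abs_self _).trans ?_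
    rw [abs_mul, abs_mul]
    exact mul_le_mul (hH k l) (mul_le_mul (abs_apply_le_norm w k) (abs_apply_le_norm w l)
      (abs_nonneg _) (norm_nonneg _)) (by positivity) ((abs_nonneg _).trans (hH k l))
  simp only [Finset.sum_const, Finset.card_univ, Fintype.card_fin, nsmul_eq_mul] at h1
  push_cast at h1
  have h2 := hF w
  nlinarith [mul_le_mul_of_nonneg_right hε (sq_nonneg ‖w‖)]

/-- Expanding the likelihood equation row by row gives `F w = s` up to `4 ε r` in each component.
For `d = w - F⁻¹ s` coercivity yields `2 m ‖d‖² ≤ 16 ε r ‖d‖`. -/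
lemma norm_sub_inv_mulVec_le {h : ℝ} (hh : 0 < h) {n : ℕ} {x : Fin n → ℝ} {θ w : E4}
    {F : Matrix (Fin 4) (Fin 4) ℝ} {m ε r : ℝ} (hm : 0 < m) (hε : 0 ≤ ε) (hr : 0 ≤ r)
    (hpos : F.PosDef) (hF : ∀ w : E4, 2 * m * ‖w‖ ^ 2 ≤ ∑ k, ∑ l, F k l * w k * w l)
    (hreg : ∀ t ∈ Icc (0 : ℝ) 1, θ + t • diagMul (rate h n) w ∈ region)
    (hH : ∀ t ∈ Icc (0 : ℝ) 1, ∀ k l, |rate h n k * rate h n l *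
      hessL h x (θ + t • diagMul (rate h n) w) k l + F k l| ≤ ε)
    (hw : ‖w‖ ≤ r) (hzero : ∀ k, scoreL h x (θ + diagMul (rate h n) w) k = 0) :
    ‖w - WithLp.toLp 2 (F⁻¹.mulVec (nscore h θ x))‖ ≤ 8 * ε * r / m := by
  set s := nscore h θ x with hs
  set d : E4 := w - WithLp.toLp 2 (F⁻¹.mulVec s) with hd
  have hsymm : ∀ k l, F k l = F l k := fun k l => by
    simpa using (congrFun (congrFun hpos.isHermitian.eq k) l).symm
  have hFs : F.mulVec (F⁻¹.mulVec s) = s := by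
    rw [Matrix.mulVec_mulVec, Matrix.mul_nonsing_inv _ hpos.det_pos.ne'.isUnit, Matrix.one_mulVec]
  have hFw : ∀ l, |∑ k, F k l * w k - s l| ≤ 4 * (ε * r) := fun l => by
    obtain ⟨t, ht, he⟩ := exists_scoreL_sub_eq hh x hreg l
    rw [hzero l, zero_sub] at he
    have e : ∑ k, F k l * w k - s l = ∑ k, (rate h n k * rate h n l *
        hessL h x (θ + t • diagMul (rate h n) w) k l + F k l) * w k := by
      have e1 : s l = -(rate h n l * ∑ k, hessL h x (θ + t • diagMul (rate h n) w) k l *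
          diagMul (rate h n) w k) := by
        rw [← he]; simp only [hs, nscore]; ring
      rw [e1, Finset.mul_sum, sub_neg_eq_add, ← Finset.sum_add_distrib]
      refine Finset.sum_congr rfl fun k _ => ?_
      simp only [diagMul]; ring
    rw [e]
    refine (Finset.abs_sum_le_sum_abs _ _).trans ?_
    calc _ ≤ ∑ _k : Fin 4, ε * r := Finset.sum_le_sum fun k _ => by
          rw [abs_mul]
          exact mul_le_mul (hH t ht k l) ((abs_apply_le_norm w k).trans hw) (abs_nonneg _) hε
      _ = _ := by simp
  have hFd : ∀ l, ∑ k, F k l * d k = ∑ k, F k l * w k - s l := fun l => by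
    have h1 := congrFun hFs l
    simp only [Matrix.mulVec, dotProduct] at h1
    have : ∀ k, F k l * d k = F k l * w k - F l k * F⁻¹.mulVec s k := fun k => by
      simp only [hd, PiLp.sub_apply, hsymm l k]; ring
    simp_rw [this, Finset.sum_sub_distrib]
    rw [← h1]
    rfl
  have h1 := hF d
  have h2 : ∑ k, ∑ l, F k l * d k * d l ≤ 16 * (ε * r) * ‖d‖ := by
    rw [Finset.sum_comm]
    calc _ ≤ ∑ _l : Fin 4, 4 * (ε * r) * ‖d‖ := Finset.sum_le_sum fun l _ => by
          rw [← Finset.sum_mul, hFd]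
          refine (le_abs_self _).trans ?_
          rw [abs_mul]
          exact mul_le_mul (hFw l) (abs_apply_le_norm d l) (abs_nonneg _) (by positivity)
      _ = _ := by simp; ring
  rw [le_div_iff₀ hm]
  rcases (norm_nonneg d).eq_or_lt with h0 | h0
  · rw [← h0, zero_mul]; positivity
  · nlinarith

end NIG

end

/-! ### Coercivity of the information and construction of the estimator -/

noncomputable section

namespace NIG

open Set Real

variable {c B : ℝ}

/-- The quadratic form is continuous and positive on the compact product of `K` with the unit
sphere; homogeneity extends its minimum to all vectors. -/
lemma exists_fisher_coercive (hc : 0 < c) {K : Set E4} (hK : IsCompact K) (hbox : K ⊆ box c B) :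
    ∃ m > 0, ∀ ρ ∈ K, ∀ w : E4, 2 * m * ‖w‖ ^ 2 ≤ ∑ k, ∑ l, fisher ρ k l * w k * w l := by
  set Q : E4 × E4 → ℝ := fun p => ∑ k, ∑ l, fisher p.1 k l * p.2 k * p.2 l with hQ
  have hQc : ContinuousOn Q (K ×ˢ Metric.sphere 0 1) := by
    have hF : ∀ k l, ContinuousOn (fun ρ : E4 => fisher ρ k l) K := fun k l => by
      rw [continuousOn_iff_continuous_domRestrict, continuous_iff_seqContinuous]
      intro θ θ₀ ht
      exact tendsto_fisher hc (θ := fun i => (θ i : E4)) (fun i => hbox (θ i).2) (hbox θ₀.2)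
        ((continuous_subtype_val.tendsto _).comp ht) k l
    refine continuousOn_finsetSum _ fun k _ => continuousOn_finsetSum _ fun l _ => ?_
    have h1 : ContinuousOn (fun p : E4 × E4 => fisher p.1 k l) (K ×ˢ Metric.sphere 0 1) :=
      (hF k l).comp continuousOn_fst fun p hp => hp.1
    have h2 : ∀ j, Continuous fun p : E4 × E4 => p.2 j := fun j =>
      (pr j).continuous.comp continuous_snd
    exact (h1.mul (h2 k).continuousOn).mul (h2 l).continuousOn
  have hQpos : ∀ ρ ∈ K, ∀ w : E4, w ≠ 0 → 0 < Q (ρ, w) := fun ρ hρ w hw => by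
    have h1 := (fisher_posDef hc (hbox hρ)).dotProduct_mulVec_pos (x := w.ofLp) (by simpa using hw)
    have e : star w.ofLp ⬝ᵥ (fisher ρ).mulVec w.ofLp = Q (ρ, w) := by
      simp only [hQ, dotProduct, Matrix.mulVec, Finset.mul_sum, Pi.star_apply, star_trivial]
      exact Finset.sum_congr rfl fun k _ => Finset.sum_congr rfl fun l _ => by ring
    rwa [e] at h1
  have hscale : ∀ ρ (w : E4) (t : ℝ), Q (ρ, t • w) = t ^ 2 * Q (ρ, w) := fun ρ w t => by
    simp only [hQ, Finset.mul_sum, PiLp.smul_apply, smul_eq_mul]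
    exact Finset.sum_congr rfl fun k _ => Finset.sum_congr rfl fun l _ => by ring
  have hcomp : IsCompact (K ×ˢ Metric.sphere (0 : E4) 1) := hK.prod (isCompact_sphere 0 1)
  obtain ⟨m, hm, H⟩ : ∃ m > 0, ∀ ρ ∈ K, ∀ w : E4, ‖w‖ = 1 → m ≤ Q (ρ, w) := by
    rcases (K ×ˢ Metric.sphere (0 : E4) 1).eq_empty_or_nonempty with he | hne
    · refine ⟨1, one_pos, fun ρ hρ w hw => ?_⟩
      have : (ρ, w) ∈ K ×ˢ Metric.sphere (0 : E4) 1 := ⟨hρ, by simpa using hw⟩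
      simp [he] at this
    · obtain ⟨p, hp, hmin⟩ := hcomp.exists_isMinOn hne hQc
      have hp2 : ‖p.2‖ = 1 := by simpa using hp.2
      refine ⟨Q p, hQpos p.1 hp.1 p.2 (norm_ne_zero_iff.1 (by rw [hp2]; exact one_ne_zero)),
        fun ρ hρ w hw => isMinOn_iff.1 hmin (ρ, w) ⟨hρ, by simpa using hw⟩⟩
  refine ⟨m / 2, half_pos hm, fun ρ hρ w => ?_⟩
  change _ ≤ Q (ρ, w)
  rcases eq_or_ne w 0 with rfl | hw
  · simp [hQ]
  · have hn := norm_pos_iff.2 hw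
    have h1 := H ρ hρ (‖w‖⁻¹ • w) (by rw [norm_smul, norm_inv, norm_norm, inv_mul_cancel₀ hn.ne'])
    rw [hscale, inv_pow, ← div_eq_inv_mul, le_div_iff₀ (by positivity)] at h1
    linarith

/-- The mean of `zsum` is at most `C` and its fluctuations vanish in mean square. The bound must not
depend on the regime, since the radius of the neighbourhood of concavity, and with it the estimator,
is fixed before any parameter is chosen. -/
lemma exists_zsum_bound (hc : 0 < c) (B : ℝ) : ∃ D, 0 ≤ D ∧
    ∀ {N : ℕ → ℕ} {h : ℕ → ℝ} {θ : ℕ → E4} {θ₀ : E4}, Regime c B N h θ θ₀ → ∀ k l,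
      Negligible (fun i => dat (h i) (N i) (θ i)) fun i => {x | D ≤ zsum (h i) x k l} := by
  obtain ⟨C, hC, H⟩ := exists_zsize_moments hc B
  refine ⟨C + 1, by positivity, fun {N h θ θ₀} R k l => ?_⟩
  obtain ⟨h1, h2⟩ := R.tendsto_sum_sub_sq (k := k) (l := l) (g := fun i => zsize k l (h i)) (A := 1)
    (b := fun i => covScale k l (h i) * ∫ y, zsize k l (h i) y ∂(inc (h i) (θ i)))
    (fun i => measurable_zsize k l _)
    (fun i y => by rw [one_mul, abs_of_nonneg (zsize_nonneg (R.pos i) k l y)]) (by simp)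
  refine (Negligible.of_sq h1 h2 one_pos).mono (Eventually.of_forall fun i x hx => ?_)
  have h3 := (H _ (R.pos i) (R.le_one i) _ (R.mem i) k l).2.1
  have hx' : C + 1 ≤ rate (h i) (N i) k * rate (h i) (N i) l * ∑ j, zsize k l (h i) (x j) := hx
  exact (show (1 : ℝ) ≤ _ by linarith).trans (le_abs_self _)

/-! ### The maximum-likelihood estimator -/

/-- The parameters in `Θ` that are compatible with the preliminary statistics. -/
def candidates (Θ : Set E4) (ε h : ℝ) {n : ℕ} (x : Fin n → ℝ) : Set E4 :=
  {ρ | ρ ∈ Θ ∧ dist (ident ρ) (prelim h x) < ε}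

/-- The maximum-likelihood estimator: a maximizer of the likelihood over the parameters compatible
with the preliminary statistics. -/
def mle (Θ : Set E4) (ε h : ℝ) (n : ℕ) (x : Fin n → ℝ) : E4 :=
  argmaxOn (candidates Θ ε h x) fun ρ => logLik h n ρ x

lemma measurable_logLik {h : ℝ} (hh : 0 < h) (n : ℕ) {ρ : E4} (hρ : ρ ∈ region) :
    Measurable fun x => logLik h n ρ x :=
  Finset.measurable_sum _ fun j _ => measurable_log.comp
    ((continuous_pd hh hρ).measurable.comp (measurable_pi_apply j))

lemma measurable_mle {Θ : Set E4} (hreg : Θ ⊆ region) (ε : ℝ) {h : ℝ} (hh : 0 < h) (n : ℕ) :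
    Measurable (mle Θ ε h n) := by
  refine measurable_argmaxOn (fun ρ => ?_) fun ρ ⟨x, hx⟩ => measurable_logLik hh n (hreg hx.1)
  by_cases hρ : ρ ∈ Θ
  · have : {x : Fin n → ℝ | ρ ∈ candidates Θ ε h x} = {x | dist (ident ρ) (prelim h x) < ε} := by
      ext x; simp [candidates, hρ]
    rw [this]
    exact measurableSet_lt (measurable_const.dist (measurable_prelim h n)) measurable_const
  · have : {x : Fin n → ℝ | ρ ∈ candidates Θ ε h x} = ∅ :=
      eq_empty_of_forall_notMem fun x hx => hρ hx.1
    rw [this]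
    exact MeasurableSet.empty

/-- The rescaled estimation error `A_n⁻¹ (ρ - θ)`. -/
def nerror (h : ℝ) (n : ℕ) (θ ρ : E4) : E4 := WithLp.toLp 2 fun k => (rate h n k)⁻¹ * (ρ k - θ k)

lemma nerror_add_diagMul {h : ℝ} (hh : 0 < h) {n : ℕ} (hn : 0 < n) (θ w : E4) :
    nerror h n θ (θ + diagMul (rate h n) w) = w := by
  ext k
  have := (rate_pos hn hh k).ne'
  simp [nerror, diagMul, this]

/-- On the event where the score is bounded, the rescaled Hessian is close to the Fisher information
and varies little, and the preliminary statistics are accurate, the estimator is a local maximizer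
close to its linearization. -/
lemma mle_spec (hc : 0 < c) {Θ : Set E4} (hconv : Convex ℝ Θ) (hbox : Θ ⊆ box c B) {h : ℝ}
    (hh : 0 < h) {n : ℕ} (hn : 0 < n) {x : Fin n → ℝ} {θ : E4} (hθ : θ ∈ Θ) {m : ℝ} (hm : 0 < m)
    (hF : ∀ w : E4, 2 * m * ‖w‖ ^ 2 ≤ ∑ k, ∑ l, fisher θ k l * w k * w l)
    {C D : ℝ} (hC : 0 ≤ C) (hD : 0 ≤ D)
    (hlip : ∀ k l, ∀ ρ ∈ box c B, ∀ σ ∈ box c B, |rate h n k * rate h n l *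
      (hessL h x ρ k l - hessL h x σ k l)| ≤ C * zsum h x k l * ‖ρ - σ‖)
    (hz : ∀ k l, zsum h x k l < D) {η : ℝ} (hη : 32 * (C * D * η) ≤ m)
    {ε : ℝ} (hcand : ∀ ρ ∈ candidates Θ ε h x, dist ρ θ < η)
    {V : Set E4} (hV : IsOpen V) (hVc : V ⊆ candidates Θ ε h x)
    {A r ε' b δ : ℝ} (hr : 0 < r) (hA : 8 * A < m * r) (hs : ∀ k, |nscore h θ x k| < A)
    (hb : ∀ k, rate h n k ≤ b) (hb1 : b ≤ 1) (hbV : Metric.ball θ (2 * (b * r)) ⊆ V)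
    (hε' : 32 * ε' ≤ m)
    (hinfo : ∀ k l, |rate h n k * rate h n l * (-hessL h x θ k l) - fisher θ k l| < ε')
    (hδ : 8 * (C * D * (b * r) + ε') * r ≤ δ * m) :
    mle Θ ε h n x ∈ Θ ∧ IsLocalMax (fun ρ => logLik h n ρ x) (mle Θ ε h n x) ∧
      ‖nerror h n θ (mle Θ ε h n x) -
        WithLp.toLp 2 ((fisher θ)⁻¹.mulVec (nscore h θ x))‖ ≤ δ := by
  have ha := rate_pos hn hh
  have hb0 : 0 < b := (ha 0).trans_le (hb 0)
  have hreg : Θ ⊆ region := hbox.trans (box_subset_region hc)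
  have hε0 : 0 ≤ ε' := (abs_nonneg _).trans (hinfo 0 0).le
  have hdiag : ∀ w : E4, ‖diagMul (rate h n) w‖ ≤ b * ‖w‖ :=
    norm_diagMul_le hb0.le fun k => by rw [abs_of_pos (ha k)]; exact hb k
  have hH : ∀ ρ ∈ Θ, ∀ s, ‖ρ - θ‖ ≤ s → ∀ k l,
      |rate h n k * rate h n l * hessL h x ρ k l + fisher θ k l| ≤ C * D * s + ε' := by
    intro ρ hρ s hs k l
    have h1 := hlip k l ρ (hbox hρ) θ (hbox hθ)
    have h2 := hinfo k l
    have h3 : C * zsum h x k l * ‖ρ - θ‖ ≤ C * D * s := by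
      have : C * zsum h x k l ≤ C * D := mul_le_mul_of_nonneg_left (hz k l).le hC
      exact (mul_le_mul_of_nonneg_right this (norm_nonneg _)).trans
        (mul_le_mul_of_nonneg_left hs (by positivity))
    have e : rate h n k * rate h n l * hessL h x ρ k l + fisher θ k l =
        rate h n k * rate h n l * (hessL h x ρ k l - hessL h x θ k l) -
          (rate h n k * rate h n l * (-hessL h x θ k l) - fisher θ k l) := by ring
    rw [e]
    refine (abs_sub _ _).trans ?_
    linarith
  have hθV : θ ∈ V := hbV (Metric.mem_ball_self (by positivity))
  have hVD : ∀ w : E4, ‖w‖ ≤ r → θ + diagMul (rate h n) w ∈ V := fun w hw => hbV (by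
    rw [Metric.mem_ball, dist_eq_norm, add_sub_cancel_left]
    have h1 : b * ‖w‖ ≤ b * r := mul_le_mul_of_nonneg_left hw hb0.le
    have h2 : 0 < b * r := by positivity
    linarith [hdiag w])
  -- Strong concavity is applied on a ball of fixed radius `η`, which contains all candidates,
  -- rather than on the shrinking ball of radius of the order of the rate. This turns the local
  -- maximizer into the maximizer over all candidates.
  obtain ⟨w, hwr, hzero, hloc, hmax⟩ := exists_localMax hh x ha (U := Θ ∩ Metric.ball θ η)
    (hconv.inter (convex_ball θ η)) (inter_subset_left.trans hreg) (θ := θ) (m := m) (r := r)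
    (A := 4 * A) hr (by linarith)
    (fun ρ hρ w => hessQ_le (ε := C * D * η + ε') (by linarith) hF
      (hH ρ hρ.1 η (by rw [← dist_eq_norm]; exact hρ.2.le)) w)
    (fun w => by
      calc ∑ k, scoreL h x θ k * diagMul (rate h n) w k ≤ ∑ _k : Fin 4, A * ‖w‖ :=
            Finset.sum_le_sum fun k _ => by
              have e : scoreL h x θ k * diagMul (rate h n) w k = nscore h θ x k * w k := by
                simp only [diagMul, nscore]; ring
              rw [e]
              refine (le_abs_self _).trans ?_
              rw [abs_mul]
              exact mul_le_mul (hs k).le (abs_apply_le_norm w k) (abs_nonneg _)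
                ((abs_nonneg _).trans (hs k).le)
        _ = 4 * A * ‖w‖ := by simp; ring)
    (fun w hw => ⟨(hVc (hVD w hw)).1, hcand _ (hVc (hVD w hw))⟩)
  set σ := θ + diagMul (rate h n) w with hσ
  have hσV : σ ∈ V := hVD w hwr.le
  have hmle : mle Θ ε h n x = σ := by
    refine argmaxOn_eq (half_pos hm) hV hσV hVc (continuousAt_logLik hh x (hreg (hVc hσV).1))
      fun ρ hρ => ?_
    set v := diagMul (fun k => (rate h n k)⁻¹) (ρ - σ) with hv
    have hρv : σ + diagMul (rate h n) v = ρ := by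
      rw [hv, diagMul_inv fun k => (ha k).ne', add_sub_cancel]
    have h1 := hmax v (by rw [hρv]; exact ⟨hρ.1, hcand ρ hρ⟩)
    rw [hρv] at h1
    -- As the rates are at most one, quadratic separation in rescaled coordinates implies it in the
    -- original ones, as needed by `argmaxOn_eq`.
    have h2 : ‖ρ - σ‖ ≤ ‖v‖ := by
      rw [← hρv, add_sub_cancel_left]
      exact (hdiag v).trans (mul_le_of_le_one_left (norm_nonneg _) hb1)
    have h3 : m / 2 * ‖ρ - σ‖ ^ 2 ≤ m / 2 * ‖v‖ ^ 2 := by gcongr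
    linarith
  rw [hmle]
  refine ⟨(hVc hσV).1, hloc, ?_⟩
  rw [hσ, nerror_add_diagMul hh hn]
  have hseg : ∀ t ∈ Icc (0 : ℝ) 1, θ + t • diagMul (rate h n) w ∈ Θ := fun t ht =>
    hconv.add_smul_mem hθ (hVc hσV).1 ht
  refine (norm_sub_inv_mulVec_le hh (ε := C * D * (b * r) + ε') hm (by positivity) hr.le
    (fisher_posDef hc (hbox hθ)) hF (fun t ht => hreg (hseg t ht)) (fun t ht =>
      hH _ (hseg t ht) _ ?_) hwr.le hzero).trans ?_
  · rw [add_sub_cancel_left, norm_smul, norm_of_nonneg ht.1]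
    calc t * ‖diagMul (rate h n) w‖ ≤ 1 * (b * ‖w‖) :=
          mul_le_mul ht.2 (hdiag w) (norm_nonneg _) zero_le_one
      _ ≤ b * r := by rw [one_mul]; exact mul_le_mul_of_nonneg_left hwr.le hb0.le
  · rwa [div_le_iff₀ hm]

namespace Regime

variable {N : ℕ → ℕ} {h : ℕ → ℝ} {θ : ℕ → E4} {θ₀ : E4} (R : Regime c B N h θ θ₀)
include R

/-- Chebyshev's inequality with the limiting variances, each increased by one to hold for all late
indices. -/
lemma exists_score_bound {δ : ℝ} (hδ : 0 < δ) : ∃ A > 0, ∀ᶠ i in atTop,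
    dat (h i) (N i) (θ i) (⋃ k, {x | A ≤ |nscore (h i) (θ i) x k|}) ≤ ENNReal.ofReal δ := by
  set S := ∑ k, (fisher θ₀ k k + 1) with hS
  have hpos : ∀ k, 0 < fisher θ₀ k k := fun k =>
    (fisher_posDef R.c_pos R.mem_lim).diag_pos
  have hS0 : 0 < S := Finset.sum_pos (fun k _ => by linarith [hpos k]) Finset.univ_nonempty
  refine ⟨√(S / δ), sqrt_pos.2 (by positivity), ?_⟩
  have hA2 : √(S / δ) ^ 2 = S / δ := sq_sqrt (by positivity)
  have hev : ∀ᶠ i in atTop, ∀ k, covScale k k (h i) *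
      ∫ y, score1 (h i) y (θ i) k * score1 (h i) y (θ i) k ∂(inc (h i) (θ i)) < fisher θ₀ k k + 1 :=
    eventually_all.2 fun k => (R.tendsto_cov k k).eventually (gt_mem_nhds (by linarith))
  filter_upwards [hev] with i hi
  refine (measure_iUnion_fintype_le _ _).trans ?_
  calc _ ≤ ∑ k, ENNReal.ofReal ((fisher θ₀ k k + 1) / (S / δ)) := Finset.sum_le_sum fun k _ => by
        refine (measure_le_abs_le (R.integral_sq_score_le k i).1 (sqrt_pos.2 (by positivity))).trans ?_
        rw [hA2]
        refine ENNReal.ofReal_le_ofReal ?_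
        have := ((R.integral_sq_score_le k i).2.trans (hi k).le)
        gcongr
    _ = ENNReal.ofReal δ := by
        rw [← ENNReal.ofReal_sum_of_nonneg fun k _ => by
          have := hpos k
          positivity, ← Finset.sum_div, ← hS]
        congr 1
        field_simp

end Regime

/-- The estimator is a local maximizer close to its linearization, with probability tending to one. -/
lemma exists_mle_radius (hc : 0 < c) {Θ : Set E4} (hopen : IsOpen Θ) (hconv : Convex ℝ Θ)
    (hcomp : IsCompact (closure Θ)) (hbox : closure Θ ⊆ box c B) : ∃ ε > 0,
    ∀ {N : ℕ → ℕ} {h : ℕ → ℝ} {θ : ℕ → E4} {θ₀ : E4}, Regime c B N h θ θ₀ → (∀ i, θ i ∈ Θ) → θ₀ ∈ Θ →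
    ∀ δ > 0, ∀ᶠ i in atTop, dat (h i) (N i) (θ i)
      {x | ¬ (mle Θ ε (h i) (N i) x ∈ Θ ∧
        IsLocalMax (fun ρ => logLik (h i) (N i) ρ x) (mle Θ ε (h i) (N i) x) ∧
        ‖nerror (h i) (N i) (θ i) (mle Θ ε (h i) (N i) x) -
          WithLp.toLp 2 ((fisher (θ i))⁻¹.mulVec (nscore (h i) (θ i) x))‖ ≤ δ)} ≤
      ENNReal.ofReal δ := by
  obtain ⟨m, hm, hF⟩ := exists_fisher_coercive hc hcomp hbox
  obtain ⟨C, hC, hlip⟩ := exists_hessL_lipschitz hc B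
  obtain ⟨D, hD, hz⟩ := exists_zsum_bound hc B
  have hreg := hbox.trans (box_subset_region hc)
  -- Within `η` the Hessian varies by at most `C D η ≤ m/32`. Together with an error `ε' ≤ m/32` at
  -- the true parameter this meets the requirement `16 ε ≤ m` of `hessQ_le`.
  obtain ⟨η, hη, hηm⟩ : ∃ η > 0, 32 * (C * D * η) ≤ m := by
    refine ⟨m / (32 * (C * D + 1)), by positivity, ?_⟩
    have : 0 ≤ C * D := by positivity
    rw [mul_div_assoc', mul_div_assoc', div_le_iff₀ (by positivity)]
    nlinarith
  obtain ⟨ε, hε, hmod⟩ := exists_ident_modulus hcomp hreg hη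
  -- Statistics accurate to `ε/4` and candidates within `ε/2` put `ident` of every candidate within
  -- `ε` of the true value, hence the candidate within `η`. Conversely a ball around `θ₀` on which
  -- `ident` varies by `ε/8` consists of candidates.
  refine ⟨ε / 2, half_pos hε, fun {N h θ θ₀} R hθ hθ₀ δ hδ => ?_⟩
  have hid : ∀ᶠ ρ in 𝓝 θ₀, ρ ∈ Θ ∧ dist (ident ρ) (ident θ₀) < ε / 8 := by
    have h1 := continuousOn_ident.continuousAt (isOpen_region.mem_nhds R.reg_lim)
    exact Eventually.and (hopen.mem_nhds hθ₀) (Metric.tendsto_nhds.1 h1 _ (by positivity))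
  obtain ⟨s, hs, hsV⟩ := Metric.eventually_nhds_iff_ball.1 hid
  obtain ⟨A, hA, hscore⟩ := R.exists_score_bound (half_pos hδ)
  -- Large enough for the quadratic term to beat a score bounded by `A` on the sphere of radius `r`.
  set r := 8 * A / m + 1 with hr
  have hr0 : 0 < r := by positivity
  have hAr : 8 * A < m * r := by
    rw [hr, mul_add, mul_div_cancel₀ _ hm.ne']
    linarith
  -- The first bound serves concavity, the second one the accuracy `δ` of the linearization.
  set ε' := min (m / 32) (δ * m / (16 * r)) with hε'
  have hε'0 : 0 < ε' := by positivity
  set b : ℕ → ℝ := fun i => ∑ k, rate (h i) (N i) k with hb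
  have hbt : Tendsto b atTop (𝓝 0) := by
    simpa using tendsto_finsetSum Finset.univ fun k _ => R.tendsto_rate k
  have hneg := ((R.negligible_prelim (ε := ε / 4) (by positivity)).union
    (Negligible.iUnion fun k => Negligible.iUnion fun l => hz R k l)).union
    (Negligible.iUnion fun k => Negligible.iUnion fun l =>
      Negligible.of_sq (R.tendsto_info_sq k l).1 (R.tendsto_info_sq k l).2 hε'0)
  have hev1 := (ENNReal.tendsto_nhds_zero.1 hneg) (ENNReal.ofReal (δ / 2)) (by simpa using hδ)
  have hev2 : ∀ᶠ i in atTop, b i < 1 := hbt.eventually (gt_mem_nhds one_pos)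
  have hev3 : ∀ᶠ i in atTop, 2 * (b i * r) < s / 2 := by
    have : Tendsto (fun i => 2 * (b i * r)) atTop (𝓝 0) := by
      simpa using (hbt.mul_const r).const_mul 2
    exact this.eventually (gt_mem_nhds (by positivity))
  have hev4 : ∀ᶠ i in atTop, 8 * (C * D * (b i * r)) * r < δ * m / 2 := by
    have : Tendsto (fun i => 8 * (C * D * (b i * r)) * r) atTop (𝓝 0) := by
      simpa using (((hbt.mul_const r).const_mul (C * D)).const_mul 8).mul_const r
    exact this.eventually (gt_mem_nhds (by positivity))
  have hev5 : ∀ᶠ i in atTop, dist (θ i) θ₀ < s / 2 :=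
    Metric.tendsto_nhds.1 R.tendsto _ (by positivity)
  filter_upwards [hscore, hev1, hev2, hev3, hev4, hev5] with i i0 i1 i2 i3 i4 i5
  have hsum : ENNReal.ofReal δ = ENNReal.ofReal (δ / 2) + ENNReal.ofReal (δ / 2) := by
    rw [← ENNReal.ofReal_add (by positivity) (by positivity), add_halves]
  rw [hsum]
  refine le_trans (measure_mono ?_) ((measure_union_le _ _).trans (add_le_add i1 i0))
  intro x hx
  by_contra hcon
  simp only [mem_union, mem_iUnion, not_or, not_exists, mem_ofPred_eq, not_le] at hcon
  obtain ⟨⟨⟨c1, c2⟩, c3⟩, c4⟩ := hcon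
  refine hx ?_
  have hθi : ident (θ i) ∈ Metric.ball (ident θ₀) (ε / 8) :=
    (hsV _ (by rw [Metric.mem_ball]; linarith)).2
  have hε'2 : 8 * ε' * r ≤ δ * m / 2 := by
    have h1 : ε' ≤ δ * m / (16 * r) := min_le_right _ _
    rw [le_div_iff₀ (by positivity)] at h1
    linarith
  refine mle_spec hc hconv (subset_closure.trans hbox) (R.pos i) (R.N_pos i) (hθ i) hm
    (hF _ (subset_closure (hθ i))) hC hD (fun k l => hlip _ x k l _ (R.N_pos i) (R.pos i))
    c2 hηm (fun ρ hρ => hmod _ (subset_closure hρ.1) _ (subset_closure (hθ i)) ?_)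
    (V := Metric.ball θ₀ s) Metric.isOpen_ball (fun ρ hρ => ⟨(hsV ρ hρ).1, ?_⟩) hr0 hAr c4
    (b := b i) (fun k => Finset.single_le_sum (f := fun k => rate (h i) (N i) k)
      (fun k _ => (rate_pos (R.N_pos i) (R.pos i) k).le) (Finset.mem_univ k)) i2.le
    (Metric.ball_subset_ball' (by linarith)) (ε' := ε') ?_ c3 (by linarith)
  · have h1 := hρ.2
    have h2 := dist_triangle (ident ρ) (prelim (h i) x) (ident (θ i))
    linarith
  · have h1 := (hsV ρ hρ).2
    have h2 := dist_triangle4 (ident ρ) (ident θ₀) (ident (θ i)) (prelim (h i) x)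
    rw [Metric.mem_ball, dist_comm] at hθi
    rw [dist_comm] at c1
    linarith
  · have h1 : ε' ≤ m / 32 := min_le_left _ _
    linarith

end NIG

end

/-! ### Asymptotic normality of the estimator -/

noncomputable section

namespace NIG

open Set Real

variable {c B : ℝ}

/-- Off an event of probability at most `δ` the two values of a test function differ by at most `δ`,
and on it by at most `2`. -/
lemma blDist_map_le {S F : Type*} [MeasurableSpace S] [NormedAddCommGroup F] [MeasurableSpace F]
    [BorelSpace F] {μ : Measure S} [IsProbabilityMeasure μ] {f g : S → F} (hf : Measurable f)
    (hg : Measurable g) {δ : ℝ} (hδ : 0 ≤ δ)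
    (hμ : μ {x | ¬ ‖f x - g x‖ ≤ δ} ≤ ENNReal.ofReal δ) :
    blDist (μ.map f) (μ.map g) ≤ 3 * δ := by
  refine blDist_le (by positivity) fun φ hφ => ?_
  have hφm := hφ.lipschitz.continuous.measurable
  -- The exceptional event is replaced by a measurable hull of the same measure.
  set T := toMeasurable μ {x | ¬ ‖f x - g x‖ ≤ δ} with hT
  have hTm : MeasurableSet T := measurableSet_toMeasurable _ _
  have hTμ : μ.real T ≤ δ := by
    refine ENNReal.toReal_le_of_le_ofReal hδ ?_
    rwa [hT, measure_toMeasurable]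
  have hint : ∀ {u : S → F}, Measurable u → Integrable (fun x => φ (u x)) μ := fun hu =>
    (integrable_const (1 : ℝ)).mono' (hφm.comp hu).aestronglyMeasurable
      (ae_of_all _ fun x => hφ.le_one _)
  rw [integral_map hf.aemeasurable hφm.aestronglyMeasurable,
    integral_map hg.aemeasurable hφm.aestronglyMeasurable, ← integral_sub (hint hf) (hint hg)]
  have hTi : Integrable (fun x => δ + T.indicator (fun _ => (2 : ℝ)) x) μ :=
    (integrable_const δ).add ((integrable_const (2 : ℝ)).indicator hTm)
  rw [← norm_eq_abs]
  refine (norm_integral_le_of_norm_le hTi (ae_of_all _ fun x => ?_)).trans ?_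
  · by_cases hx : x ∈ T
    · rw [indicator_of_mem hx, norm_eq_abs]
      refine (abs_sub _ _).trans ?_
      linarith [hφ.le_one (f x), hφ.le_one (g x)]
    · rw [indicator_of_notMem hx, add_zero]
      have hx' : ‖f x - g x‖ ≤ δ := by
        by_contra hcon
        exact hx (subset_toMeasurable _ _ hcon)
      have := hφ.lipschitz.dist_le_mul (f x) (g x)
      rw [NNReal.coe_one, one_mul, dist_eq_norm, dist_eq_norm] at this
      exact this.trans hx'
  · rw [integral_add (integrable_const δ) ((integrable_const (2 : ℝ)).indicator hTm),
      integral_indicator hTm]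
    simp only [integral_const, probReal_univ, smul_eq_mul, one_mul, measureReal_restrict_apply_univ]
    linarith

lemma measurable_nerror (h : ℝ) (n : ℕ) (θ : E4) : Measurable (nerror h n θ) := by
  unfold nerror
  fun_prop

/-- Asymptotic normality of the maximum-likelihood estimator. -/
lemma exists_mle_tendsto (hc : 0 < c) {Θ : Set E4} (hopen : IsOpen Θ) (hconv : Convex ℝ Θ)
    (hcomp : IsCompact (closure Θ)) (hbox : closure Θ ⊆ box c B) : ∃ ε > 0,
    ∀ {N : ℕ → ℕ} {h : ℕ → ℝ} {θ : ℕ → E4} {θ₀ : E4}, Regime c B N h θ θ₀ → (∀ i, θ i ∈ Θ) → θ₀ ∈ Θ →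
    Tendsto (fun i => (dat (h i) (N i) (θ i)).real
      {x | ¬ (mle Θ ε (h i) (N i) x ∈ Θ ∧
        IsLocalMax (fun ρ => logLik (h i) (N i) ρ x) (mle Θ ε (h i) (N i) x))}) atTop (𝓝 0) ∧
    Tendsto (fun i => blDist ((dat (h i) (N i) (θ i)).map fun x =>
        nerror (h i) (N i) (θ i) (mle Θ ε (h i) (N i) x))
      (multivariateGaussian 0 (fisher (θ i))⁻¹)) atTop (𝓝 0) := by
  obtain ⟨ε, hε, H⟩ := exists_mle_radius hc hopen hconv hcomp hbox
  have hreg : Θ ⊆ region := subset_closure.trans (hbox.trans (box_subset_region hc))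
  refine ⟨ε, hε, fun {N h θ θ₀} R hθ hθ₀ => ⟨?_, ?_⟩⟩
  · rw [Metric.tendsto_nhds]
    intro δ hδ
    filter_upwards [H R hθ hθ₀ (δ / 2) (half_pos hδ)] with i hi
    rw [dist_zero_right, norm_of_nonneg measureReal_nonneg]
    refine lt_of_le_of_lt (ENNReal.toReal_le_of_le_ofReal (half_pos hδ).le
      (le_trans (measure_mono ?_) hi)) (half_lt_self hδ)
    exact fun x hx h' => hx ⟨h'.1, h'.2.1⟩
  · have hpr := R.prob_dat
    have hm1 : ∀ i, Measurable fun x : Fin (N i) → ℝ =>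
        nerror (h i) (N i) (θ i) (mle Θ ε (h i) (N i) x) := fun i =>
      (measurable_nerror _ _ _).comp (measurable_mle hreg ε (R.pos i) (N i))
    have hm2 := fun i => measurable_toLp_mulVec_nscore (n := N i) (R.pos i) (R.reg i) (fisher (θ i))⁻¹
    have hp1 := fun i => Measure.isProbabilityMeasure_map (μ := dat (h i) (N i) (θ i))
      (hm1 i).aemeasurable
    have hp2 := fun i => Measure.isProbabilityMeasure_map (μ := dat (h i) (N i) (θ i))
      (hm2 i).aemeasurable
    have t1 : Tendsto (fun i => blDist ((dat (h i) (N i) (θ i)).map fun x =>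
        nerror (h i) (N i) (θ i) (mle Θ ε (h i) (N i) x)) ((dat (h i) (N i) (θ i)).map fun x =>
          (WithLp.toLp 2 ((fisher (θ i))⁻¹.mulVec (nscore (h i) (θ i) x)) : E4))) atTop (𝓝 0) := by
      rw [Metric.tendsto_nhds]
      intro δ hδ
      filter_upwards [H R hθ hθ₀ (δ / 4) (by positivity)] with i hi
      rw [dist_zero_right, norm_of_nonneg (blDist_nonneg _ _)]
      refine lt_of_le_of_lt (blDist_map_le (hm1 i) (hm2 i) (δ := δ / 4) (by positivity)
        (le_trans (measure_mono ?_) hi)) (by linarith)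
      exact fun x hx h' => hx h'.2.2
    have t2 := t1.add R.tendsto_blDist_score_inv
    rw [add_zero] at t2
    refine squeeze_zero (fun i => blDist_nonneg _ _) (fun i => ?_) t2
    have h1 := blDist_triangle ((dat (h i) (N i) (θ i)).map fun x =>
        nerror (h i) (N i) (θ i) (mle Θ ε (h i) (N i) x)) ((dat (h i) (N i) (θ i)).map fun x =>
          (WithLp.toLp 2 ((fisher (θ i))⁻¹.mulVec (nscore (h i) (θ i) x)) : E4))
      (multivariateGaussian 0 (fisher (θ i))⁻¹)
    rwa [blDist_comm (multivariateGaussian 0 (fisher (θ i))⁻¹)] at h1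

lemma exists_subset_box {K : Set E4} (hK : IsCompact K) (hreg : K ⊆ region) :
    ∃ c B : ℝ, 0 < c ∧ K ⊆ box c B := by
  have p : ∀ k, Continuous fun ρ : E4 => ρ k := fun k => (pr k).continuous
  have low : ∀ f : E4 → ℝ, Continuous f → (∀ ρ ∈ K, 0 < f ρ) → ∃ c > 0, ∀ ρ ∈ K, c ≤ f ρ := by
    intro f hf hpos
    rcases K.eq_empty_or_nonempty with rfl | hne
    · exact ⟨1, one_pos, by simp⟩
    · obtain ⟨σ, hσ, hmin⟩ := hK.exists_isMinOn hne hf.continuousOn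
      exact ⟨f σ, hpos σ hσ, isMinOn_iff.1 hmin⟩
  obtain ⟨c₁, h1, H1⟩ := low (fun ρ => ρ 0 - |ρ 1|) ((p 0).sub (p 1).abs)
    fun ρ hρ => sub_pos.2 (hreg hρ).2.1
  obtain ⟨c₂, h2, H2⟩ := low (fun ρ => ρ 2) (p 2) fun ρ hρ => (hreg hρ).2.2
  obtain ⟨B, hB⟩ := hK.isBounded.exists_norm_le
  refine ⟨min c₁ c₂, B, lt_min h1 h2, fun ρ hρ => ?_⟩
  have hk : ∀ k, |ρ k| ≤ B := fun k => (abs_apply_le_norm ρ k).trans (hB ρ hρ)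
  exact ⟨(min_le_left _ _).trans (H1 ρ hρ), (min_le_right _ _).trans (H2 ρ hρ),
    (le_abs_self _).trans (hk 0), (le_abs_self _).trans (hk 2), hk 3⟩

end NIG

end

/-! ### Proof of the theorem -/

theorem mainTheorem3 {Ω : Type*} [MeasurableSpace Ω]
    (Θ : Set (EuclideanSpace ℝ (Fin 4))) (hopen : IsOpen Θ) (hconv : Convex ℝ Θ)
    (hbdd : Bornology.IsBounded Θ) (hreg : closure Θ ⊆ NIG.region)
    (X : ℝ≥0 → Ω → ℝ) (P : EuclideanSpace ℝ (Fin 4) → Measure Ω)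
    (hX : ∀ θ ∈ Θ, NIG.IsLevyProcess X (P θ))
    (hlaw : ∀ θ ∈ Θ, (P θ).map (X 1) = NIG.law (θ 0) (θ 1) (θ 2) (θ 3))
    (h : ℕ → ℝ≥0) (hpos : ∀ n, 0 < h n) (hzero : Tendsto h atTop (𝓝 0))
    (hT : Tendsto (fun n : ℕ => (n : ℝ≥0) * h n) atTop atTop) :
    -- ULAN of the laws of the sampled increments
    NIG.IsULAN Θ (fun n θ => (P θ).map (NIG.increments X (h n) n))
      (fun n => NIG.logLik (h n) n) (fun n _ => NIG.rate (h n) n) NIG.fisher ∧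
    -- finiteness of the integral and positive definiteness
    (∀ θ ∈ Θ, IntegrableOn (NIG.integrand θ) (Set.Ioi 0) ∧ (NIG.fisher θ).PosDef) ∧
    -- the maximum-likelihood estimator: a local maximizer with probability tending to one,
    -- uniformly asymptotically normal
    ∃ est : ∀ n : ℕ, (Fin n → ℝ) → EuclideanSpace ℝ (Fin 4),
      (∀ n, Measurable (est n)) ∧
      (∀ K ⊆ Θ, IsCompact K → TendstoUniformlyOn
        (fun n θ => ((P θ).map (NIG.increments X (h n) n)).real
          {x | ¬ (est n x ∈ Θ ∧ IsLocalMax (fun ρ => NIG.logLik (h n) n ρ x) (est n x))})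
        0 atTop K) ∧
      NIG.TendstoInLawU Θ (fun n θ => (P θ).map (NIG.increments X (h n) n))
        (fun n θ x => (WithLp.toLp 2 fun k => (NIG.rate (h n) n k)⁻¹ * (est n x k - θ k) :
          EuclideanSpace ℝ (Fin 4)))
        (fun θ => multivariateGaussian 0 (NIG.fisher θ)⁻¹) := by
  have hcomp : IsCompact (closure Θ) := hbdd.isCompact_closure
  obtain ⟨c, B, hc, hbox⟩ := NIG.exists_subset_box hcomp hreg
  have hΘbox : Θ ⊆ NIG.box c B := subset_closure.trans hbox
  have hΘreg : Θ ⊆ NIG.region := subset_closure.trans hreg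
  have hpos' : ∀ n, (0 : ℝ) < h n := fun n => NNReal.coe_pos.2 (hpos n)
  have hzero' : Tendsto (fun n => (h n : ℝ)) atTop (𝓝 0) := by
    simpa using NNReal.tendsto_coe.2 hzero
  have hT' : Tendsto (fun n : ℕ => (n : ℝ) * h n) atTop atTop := by
    exact_mod_cast NNReal.tendsto_coe_atTop.2 hT
  -- All moment bounds assume `h ≤ 1`, and the rates are positive only for `n > 0`.
  obtain ⟨n₀, hn₀⟩ : ∃ n₀ : ℕ, ∀ n, n₀ ≤ n → 0 < n ∧ (h n : ℝ) ≤ 1 := eventually_atTop.1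
    ((eventually_gt_atTop 0).and (hzero'.eventually (ge_mem_nhds one_pos)))
  -- From here on the process enters only through this product law of the sample.
  have hdat : ∀ n, ∀ θ ∈ Θ, (P θ).map (NIG.increments X (h n) n) = NIG.dat (h n) n θ :=
    fun n θ hθ => (hX θ hθ).map_increments_eq_dat (hΘreg hθ) (hlaw θ hθ) (hpos n) n
  have regime : ∀ K ⊆ Θ, ∀ φ : ℕ → ℕ, Tendsto φ atTop atTop → (∀ i, n₀ ≤ φ i) →
      ∀ θ : ℕ → EuclideanSpace ℝ (Fin 4), (∀ i, θ i ∈ K) → ∀ θ₀ ∈ K, Tendsto θ atTop (𝓝 θ₀) →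
      NIG.Regime c B φ (fun i => (h (φ i) : ℝ)) θ θ₀ := fun K hK φ hφ hφ₀ θ hθ θ₀ hθ₀ ht =>
    { c_pos := hc
      pos := fun i => hpos' _
      le_one := fun i => (hn₀ _ (hφ₀ i)).2
      tendsto_zero := hzero'.comp hφ
      mem := fun i => hΘbox (hK (hθ i))
      mem_lim := hΘbox (hK hθ₀)
      tendsto := ht
      N_pos := fun i => (hn₀ _ (hφ₀ i)).1
      tendsto_T := hT'.comp hφ }
  have hscore : ∀ n x, ∀ θ ∈ Θ, ∀ k,
      NIG.score (fun ρ => NIG.logLik (h n) n ρ x) θ k = NIG.scoreL (h n) x θ k :=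
    fun n x θ hθ k => NIG.score_logLik (hpos' n) (hΘreg hθ) n x k
  have hinfo : ∀ n x, ∀ θ ∈ Θ, ∀ k l,
      NIG.obsInfo (fun ρ => NIG.logLik (h n) n ρ x) θ k l = -NIG.hessL (h n) x θ k l :=
    fun n x θ hθ k l => NIG.obsInfo_logLik (hpos' n) (hΘreg hθ) n x k l
  have hposDef : ∀ θ ∈ Θ, (NIG.fisher θ).PosDef := fun θ hθ => NIG.fisher_posDef hc (hΘbox hθ)
  refine ⟨⟨?_, ?_, ?_, ?_, hposDef, ?_, ?_, ?_⟩, ?_, ?_⟩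
  · intro n θ hθ
    rw [hdat n θ hθ]
    exact NIG.dat_eq_withDensity (hpos' n) n (hΘreg hθ)
  · exact fun n x => (NIG.contDiffOn_logLik (hpos' n) n x).mono hΘreg
  · filter_upwards [eventually_gt_atTop 0] with n hn θ _ k using NIG.rate_pos hn (hpos' n) k
  · intro K hK hKc k
    exact NIG.tendstoUniformlyOn_zero_of_seq hKc n₀ fun φ hφ hφ₀ θ hθ θ₀ hθ₀ ht =>
      (regime K hK φ hφ hφ₀ θ hθ θ₀ hθ₀ ht).tendsto_rate k
  · intro K hK hKc
    refine NIG.tendstoUniformlyOn_zero_of_seq hKc n₀ fun φ hφ hφ₀ θ hθ θ₀ hθ₀ ht => ?_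
    refine (regime K hK φ hφ hφ₀ θ hθ θ₀ hθ₀ ht).tendsto_blDist_score_fisher.congr fun i => ?_
    simp only [hdat _ _ (hK (hθ i)), hscore _ _ _ (hK (hθ i))]
    rfl
  · intro k l K hK hKc
    refine NIG.tendstoUniformlyOn_zero_of_seq hKc n₀ fun φ hφ hφ₀ θ hθ θ₀ hθ₀ ht => ?_
    refine ((regime K hK φ hφ hφ₀ θ hθ θ₀ hθ₀ ht).tendsto_probDist_info k l).congr fun i => ?_
    simp only [hdat _ _ (hK (hθ i)), hinfo _ _ _ (hK (hθ i))]
    congr 1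
    ext x
    ring
  · intro u hu K hK hKc
    obtain ⟨U, hU⟩ := hu.exists_norm_le
    -- A uniform distance from `K` to the complement of `Θ` keeps the perturbed parameters, for late
    -- indices, in the set where the bounds hold.
    obtain ⟨r, hr, hrΘ⟩ := hKc.exists_thickening_subset_open hopen hK
    refine NIG.tendstoUniformlyOn_zero_of_seq hKc n₀ fun φ hφ hφ₀ θ hθ θ₀ hθ₀ ht => ?_
    refine ((regime K hK φ hφ hφ₀ θ hθ θ₀ hθ₀ ht).tendsto_probDist_expansion hr
      (fun i => (Metric.ball_subset_thickening (hθ i) r).trans (hrΘ.trans hΘbox))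
      (u := fun i => u (φ i)) (U := U) fun i => hU _ ⟨φ i, rfl⟩).congr fun i => ?_
    simp only [hdat _ _ (hK (hθ i)), hscore _ _ _ (hK (hθ i)), hinfo _ _ _ (hK (hθ i))]
  · exact fun θ hθ => ⟨NIG.integrableOn_integrand hc (hΘbox hθ), hposDef θ hθ⟩
  · obtain ⟨ε, -, H⟩ := NIG.exists_mle_tendsto hc hopen hconv hcomp hbox
    refine ⟨fun n => NIG.mle Θ ε (h n) n, fun n => NIG.measurable_mle hΘreg ε (hpos' n) n,
      fun K hK hKc => ?_, fun K hK hKc => ?_⟩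
    · refine NIG.tendstoUniformlyOn_zero_of_seq hKc n₀ fun φ hφ hφ₀ θ hθ θ₀ hθ₀ ht => ?_
      refine (H (regime K hK φ hφ hφ₀ θ hθ θ₀ hθ₀ ht) (fun i => hK (hθ i)) (hK hθ₀)).1.congr
        fun i => ?_
      rw [hdat _ _ (hK (hθ i))]
    · refine NIG.tendstoUniformlyOn_zero_of_seq hKc n₀ fun φ hφ hφ₀ θ hθ θ₀ hθ₀ ht => ?_
      refine (H (regime K hK φ hφ hφ₀ θ hθ θ₀ hθ₀ ht) (fun i => hK (hθ i)) (hK hθ₀)).2.congr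
        fun i => ?_
      simp only [hdat _ _ (hK (hθ i))]
      rfl
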